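/- Let $m,n\ge 0$, $\mathbb{C}_q=\mathbb{C}[q,q^{-1}]$, $p(i)=0$ for $1\le i\le m$, $p(i)=1$ for $m<i\le m+n$, and $\pi(a_{ij})=p(i)+p(j)$ modulo $2$. For $t\in\{q,q^{-1}\}$ let $M_t(m|n)$ be the superalgebra over $\mathbb{C}_q$ generated by $a_{ij}$ ($1\le i,j\le m+n$), of parity $\pi(a_{ij})$, with relations \begin{align*} &a_{ij}^2=0 && \pi(a_{ij})=1,\\ &a_{ij}a_{il}=(-1)^{\pi(a_{ij})\pi(a_{il})}\,t^{(-1)^{p(i)+1}}a_{il}a_{ij} && j<l,\\ &a_{ij}a_{kj}=(-1)^{\pi(a_{ij})\pi(a_{kj})}\,t^{(-1)^{p(j)+1}}a_{kj}a_{ij} && i<k,\\ &a_{ij}a_{kl}=(-1)^{\pi(a_{ij})\pi(a_{kl})}a_{kl}a_{ij} && i<k,\ j>l \text{ or } i>k,\ j<l,\\ &a_{ij}a_{kl}-(-1)^{\pi(a_{ij})\pi(a_{kl})}a_{kl}a_{ij}=(-1)^{p(k)p(l)+p(j)p(l)+p(k)p(j)}(t^{-1}-t)\,a_{il}a_{kj}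 && i<k,\ j<l. \end{align*} Write $M=(a_{ij})=\begin{pmatrix}A&\Lambda\\ \Upsilon&B\end{pmatrix}$ with blocks of sizes $m$ and $n$. For a $k\times k$ matrix $X$ and a parameter $u$ put $\det_u X=\sum_{\sigma\in S_k}(-u)^{-\ell(\sigma)}X_{1\sigma(1)}\cdots X_{k\sigma(k)}$, where $\ell(\sigma)$ is the number of inversions of $\sigma$, and $S_u(X)_{ij}=(-u)^{j-i}\det_u X(j,i)\,(\det_u X)^{-1}$, where $X(j,i)$ is $X$ with row $j$ and column $i$ removed. Let $\mathrm{GL}_t(m|n)$ be obtained from $M_t(m|n)$ by adjoining even two-sided inverses of $D_1=\det_t A$ and of $D_2=\det_{t^{-1}}B$. Put $H=B-\Upsilon S_t(A)\Lambda$, $\mathrm{Ber}_t=\det_t A\cdot\det_t\big(S_{t^{-1}}(H)\big)$, and $\mathrm{SL}_t(m|n)=\mathrm{GL}_t(m|n)/\langle \mathrm{Ber}_t-1\rangle$. The superalgebra $\mathrm{GL}_t(m|n)$ is a Hopf superalgebra with $$\Delta(a_{ij})=\sum_k a_{ik}\otimes a_{kj},\qquad \varepsilon(a_{ij})=\delta_{ij},$$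 $$S(A)=S_t(A)+S_t(A)\Lambda S_{t^{-1}}(H)\Upsilon S_t(A),\quad S(B)=S_{t^{-1}}(H),\quad S(\Lambda)=-S_t(A)\Lambda S_{t^{-1}}(H),\quad S(\Upsilon)=-S_{t^{-1}}(H)\Upsilon S_t(A),$$ and this structure induces one on $\mathrm{SL}_t(m|n)$, with antipode again denoted $S$. There is a $\mathbb{C}_q$-algebra automorphism $\mathrm{st}$ of $\mathrm{SL}_q(m|n)$, the supertranspose, with $\mathrm{st}(a_{ij})=(-1)^{(p(j)+1)p(i)}a_{ji}$. There is a parity-preserving $\mathbb{C}_q$-linear bijection $\tau:\mathrm{SL}_q(m|n)\to\mathrm{SL}_{q^{-1}}(m|n)$ with $\tau(1)=1$, $\tau(a_{ij})=a_{ij}$ and $\tau(xy)=(-1)^{|x||y|}\tau(y)\tau(x)$ for homogeneous $x,y$. These data determine the Hopf structures, $\mathrm{st}$ and $\tau$ uniquely. **Proposition.** Identify the underlying spaces of $\mathrm{SL}_q(m|n)$ and $\mathrm{SL}_{q^{-1}}(m|n)$ through $\tau$. Then $S\circ\mathrm{st}$ is an isomorphism of Hopf superalgebras $\mathrm{SL}_q(m|n)\to\mathrm{SL}_{q^{-1}}(m|n)$.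 That is, $\tau\circ S\circ\mathrm{st}$ is a parity-preserving isomorphism of $\mathbb{C}_q$-algebras that is compatible with the comultiplications, the counits and the antipodes. -/

import Mathlib

open scoped TensorProduct DirectSum

noncomputable section

namespace QuantumSuper

/-! ### Superalgebras and Hopf superalgebras -/

section Super

variable {R A : Type} [CommRing R] [Ring A] [Algebra R A]

/-- The even part (`i = 0`) and the odd part (`i = 1`) determined by a parity automorphism `σ`
(the automorphism that is `1` on even and `-1` on odd elements). -/
def parityPart (σ : A →ₐ[R] A) (i : ZMod 2) : Submodule R A where
  carrier := {x | σ x = (-1 : R) ^ i.val • x}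
  add_mem' := by
    intro x y hx hy
    simp only [Set.mem_ofPred_eq] at *
    rw [map_add, hx, hy, smul_add]
  zero_mem' := by simp
  smul_mem' := by
    intro c x hx
    simp only [Set.mem_ofPred_eq] at *
    rw [map_smul, hx, smul_comm]

theorem mem_parityPart {σ : A →ₐ[R] A} {i : ZMod 2} {x : A} :
    x ∈ parityPart σ i ↔ σ x = (-1 : R) ^ i.val • x := Iff.rfl

theorem mem_parityPart_zero {σ : A →ₐ[R] A} {x : A} : x ∈ parityPart σ 0 ↔ σ x = x := by
  simp [mem_parityPart]

theorem mem_parityPart_one {σ : A →ₐ[R] A} {x : A} : x ∈ parityPart σ 1 ↔ σ x = -x := by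
  simp [mem_parityPart, ZMod.val_one]

theorem neg_one_pow_val_add (i j : ZMod 2) :
    (-1 : R) ^ (i + j).val = (-1 : R) ^ i.val * (-1 : R) ^ j.val := by
  rw [ZMod.val_add, ← pow_add]
  exact (neg_one_pow_eq_pow_mod_two _).symm

instance parityPart_gradedMonoid (σ : A →ₐ[R] A) : SetLike.GradedMonoid (parityPart σ) where
  one_mem := by simp [mem_parityPart]
  mul_mem := by
    intro i j x y hx hy
    rw [mem_parityPart] at *
    rw [map_mul, hx, hy, neg_one_pow_val_add, smul_mul_smul_comm]

/-- The projection `x ↦ (x + (-1) ^ i σ x) / 2` onto the part of parity `i`. -/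
def parityProj [Invertible (2 : R)] (σ : A →ₐ[R] A) (hσ : ∀ x, σ (σ x) = x) (i : ZMod 2) :
    A →ₗ[R] parityPart σ i :=
  LinearMap.codRestrict (parityPart σ i)
    ((⅟2 : R) • (LinearMap.id + (-1 : R) ^ i.val • σ.toLinearMap)) (by
      intro x
      have hsq : (-1 : R) ^ i.val * (-1 : R) ^ i.val = 1 := by
        rw [← mul_pow]; simp
      simp only [mem_parityPart, LinearMap.smul_apply, LinearMap.add_apply, LinearMap.id_apply,
        AlgHom.toLinearMap_apply, map_smul, map_add, hσ]
      rw [smul_comm ((-1 : R) ^ i.val) (⅟2 : R), smul_add ((-1 : R) ^ i.val),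
        smul_smul ((-1 : R) ^ i.val), hsq, one_smul, add_comm])

theorem coe_parityProj [Invertible (2 : R)] (σ : A →ₐ[R] A) (hσ : ∀ x, σ (σ x) = x)
    (i : ZMod 2) (x : A) :
    (parityProj σ hσ i x : A) = (⅟2 : R) • (x + (-1 : R) ^ i.val • σ x) := rfl

/-- An algebra in which `2` is invertible, with an involutive algebra automorphism, is graded by
`ℤ/2`, that is, a superalgebra. -/
@[reducible]
def parityGradedAlgebra [Invertible (2 : R)] (σ : A →ₐ[R] A) (hσ : ∀ x, σ (σ x) = x) :
    GradedAlgebra (parityPart σ) where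
  toGradedMonoid := parityPart_gradedMonoid σ
  toDecomposition := DirectSum.Decomposition.ofLinearMap (parityPart σ)
    (DirectSum.lof R (ZMod 2) (fun i => parityPart σ i) 0 ∘ₗ parityProj σ hσ 0 +
      DirectSum.lof R (ZMod 2) (fun i => parityPart σ i) 1 ∘ₗ parityProj σ hσ 1)
    (by
      ext x
      simp only [LinearMap.comp_apply, LinearMap.add_apply, map_add, DirectSum.coeLinearMap_lof,
        coe_parityProj, LinearMap.id_apply]
      rw [← smul_add]
      have h : x + (-1 : R) ^ (0 : ZMod 2).val • σ x + (x + (-1 : R) ^ (1 : ZMod 2).val • σ x)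
          = (2 : R) • x := by
        rw [two_smul]
        simp only [ZMod.val_zero, ZMod.val_one, pow_zero, pow_one, one_smul, neg_smul]
        abel
      rw [h, invOf_smul_smul])
    (by
      have hi2 : ∀ i : ZMod 2, i = 0 ∨ i = 1 := by decide
      refine DirectSum.linearMap_ext R fun i => ?_
      ext1 x
      obtain ⟨x, hx⟩ := x
      have key0 : σ x = x → (⅟2 : R) • (x + σ x) = x := fun h => by
        rw [h, ← two_smul R x, invOf_smul_smul]
      have key1 : σ x = -x → (⅟2 : R) • (x - σ x) = x := fun h => by
        rw [h, sub_neg_eq_add, ← two_smul R x, invOf_smul_smul]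
      simp only [LinearMap.comp_apply, LinearMap.add_apply, DirectSum.coeLinearMap_lof,
        LinearMap.id_apply]
      rcases hi2 i with rfl | rfl
      · have h : σ x = x := mem_parityPart_zero.1 hx
        have h0 : parityProj σ hσ 0 x = ⟨x, hx⟩ := Subtype.ext (by
          rw [coe_parityProj]; simpa using key0 h)
        have h1 : parityProj σ hσ 1 x = 0 := Subtype.ext (by
          rw [coe_parityProj]; simp [ZMod.val_one, h])
        rw [h0, h1, map_zero, add_zero]
      · have h : σ x = -x := mem_parityPart_one.1 hx
        have h0 : parityProj σ hσ 0 x = 0 := Subtype.ext (by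
          rw [coe_parityProj]; simp [h])
        have h1 : parityProj σ hσ 1 x = ⟨x, hx⟩ := Subtype.ext (by
          rw [coe_parityProj]; simpa [ZMod.val_one, sub_eq_add_neg] using key1 h)
        rw [h0, h1, map_zero, zero_add])

/-- The part of parity `i` of the tensor product of two superspaces. -/
def tensorPart {B : Type} [Ring B] [Algebra R B] (𝒜 : ZMod 2 → Submodule R A)
    (ℬ : ZMod 2 → Submodule R B) (i : ZMod 2) : Submodule R (A ⊗[R] B) :=
  Submodule.span R {z | ∃ j k : ZMod 2, j + k = i ∧ ∃ a ∈ 𝒜 j, ∃ b ∈ ℬ k, z = a ⊗ₜ[R] b}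

variable (R) in
/-- A Hopf superalgebra structure on the superalgebra `A` with even part `𝒜 0` and odd part `𝒜 1`:
a coalgebra structure whose comultiplication and counit are morphisms of superalgebras, together
with an antipode. The multiplication of `A ⊗ A` is the one of the super tensor product
`𝒜 ᵍ⊗[R] 𝒜`, that is `(a ⊗ b) (c ⊗ d) = (-1) ^ (|b| |c|) ac ⊗ bd`. -/
structure HopfSuperalgebra (𝒜 : ZMod 2 → Submodule R A) [GradedAlgebra 𝒜]
    extends Coalgebra R A where
  comul_mem : ∀ i, ∀ x ∈ 𝒜 i, comul x ∈ tensorPart 𝒜 𝒜 i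
  comul_one : comul 1 = (1 : A) ⊗ₜ[R] (1 : A)
  comul_mul : ∀ x y : A, GradedTensorProduct.of R 𝒜 𝒜 (comul (x * y)) =
    GradedTensorProduct.of R 𝒜 𝒜 (comul x) * GradedTensorProduct.of R 𝒜 𝒜 (comul y)
  counit_odd : ∀ x ∈ 𝒜 1, counit x = 0
  counit_one : counit 1 = 1
  counit_mul : ∀ x y : A, counit (x * y) = counit x * counit y
  /-- The antipode. -/
  antipode : A →ₗ[R] A
  antipode_mem : ∀ i, ∀ x ∈ 𝒜 i, antipode x ∈ 𝒜 i
  mul_antipode_rTensor_comul :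
    LinearMap.mul' R A ∘ₗ antipode.rTensor A ∘ₗ comul = Algebra.linearMap R A ∘ₗ counit
  mul_antipode_lTensor_comul :
    LinearMap.mul' R A ∘ₗ antipode.lTensor A ∘ₗ comul = Algebra.linearMap R A ∘ₗ counit

/-- The algebra morphism `f` is a morphism of Hopf superalgebras. -/
structure IsHopfMorphism {B : Type} [Ring B] [Algebra R B]
    {𝒜 : ZMod 2 → Submodule R A} [GradedAlgebra 𝒜] {ℬ : ZMod 2 → Submodule R B} [GradedAlgebra ℬ]
    (H : HopfSuperalgebra R 𝒜) (K : HopfSuperalgebra R ℬ) (f : A →ₐ[R] B) : Prop where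
  map_mem : ∀ i, ∀ x ∈ 𝒜 i, f x ∈ ℬ i
  map_comul : ∀ x, K.comul (f x) = TensorProduct.map f.toLinearMap f.toLinearMap (H.comul x)
  map_counit : ∀ x, K.counit (f x) = H.counit x
  map_antipode : ∀ x, K.antipode (f x) = f (H.antipode x)

end Super

/-! ### Quantum determinants and cofactor matrices -/

/-- The ring `ℂ[q, q⁻¹]`. -/
abbrev Cq : Type := LaurentPolynomial ℂ

/-- The indeterminate `q`, as a unit of `ℂ[q, q⁻¹]`. -/
def q : Cqˣ where
  val := LaurentPolynomial.T 1
  inv := LaurentPolynomial.T (-1)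
  val_inv := by rw [← LaurentPolynomial.T_add]; simp
  inv_val := by rw [← LaurentPolynomial.T_add]; simp

instance invertibleTwo : Invertible (2 : Cq) :=
  (Invertible.map (algebraMap ℂ Cq) 2).copy 2 (map_ofNat (algebraMap ℂ Cq) 2).symm

section Det

variable {A : Type} [Ring A] [Algebra Cq A]

/-- The length of a permutation: its number of inversions. -/
def permLength {k : ℕ} (s : Equiv.Perm (Fin k)) : ℕ :=
  (Finset.univ.filter fun x : Fin k × Fin k => x.1 < x.2 ∧ s x.2 < s x.1).card

/-- The quantum determinant with parameter `t`:
`∑ s, (-t) ^ (-ℓ(s)) X_{1 s(1)} ⋯ X_{k s(k)}`, the factors in this order. -/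
def qdet (t : Cqˣ) {k : ℕ} (X : Matrix (Fin k) (Fin k) A) : A :=
  ∑ s : Equiv.Perm (Fin k),
    (((-t) ^ (-(permLength s : ℤ)) : Cqˣ) : Cq) • (List.ofFn fun i => X i (s i)).prod

/-- The matrix `S_e(X)` of the antipode of the (even) quantum general linear group with parameter
`t`: its `(i, j)` entry is `(-t) ^ (j - i)` times the quantum determinant of `X` with row `j` and
column `i` removed times the inverse of the quantum determinant of `X`. -/
def qantipode (t : Cqˣ) : {k : ℕ} → Matrix (Fin k) (Fin k) A → Matrix (Fin k) (Fin k) A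
  | 0, X => X
  | _ + 1, X => Matrix.of fun i j =>
      (((-t) ^ ((j : ℤ) - (i : ℤ)) : Cqˣ) : Cq) •
        (qdet t (X.submatrix j.succAbove i.succAbove) * Ring.inverse (qdet t X))

variable {m n : ℕ}

/-- The upper left (even-even) block. -/
def blockA (X : Matrix (Fin (m + n)) (Fin (m + n)) A) : Matrix (Fin m) (Fin m) A :=
  X.submatrix (Fin.castAdd n) (Fin.castAdd n)

/-- The upper right (even-odd) block. -/
def blockΛ (X : Matrix (Fin (m + n)) (Fin (m + n)) A) : Matrix (Fin m) (Fin n) A :=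
  X.submatrix (Fin.castAdd n) (Fin.natAdd m)

/-- The lower left (odd-even) block. -/
def blockΥ (X : Matrix (Fin (m + n)) (Fin (m + n)) A) : Matrix (Fin n) (Fin m) A :=
  X.submatrix (Fin.natAdd m) (Fin.castAdd n)

/-- The lower right (odd-odd) block. -/
def blockB (X : Matrix (Fin (m + n)) (Fin (m + n)) A) : Matrix (Fin n) (Fin n) A :=
  X.submatrix (Fin.natAdd m) (Fin.natAdd m)

/-- The matrix `H = B - Υ S_e(A) Λ`. -/
def blockH (t : Cqˣ) (X : Matrix (Fin (m + n)) (Fin (m + n)) A) : Matrix (Fin n) (Fin n) A :=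
  blockB X - blockΥ X * qantipode t (blockA X) * blockΛ X

/-- The quantum Berezinian `det_t(A) det_t(S_e(B - Υ S_e(A) Λ))`. In a quantum supermatrix with
parameter `t` the odd-odd block `B`, and with it `H`, is a quantum matrix with parameter `t⁻¹`,
so that `S_e(H)` is formed with `t⁻¹`. -/
def berezinian (t : Cqˣ) (X : Matrix (Fin (m + n)) (Fin (m + n)) A) : A :=
  qdet t (blockA X) * qdet t (qantipode t⁻¹ (blockH t X))

end Det

/-! ### The quantum general linear supergroup -/

/-- The parity `p(i)`: `0` for the first `m` indices and `1` for the last `n`. -/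
def p {m n : ℕ} (i : Fin (m + n)) : ℕ := if (i : ℕ) < m then 0 else 1

/-- The generators `a_{ij}`, `D₁⁻¹`, `D₂⁻¹`. -/
inductive Gen (m n : ℕ) : Type
  | a (i j : Fin (m + n))
  | dInv₁
  | dInv₂

/-- The matrix of the generators `a_{ij}` of the free algebra. -/
def freeMatrix (m n : ℕ) : Matrix (Fin (m + n)) (Fin (m + n)) (FreeAlgebra Cq (Gen m n)) :=
  Matrix.of fun i j => FreeAlgebra.ι Cq (Gen.a i j)

/-- The sign `(-1) ^ (π(a_{ij}) π(a_{kl}))`, where `π(a_{ij}) = p(i) + p(j)`. -/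
def koszul {m n : ℕ} (i j k l : Fin (m + n)) : Cq := (-1) ^ ((p i + p j) * (p k + p l))

/-- The sign `η = (-1) ^ (p(k) p(l) + p(j) p(l) + p(k) p(j))`. -/
def η {m n : ℕ} (j k l : Fin (m + n)) : Cq := (-1) ^ (p k * p l + p j * p l + p k * p j)

/-- The defining relations of the quantum general linear supergroup with parameter `t`: the Manin
relations of quantum supermatrices, including that the odd generators have square zero, and the
relations saying that `D₁⁻¹` and `D₂⁻¹` are inverse to the quantum determinants `D₁` and `D₂` of
the diagonal blocks. The block `B` is a quantum matrix with parameter `t⁻¹`, and `D₂` is its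
quantum determinant as such. -/
inductive GLRel (t : Cqˣ) (m n : ℕ) :
    FreeAlgebra Cq (Gen m n) → FreeAlgebra Cq (Gen m n) → Prop
  | sq (i j : Fin (m + n)) (h : p i + p j = 1) :
      GLRel t m n (freeMatrix m n i j * freeMatrix m n i j) 0
  | row (i j l : Fin (m + n)) (h : j < l) :
      GLRel t m n (freeMatrix m n i j * freeMatrix m n i l)
        ((koszul i j i l * (t ^ ((-1 : ℤ) ^ (p i + 1)) : Cqˣ)) •
          (freeMatrix m n i l * freeMatrix m n i j))
  | col (i j k : Fin (m + n)) (h : i < k) :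
      GLRel t m n (freeMatrix m n i j * freeMatrix m n k j)
        ((koszul i j k j * (t ^ ((-1 : ℤ) ^ (p j + 1)) : Cqˣ)) •
          (freeMatrix m n k j * freeMatrix m n i j))
  | comm (i j k l : Fin (m + n)) (h : i < k ∧ l < j ∨ k < i ∧ j < l) :
      GLRel t m n (freeMatrix m n i j * freeMatrix m n k l)
        (koszul i j k l • (freeMatrix m n k l * freeMatrix m n i j))
  | cross (i j k l : Fin (m + n)) (hik : i < k) (hjl : j < l) :
      GLRel t m n
        (freeMatrix m n i j * freeMatrix m n k l -
          koszul i j k l • (freeMatrix m n k l * freeMatrix m n i j))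
        ((η j k l * (((t⁻¹ : Cqˣ) : Cq) - (t : Cq))) •
          (freeMatrix m n i l * freeMatrix m n k j))
  | mul_dInv₁ : GLRel t m n (qdet t (blockA (freeMatrix m n)) * FreeAlgebra.ι Cq Gen.dInv₁) 1
  | dInv₁_mul : GLRel t m n (FreeAlgebra.ι Cq Gen.dInv₁ * qdet t (blockA (freeMatrix m n))) 1
  | mul_dInv₂ : GLRel t m n (qdet t⁻¹ (blockB (freeMatrix m n)) * FreeAlgebra.ι Cq Gen.dInv₂) 1
  | dInv₂_mul : GLRel t m n (FreeAlgebra.ι Cq Gen.dInv₂ * qdet t⁻¹ (blockB (freeMatrix m n))) 1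

/-- The quantum general linear supergroup `GL_t(m|n)`, an algebra over `ℂ[q, q⁻¹]`. -/
def QGL (t : Cqˣ) (m n : ℕ) : Type := RingQuot (GLRel t m n)

namespace QGL

variable (t : Cqˣ) (m n : ℕ)

instance : Ring (QGL t m n) := inferInstanceAs (Ring (RingQuot (GLRel t m n)))

instance : Algebra Cq (QGL t m n) := inferInstanceAs (Algebra Cq (RingQuot (GLRel t m n)))

/-- The quotient map from the free algebra. -/
def mk : FreeAlgebra Cq (Gen m n) →ₐ[Cq] QGL t m n := RingQuot.mkAlgHom Cq (GLRel t m n)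

/-- The quantum supermatrix `(a_{ij})`. -/
def a : Matrix (Fin (m + n)) (Fin (m + n)) (QGL t m n) := (freeMatrix m n).map (mk t m n)

end QGL

/-- The relation `Ber_t = 1`. -/
inductive SLRel (t : Cqˣ) (m n : ℕ) : QGL t m n → QGL t m n → Prop
  | ber : SLRel t m n (berezinian t (QGL.a t m n)) 1

/-- The quantum special linear supergroup `SL_t(m|n) = GL_t(m|n) / ⟨Ber_t - 1⟩`. -/
def QSL (t : Cqˣ) (m n : ℕ) : Type := RingQuot (SLRel t m n)

namespace QSL

variable (t : Cqˣ) (m n : ℕ)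

instance : Ring (QSL t m n) := inferInstanceAs (Ring (RingQuot (SLRel t m n)))

instance : Algebra Cq (QSL t m n) := inferInstanceAs (Algebra Cq (RingQuot (SLRel t m n)))

/-- The quotient map `GL_t(m|n) → SL_t(m|n)`. -/
def proj : QGL t m n →ₐ[Cq] QSL t m n := RingQuot.mkAlgHom Cq (SLRel t m n)

/-- The quantum supermatrix `(a_{ij})` of `SL_t(m|n)`. -/
def a : Matrix (Fin (m + n)) (Fin (m + n)) (QSL t m n) := (QGL.a t m n).map (proj t m n)

end QSL

/-! ### The superalgebra structures -/

section Naturality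

variable {A B : Type} [Ring A] [Algebra Cq A] [Ring B] [Algebra Cq B]

theorem qdet_map (f : A →ₐ[Cq] B) (t : Cqˣ) {k : ℕ} (X : Matrix (Fin k) (Fin k) A) :
    qdet t (X.map f) = f (qdet t X) := by
  simp only [qdet, map_sum, map_smul, map_list_prod, List.map_ofFn]
  rfl

theorem map_inverse_of_fixed (f : A →ₐ[Cq] A) {x : A} (hx : f x = x) :
    f (Ring.inverse x) = Ring.inverse x := by
  by_cases h : IsUnit x
  · obtain ⟨u, rfl⟩ := h
    rw [Ring.inverse_unit]
    have h1 : f (↑u⁻¹ : A) * (u : A) = 1 := by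
      calc f (↑u⁻¹ : A) * (u : A) = f (↑u⁻¹ : A) * f (u : A) := by rw [hx]
        _ = 1 := by rw [← map_mul, Units.inv_mul, map_one]
    exact Units.eq_inv_of_mul_eq_one_right h1
  · rw [Ring.inverse_non_unit _ h, map_zero]

theorem qantipode_fixed (f : A →ₐ[Cq] A) (t : Cqˣ) :
    ∀ {k : ℕ} (X : Matrix (Fin k) (Fin k) A), X.map f = X →
      (qantipode t X).map f = qantipode t X
  | 0, X, h => h
  | k + 1, X, h => by
    have hd : f (qdet t X) = qdet t X := by rw [← qdet_map, h]
    ext i j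
    simp only [qantipode, Matrix.map_apply, Matrix.of_apply, map_smul, map_mul,
      map_inverse_of_fixed f hd]
    rw [← qdet_map]
    congr 3
    ext a b
    exact congrFun (congrFun h _) _

end Naturality

section Parity

variable (t : Cqˣ) (m n : ℕ)

theorem p_castAdd (i : Fin m) : p (Fin.castAdd n i) = 0 := by simp [p]

theorem p_natAdd (i : Fin n) : p (Fin.natAdd m i) = 1 := by simp [p]

/-- The parity automorphism on generators: `a_{ij} ↦ (-1) ^ (p(i) + p(j)) a_{ij}`, while `D₁⁻¹` and
`D₂⁻¹` are fixed. -/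
def freeParity : FreeAlgebra Cq (Gen m n) →ₐ[Cq] FreeAlgebra Cq (Gen m n) :=
  FreeAlgebra.lift Cq fun g => match g with
    | .a i j => ((-1 : Cq) ^ (p i + p j)) • freeMatrix m n i j
    | .dInv₁ => FreeAlgebra.ι Cq .dInv₁
    | .dInv₂ => FreeAlgebra.ι Cq .dInv₂

theorem freeParity_a (i j : Fin (m + n)) :
    freeParity m n (freeMatrix m n i j) = ((-1 : Cq) ^ (p i + p j)) • freeMatrix m n i j := by
  simp [freeParity, freeMatrix]

theorem freeParity_blockA :
    freeParity m n (qdet t (blockA (freeMatrix m n))) = qdet t (blockA (freeMatrix m n)) := by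
  rw [← qdet_map]
  congr 1
  ext i j
  simp [blockA, freeParity_a, p_castAdd]

theorem freeParity_blockB :
    freeParity m n (qdet t (blockB (freeMatrix m n))) = qdet t (blockB (freeMatrix m n)) := by
  rw [← qdet_map]
  congr 1
  ext i j
  simp [blockB, freeParity_a, p_natAdd]

theorem mk_freeParity_rel ⦃x y : FreeAlgebra Cq (Gen m n)⦄ (h : GLRel t m n x y) :
    QGL.mk t m n (freeParity m n x) = QGL.mk t m n (freeParity m n y) := by
  have hrel : ∀ {x y}, GLRel t m n x y → QGL.mk t m n x = QGL.mk t m n y :=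
    fun h => RingQuot.mkAlgHom_rel Cq h
  have e1 : freeParity m n (FreeAlgebra.ι Cq Gen.dInv₁) = FreeAlgebra.ι Cq Gen.dInv₁ := by
    simp [freeParity]
  have e2 : freeParity m n (FreeAlgebra.ι Cq Gen.dInv₂) = FreeAlgebra.ι Cq Gen.dInv₂ := by
    simp [freeParity]
  have h0 := hrel h
  cases h with
  | mul_dInv₁ => rw [map_mul, freeParity_blockA, e1, map_one]; exact h0
  | dInv₁_mul => rw [map_mul, freeParity_blockA, e1, map_one]; exact h0
  | mul_dInv₂ => rw [map_mul, freeParity_blockB, e2, map_one]; exact h0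
  | dInv₂_mul => rw [map_mul, freeParity_blockB, e2, map_one]; exact h0
  | sq i j h =>
    simp only [map_mul, freeParity_a, map_smul, smul_mul_smul_comm, map_zero] at h0 ⊢
    rw [h0, smul_zero]
  | row i j l h =>
    simp only [map_mul, freeParity_a, map_smul, smul_mul_smul_comm] at h0 ⊢
    rw [h0, smul_comm, mul_comm ((-1 : Cq) ^ (p i + p j))]
  | col i j k h =>
    simp only [map_mul, freeParity_a, map_smul, smul_mul_smul_comm] at h0 ⊢
    rw [h0, smul_comm, mul_comm ((-1 : Cq) ^ (p i + p j))]
  | comm i j k l h =>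
    simp only [map_mul, freeParity_a, map_smul, smul_mul_smul_comm] at h0 ⊢
    rw [h0, smul_comm, mul_comm ((-1 : Cq) ^ (p i + p j))]
  | cross i j k l hik hjl =>
    simp only [map_mul, map_sub, freeParity_a, map_smul, smul_mul_smul_comm] at h0 ⊢
    have hs : (-1 : Cq) ^ (p i + p l) * (-1 : Cq) ^ (p k + p j) =
        (-1 : Cq) ^ (p i + p j) * (-1 : Cq) ^ (p k + p l) := by
      rw [← pow_add, ← pow_add]; congr 1; ring
    rw [hs, mul_comm ((-1 : Cq) ^ (p k + p l)), smul_comm (koszul i j k l), ← smul_sub, h0,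
      smul_comm]

/-- The parity automorphism of `GL_t(m|n)`. -/
def QGL.parity : QGL t m n →ₐ[Cq] QGL t m n :=
  RingQuot.liftAlgHom Cq ⟨(QGL.mk t m n).comp (freeParity m n), fun _ _ h =>
    mk_freeParity_rel t m n h⟩

theorem QGL.parity_mk (x : FreeAlgebra Cq (Gen m n)) :
    QGL.parity t m n (QGL.mk t m n x) = QGL.mk t m n (freeParity m n x) :=
  RingQuot.liftAlgHom_mkAlgHom_apply Cq _ _ x

theorem QGL.parity_a (i j : Fin (m + n)) :
    QGL.parity t m n (QGL.a t m n i j) = ((-1 : Cq) ^ (p i + p j)) • QGL.a t m n i j := by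
  rw [QGL.a, Matrix.map_apply, QGL.parity_mk, freeParity_a, map_smul]

theorem QGL.parity_involutive (x : QGL t m n) : QGL.parity t m n (QGL.parity t m n x) = x := by
  obtain ⟨x, rfl⟩ := RingQuot.mkAlgHom_surjective Cq (GLRel t m n) x
  change QGL.parity t m n (QGL.parity t m n (QGL.mk t m n x)) = QGL.mk t m n x
  rw [QGL.parity_mk, QGL.parity_mk]
  congr 1
  have : (freeParity m n).comp (freeParity m n) = AlgHom.id Cq _ := by
    ext g
    cases g with
    | a i j =>
      have h := freeParity_a m n i j
      rw [freeMatrix, Matrix.of_apply] at h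
      simp only [Function.comp_apply, AlgHom.comp_apply, h, map_smul, smul_smul]
      rw [← mul_pow]
      simp
    | dInv₁ => simp [freeParity]
    | dInv₂ => simp [freeParity]
  exact DFunLike.congr_fun this x

theorem QGL.parity_berezinian :
    QGL.parity t m n (berezinian t (QGL.a t m n)) = berezinian t (QGL.a t m n) := by
  have hA : (blockA (QGL.a t m n)).map (QGL.parity t m n) = blockA (QGL.a t m n) := by
    ext i j; simp [blockA, QGL.parity_a, p_castAdd]
  have hB : (blockB (QGL.a t m n)).map (QGL.parity t m n) = blockB (QGL.a t m n) := by
    ext i j; simp [blockB, QGL.parity_a, p_natAdd]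
  have hΛ : (blockΛ (QGL.a t m n)).map (QGL.parity t m n) = -blockΛ (QGL.a t m n) := by
    ext i j; simp [blockΛ, QGL.parity_a, p_castAdd, p_natAdd]
  have hΥ : (blockΥ (QGL.a t m n)).map (QGL.parity t m n) = -blockΥ (QGL.a t m n) := by
    ext i j; simp [blockΥ, QGL.parity_a, p_castAdd, p_natAdd]
  have hH : (blockH t (QGL.a t m n)).map (QGL.parity t m n) = blockH t (QGL.a t m n) := by
    rw [blockH, Matrix.map_sub _ (map_sub _), Matrix.map_mul, Matrix.map_mul, hB, hΛ, hΥ,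
      qantipode_fixed _ _ _ hA]
    simp
  rw [berezinian, map_mul, ← qdet_map, ← qdet_map, hA, qantipode_fixed _ _ _ hH]

/-- The parity automorphism of `SL_t(m|n)`. -/
def QSL.parity : QSL t m n →ₐ[Cq] QSL t m n :=
  RingQuot.liftAlgHom Cq ⟨(QSL.proj t m n).comp (QGL.parity t m n), fun x y h => by
    cases h
    rw [AlgHom.comp_apply, AlgHom.comp_apply, QGL.parity_berezinian, map_one]
    exact RingQuot.mkAlgHom_rel Cq SLRel.ber⟩

theorem QSL.parity_proj (x : QGL t m n) :
    QSL.parity t m n (QSL.proj t m n x) = QSL.proj t m n (QGL.parity t m n x) :=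
  RingQuot.liftAlgHom_mkAlgHom_apply Cq _ _ x

theorem QSL.parity_involutive (x : QSL t m n) : QSL.parity t m n (QSL.parity t m n x) = x := by
  obtain ⟨x, rfl⟩ := RingQuot.mkAlgHom_surjective Cq (SLRel t m n) x
  change QSL.parity t m n (QSL.parity t m n (QSL.proj t m n x)) = QSL.proj t m n x
  rw [QSL.parity_proj, QSL.parity_proj, QGL.parity_involutive]

/-- The even and odd parts of `GL_t(m|n)`. -/
abbrev QGL.grading : ZMod 2 → Submodule Cq (QGL t m n) := parityPart (QGL.parity t m n)

instance QGL.gradedAlgebra : GradedAlgebra (QGL.grading t m n) :=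
  parityGradedAlgebra (QGL.parity t m n) (QGL.parity_involutive t m n)

/-- The even and odd parts of `SL_t(m|n)`. -/
abbrev QSL.grading : ZMod 2 → Submodule Cq (QSL t m n) := parityPart (QSL.parity t m n)

instance QSL.gradedAlgebra : GradedAlgebra (QSL.grading t m n) :=
  parityGradedAlgebra (QSL.parity t m n) (QSL.parity_involutive t m n)

end Parity

/-! ### The Hopf structures, the supertranspose, and passing from `t` to `t⁻¹` -/

section Maps

variable {t : Cqˣ} {m n : ℕ}

/-- `G` is the Hopf superalgebra structure of `GL_t(m|n)`: on the generators `a_{ij}` the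
comultiplication is matrix multiplication, the counit is the identity matrix, and the antipode is
given, block by block, by the inverse supermatrix. Since the comultiplication and the counit
are multiplicative and the antipode is unique, `G` is determined by these values. -/
structure IsStandardGL (G : HopfSuperalgebra Cq (QGL.grading t m n)) : Prop where
  comul_a : ∀ i j, G.comul (QGL.a t m n i j) = ∑ k, QGL.a t m n i k ⊗ₜ[Cq] QGL.a t m n k j
  counit_a : ∀ i j, G.counit (QGL.a t m n i j) = if i = j then 1 else 0
  antipode_A : (blockA (QGL.a t m n)).map G.antipode =
    qantipode t (blockA (QGL.a t m n)) +
      qantipode t (blockA (QGL.a t m n)) *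
        (blockΛ (QGL.a t m n) * qantipode t⁻¹ (blockH t (QGL.a t m n)) * blockΥ (QGL.a t m n)) *
        qantipode t (blockA (QGL.a t m n))
  antipode_B : (blockB (QGL.a t m n)).map G.antipode = qantipode t⁻¹ (blockH t (QGL.a t m n))
  antipode_Λ : (blockΛ (QGL.a t m n)).map G.antipode =
    -(qantipode t (blockA (QGL.a t m n)) * blockΛ (QGL.a t m n) *
      qantipode t⁻¹ (blockH t (QGL.a t m n)))
  antipode_Υ : (blockΥ (QGL.a t m n)).map G.antipode =
    -(qantipode t⁻¹ (blockH t (QGL.a t m n)) * blockΥ (QGL.a t m n) *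
      qantipode t (blockA (QGL.a t m n)))

/-- `H` is the Hopf superalgebra structure of `SL_t(m|n)`: the one induced from `GL_t(m|n)` by the
(surjective) quotient map. -/
def IsStandardSL (H : HopfSuperalgebra Cq (QSL.grading t m n)) : Prop :=
  ∃ G : HopfSuperalgebra Cq (QGL.grading t m n),
    IsStandardGL G ∧ IsHopfMorphism G H (QSL.proj t m n)

/-- `st` is the supertranspose `a_{ij} ↦ (-1) ^ ((p(j) + 1) p(i)) a_{ji}`. An algebra morphism is
determined by these values. -/
def IsSupertranspose (st : QSL t m n ≃ₐ[Cq] QSL t m n) : Prop :=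
  ∀ i j, st (QSL.a t m n i j) = ((-1 : Cq) ^ ((p j + 1) * p i)) • QSL.a t m n j i

/-- `τ` is the identification of `SL_t(m|n)` with `SL_{t⁻¹}(m|n)`, the superalgebra with
the parameter `t` replaced by `t⁻¹`, by `a_{ij} ↦ a_{ij}`: an antiautomorphism in the super sense,
`τ (x y) = (-1) ^ (|x| |y|) τ y τ x`. It is determined by its values on the `a_{ij}`. -/
structure IsReversal (τ : QSL t m n ≃ₗ[Cq] QSL t⁻¹ m n) : Prop where
  map_a : ∀ i j, τ (QSL.a t m n i j) = QSL.a t⁻¹ m n i j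
  map_one : τ 1 = 1
  map_mem : ∀ i, ∀ x ∈ QSL.grading t m n i, τ x ∈ QSL.grading t⁻¹ m n i
  map_mul : ∀ i j : ZMod 2, ∀ x ∈ QSL.grading t m n i, ∀ y ∈ QSL.grading t m n j,
    τ (x * y) = ((-1 : Cq) ^ (i.val * j.val)) • (τ y * τ x)

end Maps

end QuantumSuper

end

/-!
# The isomorphism `τ ∘ S ∘ st` between quantum special linear supergroups

**Points.** A homogeneous matrix `X` over a superalgebra that satisfies the defining relations and
has invertible quantum determinants of its diagonal blocks is called a point (`IsPoint`); by the
universal properties (`QGL.ofPoint`, `QSL.ofPoint`) points are algebra morphisms on `GL_t(m|n)`,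
and those of Berezinian `1` are algebra morphisms on `SL_t(m|n)`. All structure maps are obtained
by showing that some matrix is a point: the product `(X ⊗ 1) (1 ⊗ X)` over the super tensor square
(`IsPoint.comulMatrix`), the inverse of `X`, which inverts the parameter (`IsPoint.inverse`), the
matrix `X` over the opposite algebra, which inverts the parameter too (`IsPoint.op`), and the
supertranspose (`IsPoint.superTranspose`). Antimorphisms in the super sense are morphisms to the
opposite algebra, up to a square root of `-1` on the odd part (`untwist`).

**Removing the signs.** Let a superalgebra act on itself by left multiplication. When the odd
columns of a point are multiplied by the parity operator, the Koszul signs disappear and the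
relations become `R X₁ X₂ = X₁ X₂ R` for an ordinary matrix `R` (`isQ_iff_hatR`,
`rttEntries_iff_commute`). In this form it is evident that products with commuting entries and
inverses satisfy such relations. Two facts are not formal. The odd entries generate a nilpotent
ideal (`exists_nilpotent_ideal`), so that points are invertible matrices and the blocks of products
are invertible. The odd entries of the inverse have square zero (`RTT.sqZero_inverse`), which does
not follow from the other relations because `t + t⁻¹` may be a zero divisor.

**Quantum determinants.** For a matrix without odd entries the quantum minors are coefficients of
products of linear forms in the quantum exterior algebra (`prod_coact_mulL_apply`). This gives the
Laplace expansions (`RTT.laplace`), the inverse matrix `S_t(X)` (`RTT.mul_qantipode`) and the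
reciprocity `det_t X · det_{t⁻¹} X⁻¹ = 1` (`RTT.qdet_mul_qdet_of_mul_eq_one`).

**The Berezinian** is group-like (`IsPoint.berezinian_comulMatrix`). A point and its inverse act on
the Koszul complex of a quantum superspace, the tensor product of an exterior superspace and its
dual, by coordinate changes. The cohomology is spanned by one monomial, the product of the exterior
variables of even index and the dual variables of odd index (`koszul_cocycle`), and the Berezinian
is the factor by which its class is multiplied (`kber_eq`); hence it is multiplicative
(`kber_mul`). So the counit and the antipode map it to `1` and to its inverse, and the Hopf
structure descends from `GL_t(m|n)` to `SL_t(m|n)` (`QGL.hopfData`, `QSL.hopfData`).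

**Supertranspose and reversal.** The condition `Ber = 1` says that `A` and the Schur complement `H
= B - Υ S_t(A) Λ` have the same quantum determinant (`IsPoint.berezinian_eq_one_iff`). Quantum
determinants do not change under transposition and under the passage to the opposite algebra. Both
operations also commute with the formation of `H`: `S_t(Aᵀ)` differs from the transpose of `S_t(A)`
by powers of `t ^ 2`, and exactly these make up for moving `Λ` and `Υ` past `S_t(A)`
(`IsPoint.transpose_mul_qantipode_mul`). Hence `st` and `τ` exist on `SL_t(m|n)`.

**The isomorphism.** The map `φ = τ ∘ S ∘ st` is an algebra morphism, as `τ` and `S` are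
antimorphisms, and it is bijective, as `S ∘ τ` and its analogue for `t⁻¹` are inverse to each other
(`QSL.antipodeReversal_comp`). It maps the generating matrix of `SL_t(m|n)` to the inverse of the
supertranspose `ã` of the generating matrix of `SL_{t⁻¹}(m|n)`. The comultiplication of
`SL_{t⁻¹}(m|n)` takes `ã` to `(1 ⊗ ã) (ã ⊗ 1)`, so it takes the inverse to the product in the usual
order; likewise the counit takes it to the unit matrix and the antipode takes it to `ã`. Thus the
Hopf structure of `SL_{t⁻¹}(m|n)` is given on the images of the generators by the same formulas as
that of `SL_t(m|n)` (`QSL.transportedHopfData`), and `φ` is a morphism of Hopf superalgebras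
(`HopfData.isHopfMorphism`). A Hopf structure is determined by the comultiplication and the counit
of the generators, because the antipode is a convolution inverse
(`HopfSuperalgebra.eq_of_comul_counit`), and `st` and `τ` are determined by their values on the
generators; so nothing depends on the choice of these data.
-/


noncomputable section

namespace QuantumSuper

/-! ### Inversions and the expansion of a quantum determinant along its first row -/

section Perm

/-- The permutation that sends `0` to `j` and is otherwise the permutation `τ`, its values being
those different from `j`. -/
def consPerm {k : ℕ} (j : Fin (k + 1)) (τ : Equiv.Perm (Fin k)) : Equiv.Perm (Fin (k + 1)) :=
  Equiv.ofBijective (Fin.cons j fun i => j.succAbove (τ i) : Fin (k + 1) → Fin (k + 1))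
    (Finite.injective_iff_bijective.1 (Fin.cons_injective_iff.2
      ⟨by rintro ⟨i, hi⟩; exact Fin.succAbove_ne _ _ hi,
        Fin.succAbove_right_injective.comp τ.injective⟩))

@[simp] theorem consPerm_zero {k : ℕ} (j : Fin (k + 1)) (τ : Equiv.Perm (Fin k)) :
    consPerm j τ 0 = j := rfl

@[simp] theorem consPerm_succ {k : ℕ} (j : Fin (k + 1)) (τ : Equiv.Perm (Fin k)) (i : Fin k) :
    consPerm j τ i.succ = j.succAbove (τ i) := rfl

theorem consPerm_bijective (k : ℕ) : Function.Bijective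
    fun x : Fin (k + 1) × Equiv.Perm (Fin k) => consPerm x.1 x.2 := by
  rw [Fintype.bijective_iff_injective_and_card]
  constructor
  · rintro ⟨j, τ⟩ ⟨j', τ'⟩ h
    have h0 : j = j' := by simpa using DFunLike.congr_fun h 0
    subst h0
    refine Prod.ext rfl (Equiv.ext fun i => ?_)
    have := DFunLike.congr_fun h i.succ
    simpa using this
  · simp [Fintype.card_perm, Nat.factorial_succ]

/-- A sum over the permutations of `k + 1` letters, sorted by the image of the first letter. -/
theorem sum_perm_succ {k : ℕ} {M : Type*} [AddCommMonoid M]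
    (f : Equiv.Perm (Fin (k + 1)) → M) :
    ∑ s, f s = ∑ j, ∑ τ, f (consPerm j τ) := by
  rw [← Fintype.sum_prod_type' fun j τ => f (consPerm j τ)]
  exact ((consPerm_bijective k).sum_comp f).symm

theorem permLength_eq_sum {k : ℕ} (s : Equiv.Perm (Fin k)) :
    permLength s = ∑ x, ∑ y, if x < y ∧ s y < s x then 1 else 0 := by
  rw [permLength, Finset.card_filter, Fintype.sum_prod_type]

theorem sum_succAbove_lt {k : ℕ} (j : Fin (k + 1)) :
    ∑ i, (if j.succAbove i < j then 1 else 0) = (j : ℕ) := by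
  simp only [Fin.succAbove_lt_iff_castSucc_lt]
  rw [← Finset.card_filter]
  have : (Finset.univ.filter fun i : Fin k => i.castSucc < j).card =
      (Finset.range (j : ℕ)).card := by
    refine Finset.card_bij (fun i _ => (i : ℕ)) ?_ ?_ ?_
    · intro i hi
      simpa [Fin.lt_def] using hi
    · intro a _ b _ h
      exact Fin.ext h
    · intro b hb
      have hb := Finset.mem_range.1 hb
      exact ⟨⟨b, by omega⟩, by simpa [Fin.lt_def] using hb, rfl⟩
  rw [this, Finset.card_range]

theorem permLength_consPerm {k : ℕ} (j : Fin (k + 1)) (τ : Equiv.Perm (Fin k)) :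
    permLength (consPerm j τ) = j + permLength τ := by
  rw [permLength_eq_sum, permLength_eq_sum, Fin.sum_univ_succ]
  congr 1
  · rw [Fin.sum_univ_succ]
    simp only [lt_self_iff_false, false_and, if_false, zero_add, Fin.succ_pos, true_and,
      consPerm_zero, consPerm_succ]
    rw [Equiv.sum_comp τ fun i => if j.succAbove i < j then 1 else 0, sum_succAbove_lt]
  · refine Finset.sum_congr rfl fun x _ => ?_
    rw [Fin.sum_univ_succ]
    simp [Fin.succAbove_lt_succAbove_iff]

theorem permLength_refl (k : ℕ) : permLength (1 : Equiv.Perm (Fin k)) = 0 := by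
  rw [permLength, Finset.card_eq_zero, Finset.filter_eq_empty_iff]
  rintro ⟨x, y⟩ _ ⟨h, h'⟩
  exact lt_asymm h h'

/-- Reversing all letters turns inversions into non-inversions. -/
theorem permLength_revPerm_trans {k : ℕ} (s : Equiv.Perm (Fin k)) :
    permLength (Fin.revPerm.trans s) + permLength s =
      permLength (Fin.revPerm : Equiv.Perm (Fin k)) := by
  simp only [permLength_eq_sum]
  have h : ∑ x : Fin k, ∑ y : Fin k, (if x < y ∧ (Fin.revPerm.trans s) y <
      (Fin.revPerm.trans s) x then 1 else 0) =
      ∑ x : Fin k, ∑ y : Fin k, (if x < y ∧ s x < s y then 1 else 0) := by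
    rw [Finset.sum_comm]
    rw [← Equiv.sum_comp Fin.revPerm]
    refine Finset.sum_congr rfl fun x _ => ?_
    rw [← Equiv.sum_comp Fin.revPerm]
    refine Finset.sum_congr rfl fun y _ => ?_
    simp [Fin.rev_lt_rev]
  rw [h, ← Finset.sum_add_distrib]
  refine Finset.sum_congr rfl fun x _ => ?_
  rw [← Finset.sum_add_distrib]
  refine Finset.sum_congr rfl fun y _ => ?_
  by_cases hxy : x < y
  · have hne : s x ≠ s y := fun e => hxy.ne (s.injective e)
    rcases lt_or_gt_of_ne hne with h1 | h1
    · simp [hxy, h1, h1.not_gt, Fin.rev_lt_rev]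
    · simp [hxy, h1, h1.not_gt, Fin.rev_lt_rev]
  · simp [hxy]

end Perm

section Laplace

variable {A : Type} [Ring A] [Algebra Cq A]

theorem qdet_zero (t : Cqˣ) (X : Matrix (Fin 0) (Fin 0) A) : qdet t X = 1 := by
  simp [qdet, permLength]

theorem qdet_succ (t : Cqˣ) {k : ℕ} (X : Matrix (Fin (k + 1)) (Fin (k + 1)) A) :
    qdet t X = ∑ j : Fin (k + 1), (((-t) ^ (-(j : ℤ)) : Cqˣ) : Cq) •
      (X 0 j * qdet t (X.submatrix Fin.succ j.succAbove)) := by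
  rw [qdet, sum_perm_succ]
  refine Finset.sum_congr rfl fun j _ => ?_
  rw [qdet, Finset.mul_sum, Finset.smul_sum]
  refine Finset.sum_congr rfl fun τ _ => ?_
  rw [permLength_consPerm, mul_smul_comm, smul_smul, ← Units.val_mul, ← zpow_add,
    List.ofFn_succ, List.prod_cons]
  congr 3
  push_cast
  ring

/-- The two expansions, along the first row and along the first column, have the same second
steps; only the commutation of entries in northeast-southwest position is used. -/
theorem qdet_transpose_of_comm (t : Cqˣ) : ∀ {k : ℕ} (X : Matrix (Fin k) (Fin k) A),
    (∀ i j k l, i < k → l < j → X i j * X k l = X k l * X i j) → qdet t X.transpose = qdet t X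
  | 0, X, _ => by rw [qdet_zero, qdet_zero]
  | 1, X, _ => by
    congr 1
    ext i j
    rw [Subsingleton.elim i j, Matrix.transpose_apply]
  | k + 2, X, h => by
    have ih1 : ∀ i j : Fin (k + 2), qdet t (X.submatrix i.succAbove j.succAbove).transpose =
        qdet t (X.submatrix i.succAbove j.succAbove) := fun i j =>
      qdet_transpose_of_comm t _ fun a b c d hac hdb =>
        h _ _ _ _ (Fin.succAbove_lt_succAbove_iff.2 hac) (Fin.succAbove_lt_succAbove_iff.2 hdb)
    have ih2 : ∀ i j : Fin (k + 1),
        qdet t (X.submatrix (Fin.succ ∘ i.succAbove) (Fin.succ ∘ j.succAbove)).transpose =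
        qdet t (X.submatrix (Fin.succ ∘ i.succAbove) (Fin.succ ∘ j.succAbove)) := fun i j =>
      qdet_transpose_of_comm t _ fun a b c d hac hdb =>
        h _ _ _ _ (Fin.succ_lt_succ_iff.2 (Fin.succAbove_lt_succAbove_iff.2 hac))
          (Fin.succ_lt_succ_iff.2 (Fin.succAbove_lt_succAbove_iff.2 hdb))
    -- expansion along the first row, and of the minors that contain the first column along that
    -- column
    have key : ∀ Y : Matrix (Fin (k + 2)) (Fin (k + 2)) A,
        (∀ i j : Fin (k + 2), qdet t (Y.submatrix i.succAbove j.succAbove).transpose =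
          qdet t (Y.submatrix i.succAbove j.succAbove)) →
        qdet t Y = Y 0 0 * qdet t (Y.submatrix Fin.succ Fin.succ) +
          ∑ j : Fin (k + 1), ∑ i : Fin (k + 1),
            (((-t) ^ (-((j : ℤ) + 1 + i)) : Cqˣ) : Cq) • (Y 0 j.succ * Y i.succ 0 *
              qdet t (Y.submatrix (Fin.succ ∘ i.succAbove) (Fin.succ ∘ j.succAbove)).transpose) := by
      intro Y hY
      rw [qdet_succ, Fin.sum_univ_succ]
      congr 1
      · simp
      · refine Finset.sum_congr rfl fun j _ => ?_
        have := hY 0 j.succ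
        rw [Fin.succAbove_zero] at this
        rw [← this, qdet_succ, Finset.mul_sum, Finset.smul_sum]
        refine Finset.sum_congr rfl fun i _ => ?_
        rw [mul_smul_comm, smul_smul, ← Units.val_mul, ← zpow_add, mul_assoc]
        congr 3
        · rw [Fin.val_succ]
          push_cast
          ring
        · congr 2
          ext a b
          simp
    rw [key X ih1, key X.transpose fun i j => (ih1 j i).symm]
    congr 1
    · rw [← Matrix.transpose_submatrix]
      have := ih1 0 0
      rw [Fin.succAbove_zero] at this
      rw [this, Matrix.transpose_apply]
    -- the summands of `X` and of its transpose correspond under the exchange of `i` and `j`, up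
    -- to the order of two entries in northeast-southwest position
    · rw [Finset.sum_comm]
      refine Finset.sum_congr rfl fun i _ => Finset.sum_congr rfl fun j _ => ?_
      rw [← Matrix.transpose_submatrix, Matrix.transpose_transpose, ih2, Matrix.transpose_apply,
        Matrix.transpose_apply, h 0 i.succ j.succ 0 (Fin.succ_pos _) (Fin.succ_pos _)]
      congr 3
      ring

end Laplace

/-! ### Quadratic relations of quantum matrices -/

section RTT

/-- The sign `(-1) ^ (P i * P k)`. -/
def sgn {N : ℕ} (P : Fin N → ℕ) (i k : Fin N) : Cq := (-1) ^ (P i * P k)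

/-- The eigenvalue `t⁻¹` (for even `i`) or `-t` (for odd `i`) of the `R`-matrix. -/
def eig {N : ℕ} (t : Cqˣ) (P : Fin N → ℕ) (i : Fin N) : Cq :=
  (-1) ^ P i * (t ^ ((-1 : ℤ) ^ (P i + 1)) : Cqˣ)

/-- The coefficient `t⁻¹ - t`. -/
def qdiff (t : Cqˣ) : Cq := ((t⁻¹ : Cqˣ) : Cq) - (t : Cq)

variable {N : ℕ} {T : Type} [Ring T] [Algebra Cq T]

/-- The relations `R X₁ X₂ = X₁ X₂ R` of a quantum matrix without Koszul signs, where `R` is the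
`R`-matrix with parameter `t` of a superspace whose basis has the parities `P`. A quantum
supermatrix satisfies them once its entries have been multiplied by suitable powers of the
parity automorphism. -/
structure RTT (t : Cqˣ) (P : Fin N → ℕ) (X : Matrix (Fin N) (Fin N) T) : Prop where
  row : ∀ i j l, j < l → X i j * X i l = (eig t P i * sgn P j l) • (X i l * X i j)
  col : ∀ i j k, i < k → X i j * X k j = (eig t P j * sgn P i k) • (X k j * X i j)
  comm : ∀ i j k l, i < k → l < j → X i j * X k l = (sgn P i k * sgn P j l) • (X k l * X i j)
  cross : ∀ i j k l, i < k → j < l → X i j * X k l =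
    (sgn P i k * sgn P j l) • (X k l * X i j) + (sgn P j l * qdiff t) • (X i l * X k j)

/-- The entries in odd position have square zero. -/
def SqZero (P : Fin N → ℕ) (X : Matrix (Fin N) (Fin N) T) : Prop :=
  ∀ i j, Odd (P i + P j) → X i j * X i j = 0

theorem sgn_mul_self (P : Fin N → ℕ) (i k : Fin N) : sgn P i k * sgn P i k = 1 := by
  rw [sgn, ← mul_pow]; simp

theorem sgn_comm (P : Fin N → ℕ) (i k : Fin N) : sgn P i k = sgn P k i := by
  rw [sgn, sgn, mul_comm]

theorem eig_even (t : Cqˣ) {P : Fin N → ℕ} {i : Fin N} (h : Even (P i)) :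
    eig t P i = ((t⁻¹ : Cqˣ) : Cq) := by
  rw [eig, h.neg_one_pow, h.add_one.neg_one_pow, one_mul, zpow_neg_one]

theorem eig_odd (t : Cqˣ) {P : Fin N → ℕ} {i : Fin N} (h : Odd (P i)) :
    eig t P i = -(t : Cq) := by
  rw [eig, h.neg_one_pow, h.add_one.neg_one_pow, neg_one_mul, zpow_one]

theorem eig_mul_eig_inv (t : Cqˣ) (P : Fin N → ℕ) (i : Fin N) :
    eig t P i * eig t⁻¹ P i = 1 := by
  rcases Nat.even_or_odd (P i) with h | h
  · rw [eig_even _ h, eig_even _ h, inv_inv, Units.inv_mul]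
  · rw [eig_odd _ h, eig_odd _ h, neg_mul_neg, Units.mul_inv]

theorem qdiff_inv (t : Cqˣ) : qdiff t⁻¹ = -qdiff t := by
  rw [qdiff, qdiff, inv_inv, neg_sub]

theorem eig_sub_qdiff (t : Cqˣ) (P : Fin N → ℕ) (i : Fin N) :
    eig t P i - qdiff t = eig t⁻¹ P i := by
  rcases Nat.even_or_odd (P i) with h | h
  · rw [eig_even _ h, eig_even _ h, qdiff, inv_inv]; ring
  · rw [eig_odd _ h, eig_odd _ h, qdiff]; ring

/-- The off-diagonal coefficients of the `R`-matrix. -/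
def swapCoeff (t : Cqˣ) (P : Fin N → ℕ) (i k : Fin N) : Cq :=
  if i = k then eig t P i else sgn P i k

/-- The diagonal coefficients of the `R`-matrix. -/
def diagCoeff (t : Cqˣ) (i k : Fin N) : Cq := if i < k then qdiff t else 0

theorem swapCoeff_comm (t : Cqˣ) (P : Fin N → ℕ) (i k : Fin N) :
    swapCoeff t P i k = swapCoeff t P k i := by
  rcases eq_or_ne i k with rfl | h
  · rfl
  · rw [swapCoeff, swapCoeff, if_neg h, if_neg h.symm, sgn_comm]

/-- The entries of `R X₁ X₂ = X₁ X₂ R`. -/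
def RTTEntries (t : Cqˣ) (P : Fin N → ℕ) (X : Matrix (Fin N) (Fin N) T) : Prop :=
  ∀ i k j l, swapCoeff t P i k • (X k j * X i l) + diagCoeff t i k • (X i j * X k l) =
    swapCoeff t P j l • (X i l * X k j) + diagCoeff t j l • (X i j * X k l)

theorem sgn_smul_sgn_mul_smul (P : Fin N → ℕ) (a b : Fin N) (c : Cq) (x : T) :
    sgn P a b • ((sgn P a b * c) • x) = c • x := by
  rw [smul_smul, ← mul_assoc, sgn_mul_self, one_mul]

theorem eig_smul_eig_inv_smul (t : Cqˣ) (P : Fin N → ℕ) (i : Fin N) (x : T) :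
    eig t P i • (eig t⁻¹ P i • x) = x := by
  rw [smul_smul, eig_mul_eig_inv, one_smul]

theorem RTT.row_symm {t : Cqˣ} {P : Fin N → ℕ} {X : Matrix (Fin N) (Fin N) T} (h : RTT t P X)
    (i j l : Fin N) (hjl : j < l) :
    X i l * X i j = (eig t⁻¹ P i * sgn P j l) • (X i j * X i l) := by
  rw [h.row i j l hjl, smul_smul, mul_mul_mul_comm, sgn_mul_self, mul_comm (eig t⁻¹ P i),
    eig_mul_eig_inv, one_mul, one_smul]

theorem RTT.col_symm {t : Cqˣ} {P : Fin N → ℕ} {X : Matrix (Fin N) (Fin N) T} (h : RTT t P X)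
    (i j k : Fin N) (hik : i < k) :
    X k j * X i j = (eig t⁻¹ P j * sgn P i k) • (X i j * X k j) := by
  rw [h.col i j k hik, smul_smul, mul_mul_mul_comm, sgn_mul_self, mul_comm (eig t⁻¹ P j),
    eig_mul_eig_inv, one_mul, one_smul]

theorem RTT.comm_symm {t : Cqˣ} {P : Fin N → ℕ} {X : Matrix (Fin N) (Fin N) T} (h : RTT t P X)
    (i j k l : Fin N) (hik : i < k) (hlj : l < j) :
    X k l * X i j = (sgn P i k * sgn P j l) • (X i j * X k l) := by
  rw [h.comm i j k l hik hlj, smul_smul, mul_mul_mul_comm, sgn_mul_self, sgn_mul_self, one_mul,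
    one_smul]

theorem RTT.cross_symm {t : Cqˣ} {P : Fin N → ℕ} {X : Matrix (Fin N) (Fin N) T} (h : RTT t P X)
    (i j k l : Fin N) (hik : i < k) (hjl : j < l) :
    X k l * X i j = (sgn P i k * sgn P j l) • (X i j * X k l) -
      (sgn P i k * qdiff t) • (X i l * X k j) := by
  rw [h.cross i j k l hik hjl, smul_add, smul_smul, smul_smul, mul_mul_mul_comm, sgn_mul_self,
    sgn_mul_self, one_mul, one_smul, mul_assoc, ← mul_assoc (sgn P j l), sgn_mul_self, one_mul,
    add_sub_cancel_right]

theorem RTT.entries {t : Cqˣ} {P : Fin N → ℕ} {X : Matrix (Fin N) (Fin N) T} (h : RTT t P X)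
    (hs : SqZero P X) : RTTEntries t P X := by
  intro i k j l
  rcases lt_trichotomy i k with hik | rfl | hik <;> rcases lt_trichotomy j l with hjl | rfl | hjl
  · simp only [swapCoeff, diagCoeff, if_pos hik, if_pos hjl, hik.ne, hjl.ne, if_false]
    rw [h.comm i l k j hik hjl, sgn_comm P l j, mul_comm (sgn P i k), sgn_smul_sgn_mul_smul]
  · simp only [swapCoeff, diagCoeff, if_pos hik, hik.ne, lt_irrefl, if_false, if_true, zero_smul,
      add_zero]
    rw [h.col_symm _ _ _ hik, mul_comm (eig t⁻¹ P j), sgn_smul_sgn_mul_smul, ← add_smul,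
      ← eig_sub_qdiff, sub_add_cancel]
  · simp only [swapCoeff, diagCoeff, if_pos hik, hik.ne, hjl.ne', hjl.not_gt, if_false, zero_smul,
      add_zero]
    rw [h.cross i l k j hik hjl, smul_add, sgn_comm P j l, sgn_smul_sgn_mul_smul,
      mul_comm (sgn P i k), sgn_smul_sgn_mul_smul]
  · simp only [swapCoeff, diagCoeff, if_pos hjl, hjl.ne, lt_irrefl, if_false, if_true, zero_smul,
      add_zero]
    rw [h.row_symm _ _ _ hjl, mul_comm (eig t⁻¹ P i), sgn_smul_sgn_mul_smul, ← add_smul,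
      ← eig_sub_qdiff, sub_add_cancel]
  · simp only [swapCoeff, diagCoeff, lt_irrefl, if_false, if_true, zero_smul, add_zero]
    rcases Nat.even_or_odd (P i + P j) with he | ho
    · congr 1
      rcases Nat.even_or_odd (P i) with hi | hi
      · rw [eig_even t hi, eig_even t ((Nat.even_add.1 he).1 hi)]
      · rw [eig_odd t hi, eig_odd t (by
          rw [← Nat.not_even_iff_odd] at hi ⊢; exact fun hj => hi ((Nat.even_add.1 he).2 hj))]
    · rw [hs i j ho, smul_zero, smul_zero]
  · simp only [swapCoeff, diagCoeff, hjl.ne', hjl.not_gt, lt_irrefl, if_false, if_true, zero_smul,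
      add_zero]
    rw [h.row_symm _ _ _ hjl, mul_comm (eig t⁻¹ P i), mul_smul, sgn_comm P j l, smul_comm,
      eig_smul_eig_inv_smul]
  · simp only [swapCoeff, diagCoeff, if_pos hjl, hik.ne', hjl.ne, hik.not_gt, if_false, zero_smul,
      add_zero]
    rw [h.cross k j i l hik hjl, smul_add, sgn_comm P i k, sgn_smul_sgn_mul_smul,
      h.comm k l i j hik hjl, smul_smul, smul_smul, sgn_comm P l j]
    congr 2
    linear_combination qdiff t * sgn_mul_self P k i * sgn P j l * sgn P j l +
      qdiff t * sgn_mul_self P j l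
  · simp only [swapCoeff, diagCoeff, hik.ne', hik.not_gt, lt_irrefl, if_false, if_true, zero_smul,
      add_zero]
    rw [h.col _ _ _ hik, mul_comm (eig t P j), mul_smul, sgn_comm P i k, smul_smul, sgn_mul_self,
      one_smul]
  · simp only [swapCoeff, diagCoeff, hik.ne', hik.not_gt, hjl.ne', hjl.not_gt, if_false, zero_smul,
      add_zero]
    rw [h.comm k j i l hik hjl, sgn_comm P i k, sgn_smul_sgn_mul_smul]

/-- The relation at `((i, i), (j, j))` for an odd entry says `(t⁻¹ + t) X i j ^ 2 = 0`, which does not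
imply `SqZero`; so the converse of `RTT.entries` is restricted to the other relations. -/
theorem RTTEntries.rtt {t : Cqˣ} {P : Fin N → ℕ} {X : Matrix (Fin N) (Fin N) T}
    (h : RTTEntries t P X) : RTT t P X where
  row i j l hjl := by
    have := h i i l j
    simp only [swapCoeff, diagCoeff, hjl.ne', hjl.not_gt, lt_irrefl, if_false, if_true, zero_smul,
      add_zero] at this
    rw [mul_smul, smul_comm, this, sgn_comm P l j, smul_smul, sgn_mul_self, one_smul]
  col i j k hik := by
    have := h k i j j
    simp only [swapCoeff, diagCoeff, hik.ne', hik.not_gt, lt_irrefl, if_false, if_true, zero_smul,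
      add_zero] at this
    rw [mul_comm, mul_smul, ← this, sgn_comm P k i, smul_smul, sgn_mul_self, one_smul]
  comm i j k l hik hlj := by
    have := h i k l j
    simp only [swapCoeff, diagCoeff, hik.ne, if_pos hik, if_pos hlj, hlj.ne, if_false] at this
    rw [add_right_cancel_iff] at this
    rw [mul_comm, mul_smul, this, sgn_comm P j l, smul_smul, sgn_mul_self, one_smul]
  cross i j k l hik hjl := by
    have h1 := h k i j l
    have h2 := h i k j l
    simp only [swapCoeff, diagCoeff, hik.ne', hik.not_gt, if_pos hjl, hjl.ne, if_false, zero_smul,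
      add_zero] at h1
    simp only [swapCoeff, diagCoeff, hik.ne, if_pos hik, if_pos hjl, hjl.ne, if_false] at h2
    rw [add_right_cancel_iff] at h2
    rw [sgn_comm P k i] at h1
    have e1 : X i j * X k l = sgn P i k • (sgn P i k • (X i j * X k l)) := by
      rw [smul_smul, sgn_mul_self, one_smul]
    have e2 : sgn P j l • (X i l * X k j) = sgn P i k • (X k j * X i l) := h2.symm
    rw [e1, h1, smul_add, smul_smul, mul_comm (sgn P j l) (qdiff t), mul_smul (qdiff t), e2,
      smul_comm (qdiff t)]

/-- The tensor leg `X₁`. -/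
def leg₁ (X : Matrix (Fin N) (Fin N) T) : Matrix (Fin N × Fin N) (Fin N × Fin N) T :=
  Matrix.of fun a b => if a.2 = b.2 then X a.1 b.1 else 0

/-- The tensor leg `X₂`. -/
def leg₂ (X : Matrix (Fin N) (Fin N) T) : Matrix (Fin N × Fin N) (Fin N × Fin N) T :=
  Matrix.of fun a b => if a.1 = b.1 then X a.2 b.2 else 0

variable (T) in
/-- The `R`-matrix. -/
def rMatrix (t : Cqˣ) (P : Fin N → ℕ) : Matrix (Fin N × Fin N) (Fin N × Fin N) T :=
  Matrix.of fun a b => algebraMap Cq T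
    ((if a.swap = b then swapCoeff t P a.1 a.2 else 0) + if a = b then diagCoeff t a.1 a.2 else 0)

theorem leg₁_mul_leg₂ (X Y : Matrix (Fin N) (Fin N) T) (i k j l : Fin N) :
    (leg₁ X * leg₂ Y) (i, k) (j, l) = X i j * Y k l := by
  simp [Matrix.mul_apply, leg₁, leg₂, Fintype.sum_prod_type, ite_and]

theorem leg₂_mul_leg₁ (X Y : Matrix (Fin N) (Fin N) T) (i k j l : Fin N) :
    (leg₂ Y * leg₁ X) (i, k) (j, l) = Y k l * X i j := by
  simp [Matrix.mul_apply, leg₁, leg₂, Fintype.sum_prod_type, ite_and]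

theorem leg₁_mul (X Y : Matrix (Fin N) (Fin N) T) : leg₁ (X * Y) = leg₁ X * leg₁ Y := by
  ext ⟨i, k⟩ ⟨j, l⟩
  simp only [Matrix.mul_apply, leg₁, Fintype.sum_prod_type, Matrix.of_apply]
  by_cases h : k = l <;> simp [h]

theorem leg₂_mul (X Y : Matrix (Fin N) (Fin N) T) : leg₂ (X * Y) = leg₂ X * leg₂ Y := by
  ext ⟨i, k⟩ ⟨j, l⟩
  simp only [Matrix.mul_apply, leg₂, Fintype.sum_prod_type, Matrix.of_apply]
  by_cases h : i = j <;> simp [h]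

theorem leg₁_one : leg₁ (1 : Matrix (Fin N) (Fin N) T) = 1 := by
  ext ⟨i, k⟩ ⟨j, l⟩
  by_cases h : k = l <;> by_cases h' : i = j <;> simp [leg₁, Matrix.one_apply, h, h']

theorem leg₂_one : leg₂ (1 : Matrix (Fin N) (Fin N) T) = 1 := by
  ext ⟨i, k⟩ ⟨j, l⟩
  by_cases h : k = l <;> by_cases h' : i = j <;> simp [leg₂, Matrix.one_apply, h, h']

theorem rMatrix_mul_apply (t : Cqˣ) (P : Fin N → ℕ)
    (Z : Matrix (Fin N × Fin N) (Fin N × Fin N) T) (i k : Fin N) (b : Fin N × Fin N) :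
    (rMatrix T t P * Z) (i, k) b =
      swapCoeff t P i k • Z (k, i) b + diagCoeff t i k • Z (i, k) b := by
  simp only [Matrix.mul_apply, rMatrix, Matrix.of_apply, map_add, add_mul, Finset.sum_add_distrib]
  simp [Algebra.smul_def, apply_ite (algebraMap Cq T), ite_mul]

theorem mul_rMatrix_apply (t : Cqˣ) (P : Fin N → ℕ)
    (Z : Matrix (Fin N × Fin N) (Fin N × Fin N) T) (a : Fin N × Fin N) (j l : Fin N) :
    (Z * rMatrix T t P) a (j, l) =
      swapCoeff t P j l • Z a (l, j) + diagCoeff t j l • Z a (j, l) := by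
  have e : ∀ b : Fin N × Fin N, b.swap = (j, l) ↔ b = (l, j) := fun b => by
    rw [← Prod.swap_inj, Prod.swap_swap, Prod.swap_prod_mk]
  simp only [Matrix.mul_apply, rMatrix, Matrix.of_apply, map_add, mul_add, Finset.sum_add_distrib,
    e]
  simp [Algebra.smul_def, apply_ite (algebraMap Cq T), mul_ite, swapCoeff_comm t P l j,
    Algebra.commutes]

theorem rttEntries_iff_commute {t : Cqˣ} {P : Fin N → ℕ} {X : Matrix (Fin N) (Fin N) T} :
    RTTEntries t P X ↔ rMatrix T t P * (leg₁ X * leg₂ X) = leg₁ X * leg₂ X * rMatrix T t P := by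
  constructor
  · intro h
    ext ⟨i, k⟩ ⟨j, l⟩
    rw [rMatrix_mul_apply, mul_rMatrix_apply]
    simp only [leg₁_mul_leg₂]
    exact h i k j l
  · intro h i k j l
    have := congrFun (congrFun h (i, k)) (j, l)
    rw [rMatrix_mul_apply, mul_rMatrix_apply] at this
    simpa only [leg₁_mul_leg₂] using this

/-- The product of two quantum matrices whose entries commute is a quantum matrix. -/
theorem RTTEntries.mul {t : Cqˣ} {P : Fin N → ℕ} {X Y : Matrix (Fin N) (Fin N) T}
    (hX : RTTEntries t P X) (hY : RTTEntries t P Y)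
    (hc : ∀ i j k l, X i j * Y k l = Y k l * X i j) : RTTEntries t P (X * Y) := by
  rw [rttEntries_iff_commute] at *
  have hXY : leg₁ Y * leg₂ X = leg₂ X * leg₁ Y := by
    ext ⟨i, k⟩ ⟨j, l⟩
    rw [leg₁_mul_leg₂, leg₂_mul_leg₁, hc]
  have e : leg₁ (X * Y) * leg₂ (X * Y) = (leg₁ X * leg₂ X) * (leg₁ Y * leg₂ Y) := by
    rw [leg₁_mul, leg₂_mul, mul_assoc, ← mul_assoc (leg₁ Y), hXY]
    simp only [mul_assoc]
  rw [e, ← mul_assoc, hX, mul_assoc, hY]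
  simp only [mul_assoc]

/-- The entries of the product of two quantum matrices with commuting entries have square zero in
odd position. -/
theorem SqZero.mul {t : Cqˣ} {P : Fin N → ℕ} {X Y : Matrix (Fin N) (Fin N) T}
    (hX : RTT t P X) (hX' : SqZero P X) (hY : RTT t P Y) (hY' : SqZero P Y)
    (hc : ∀ i j k l, X i j * Y k l = Y k l * X i j) : SqZero P (X * Y) := by
  intro i j hij
  have e : (X * Y) i j * (X * Y) i j = ∑ k, ∑ l, (X i k * X i l) * (Y k j * Y l j) := by
    simp only [Matrix.mul_apply, Finset.sum_mul_sum]
    refine Finset.sum_congr rfl fun k _ => Finset.sum_congr rfl fun l _ => ?_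
    rw [mul_assoc, ← mul_assoc (Y k j), ← hc]
    simp only [mul_assoc]
  have hν : eig t P i * eig t P j = -1 := by
    rcases Nat.even_or_odd (P i) with h | h
    · have : Odd (P j) := by
        rw [← Nat.not_even_iff_odd] at hij ⊢
        exact fun hj => hij (h.add hj)
      rw [eig_even t h, eig_odd t this, mul_neg, Units.inv_mul]
    · have : Even (P j) := by
        rw [← Nat.not_odd_iff_even]
        exact fun hj => (Nat.not_even_iff_odd.2 hij) (h.add_odd hj)
      rw [eig_odd t h, eig_even t this, neg_mul, Units.mul_inv]
  -- opposite off-diagonal terms cancel because the two eigenvalues have product `-1`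
  rw [e, ← Finset.sum_product']
  refine Finset.sum_involution (fun x _ => x.swap) ?_ ?_ (fun _ _ => Finset.mem_univ _)
    (fun x _ => x.swap_swap)
  · rintro ⟨k, l⟩ -
    have key : ∀ k l, k < l →
        X i k * X i l * (Y k j * Y l j) + X i l * X i k * (Y l j * Y k j) = 0 := by
      intro k l hkl
      rw [hX.row i k l hkl, hY.col k j l hkl, smul_mul_smul_comm, mul_mul_mul_comm, sgn_mul_self, hν,
        mul_one, neg_one_smul, neg_add_cancel]
    rcases lt_trichotomy k l with hkl | rfl | hkl
    · exact key k l hkl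
    · have : X i k * X i k * (Y k j * Y k j) = 0 := by
        rcases Nat.even_or_odd (P i + P k) with h | h
        · rw [hY' k j, mul_zero]
          rw [← Nat.not_even_iff_odd] at hij ⊢
          intro h'
          apply hij
          have := h.add h'
          rw [show P i + P k + (P k + P j) = (P i + P j) + 2 * P k by ring, Nat.even_add] at this
          exact this.2 (even_two_mul _)
        · rw [hX' i k h, zero_mul]
      simp [this]
    · rw [add_comm]
      exact key l k hkl
  · rintro ⟨k, l⟩ - hne h
    have hkl : l = k := congrArg Prod.fst h
    subst hkl
    apply hne
    rcases Nat.even_or_odd (P i + P l) with h | h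
    · rw [hY' l j, mul_zero]
      rw [← Nat.not_even_iff_odd] at hij ⊢
      intro h'
      apply hij
      have := h.add h'
      rw [show P i + P l + (P l + P j) = (P i + P j) + 2 * P l by ring, Nat.even_add] at this
      exact this.2 (even_two_mul _)
    · rw [hX' i l h, zero_mul]

/-- A quantum matrix over the opposite algebra is a quantum matrix with the inverse parameter. -/
theorem RTT.of_op {t : Cqˣ} {P : Fin N → ℕ} {X : Matrix (Fin N) (Fin N) T}
    (h : RTT t P (X.map MulOpposite.op)) : RTT t⁻¹ P X where
  row i j l hjl := MulOpposite.op_injective (by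
    simpa using h.row_symm i j l hjl)
  col i j k hik := MulOpposite.op_injective (by
    simpa using h.col_symm i j k hik)
  comm i j k l hik hlj := MulOpposite.op_injective (by
    simpa using h.comm_symm i j k l hik hlj)
  cross i j k l hik hjl := MulOpposite.op_injective (by
    have h1 := h.cross_symm i j k l hik hjl
    have h2 := h.comm i l k j hik hjl
    simp only [Matrix.map_apply] at h1 h2
    rw [h2] at h1
    rw [MulOpposite.op_mul, h1, MulOpposite.op_add, MulOpposite.op_smul, MulOpposite.op_smul,
      MulOpposite.op_mul, MulOpposite.op_mul, qdiff_inv, sub_eq_add_neg, ← neg_smul, smul_smul]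
    congr 2
    rw [sgn_comm P l j]
    linear_combination -qdiff t * sgn P j l * sgn_mul_self P i k)

theorem RTT.op {t : Cqˣ} {P : Fin N → ℕ} {X : Matrix (Fin N) (Fin N) T}
    (h : RTT t P X) : RTT t⁻¹ P (X.map MulOpposite.op) where
  row i j l hjl := MulOpposite.unop_injective (by
    simpa using h.row_symm i j l hjl)
  col i j k hik := MulOpposite.unop_injective (by
    simpa using h.col_symm i j k hik)
  comm i j k l hik hlj := MulOpposite.unop_injective (by
    simpa using h.comm_symm i j k l hik hlj)
  cross i j k l hik hjl := MulOpposite.unop_injective (by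
    have h1 := h.cross_symm i j k l hik hjl
    have h2 := h.comm i l k j hik hjl
    rw [h2] at h1
    simp only [Matrix.map_apply, MulOpposite.unop_mul, MulOpposite.unop_op, MulOpposite.unop_add,
      MulOpposite.unop_smul]
    rw [h1, qdiff_inv, sub_eq_add_neg, ← neg_smul, smul_smul]
    congr 2
    rw [sgn_comm P l j]
    linear_combination -qdiff t * sgn P j l * sgn_mul_self P i k)

theorem RTT.transpose {t : Cqˣ} {P : Fin N → ℕ} {X : Matrix (Fin N) (Fin N) T}
    (h : RTT t P X) : RTT t P X.transpose where
  row i j l hjl := h.col j i l hjl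
  col i j k hik := h.row j i k hik
  comm i j k l hik hlj := by
    have := h.comm_symm l k j i hlj hik
    rw [mul_comm, sgn_comm P l j, sgn_comm P k i] at this
    exact this
  cross i j k l hik hjl := by
    have h1 := h.cross j i l k hjl hik
    have h2 := h.comm j k l i hjl hik
    simp only [Matrix.transpose_apply]
    rw [h1, h2, smul_smul, mul_comm (sgn P j l) (sgn P i k)]
    congr 2
    rw [sgn_comm P k i]
    linear_combination qdiff t * sgn P j l * sgn_mul_self P i k

theorem SqZero.transpose {P : Fin N → ℕ} {X : Matrix (Fin N) (Fin N) T}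
    (h : SqZero P X) : SqZero P X.transpose :=
  fun i j hij => h j i (by rwa [add_comm])

theorem SqZero.op {P : Fin N → ℕ} {X : Matrix (Fin N) (Fin N) T}
    (h : SqZero P X) : SqZero P (X.map MulOpposite.op) :=
  fun i j hij => MulOpposite.unop_injective (h i j hij)

/-- The inverse of a quantum matrix is a quantum matrix with the inverse parameter. -/
theorem RTTEntries.inverse {t : Cqˣ} {P : Fin N → ℕ} {X Y : Matrix (Fin N) (Fin N) T}
    (hX : RTTEntries t P X) (hXY : X * Y = 1) (hYX : Y * X = 1) : RTT t⁻¹ P Y := by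
  have h : rMatrix T t P * (leg₂ Y * leg₁ Y) = leg₂ Y * leg₁ Y * rMatrix T t P := by
    rw [rttEntries_iff_commute] at hX
    have h1 : leg₁ X * leg₂ X * (leg₂ Y * leg₁ Y) = 1 := by
      rw [mul_assoc, ← mul_assoc (leg₂ X), ← leg₂_mul, hXY, leg₂_one, one_mul, ← leg₁_mul, hXY,
        leg₁_one]
    have h2 : leg₂ Y * leg₁ Y * (leg₁ X * leg₂ X) = 1 := by
      rw [mul_assoc, ← mul_assoc (leg₁ Y), ← leg₁_mul, hYX, leg₁_one, one_mul, ← leg₂_mul, hYX,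
        leg₂_one]
    calc rMatrix T t P * (leg₂ Y * leg₁ Y)
        = (leg₂ Y * leg₁ Y * (leg₁ X * leg₂ X)) * rMatrix T t P * (leg₂ Y * leg₁ Y) := by
          rw [h2, one_mul]
      _ = leg₂ Y * leg₁ Y * (rMatrix T t P * (leg₁ X * leg₂ X)) * (leg₂ Y * leg₁ Y) := by
          rw [hX]; simp only [mul_assoc]
      _ = leg₂ Y * leg₁ Y * rMatrix T t P * (leg₁ X * leg₂ X * (leg₂ Y * leg₁ Y)) := by
          simp only [mul_assoc]
      _ = _ := by rw [h1, mul_one]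
  -- the entries of the inverse occur in the opposite order, hence satisfy the relations over the
  -- opposite algebra
  refine RTT.of_op (RTTEntries.rtt fun i k j l => MulOpposite.unop_injective ?_)
  have := congrFun (congrFun h (i, k)) (j, l)
  rw [rMatrix_mul_apply, mul_rMatrix_apply] at this
  simpa only [leg₂_mul_leg₁, Matrix.map_apply, MulOpposite.unop_add, MulOpposite.unop_smul,
    MulOpposite.unop_mul, MulOpposite.unop_op] using this

theorem RTT.submatrix {M : ℕ} {t : Cqˣ} {P : Fin N → ℕ} {X : Matrix (Fin N) (Fin N) T}
    (h : RTT t P X) {f : Fin M → Fin N} (hf : StrictMono f) :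
    RTT t (P ∘ f) (X.submatrix f f) where
  row i j l hjl := h.row _ _ _ (hf hjl)
  col i j k hik := h.col _ _ _ (hf hik)
  comm i j k l hik hlj := h.comm _ _ _ _ (hf hik) (hf hlj)
  cross i j k l hik hjl := h.cross _ _ _ _ (hf hik) (hf hjl)

theorem RTT.map {T' : Type} [Ring T'] [Algebra Cq T'] {t : Cqˣ} {P : Fin N → ℕ}
    {X : Matrix (Fin N) (Fin N) T} (h : RTT t P X) (f : T →ₐ[Cq] T') : RTT t P (X.map f) where
  row i j l hjl := by simpa using congrArg f (h.row i j l hjl)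
  col i j k hik := by simpa using congrArg f (h.col i j k hik)
  comm i j k l hik hlj := by simpa using congrArg f (h.comm i j k l hik hlj)
  cross i j k l hik hjl := by simpa using congrArg f (h.cross i j k l hik hjl)

/-- An odd-odd block is an even quantum matrix with the inverse parameter. -/
theorem RTT.of_one {t : Cqˣ} {X : Matrix (Fin N) (Fin N) T} (h : RTT t (fun _ => 1) X) :
    RTT t⁻¹ (fun _ => 0) X where
  row i j l hjl := by simpa [eig, sgn] using h.row i j l hjl
  col i j k hik := by simpa [eig, sgn] using h.col i j k hik
  comm i j k l hik hlj := by simpa [eig, sgn] using h.comm i j k l hik hlj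
  cross i j k l hik hjl := by
    simpa [eig, sgn, qdiff_inv] using h.cross i j k l hik hjl

theorem sqZero_even (X : Matrix (Fin N) (Fin N) T) : SqZero (fun _ => 0) X := by
  intro i j h
  simp at h

end RTT

/-! ### Families of elements that commute up to scalars -/

section QComm

variable {N : ℕ} {𝓡 : Type} [Ring 𝓡] [Algebra Cq 𝓡]

/-- The elements `x i` commute up to the scalars `κ i k`. -/
def QComm (κ : Fin N → Fin N → Cqˣ) (x : Fin N → 𝓡) : Prop :=
  ∀ i k, i < k → x k * x i = (κ i k : Cq) • (x i * x k)

/-- The ordered monomial with exponents `e`. -/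
def mon (x : Fin N → 𝓡) (e : Fin N → ℕ) : 𝓡 := (List.ofFn fun k => x k ^ e k).prod

/-- The scalar by which `x i` times an ordered monomial differs from an ordered monomial. -/
def chiL (κ : Fin N → Fin N → Cqˣ) (i : Fin N) (e : Fin N → ℕ) : Cqˣ :=
  ∏ k, if k < i then κ k i ^ e k else 1

/-- The scalar by which an ordered monomial times `x i` differs from an ordered monomial. -/
def chiR (κ : Fin N → Fin N → Cqˣ) (i : Fin N) (e : Fin N → ℕ) : Cqˣ :=
  ∏ k, if i < k then κ i k ^ e k else 1

theorem chiL_add (κ : Fin N → Fin N → Cqˣ) (i : Fin N) (e f : Fin N → ℕ) :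
    chiL κ i (e + f) = chiL κ i e * chiL κ i f := by
  rw [chiL, chiL, chiL, ← Finset.prod_mul_distrib]
  refine Finset.prod_congr rfl fun k _ => ?_
  split_ifs
  · rw [Pi.add_apply, pow_add]
  · rw [one_mul]

theorem chiR_add (κ : Fin N → Fin N → Cqˣ) (i : Fin N) (e f : Fin N → ℕ) :
    chiR κ i (e + f) = chiR κ i e * chiR κ i f := by
  rw [chiR, chiR, chiR, ← Finset.prod_mul_distrib]
  refine Finset.prod_congr rfl fun k _ => ?_
  split_ifs
  · rw [Pi.add_apply, pow_add]
  · rw [one_mul]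

theorem chiL_single (κ : Fin N → Fin N → Cqˣ) (i k : Fin N) :
    chiL κ i (Pi.single k 1) = if k < i then κ k i else 1 := by
  rw [chiL, Finset.prod_eq_single k]
  · simp
  · intro b _ hb
    simp [Pi.single_eq_of_ne hb]
  · simp

theorem chiR_single (κ : Fin N → Fin N → Cqˣ) (i k : Fin N) :
    chiR κ i (Pi.single k 1) = if i < k then κ i k else 1 := by
  rw [chiR, Finset.prod_eq_single k]
  · simp
  · intro b _ hb
    simp [Pi.single_eq_of_ne hb]
  · simp

theorem mon_succ (x : Fin (N + 1) → 𝓡) (e : Fin (N + 1) → ℕ) :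
    mon x e = x 0 ^ e 0 * mon (x ∘ Fin.succ) (e ∘ Fin.succ) := by
  rw [mon, List.ofFn_succ, List.prod_cons]; rfl

theorem mul_pow_of_smul {y z : 𝓡} {c : Cqˣ} (h : y * z = (c : Cq) • (z * y)) (n : ℕ) :
    y * z ^ n = ((c ^ n : Cqˣ) : Cq) • (z ^ n * y) := by
  induction n with
  | zero => simp
  | succ n ih =>
    rw [pow_succ, ← mul_assoc, ih, smul_mul_assoc, mul_assoc, h, mul_smul_comm, smul_smul,
      pow_succ, Units.val_mul, mul_assoc]

theorem pow_mul_of_smul {y z : 𝓡} {c : Cqˣ} (h : z * y = (c : Cq) • (y * z)) (n : ℕ) :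
    z ^ n * y = ((c ^ n : Cqˣ) : Cq) • (y * z ^ n) := by
  induction n with
  | zero => simp
  | succ n ih =>
    rw [pow_succ', mul_assoc, ih, mul_smul_comm, ← mul_assoc, h, smul_mul_assoc, smul_smul,
      pow_succ, Units.val_mul, mul_assoc]

theorem mon_mul_of_smul : ∀ {N : ℕ} (x : Fin N → 𝓡) (e : Fin N → ℕ) (y : 𝓡) (c : Fin N → Cqˣ),
    (∀ k, x k * y = (c k : Cq) • (y * x k)) →
      mon x e * y = ((∏ k, c k ^ e k : Cqˣ) : Cq) • (y * mon x e)
  | 0, x, e, y, c, h => by simp [mon]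
  | N + 1, x, e, y, c, h => by
    rw [mon_succ, mul_assoc, mon_mul_of_smul (x ∘ Fin.succ) (e ∘ Fin.succ) y (c ∘ Fin.succ)
      (fun k => h k.succ), mul_smul_comm, ← mul_assoc, pow_mul_of_smul (h 0), smul_mul_assoc,
      smul_smul, mul_assoc, Fin.prod_univ_succ, Units.val_mul, mul_comm (Units.val _)]
    rfl

theorem add_single_zero_comp_succ (e : Fin (N + 1) → ℕ) :
    (e + Pi.single 0 1) ∘ Fin.succ = e ∘ Fin.succ := by
  funext k
  simp [Fin.succ_ne_zero]

theorem add_single_succ_comp_succ (e : Fin (N + 1) → ℕ) (i : Fin N) :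
    (e + Pi.single i.succ 1) ∘ Fin.succ = e ∘ Fin.succ + Pi.single i 1 := by
  funext k
  simp only [Function.comp_apply, Pi.add_apply, Pi.single_apply, Fin.succ_inj]

theorem mul_mon : ∀ {N : ℕ} {κ : Fin N → Fin N → Cqˣ} {x : Fin N → 𝓡} (_ : QComm κ x)
    (i : Fin N) (e : Fin N → ℕ),
    x i * mon x e = (chiL κ i e : Cq) • mon x (e + Pi.single i 1)
  | N + 1, κ, x, h, i, e => by
    refine Fin.cases ?_ (fun i => ?_) i
    · rw [mon_succ, mon_succ, add_single_zero_comp_succ, ← mul_assoc, ← pow_succ']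
      simp [chiL]
    · have ih := mul_mon (κ := fun a b => κ a.succ b.succ) (x := x ∘ Fin.succ)
        (fun a b hab => h _ _ (Fin.succ_lt_succ_iff.2 hab)) i (e ∘ Fin.succ)
      rw [Function.comp_apply] at ih
      rw [mon_succ, mon_succ, add_single_succ_comp_succ, ← mul_assoc,
        mul_pow_of_smul (h 0 i.succ (Fin.succ_pos i)), smul_mul_assoc, mul_assoc, ih,
        mul_smul_comm, smul_smul, ← Units.val_mul]
      congr 2
      rw [chiL, chiL, Fin.prod_univ_succ]
      simp

theorem mon_mul : ∀ {N : ℕ} {κ : Fin N → Fin N → Cqˣ} {x : Fin N → 𝓡} (_ : QComm κ x)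
    (i : Fin N) (e : Fin N → ℕ),
    mon x e * x i = (chiR κ i e : Cq) • mon x (e + Pi.single i 1)
  | N + 1, κ, x, h, i, e => by
    refine Fin.cases ?_ (fun i => ?_) i
    · rw [mon_succ, mon_succ, add_single_zero_comp_succ, mul_assoc,
        mon_mul_of_smul (x ∘ Fin.succ) (e ∘ Fin.succ) (x 0) (fun k => κ 0 k.succ)
          (fun k => h 0 k.succ (Fin.succ_pos k)), mul_smul_comm, ← mul_assoc, ← pow_succ]
      simp [chiR, Fin.prod_univ_succ]
    · have ih := mon_mul (κ := fun a b => κ a.succ b.succ) (x := x ∘ Fin.succ)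
        (fun a b hab => h _ _ (Fin.succ_lt_succ_iff.2 hab)) i (e ∘ Fin.succ)
      rw [Function.comp_apply] at ih
      rw [mon_succ, mon_succ, add_single_succ_comp_succ, mul_assoc, ih, mul_smul_comm]
      congr 2
      rw [chiR, chiR, Fin.prod_univ_succ]
      simp

theorem mon_zero (x : Fin N → 𝓡) : mon x 0 = 1 := by
  rw [mon]
  exact List.prod_eq_one (by simp)

theorem mon_eq_zero (x : Fin N → 𝓡) {i : Fin N} (h : x i * x i = 0) {e : Fin N → ℕ}
    (he : 2 ≤ e i) : mon x e = 0 := by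
  rw [mon]
  refine List.prod_eq_zero (List.mem_ofFn.2 ⟨i, ?_⟩)
  obtain ⟨a, ha⟩ := Nat.exists_eq_add_of_le he
  rw [ha, pow_add, pow_two, h, zero_mul]

/-- Every word in a family commuting up to scalars is a scalar times an ordered monomial. -/
theorem exists_prod_eq_smul_mon {κ : Fin N → Fin N → Cqˣ} {x : Fin N → 𝓡} (h : QComm κ x) :
    ∀ {r : ℕ} (w : Fin r → Fin N), ∃ c : Cq,
      (List.ofFn fun a => x (w a)).prod = c • mon x (∑ a, Pi.single (w a) 1)
  | 0, w => ⟨1, by simp [mon_zero]⟩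
  | r + 1, w => by
    obtain ⟨c, hc⟩ := exists_prod_eq_smul_mon h (w ∘ Fin.succ)
    refine ⟨c * chiL κ (w 0) (∑ a, Pi.single ((w ∘ Fin.succ) a) 1), ?_⟩
    rw [List.ofFn_succ, List.prod_cons]
    simp only [Function.comp_apply] at hc
    rw [hc, mul_smul_comm, mul_mon h, smul_smul, Fin.sum_univ_succ,
      add_comm (Pi.single (w 0) 1)]
    rfl

/-- A word with a repeated letter vanishes when all letters have square zero. -/
theorem prod_eq_zero_of_not_injective {κ : Fin N → Fin N → Cqˣ} {x : Fin N → 𝓡} (h : QComm κ x)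
    (hs : ∀ i, x i * x i = 0) {r : ℕ} {w : Fin r → Fin N} (hw : ¬ Function.Injective w) :
    (List.ofFn fun a => x (w a)).prod = 0 := by
  obtain ⟨c, hc⟩ := exists_prod_eq_smul_mon h w
  rw [hc]
  simp only [Function.Injective, not_forall] at hw
  obtain ⟨a, b, hab, hne⟩ := hw
  rw [mon_eq_zero x (hs (w a)), smul_zero]
  rw [Finset.sum_apply]
  calc 2 = ∑ c ∈ ({a, b} : Finset (Fin r)), (Pi.single (w c) 1 : Fin N → ℕ) (w a) := by
        rw [Finset.sum_pair hne, hab]; simp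
    _ ≤ _ := Finset.sum_le_sum_of_subset (Finset.subset_univ _)

theorem mul_prod_succAbove {c : Cqˣ} : ∀ {k : ℕ} {x : Fin (k + 1) → 𝓡}
    (_ : QComm (fun _ _ => c) x) (j : Fin (k + 1)),
    x j * (List.ofFn fun a => x (j.succAbove a)).prod =
      ((c ^ (j : ℕ) : Cqˣ) : Cq) • (List.ofFn x).prod
  | k, x, h, j => by
    refine Fin.cases ?_ (fun j => ?_) j
    · simp [List.ofFn_succ]
    · obtain ⟨k, rfl⟩ : ∃ l, k = l + 1 := ⟨k - 1, by have := j.pos; omega⟩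
      have ih := mul_prod_succAbove (c := c) (x := x ∘ Fin.succ)
        (fun a b hab => h _ _ (Fin.succ_lt_succ_iff.2 hab)) j
      rw [List.ofFn_succ, List.ofFn_succ (f := x), List.prod_cons, List.prod_cons]
      simp only [Fin.succ_succAbove_zero, Fin.succ_succAbove_succ, Function.comp_apply] at ih ⊢
      rw [← mul_assoc, h 0 j.succ (Fin.succ_pos j), smul_mul_assoc, mul_assoc, ih, mul_smul_comm,
        smul_smul, Fin.val_succ, pow_succ', Units.val_mul]
      rfl

/-- Permuting the letters of a word with all letters multiplies it by a power of the scalar. -/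
theorem prod_perm {c : Cqˣ} : ∀ {k : ℕ} {x : Fin k → 𝓡} (_ : QComm (fun _ _ => c) x)
    (s : Equiv.Perm (Fin k)),
    (List.ofFn fun a => x (s a)).prod = ((c ^ permLength s : Cqˣ) : Cq) • (List.ofFn x).prod
  | 0, x, h, s => by simp [permLength]
  | k + 1, x, h, s => by
    obtain ⟨⟨j, τ⟩, rfl⟩ := (consPerm_bijective k).2 s
    have ih := prod_perm (c := c) (x := fun a => x (j.succAbove a))
      (fun a b hab => h _ _ (Fin.succAbove_lt_succAbove_iff.2 hab)) τ
    rw [List.ofFn_succ, List.prod_cons]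
    simp only [consPerm_zero, consPerm_succ]
    rw [ih, mul_smul_comm, mul_prod_succAbove h, smul_smul, permLength_consPerm, pow_add, mul_comm,
      Units.val_mul]

/-- A double sum in which the diagonal terms vanish and opposite terms cancel. -/
theorem sum_sum_eq_zero_of_antisymm {M : Type} [AddCommGroup M] (f : Fin N → Fin N → M)
    (h1 : ∀ a, f a a = 0) (h2 : ∀ a b, a < b → f a b + f b a = 0) : ∑ a, ∑ b, f a b = 0 := by
  rw [← Finset.sum_product']
  refine Finset.sum_involution (fun x _ => x.swap) ?_ ?_ (fun _ _ => Finset.mem_univ _)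
    (fun x _ => x.swap_swap)
  · rintro ⟨a, b⟩ -
    rcases lt_trichotomy a b with hab | rfl | hab
    · exact h2 a b hab
    · simp [h1]
    · rw [add_comm]; exact h2 b a hab
  · rintro ⟨a, b⟩ - hne h
    have hab : b = a := congrArg Prod.fst h
    subst hab
    exact absurd (h1 b) hne

/-- The scalars `ε (-1) ^ (P i * P k)`. -/
def kap (ε : Cqˣ) (P : Fin N → ℕ) (i k : Fin N) : Cqˣ := ε * (-1) ^ (P i * P k)

theorem coe_kap (ε : Cqˣ) (P : Fin N → ℕ) (i k : Fin N) :
    (kap ε P i k : Cq) = ε * sgn P i k := by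
  simp [kap, sgn]

/-- The family `x` transformed by the matrix `Y`. -/
def coact (x : Fin N → 𝓡) (Y : Matrix (Fin N) (Fin N) 𝓡) (j : Fin N) : 𝓡 := ∑ i, x i * Y i j

theorem coact_mul_coact (x : Fin N → 𝓡) (Y : Matrix (Fin N) (Fin N) 𝓡)
    (hc : ∀ a i j, x a * Y i j = Y i j * x a) (j l : Fin N) :
    coact x Y j * coact x Y l = ∑ a, ∑ b, x a * x b * (Y a j * Y b l) := by
  simp only [coact, Finset.sum_mul_sum]
  refine Finset.sum_congr rfl fun a _ => Finset.sum_congr rfl fun b _ => ?_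
  rw [mul_assoc, ← mul_assoc (Y a j), ← hc]
  simp only [mul_assoc]

/-- A quantum matrix transforms generators of a quantum superspace into generators of the same
quantum superspace. The condition on `ε` singles out the two superspaces, the exterior and the
symmetric one, on which the quantum matrices with parameter `t` act. -/
theorem coact_qComm {t ε : Cqˣ} {P : Fin N → ℕ} (hε : (ε : Cq) * (qdiff t + ε) = 1)
    {x : Fin N → 𝓡} (hx : QComm (kap ε P) x) {Y : Matrix (Fin N) (Fin N) 𝓡} (hY : RTT t P Y)
    (hsq : ∀ a, x a * x a = 0 ∨ (ε : Cq) * eig t P a = 1)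
    (hc : ∀ a i j, x a * Y i j = Y i j * x a) : QComm (kap ε P) (coact x Y) := by
  intro j l hjl
  rw [coact_mul_coact x Y hc, coact_mul_coact x Y hc, ← sub_eq_zero, Finset.smul_sum,
    ← Finset.sum_sub_distrib]
  simp only [Finset.smul_sum, ← Finset.sum_sub_distrib]
  -- the diagonal terms vanish by the row relations or as `x a` has square zero; the terms of
  -- `(a, b)` and `(b, a)` cancel
  apply sum_sum_eq_zero_of_antisymm
  · intro a
    rw [sub_eq_zero, hY.row a j l hjl, mul_smul_comm, smul_smul, coe_kap, mul_mul_mul_comm,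
      sgn_mul_self, mul_one]
    rcases hsq a with h | h
    · rw [h]; simp
    · rw [h, one_smul]
  · intro a b hab
    rw [hx a b hab, hY.cross_symm a j b l hab hjl, hY.comm_symm a l b j hab hjl, coe_kap, coe_kap,
      sgn_comm P l j]
    generalize x a * x b = z
    have h1 := sgn_mul_self P a b
    have h2 := sgn_mul_self P j l
    simp only [mul_sub, mul_smul_comm, smul_mul_assoc, smul_sub, smul_smul]
    generalize z * (Y a j * Y b l) = u
    generalize z * (Y a l * Y b j) = v
    have e1 : (ε : Cq) * sgn P a b * (sgn P a b * sgn P j l) - (ε : Cq) * sgn P j l = 0 := by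
      linear_combination (ε : Cq) * sgn P j l * h1
    have e2 : 1 - (ε : Cq) * sgn P a b * (sgn P a b * qdiff t) -
        (ε : Cq) * sgn P j l * (ε * sgn P a b * (sgn P a b * sgn P j l)) = 0 := by
      linear_combination (-(ε : Cq) * qdiff t - ε * ε * sgn P j l * sgn P j l) * h1 -
        ε * ε * h2 - hε
    linear_combination (norm := module) e1 • u + e2 • v

theorem coact_sq {t ε : Cqˣ} {P : Fin N → ℕ} {x : Fin N → 𝓡} (hx : QComm (kap ε P) x)
    {Y : Matrix (Fin N) (Fin N) 𝓡} (hY : RTT t P Y) {j : Fin N}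
    (hj : eig t P j = -ε) (hsq : ∀ a, x a * x a = 0 ∨ Y a j * Y a j = 0)
    (hc : ∀ a i j, x a * Y i j = Y i j * x a) : coact x Y j * coact x Y j = 0 := by
  rw [coact_mul_coact x Y hc]
  apply sum_sum_eq_zero_of_antisymm
  · intro a
    rcases hsq a with h | h <;> rw [h] <;> simp
  · intro a b hab
    rw [hx a b hab, hY.col a j b hab, hj, coe_kap, smul_mul_assoc, mul_smul_comm, ← add_smul,
      neg_mul, neg_add_cancel, zero_smul]

end QComm

/-! ### The quantum exterior superspace -/

section ExtSpace

variable {N : ℕ} {V : Type} [AddCommGroup V] [Module Cq V]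

/-- Combinations, with coefficients in `V`, of the ordered monomials in `N` variables; a monomial is
encoded by its exponents. -/
abbrev Ext (N : ℕ) (V : Type) [AddCommGroup V] : Type := (Fin N → ℕ) →₀ V

/-- Multiplication from the left by the `i`-th variable, when the variables commute up to `κ` and
those in `Z` have square zero. -/
def mulL (κ : Fin N → Fin N → Cqˣ) (Z : Finset (Fin N)) (i : Fin N) : Module.End Cq (Ext N V) :=
  Finsupp.lsum Cq fun e =>
    (if i ∈ Z ∧ e i ≠ 0 then 0 else (chiL κ i e : Cq)) • Finsupp.lsingle (e + Pi.single i 1)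

/-- Multiplication from the right by the `i`-th variable. -/
def mulR (κ : Fin N → Fin N → Cqˣ) (Z : Finset (Fin N)) (i : Fin N) : Module.End Cq (Ext N V) :=
  Finsupp.lsum Cq fun e =>
    (if i ∈ Z ∧ e i ≠ 0 then 0 else (chiR κ i e : Cq)) • Finsupp.lsingle (e + Pi.single i 1)

/-- The action of an endomorphism on the coefficients. -/
def extMap (N : ℕ) (V : Type) [AddCommGroup V] [Module Cq V] :
    Module.End Cq V →ₐ[Cq] Module.End Cq (Ext N V) where
  toFun f := Finsupp.mapRange.linearMap f
  map_one' := by ext; simp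
  map_mul' f g := by ext; simp
  map_zero' := by ext; simp
  map_add' f g := by ext; simp
  commutes' c := by ext; simp

theorem mulL_single (κ : Fin N → Fin N → Cqˣ) (Z : Finset (Fin N)) (i : Fin N) (e : Fin N → ℕ)
    (v : V) : mulL κ Z i (Finsupp.single e v) =
      (if i ∈ Z ∧ e i ≠ 0 then 0 else (chiL κ i e : Cq)) •
        Finsupp.single (e + Pi.single i 1) v := by
  rw [mulL, Finsupp.lsum_single, LinearMap.smul_apply, Finsupp.lsingle_apply]

theorem mulR_single (κ : Fin N → Fin N → Cqˣ) (Z : Finset (Fin N)) (i : Fin N) (e : Fin N → ℕ)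
    (v : V) : mulR κ Z i (Finsupp.single e v) =
      (if i ∈ Z ∧ e i ≠ 0 then 0 else (chiR κ i e : Cq)) •
        Finsupp.single (e + Pi.single i 1) v := by
  rw [mulR, Finsupp.lsum_single, LinearMap.smul_apply, Finsupp.lsingle_apply]

theorem extMap_single (f : Module.End Cq V) (e : Fin N → ℕ) (v : V) :
    extMap N V f (Finsupp.single e v) = Finsupp.single e (f v) := by
  simp [extMap]

theorem extMap_apply (f : Module.End Cq V) (Ψ : Ext N V) (e : Fin N → ℕ) :
    extMap N V f Ψ e = f (Ψ e) := by
  simp [extMap]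

theorem mulL_comm_extMap (κ : Fin N → Fin N → Cqˣ) (Z : Finset (Fin N)) (i : Fin N)
    (f : Module.End Cq V) : mulL κ Z i * extMap N V f = extMap N V f * mulL κ Z i := by
  refine Finsupp.lhom_ext fun e v => ?_
  rw [Module.End.mul_apply, Module.End.mul_apply, extMap_single, mulL_single, mulL_single, map_smul,
    extMap_single]

theorem mulR_comm_extMap (κ : Fin N → Fin N → Cqˣ) (Z : Finset (Fin N)) (i : Fin N)
    (f : Module.End Cq V) : mulR κ Z i * extMap N V f = extMap N V f * mulR κ Z i := by
  refine Finsupp.lhom_ext fun e v => ?_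
  rw [Module.End.mul_apply, Module.End.mul_apply, extMap_single, mulR_single, mulR_single, map_smul,
    extMap_single]

theorem mulL_qComm (κ : Fin N → Fin N → Cqˣ) (Z : Finset (Fin N)) :
    QComm κ (mulL (V := V) κ Z) := by
  intro i k hik
  refine Finsupp.lhom_ext fun e v => ?_
  simp only [Module.End.mul_apply, LinearMap.smul_apply, mulL_single, map_smul, smul_smul,
    chiL_add, chiL_single, if_pos hik, if_neg hik.not_gt, Pi.add_apply, Pi.single_apply,
    if_neg hik.ne, if_neg hik.ne', add_zero, mul_one, add_right_comm e (Pi.single k 1)]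
  congr 1
  split_ifs <;> simp
  ring

theorem mulL_mul_mulR (κ : Fin N → Fin N → Cqˣ) (Z : Finset (Fin N)) (i k : Fin N) :
    mulL (V := V) κ Z i * mulR κ Z k = mulR κ Z k * mulL κ Z i := by
  refine Finsupp.lhom_ext fun e v => ?_
  simp only [Module.End.mul_apply, mulL_single, mulR_single, map_smul, smul_smul, chiL_add,
    chiR_add, chiL_single, chiR_single, add_right_comm e (Pi.single k 1), Pi.add_apply,
    Pi.single_apply]
  congr 1
  rcases eq_or_ne i k with rfl | h
  · split_ifs <;> simp_all [mul_comm]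
  · simp only [if_neg h, if_neg h.symm, add_zero]
    split_ifs <;> simp
    · ring
    · ring

theorem mulL_sq (κ : Fin N → Fin N → Cqˣ) {Z : Finset (Fin N)} {i : Fin N} (hi : i ∈ Z) :
    mulL (V := V) κ Z i * mulL κ Z i = 0 := by
  refine Finsupp.lhom_ext fun e v => ?_
  rw [Module.End.mul_apply, mulL_single, map_smul, mulL_single]
  simp [hi]

theorem mulL_apply (κ : Fin N → Fin N → Cqˣ) (Z : Finset (Fin N)) (i : Fin N) (Ψ : Ext N V)
    (e : Fin N → ℕ) : mulL κ Z i Ψ e =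
      if e i = 0 ∨ i ∈ Z ∧ e i ≠ 1 then 0 else (chiL κ i e : Cq) • Ψ (e - Pi.single i 1) := by
  induction Ψ using Finsupp.induction_linear with
  | zero => simp
  | add f g hf hg =>
    rw [map_add, Finsupp.add_apply, hf, hg]
    split_ifs
    · simp
    · rw [Finsupp.add_apply, smul_add]
  | single f v =>
    rw [mulL_single, Finsupp.smul_apply, Finsupp.single_apply, Finsupp.single_apply]
    by_cases h : f + Pi.single i 1 = e
    · subst h
      have e1 : f + Pi.single i 1 - Pi.single i 1 = f := by
        funext k; simp
      rw [e1, chiL_add, chiL_single, if_neg (lt_irrefl i), mul_one]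
      simp
    · rw [if_neg h, smul_zero]
      split_ifs with h1 h2
      · rfl
      · exfalso
        rw [not_or] at h1
        apply h
        rw [h2]
        funext k
        rcases eq_or_ne k i with rfl | hk
        · simp; omega
        · simp [hk]
      · simp

theorem chiL_sum (κ : Fin N → Fin N → Cqˣ) (i : Fin N) {ι : Type} (s : Finset ι)
    (f : ι → Fin N → ℕ) : chiL κ i (∑ x ∈ s, f x) = ∏ x ∈ s, chiL κ i (f x) := by
  classical
  induction s using Finset.induction_on with
  | empty => simp [chiL]
  | insert a s ha ih => rw [Finset.sum_insert ha, Finset.prod_insert ha, chiL_add, ih]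

/-- The exponents of the product of the variables with indices `a x`. -/
def indic {r : ℕ} (a : Fin r → Fin N) : Fin N → ℕ := ∑ x, Pi.single (a x) 1

theorem indic_apply_self {r : ℕ} {a : Fin r → Fin N} (ha : Function.Injective a) (x : Fin r) :
    indic a (a x) = 1 := by
  rw [indic, Finset.sum_apply, Finset.sum_eq_single x]
  · simp
  · intro y _ hy
    exact Pi.single_eq_of_ne (fun h => hy (ha h).symm) _
  · simp

theorem indic_apply_of_notMem {r : ℕ} {a : Fin r → Fin N} {i : Fin N} (h : i ∉ Set.range a) :
    indic a i = 0 := by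
  rw [indic, Finset.sum_apply]
  refine Finset.sum_eq_zero fun x _ => Pi.single_eq_of_ne (fun hx => h ⟨x, hx.symm⟩) _

theorem indic_sub_single {r : ℕ} (a : Fin (r + 1) → Fin N) (x : Fin (r + 1)) :
    indic a - Pi.single (a x) 1 = indic fun y => a (x.succAbove y) := by
  rw [indic, Fin.sum_univ_succAbove _ x]
  exact add_tsub_cancel_left _ _

theorem chiL_indic {κ : Fin N → Fin N → Cqˣ} {c : Cqˣ} {r : ℕ} {a : Fin r → Fin N}
    (ha : StrictMono a) (hκ : ∀ x y, κ (a x) (a y) = c) (x : Fin r) :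
    chiL κ (a x) (indic a) = c ^ (x : ℕ) := by
  simp only [indic, chiL_sum, chiL_single, ha.lt_iff_lt, hκ]
  rw [Finset.prod_ite, Finset.prod_const_one, mul_one, Finset.prod_const,
    show (Finset.univ.filter fun y => y < x) = Finset.Iio x by ext; simp, Fin.card_Iio]

theorem indic_zero (a : Fin 0 → Fin N) : indic a = 0 := by
  rw [indic, Finset.univ_eq_empty, Finset.sum_empty]

/-- The quantum minors are the coefficients of products of linear forms in the quantum exterior
algebra. -/
theorem prod_coact_mulL_apply (t : Cqˣ) {κ : Fin N → Fin N → Cqˣ} (Z : Finset (Fin N))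
    (X : Matrix (Fin N) (Fin N) (Module.End Cq V)) :
    ∀ {r : ℕ} {a : Fin r → Fin N} (_ : StrictMono a) (_ : ∀ x y, κ (a x) (a y) = (-t)⁻¹)
      (w : Fin r → Fin N) (Φ : Ext N V), (∀ e, e ≠ 0 → Φ e = 0) →
      (List.ofFn fun x => coact (mulL κ Z) (X.map (extMap N V)) (w x)).prod Φ (indic a) =
      qdet t (X.submatrix a w).transpose (Φ 0)
  | 0, a, _, _, w, Φ, _ => by simp [qdet_zero, indic_zero]
  | r + 1, a, ha, hκ, w, Φ, hΦ => by
    rw [List.ofFn_succ, List.prod_cons, Module.End.mul_apply, coact, LinearMap.sum_apply,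
      Finsupp.finsetSum_apply, qdet_succ, LinearMap.sum_apply]
    -- only the variables that divide the monomial `indic a` contribute; this is the expansion
    -- along the first row
    refine (Fintype.sum_of_injective a ha.injective _ _ ?_ ?_).symm
    · intro i hi
      rw [Module.End.mul_apply, mulL_apply, indic_apply_of_notMem hi]
      simp
    · intro x
      have ih := prod_coact_mulL_apply t Z X (ha.comp (Fin.strictMono_succAbove x))
        (fun y z => hκ _ _) (fun y => w y.succ) Φ hΦ
      rw [Module.End.mul_apply, mulL_apply, indic_apply_self ha.injective, indic_sub_single,
        Matrix.map_apply, extMap_apply, chiL_indic ha hκ, LinearMap.smul_apply,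
        Module.End.mul_apply, show (indic fun y => a (x.succAbove y)) = indic (a ∘ x.succAbove)
        from rfl, ih]
      simp
      rfl

end ExtSpace

/-! ### Quantum determinants of quantum matrices -/

section DetFacts

variable {N : ℕ} {T : Type} [Ring T] [Algebra Cq T]

/-- The linear forms in the quantum exterior algebra with the columns of `X` as coefficients. -/
def extForm (t : Cqˣ) (X : Matrix (Fin N) (Fin N) T) (j : Fin N) : Module.End Cq (Ext N T) :=
  coact (mulL (fun _ _ => (-t)⁻¹) Finset.univ) ((X.map (Algebra.lmul Cq T)).map (extMap N T)) j

/-- The quantum minors of `X` with all rows are the top coefficients of the words in the linear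
forms. -/
theorem extForm_word (t : Cqˣ) (X : Matrix (Fin N) (Fin N) T) (w : Fin N → Fin N) (v : T) :
    (List.ofFn fun x => extForm t X (w x)).prod (Finsupp.single 0 v) (indic id) =
      qdet t (X.submatrix id w).transpose * v := by
  have h := prod_coact_mulL_apply t Finset.univ (κ := fun _ _ => (-t)⁻¹)
    (X.map (Algebra.lmul Cq T)) (a := id) strictMono_id (fun _ _ => rfl) w
    (Finsupp.single 0 v) (fun e he => Finsupp.single_eq_of_ne he)
  rw [Finsupp.single_eq_same] at h
  have e : ((X.map (Algebra.lmul Cq T)).submatrix id w).transpose =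
    (X.submatrix id w).transpose.map (Algebra.lmul Cq T) := rfl
  rw [e, qdet_map] at h
  exact h

theorem extForm_qComm {t : Cqˣ} {X : Matrix (Fin N) (Fin N) T} (hX : RTT t (fun _ => 0) X) :
    QComm (fun _ _ => (-t)⁻¹) (extForm t X) := by
  have hk : (fun _ _ : Fin N => (-t)⁻¹) = kap (-t)⁻¹ (fun _ => 0) := by
    funext i k; simp [kap]
  have h1 : (((-t)⁻¹ : Cqˣ) : Cq) = -((t⁻¹ : Cqˣ) : Cq) := by rw [inv_neg, Units.val_neg]
  unfold extForm
  rw [hk]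
  refine coact_qComm (t := t) ?_ (mulL_qComm _ _) ((hX.map _).map _)
    (fun a => Or.inl (mulL_sq _ (Finset.mem_univ a))) fun a i j => mulL_comm_extMap _ _ _ _
  rw [h1, qdiff, sub_add_eq_add_sub, add_neg_cancel, zero_sub, neg_mul_neg, Units.inv_mul]

theorem extForm_sq {t : Cqˣ} {X : Matrix (Fin N) (Fin N) T} (hX : RTT t (fun _ => 0) X)
    (j : Fin N) : extForm t X j * extForm t X j = 0 := by
  have hk : (fun _ _ : Fin N => (-t)⁻¹) = kap (-t)⁻¹ (fun _ => 0) := by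
    funext i k; simp [kap]
  have h1 : (((-t)⁻¹ : Cqˣ) : Cq) = -((t⁻¹ : Cqˣ) : Cq) := by rw [inv_neg, Units.val_neg]
  unfold extForm
  rw [hk]
  refine coact_sq (t := t) (mulL_qComm _ _) ((hX.map _).map _) ?_
    (fun a => Or.inl (mulL_sq _ (Finset.mem_univ a))) fun a i j => mulL_comm_extMap _ _ _ _
  rw [h1, neg_neg, eig_even _ (by simp)]

theorem RTT.qdet_transpose {t : Cqˣ} {X : Matrix (Fin N) (Fin N) T} (hX : RTT t (fun _ => 0) X) :
    qdet t X.transpose = qdet t X :=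
  qdet_transpose_of_comm t X fun i j k l hik hlj => by
    rw [hX.comm i j k l hik hlj]; simp [sgn]

theorem RTT.qdet_perm_rows {t : Cqˣ} {X : Matrix (Fin N) (Fin N) T} (hX : RTT t (fun _ => 0) X)
    (s : Equiv.Perm (Fin N)) :
    qdet t (X.submatrix s id) = (((-t)⁻¹ ^ permLength s : Cqˣ) : Cq) • qdet t X := by
  have h := extForm_word t X.transpose s 1
  rw [prod_perm (extForm_qComm hX.transpose), LinearMap.smul_apply, Finsupp.smul_apply,
    show (List.ofFn (extForm t X.transpose)).prod (Finsupp.single 0 1) (indic id) = _ from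
      extForm_word t X.transpose id 1] at h
  simpa using h.symm

/-- The Laplace expansion along a row, and the vanishing of the expansions with alien cofactors. -/
theorem RTT.laplace {k : ℕ} {t : Cqˣ} {X : Matrix (Fin (k + 1)) (Fin (k + 1)) T}
    (hX : RTT t (fun _ => 0) X) (i j : Fin (k + 1)) :
    ∑ s : Fin (k + 1), (((-t) ^ (-(s : ℤ)) : Cqˣ) : Cq) •
      (X i s * qdet t (X.submatrix j.succAbove s.succAbove)) =
      if i = j then (((-t) ^ (-(j : ℤ)) : Cqˣ) : Cq) • qdet t X else 0 := by
  -- the sum is the top coefficient of the word in the linear forms of the rows `i` and those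
  -- different from `j`
  have h := extForm_word t X.transpose (Fin.cons i j.succAbove) 1
  have e : (X.transpose.submatrix id (Fin.cons i j.succAbove)).transpose =
    X.submatrix (Fin.cons i j.succAbove) id := rfl
  rw [e, qdet_succ, mul_one] at h
  have h2 : ∀ s : Fin (k + 1), (X.submatrix (Fin.cons i j.succAbove : Fin (k+1) → Fin (k+1)) id).submatrix Fin.succ s.succAbove =
    X.submatrix j.succAbove s.succAbove := fun s => by
    ext a b; simp
  simp only [h2] at h
  simp only [Matrix.submatrix_apply, Fin.cons_zero, id] at h
  rw [← h]
  have h3 : (List.ofFn fun x => extForm t X.transpose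
      ((Fin.cons i j.succAbove : Fin (k + 1) → Fin (k + 1)) x)).prod =
      extForm t X.transpose i * (List.ofFn fun x => extForm t X.transpose (j.succAbove x)).prod := by
    rw [List.ofFn_succ, List.prod_cons]
    simp
  split_ifs with hij
  · subst hij
    rw [h3, mul_prod_succAbove (extForm_qComm hX.transpose), LinearMap.smul_apply,
      Finsupp.smul_apply,
      show (List.ofFn (extForm t X.transpose)).prod (Finsupp.single 0 1) (indic id) = _ from
        extForm_word t X.transpose id 1]
    simp
  · rw [prod_eq_zero_of_not_injective (extForm_qComm hX.transpose) (extForm_sq hX.transpose)]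
    · simp
    · intro hinj
      obtain ⟨y, hy⟩ := Fin.exists_succAbove_eq hij
      have := @hinj 0 y.succ (by simp [hy])
      exact Fin.succ_ne_zero y this.symm

theorem unop_list_prod_ofFn {k : ℕ} (f : Fin k → Tᵐᵒᵖ) :
    MulOpposite.unop (List.ofFn f).prod = (List.ofFn fun i => MulOpposite.unop (f i.rev)).prod := by
  rw [MulOpposite.unop_list_prod, List.map_ofFn]
  congr 1
  refine List.ext_getElem (by simp) fun i h1 h2 => ?_
  simp only [List.getElem_reverse, List.getElem_ofFn, Function.comp_apply, List.length_ofFn]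
  congr 2
  ext
  simp [Fin.rev]
  omega

/-- The quantum determinant as an alternating sum of products in the reversed order. -/
theorem RTT.unop_qdet_op {t : Cqˣ} {X : Matrix (Fin N) (Fin N) T} (hX : RTT t (fun _ => 0) X) :
    MulOpposite.unop (qdet t⁻¹ (X.map MulOpposite.op)) = qdet t X := by
  have h := hX.qdet_perm_rows Fin.revPerm
  -- reversing the products amounts to reversing the rows
  have h1 : MulOpposite.unop (qdet t⁻¹ (X.map MulOpposite.op)) =
      (((-t) ^ permLength (Fin.revPerm : Equiv.Perm (Fin N)) : Cqˣ) : Cq) •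
        qdet t (X.submatrix Fin.revPerm id) := by
    rw [qdet, qdet, Finset.smul_sum, ← MulOpposite.coe_opLinearEquiv_symm Cq, map_sum]
    refine Fintype.sum_equiv (Equiv.mulRight (Fin.revPerm : Equiv.Perm (Fin N))) _ _ fun s => ?_
    rw [map_smul, MulOpposite.coe_opLinearEquiv_symm, unop_list_prod_ofFn, smul_smul]
    have hl := permLength_revPerm_trans s
    congr 1
    · rw [← Units.val_mul]
      congr 1
      rw [← hl, show Equiv.mulRight (Fin.revPerm : Equiv.Perm (Fin N)) s = Fin.revPerm.trans s from rfl,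
        show -t⁻¹ = (-t)⁻¹ from (inv_neg).symm, inv_zpow', neg_neg, ← zpow_natCast, ← zpow_add]
      congr 1
      push_cast
      ring
  rw [h1, h, smul_smul, ← Units.val_mul, ← mul_pow, mul_inv_cancel, one_pow, Units.val_one, one_smul]

/-- The columns and rows of the inverse matrix express the variables through the linear forms; comparing
the top coefficients gives a factor of `1`. -/
theorem RTT.qdet_mul_qdet_of_mul_eq_one {t : Cqˣ} {X Y : Matrix (Fin N) (Fin N) T}
    (hX : RTT t (fun _ => 0) X) (hXY : X * Y = 1) (hYX : Y * X = 1) :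
    qdet t X * qdet t⁻¹ Y = 1 := by
  have hY : RTT t⁻¹ (fun _ => 0) Y := (hX.entries (sqZero_even X)).inverse hXY hYX
  set c : Cqˣ := (-t)⁻¹ with hc
  let lf : T →ₐ[Cq] Module.End Cq (Ext N T) := (extMap N T).comp (Algebra.lmul Cq T)
  let x : Fin N → Module.End Cq (Ext N T) := mulL (fun _ _ => c) Finset.univ
  have hxl : ∀ i y, x i * lf y = lf y * x i := fun i y => mulL_comm_extMap _ _ _ _
  have hL : ∀ j, extForm t X j = ∑ i, x i * lf (X i j) := fun j => rfl
  -- the variables in terms of the linear forms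
  have hx : ∀ k, x k = ∑ j, extForm t X j * lf (Y j k) := by
    intro k
    simp only [hL, Finset.sum_mul]
    rw [Finset.sum_comm]
    simp only [mul_assoc, ← map_mul, ← Finset.mul_sum, ← map_sum, ← Matrix.mul_apply, hXY]
    rw [Finset.sum_eq_single k]
    · simp
    · intro b _ hb; simp [Matrix.one_apply_ne hb]
    · simp
  have key : ∀ {r : ℕ} (a : Fin r → Fin N), (List.ofFn fun y => x (a y)).prod =
      ∑ w : Fin r → Fin N, (List.ofFn fun y => extForm t X (w y)).prod *
        lf (MulOpposite.unop (List.ofFn fun y => MulOpposite.op (Y (w y) (a y))).prod) := by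
    intro r
    induction r with
    | zero => intro a; simp
    | succ r ih =>
      intro a
      have hw : ∀ (z : T) (b : Fin r → Fin N), (List.ofFn fun y => x (b y)).prod * lf z =
          lf z * (List.ofFn fun y => x (b y)).prod := by
        intro z b
        refine (Commute.list_prod_left _ _ fun y hy => ?_).eq
        obtain ⟨i, rfl⟩ := List.mem_ofFn.1 hy
        exact hxl _ _
      rw [List.ofFn_succ, List.prod_cons, hx, Finset.sum_mul]
      rw [← (Fin.consEquiv fun _ => Fin N).sum_comp, Fintype.sum_prod_type]
      refine Finset.sum_congr rfl fun j _ => ?_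
      rw [mul_assoc, ← hw, ih, Finset.sum_mul, Finset.mul_sum]
      refine Finset.sum_congr rfl fun w _ => ?_
      simp only [Fin.consEquiv, Equiv.coe_fn_mk, List.ofFn_succ, Fin.cons_zero, Fin.cons_succ,
        List.prod_cons, MulOpposite.unop_mul, MulOpposite.unop_op, map_mul, mul_assoc]
  -- the word of all variables has top coefficient `1`
  have h0 := extForm_word t (1 : Matrix (Fin N) (Fin N) T) id 1
  have h1 : extForm t (1 : Matrix (Fin N) (Fin N) T) = x := by
    funext j
    change ∑ i, x i * lf ((1 : Matrix (Fin N) (Fin N) T) i j) = x j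
    rw [Finset.sum_eq_single j]
    · simp
    · intro b _ hb; simp [Matrix.one_apply_ne hb]
    · simp
  have hone : qdet t (1 : Matrix (Fin N) (Fin N) T) = 1 := by
    rw [qdet, Finset.sum_eq_single 1]
    · rw [permLength_refl, List.prod_eq_one]
      · simp
      · intro y hy
        obtain ⟨i, rfl⟩ := List.mem_ofFn.1 hy
        exact Matrix.one_apply_eq i
    · intro s _ hs
      obtain ⟨i, hi⟩ : ∃ i, s i ≠ i := by
        by_contra h
        push Not at h
        exact hs (Equiv.ext h)
      rw [List.prod_eq_zero, smul_zero]
      exact List.mem_ofFn.2 ⟨i, Matrix.one_apply_ne hi.symm⟩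
    · simp
  rw [h1, key] at h0
  simp only [id, mul_one, Matrix.submatrix_id_id, Matrix.transpose_one, hone, LinearMap.sum_apply,
    Finsupp.finsetSum_apply, Module.End.mul_apply] at h0
  have hlf : ∀ z : T, lf z (Finsupp.single 0 1) = Finsupp.single 0 z := fun z => by
    change extMap N T (Algebra.lmul Cq T z) _ = _
    rw [extMap_single]
    simp
  simp only [hlf, extForm_word] at h0
  rw [← h0]
  have hYt := hY.transpose.unop_qdet_op
  rw [inv_inv, hY.qdet_transpose] at hYt
  have hdef : qdet t (Y.transpose.map MulOpposite.op) = ∑ s : Equiv.Perm (Fin N),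
    (((-t) ^ (-(permLength s : ℤ)) : Cqˣ) : Cq) •
      (List.ofFn fun i => MulOpposite.op (Y (s i) i)).prod := rfl
  rw [← hYt, hdef, ← MulOpposite.coe_opLinearEquiv_symm Cq, map_sum, Finset.mul_sum]
  -- words with a repeated letter vanish, the others are sorted
  refine Fintype.sum_of_injective (fun s : Equiv.Perm (Fin N) => (s : Fin N → Fin N))
    DFunLike.coe_injective _ _ ?_ ?_
  · intro w hw
    have hw' : ¬ Function.Injective w := fun h => hw ⟨Equiv.ofBijective w
      (Finite.injective_iff_bijective.1 h), rfl⟩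
    have h := extForm_word t X w 1
    rw [prod_eq_zero_of_not_injective (extForm_qComm hX) (extForm_sq hX) hw', mul_one] at h
    rw [← h]
    simp
  · intro s
    have h2 : (X.submatrix id s).transpose = X.transpose.submatrix s id := rfl
    rw [h2, hX.transpose.qdet_perm_rows, hX.qdet_transpose, map_smul, mul_smul_comm,
      smul_mul_assoc, MulOpposite.coe_opLinearEquiv_symm, zpow_neg, zpow_natCast, inv_pow]

theorem RTT.qdet_inv_mul_qdet_of_mul_eq_one {t : Cqˣ} {X Y : Matrix (Fin N) (Fin N) T}
    (hX : RTT t (fun _ => 0) X) (hXY : X * Y = 1) (hYX : Y * X = 1) :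
    qdet t⁻¹ Y * qdet t X = 1 := by
  have hY : RTT t⁻¹ (fun _ => 0) Y := (hX.entries (sqZero_even X)).inverse hXY hYX
  simpa using hY.qdet_mul_qdet_of_mul_eq_one hYX hXY

theorem RTT.submatrix_submatrix {M : ℕ} {t : Cqˣ} {X : Matrix (Fin N) (Fin N) T}
    (h : RTT t (fun _ => 0) X) {f g : Fin M → Fin N} (hf : StrictMono f) (hg : StrictMono g) :
    RTT t (fun _ => 0) (X.submatrix f g) where
  row i j l hjl := h.row _ _ _ (hg hjl)
  col i j k hik := h.col _ _ _ (hf hik)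
  comm i j k l hik hlj := h.comm _ _ _ _ (hf hik) (hg hlj)
  cross i j k l hik hjl := h.cross _ _ _ _ (hf hik) (hg hjl)

theorem RTT.laplace_left {k : ℕ} {t : Cqˣ} {X : Matrix (Fin (k + 1)) (Fin (k + 1)) T}
    (hX : RTT t (fun _ => 0) X) (i j : Fin (k + 1)) :
    ∑ s : Fin (k + 1), (((-t) ^ (s : ℤ) : Cqˣ) : Cq) •
      (qdet t (X.submatrix s.succAbove j.succAbove) * X s i) =
      if i = j then (((-t) ^ (j : ℤ) : Cqˣ) : Cq) • qdet t X else 0 := by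
  have h := congrArg MulOpposite.unop (hX.transpose.op.laplace i j)
  rw [apply_ite MulOpposite.unop, MulOpposite.unop_smul, hX.transpose.unop_qdet_op,
    ← MulOpposite.coe_opLinearEquiv_symm Cq, map_sum, hX.qdet_transpose] at h
  simp only [map_zero, map_smul, MulOpposite.coe_opLinearEquiv_symm, MulOpposite.unop_mul] at h
  have h1 : ∀ s : ℤ, (-t⁻¹) ^ (-s) = (-t) ^ s := fun s => by
    rw [show -t⁻¹ = (-t)⁻¹ from (inv_neg).symm, inv_zpow', neg_neg]
  simp only [h1] at h
  rw [← h]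
  refine Finset.sum_congr rfl fun s _ => ?_
  congr 2
  have hS := hX.submatrix_submatrix (Fin.strictMono_succAbove s) (Fin.strictMono_succAbove j)
  rw [← hS.qdet_transpose, ← hS.transpose.unop_qdet_op]
  rfl

/-- The matrix of signed quantum cofactors. -/
def qadj (t : Cqˣ) {k : ℕ} (X : Matrix (Fin (k + 1)) (Fin (k + 1)) T) :
    Matrix (Fin (k + 1)) (Fin (k + 1)) T := Matrix.of fun i j =>
  (((-t) ^ ((j : ℤ) - (i : ℤ)) : Cqˣ) : Cq) • qdet t (X.submatrix j.succAbove i.succAbove)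

theorem RTT.mul_qadj {k : ℕ} {t : Cqˣ} {X : Matrix (Fin (k + 1)) (Fin (k + 1)) T}
    (hX : RTT t (fun _ => 0) X) : X * qadj t X = Matrix.diagonal fun _ => qdet t X := by
  ext i j
  have h := congrArg (fun z => (((-t) ^ (j : ℤ) : Cqˣ) : Cq) • z) (hX.laplace i j)
  simp only [Finset.smul_sum, smul_smul, ← Units.val_mul, ← zpow_add, smul_ite, smul_zero,
    add_neg_cancel, zpow_zero, Units.val_one, one_smul] at h
  rw [Matrix.mul_apply, Matrix.diagonal_apply, ← h]
  refine Finset.sum_congr rfl fun s _ => ?_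
  rw [qadj, Matrix.of_apply, mul_smul_comm, sub_eq_add_neg]

theorem RTT.qadj_mul {k : ℕ} {t : Cqˣ} {X : Matrix (Fin (k + 1)) (Fin (k + 1)) T}
    (hX : RTT t (fun _ => 0) X) : qadj t X * X = Matrix.diagonal fun _ => qdet t X := by
  ext i j
  have h := congrArg (fun z => (((-t) ^ (-(i : ℤ)) : Cqˣ) : Cq) • z) (hX.laplace_left j i)
  simp only [Finset.smul_sum, smul_smul, ← Units.val_mul, ← zpow_add, smul_ite, smul_zero,
    neg_add_cancel, zpow_zero, Units.val_one, one_smul] at h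
  rw [Matrix.mul_apply, Matrix.diagonal_apply]
  simp only [eq_comm (a := i)]
  rw [← h]
  refine Finset.sum_congr rfl fun s _ => ?_
  rw [qadj, Matrix.of_apply, smul_mul_assoc, sub_eq_neg_add]

/-- The quantum determinant is central. -/
theorem RTT.qdet_comm {t : Cqˣ} {X : Matrix (Fin N) (Fin N) T} (hX : RTT t (fun _ => 0) X)
    (i j : Fin N) : X i j * qdet t X = qdet t X * X i j := by
  obtain ⟨k, rfl⟩ : ∃ l, N = l + 1 := ⟨N - 1, by have := i.pos; omega⟩
  have h := congrFun (congrFun (Matrix.mul_assoc X (qadj t X) X) i) j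
  rw [hX.mul_qadj, hX.qadj_mul] at h
  simpa using h.symm

theorem qantipode_eq_qadj (t : Cqˣ) {k : ℕ} (X : Matrix (Fin (k + 1)) (Fin (k + 1)) T)
    (i j : Fin (k + 1)) : qantipode t X i j = qadj t X i j * Ring.inverse (qdet t X) := by
  rw [qantipode, qadj, Matrix.of_apply, Matrix.of_apply, smul_mul_assoc]

theorem RTT.mul_qantipode {t : Cqˣ} {X : Matrix (Fin N) (Fin N) T} (hX : RTT t (fun _ => 0) X)
    (hu : IsUnit (qdet t X)) : X * qantipode t X = 1 := by
  cases N with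
  | zero => exact Subsingleton.elim _ _
  | succ k =>
    ext i j
    simp only [Matrix.mul_apply, qantipode_eq_qadj, ← mul_assoc, ← Finset.sum_mul]
    rw [← Matrix.mul_apply, hX.mul_qadj, Matrix.diagonal_apply, Matrix.one_apply]
    split_ifs
    · rw [Ring.mul_inverse_cancel _ hu]
    · rw [zero_mul]

theorem RTT.qantipode_mul {t : Cqˣ} {X : Matrix (Fin N) (Fin N) T} (hX : RTT t (fun _ => 0) X)
    (hu : IsUnit (qdet t X)) : qantipode t X * X = 1 := by
  cases N with
  | zero => exact Subsingleton.elim _ _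
  | succ k =>
    ext i j
    have hc : ∀ a b, Ring.inverse (qdet t X) * X a b = X a b * Ring.inverse (qdet t X) := by
      intro a b
      obtain ⟨u, hu⟩ := hu
      rw [← hu, Ring.inverse_unit, Units.inv_mul_eq_iff_eq_mul, ← mul_assoc, hu, ← hX.qdet_comm,
        mul_assoc, ← hu, Units.mul_inv, mul_one]
    simp only [Matrix.mul_apply, qantipode_eq_qadj, mul_assoc, hc]
    simp only [← mul_assoc, ← Finset.sum_mul]
    rw [← Matrix.mul_apply, hX.qadj_mul, Matrix.diagonal_apply, Matrix.one_apply]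
    split_ifs
    · rw [Ring.mul_inverse_cancel _ hu]
    · rw [zero_mul]

end DetFacts

/-! ### The quantum Koszul complex -/

section Koszul

variable {N : ℕ} {V W : Type} [AddCommGroup V] [Module Cq V] [AddCommGroup W] [Module Cq W]

theorem ext_ext {f g : Ext N (Ext N V) →ₗ[Cq] W}
    (h : ∀ e e' v, f (Finsupp.single e (Finsupp.single e' v)) =
      g (Finsupp.single e (Finsupp.single e' v))) : f = g := by
  refine Finsupp.lhom_ext' fun e => Finsupp.lhom_ext fun e' v => ?_
  exact h e e' v

/-- The operator that maps the monomial with exponents `(e, e')` to `c e e'` times the monomial with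
exponents `(s e, s' e')`. -/
def monOp (c : (Fin N → ℕ) → (Fin N → ℕ) → Cq) (s s' : (Fin N → ℕ) → Fin N → ℕ) :
    Module.End Cq (Ext N (Ext N V)) :=
  Finsupp.lsum Cq fun e => Finsupp.lsum Cq fun e' =>
    c e e' • Finsupp.lsingle (s e) ∘ₗ Finsupp.lsingle (s' e')

theorem monOp_single (c : (Fin N → ℕ) → (Fin N → ℕ) → Cq) (s s' : (Fin N → ℕ) → Fin N → ℕ)
    (e e' : Fin N → ℕ) (v : V) : monOp c s s' (Finsupp.single e (Finsupp.single e' v)) =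
      c e e' • Finsupp.single (s e) (Finsupp.single (s' e') v) := by
  simp only [monOp, Finsupp.lsum_single]
  rfl

variable (κ κ' : Fin N → Fin N → Cqˣ) (Z : Finset (Fin N))

/-- The scalar in the `i`-th summand of the Koszul differential. -/
def kchi (i : Fin N) (e e' : Fin N → ℕ) : Cqˣ := chiR κ i e * chiR κ' i e'

/-- The `i`-th summand of the Koszul differential. -/
def kd (i : Fin N) : Module.End Cq (Ext N (Ext N V)) :=
  mulR κ Z i * extMap N (Ext N V) (mulR κ' Zᶜ i)

/-- The Koszul differential. -/
def koszulD : Module.End Cq (Ext N (Ext N V)) := ∑ i, kd κ κ' Z i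

/-- The partial inverse of the `i`-th summand of the Koszul differential. -/
def kh (i : Fin N) : Module.End Cq (Ext N (Ext N V)) :=
  monOp (fun e e' => if (i ∈ Z ∧ e i = 1 ∧ 1 ≤ e' i) ∨ (i ∉ Z ∧ e' i = 1 ∧ 1 ≤ e i)
    then (((kchi κ κ' i e e')⁻¹ : Cqˣ) : Cq) else 0) (fun e => e - Pi.single i 1) (fun e' => e' - Pi.single i 1)

/-- The exponents of the product of the variables in `Z`. -/
def topExp : Fin N → ℕ := fun i => if i ∈ Z then 1 else 0

/-- The projection to the monomials whose exponents at `i` are those of the fundamental cocycle. -/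
def kp (i : Fin N) : Module.End Cq (Ext N (Ext N V)) :=
  monOp (fun e e' => if e i = topExp Z i ∧ e' i = topExp Zᶜ i then 1 else 0) id id

theorem kd_single (i : Fin N) (e e' : Fin N → ℕ) (v : V) :
    kd κ κ' Z i (Finsupp.single e (Finsupp.single e' v)) =
      (if (i ∈ Z ∧ e i ≠ 0) ∨ (i ∉ Z ∧ e' i ≠ 0) then 0 else (kchi κ κ' i e e' : Cq)) •
        Finsupp.single (e + Pi.single i 1) (Finsupp.single (e' + Pi.single i 1) v) := by
  rw [kd, Module.End.mul_apply, extMap_single, mulR_single, mulR_single, ← Finsupp.smul_single,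
    smul_smul]
  congr 1
  simp only [Finset.mem_compl, kchi, Units.val_mul]
  split_ifs <;> simp_all <;> tauto

theorem kchi_add_single (i k : Fin N) (e e' : Fin N → ℕ) :
    kchi κ κ' i (e + Pi.single k 1) (e' + Pi.single k 1) =
      kchi κ κ' i e e' * if i < k then κ i k * κ' i k else 1 := by
  simp only [kchi, chiR_add, chiR_single]
  split_ifs
  · exact mul_mul_mul_comm _ _ _ _
  · simp

variable {κ κ'}

theorem sub_add_single {e : Fin N → ℕ} {i : Fin N} (h : e i ≠ 0) :
    e - Pi.single i 1 + Pi.single i 1 = e := by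
  funext k
  rcases eq_or_ne k i with rfl | hk
  · simp; omega
  · simp [hk]

theorem add_sub_single (e : Fin N → ℕ) (i : Fin N) :
    e + Pi.single i 1 - Pi.single i 1 = e := add_tsub_cancel_right _ _

theorem add_sub_single_of_ne (e : Fin N → ℕ) {i k : Fin N} (h : i ≠ k) :
    e + Pi.single k 1 - Pi.single i 1 = e - Pi.single i 1 + Pi.single k 1 := by
  funext l
  rcases eq_or_ne l k with rfl | hk
  · simp [h.symm]
  · simp [hk]

/-- The partial inverse anticommutes with the other summands of the differential. -/
theorem kh_kd_of_ne (hκ : ∀ i k, κ i k * κ' i k = -1) {i k : Fin N} (h : i ≠ k) :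
    kd κ κ' Z k * kh κ κ' Z i + kh κ κ' Z i * kd κ κ' Z k =
      (0 : Module.End Cq (Ext N (Ext N V))) := by
  refine ext_ext fun e e' v => ?_
  rw [LinearMap.add_apply, Module.End.mul_apply, Module.End.mul_apply, kh, monOp_single, kd_single,
    map_smul, map_smul, kd_single, monOp_single, smul_smul, smul_smul, LinearMap.zero_apply]
  simp only [Pi.sub_apply, Pi.add_apply, Pi.single_eq_of_ne h, Pi.single_eq_of_ne h.symm, add_zero,
    Nat.sub_zero, add_sub_single_of_ne _ h]
  rw [← add_smul]
  convert zero_smul Cq _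
  by_cases h1 : (i ∈ Z ∧ e i = 1 ∧ 1 ≤ e' i) ∨ (i ∉ Z ∧ e' i = 1 ∧ 1 ≤ e i)
  swap
  · rw [if_neg h1, if_neg h1]; simp
  rw [if_pos h1, if_pos h1]
  by_cases h2 : (k ∈ Z ∧ e k ≠ 0) ∨ (k ∉ Z ∧ e' k ≠ 0)
  · rw [if_pos h2, if_pos h2]; simp
  rw [if_neg h2, if_neg h2]
  have he : e i ≠ 0 := by rcases h1 with h1 | h1 <;> omega
  have he' : e' i ≠ 0 := by rcases h1 with h1 | h1 <;> omega
  obtain ⟨f, rfl⟩ : ∃ f : Fin N → ℕ, e = f + Pi.single i 1 := ⟨_, (sub_add_single he).symm⟩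
  obtain ⟨f', rfl⟩ : ∃ f' : Fin N → ℕ, e' = f' + Pi.single i 1 := ⟨_, (sub_add_single he').symm⟩
  rw [add_sub_single, add_sub_single]
  simp only [kchi_add_single, hκ, lt_irrefl, if_false, mul_one]
  rcases h.lt_or_gt with h | h
  · rw [if_pos h, if_neg h.not_gt, mul_neg, inv_neg]
    simp
    ring
  · rw [if_pos h, if_neg h.not_gt]
    simp
    ring

/-- The projection to the inadmissible monomials, in which a variable of square zero occurs twice;
they are part of the space `Ext`, but are never obtained from products of variables. -/
def kn (i : Fin N) : Module.End Cq (Ext N (Ext N V)) :=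
  monOp (fun e e' => if (i ∈ Z ∧ 2 ≤ e i) ∨ (i ∉ Z ∧ 2 ≤ e' i) then 1 else 0) id id

/-- On admissible monomials, the partial inverse is a homotopy between the identity and the
projection `kp`. -/
theorem kh_kd_self (i : Fin N) :
    kd κ κ' Z i * kh κ κ' Z i + kh κ κ' Z i * kd κ κ' Z i =
      (1 - kp Z i - kn Z i : Module.End Cq (Ext N (Ext N V))) := by
  refine ext_ext fun e e' v => ?_
  rw [LinearMap.add_apply, Module.End.mul_apply, Module.End.mul_apply, kh, monOp_single, kd_single,
    map_smul, map_smul, kd_single, monOp_single, smul_smul, smul_smul, LinearMap.sub_apply,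
    LinearMap.sub_apply, kp, kn, monOp_single, monOp_single, Module.End.one_apply]
  simp only [kchi_add_single, lt_irrefl, if_false, mul_one, add_sub_single, Pi.add_apply,
    Pi.sub_apply, Pi.single_eq_same, topExp, Finset.mem_compl, id]
  have key : ∀ (h : e i ≠ 0) (h' : e' i ≠ 0),
      (((kchi κ κ' i e e')⁻¹ : Cqˣ) : Cq) * (kchi κ κ' i (e - Pi.single i 1) (e' - Pi.single i 1) : Cq) = 1 := by
    intro h h'
    have := kchi_add_single κ κ' i i (e - Pi.single i 1) (e' - Pi.single i 1)
    rw [sub_add_single h, sub_add_single h', if_neg (lt_irrefl i), mul_one] at this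
    rw [← this, Units.inv_mul]
  by_cases hZ : i ∈ Z
  · simp only [hZ, true_and, not_true, false_and, or_false, if_true, if_false]
    rcases Nat.lt_trichotomy (e i) 1 with h | h | h
    · have h0 : e i = 0 := by omega
      simp [h0]
    · rcases Nat.eq_zero_or_pos (e' i) with h' | h'
      · simp [h, h']
      · have hk := key (by omega) (by omega)
        simp [h, h'.ne', Nat.succ_le_iff, h', sub_add_single, hk]
    · simp [h.ne', show e i ≠ 0 by omega, show 2 ≤ e i by omega]
  · simp only [hZ, not_false_eq_true, true_and, false_and, false_or, if_true, if_false]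
    rcases Nat.lt_trichotomy (e' i) 1 with h | h | h
    · have h0 : e' i = 0 := by omega
      simp [h0]
    · rcases Nat.eq_zero_or_pos (e i) with h' | h'
      · simp [h, h']
      · have hk := key (by omega) (by omega)
        simp [h, h'.ne', Nat.succ_le_iff, h', sub_add_single, hk]
    · simp [h.ne', show e' i ≠ 0 by omega, show 2 ≤ e' i by omega]

theorem kd_kp_comm (i k : Fin N) :
    kd κ κ' Z k * kp Z i = (kp Z i * kd κ κ' Z k : Module.End Cq (Ext N (Ext N V))) := by
  refine ext_ext fun e e' v => ?_
  rw [Module.End.mul_apply, Module.End.mul_apply, kp, monOp_single, kd_single,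
    map_smul, map_smul, id, id, kd_single, monOp_single, smul_smul, smul_smul]
  dsimp only [id]
  congr 1
  rcases eq_or_ne i k with rfl | h
  · by_cases hZ : i ∈ Z <;> simp [hZ, topExp] <;> omega
  · simp only [Pi.add_apply, Pi.single_eq_of_ne h, add_zero]
    ring

/-- The cohomology of the Koszul complex is spanned by the fundamental cocycle: a functional that
vanishes on boundaries depends only on the coefficient of a cocycle at the fundamental monomial. -/
theorem koszul_cocycle (hκ : ∀ i k, κ i k * κ' i k = -1) (β : Ext N (Ext N V) →ₗ[Cq] W)
    (hβ : ∀ z, β (koszulD κ κ' Z z) = 0)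
    (hβ' : ∀ i e e' v, (i ∈ Z ∧ 2 ≤ e i) ∨ (i ∉ Z ∧ 2 ≤ e' i) →
      β (Finsupp.single e (Finsupp.single e' v)) = 0)
    (z : Ext N (Ext N V)) (hz : koszulD κ κ' Z z = 0) :
    β z = β (Finsupp.single (topExp Z) (Finsupp.single (topExp Zᶜ) (z (topExp Z) (topExp Zᶜ)))) := by
  have hn : ∀ i, β ∘ₗ kn Z i = 0 := fun i => ext_ext fun e e' v => by
    rw [LinearMap.comp_apply, kn, monOp_single, map_smul]
    split_ifs with h
    · rw [id, id, hβ' i e e' v h]; simp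
    · simp
  have hdp : ∀ i, koszulD κ κ' Z * kp Z i = (kp Z i * koszulD κ κ' Z :
      Module.End Cq (Ext N (Ext N V))) := fun i => by
    rw [koszulD, Finset.sum_mul, Finset.mul_sum]
    exact Finset.sum_congr rfl fun k _ => kd_kp_comm Z i k
  -- the homotopies for the single variables are homotopies for the whole differential
  have hh : ∀ i, koszulD κ κ' Z * kh κ κ' Z i + kh κ κ' Z i * koszulD κ κ' Z =
      (1 - kp Z i - kn Z i : Module.End Cq (Ext N (Ext N V))) := fun i => by
    rw [koszulD, Finset.sum_mul, Finset.mul_sum, ← Finset.sum_add_distrib,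
      Finset.sum_eq_single i (fun k _ hk => kh_kd_of_ne Z hκ hk.symm) (by simp), kh_kd_self]
  have hp : ∀ i z, koszulD κ κ' Z z = 0 → β z = β (kp Z i z) := by
    intro i z hz
    have h := congrArg β (LinearMap.congr_fun (hh i) z)
    rw [LinearMap.add_apply, Module.End.mul_apply, Module.End.mul_apply, hz, map_zero, add_zero,
      hβ, LinearMap.sub_apply, LinearMap.sub_apply, map_sub, map_sub,
      show β (kn Z i z) = 0 from LinearMap.congr_fun (hn i) z, sub_zero] at h
    exact (sub_eq_zero.1 h.symm)
  -- projecting with respect to all variables, one after the other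
  have hl : ∀ l : List (Fin N), koszulD κ κ' Z ((l.map (kp (V := V) Z)).prod z) = 0 ∧
      β z = β ((l.map (kp Z)).prod z) := by
    intro l
    induction l with
    | nil => simpa using hz
    | cons i l ih =>
      rw [List.map_cons, List.prod_cons, Module.End.mul_apply]
      refine ⟨?_, ih.2.trans (hp i _ ih.1)⟩
      rw [← Module.End.mul_apply, hdp, Module.End.mul_apply, ih.1, map_zero]
  -- the product of the projections is the projection to the fundamental monomial
  have hl2 : ∀ l : List (Fin N), (l.map (kp (V := V) Z)).prod = monOp (fun e e' =>
      if ∀ i ∈ l, e i = topExp Z i ∧ e' i = topExp Zᶜ i then 1 else 0) id id := by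
    intro l
    induction l with
    | nil => 
      refine ext_ext fun e e' v => ?_
      simp [monOp_single]
    | cons i l ih =>
      refine ext_ext fun e e' v => ?_
      rw [List.map_cons, List.prod_cons, ih, Module.End.mul_apply, monOp_single, map_smul, kp,
        monOp_single, monOp_single, smul_smul]
      congr 1
      simp only [List.mem_cons, forall_eq_or_imp, id]
      split_ifs <;> simp_all
  rw [(hl (List.finRange N)).2, hl2]
  congr 1
  have hfin : ∀ z : Ext N (Ext N V), monOp (fun e e' =>
      if ∀ i ∈ List.finRange N, e i = topExp Z i ∧ e' i = topExp Zᶜ i then 1 else 0) id id z =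
      Finsupp.single (topExp Z) (Finsupp.single (topExp Zᶜ) (z (topExp Z) (topExp Zᶜ))) := by
    intro z
    have : monOp (fun e e' =>
      if ∀ i ∈ List.finRange N, e i = topExp Z i ∧ e' i = topExp Zᶜ i then 1 else 0) id id =
      Finsupp.lsingle (topExp Z) ∘ₗ Finsupp.lsingle (M := V) (topExp Zᶜ) ∘ₗ
        Finsupp.lapply (R := Cq) (topExp Zᶜ) ∘ₗ Finsupp.lapply (R := Cq) (topExp Z) := by
      refine ext_ext fun e e' v => ?_
      rw [monOp_single]
      simp only [List.mem_finRange, true_imp_iff, LinearMap.comp_apply, Finsupp.lapply_apply,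
        Finsupp.lsingle_apply, id]
      by_cases h : e = topExp Z
      · subst h
        by_cases h' : e' = topExp Zᶜ
        · subst h'; simp
        · rw [if_neg fun h => h' (funext fun i => (h i).2), Finsupp.single_eq_same,
            Finsupp.single_eq_of_ne (Ne.symm h')]
          simp
      · rw [if_neg fun h' => h (funext fun i => (h' i).1), Finsupp.single_eq_of_ne (Ne.symm h)]
        simp
    rw [this]
    rfl
  exact hfin z

end Koszul

/-! ### Multiplicativity of the quantum Berezinian -/

section BerMul

variable {N : ℕ} {T : Type} [Ring T] [Algebra Cq T]

/-- Two mutually inverse quantum supermatrices (without Koszul signs) with inverse parameters. -/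
structure QPair (t : Cqˣ) (P : Fin N → ℕ) (X b : Matrix (Fin N) (Fin N) T) : Prop where
  rtt : RTT t P X
  sq : SqZero P X
  rtt_inv : RTT t⁻¹ P b
  sq_inv : SqZero P b
  mul_inv : X * b = 1
  inv_mul : b * X = 1

/-- The even indices. -/
def evens (P : Fin N → ℕ) : Finset (Fin N) := Finset.univ.filter fun i => Even (P i)

theorem mem_evens {P : Fin N → ℕ} {i : Fin N} : i ∈ evens P ↔ Even (P i) := by simp [evens]

theorem notMem_evens {P : Fin N → ℕ} {i : Fin N} : i ∉ evens P ↔ Odd (P i) := by simp [evens]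

variable (T) in
/-- Right multiplication, as an algebra morphism from the opposite algebra. -/
def rmulHom : Tᵐᵒᵖ →ₐ[Cq] Module.End Cq T where
  toFun x := LinearMap.mulRight Cq x.unop
  map_one' := by ext; simp
  map_mul' x y := by ext; simp [mul_assoc]
  map_zero' := by ext; simp
  map_add' x y := by ext; simp [mul_add]
  commutes' c := by ext; simp [Algebra.algebraMap_eq_smul_one]

theorem rmulHom_apply (x : Tᵐᵒᵖ) (y : T) : rmulHom T x y = y * x.unop := rfl

variable (N T) in
/-- The action of an endomorphism of `T` on the coefficients of the Koszul complex. -/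
def coeffHom : Module.End Cq T →ₐ[Cq] Module.End Cq (Ext N (Ext N T)) :=
  (extMap N (Ext N T)).comp (extMap N T)

theorem coeffHom_single (f : Module.End Cq T) (e e' : Fin N → ℕ) (v : T) :
    coeffHom N T f (Finsupp.single e (Finsupp.single e' v)) =
      Finsupp.single e (Finsupp.single e' (f v)) := by
  rw [coeffHom, AlgHom.comp_apply, extMap_single, extMap_single]

variable (t : Cqˣ) (P : Fin N → ℕ)

variable (T) in
/-- The variables of the quantum exterior superspace. -/
def kx (i : Fin N) : Module.End Cq (Ext N (Ext N T)) := mulL (kap (-t)⁻¹ P) (evens P) i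

variable (T) in
/-- The variables of the dual quantum symmetric superspace. -/
def ky (i : Fin N) : Module.End Cq (Ext N (Ext N T)) :=
  extMap N (Ext N T) (mulL (kap t P) (evens P)ᶜ i)

variable (T) in
/-- The differential of the Koszul complex of a quantum superspace. -/
def superD : Module.End Cq (Ext N (Ext N T)) := koszulD (kap (-t)⁻¹ P) (kap t P) (evens P)

/-- The coordinate change of the exterior variables. -/
def KL (X : Matrix (Fin N) (Fin N) T) : Fin N → Module.End Cq (Ext N (Ext N T)) :=
  coact (kx T t P) ((X.map (Algebra.lmul Cq T)).map (coeffHom N T))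

/-- The coordinate change of the dual variables. -/
def KR (b : Matrix (Fin N) (Fin N) T) : Fin N → Module.End Cq (Ext N (Ext N T)) :=
  coact (ky T t P) (((b.map MulOpposite.op).transpose.map (rmulHom T)).map (coeffHom N T))

theorem KL_eq (X : Matrix (Fin N) (Fin N) T) (j : Fin N) : KL t P X j =
    ∑ i, kx T t P i * coeffHom N T (Algebra.lmul Cq T (X i j)) := rfl

theorem KR_eq (b : Matrix (Fin N) (Fin N) T) (j : Fin N) : KR t P b j =
    ∑ i, ky T t P i * coeffHom N T (rmulHom T (MulOpposite.op (b j i))) := rfl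

theorem kx_comm_coeffHom (i : Fin N) (f : Module.End Cq T) :
    Commute (kx T t P i) (coeffHom N T f) := mulL_comm_extMap _ _ _ _

theorem ky_comm_coeffHom (i : Fin N) (f : Module.End Cq T) :
    Commute (ky T t P i) (coeffHom N T f) := by
  rw [ky, coeffHom, AlgHom.comp_apply]
  exact Commute.map (mulL_comm_extMap _ _ _ _) (extMap N (Ext N T))

theorem kx_comm_ky (i j : Fin N) : Commute (kx T t P i) (ky T t P j) := mulL_comm_extMap _ _ _ _

theorem lmul_comm_rmul (x y : T) :
    Commute (Algebra.lmul Cq T x) (rmulHom T (MulOpposite.op y)) := by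
  ext z
  simp [rmulHom_apply, mul_assoc]

theorem KL_comm_coeffHom (X : Matrix (Fin N) (Fin N) T) (f : Module.End Cq T)
    (hf : ∀ i j, Commute (Algebra.lmul Cq T (X i j)) f) (j : Fin N) :
    Commute (KL t P X j) (coeffHom N T f) := by
  rw [KL_eq]
  exact Commute.sum_left _ _ _ fun i _ =>
    (kx_comm_coeffHom t P i f).mul_left ((hf i j).map (coeffHom N T))

theorem KR_comm_coeffHom (b : Matrix (Fin N) (Fin N) T) (f : Module.End Cq T)
    (hf : ∀ i j, Commute (rmulHom T (MulOpposite.op (b i j))) f) (j : Fin N) :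
    Commute (KR t P b j) (coeffHom N T f) := by
  rw [KR_eq]
  exact Commute.sum_left _ _ _ fun i _ =>
    (ky_comm_coeffHom t P i f).mul_left ((hf j i).map (coeffHom N T))

theorem KL_comm_KR (X b : Matrix (Fin N) (Fin N) T) (i j : Fin N) :
    Commute (KL t P X i) (KR t P b j) := by
  rw [KR_eq]
  refine Commute.sum_right _ _ _ fun k _ => Commute.mul_right ?_
    (KL_comm_coeffHom t P X _ (fun _ _ => lmul_comm_rmul _ _) i)
  rw [KL_eq]
  exact Commute.sum_left _ _ _ fun l _ =>
    (kx_comm_ky t P l k).mul_left (ky_comm_coeffHom t P k _).symm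

theorem mon_commute {𝓡 : Type} [Ring 𝓡] {x : Fin N → 𝓡} {y : 𝓡} (h : ∀ i, Commute (x i) y)
    (e : Fin N → ℕ) : Commute (mon x e) y := by
  refine Commute.list_prod_left _ _ fun z hz => ?_
  obtain ⟨i, rfl⟩ := List.mem_ofFn.1 hz
  exact (h i).pow_left _

theorem coe_inv_neg (t : Cqˣ) : (((-t)⁻¹ : Cqˣ) : Cq) = -((t⁻¹ : Cqˣ) : Cq) := by
  rw [inv_neg, Units.val_neg]

variable {t P}

theorem QPair.KL_qComm {X b : Matrix (Fin N) (Fin N) T} (h : QPair t P X b) :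
    QComm (kap (-t)⁻¹ P) (KL t P X) := by
  refine coact_qComm (t := t) ?_ (mulL_qComm _ _) ((h.rtt.map _).map _) (fun a => ?_)
    fun a i j => kx_comm_coeffHom t P a _
  · rw [coe_inv_neg, qdiff, sub_add_eq_add_sub, add_neg_cancel, zero_sub, neg_mul_neg,
      Units.inv_mul]
  · rcases Nat.even_or_odd (P a) with ha | ha
    · exact Or.inl (mulL_sq _ (mem_evens.2 ha))
    · right
      rw [coe_inv_neg, eig_odd _ ha, neg_mul_neg, Units.inv_mul]

theorem QPair.KL_sq {X b : Matrix (Fin N) (Fin N) T} (h : QPair t P X b) {j : Fin N}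
    (hj : j ∈ evens P) : KL t P X j * KL t P X j = 0 := by
  rw [mem_evens] at hj
  refine coact_sq (t := t) (mulL_qComm _ _) ((h.rtt.map _).map _) ?_ (fun a => ?_)
    fun a i j => kx_comm_coeffHom t P a _
  · rw [coe_inv_neg, eig_even _ hj, neg_neg]
  · rcases Nat.even_or_odd (P a) with ha | ha
    · exact Or.inl (mulL_sq _ (mem_evens.2 ha))
    · right
      rw [Matrix.map_apply, Matrix.map_apply, ← map_mul, ← map_mul, h.sq a j (ha.add_even hj),
        map_zero, map_zero]

theorem ky_qComm : QComm (kap t P) (ky T t P) := by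
  intro i k hik
  rw [ky, ky, ← map_mul, mulL_qComm (kap t P) _ i k hik, map_smul, map_mul]

theorem ky_sq {j : Fin N} (hj : j ∉ evens P) : ky T t P j * ky T t P j = 0 := by
  rw [ky, ← map_mul, mulL_sq _ (Finset.mem_compl.2 hj), map_zero]

theorem QPair.rtt_op {X b : Matrix (Fin N) (Fin N) T} (h : QPair t P X b) :
    RTT t P (b.map MulOpposite.op).transpose := by
  have := h.rtt_inv.op.transpose
  rwa [inv_inv] at this

theorem QPair.KR_qComm {X b : Matrix (Fin N) (Fin N) T} (h : QPair t P X b) :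
    QComm (kap t P) (KR t P b) := by
  refine coact_qComm (t := t) ?_ ky_qComm ((h.rtt_op.map _).map _) (fun a => ?_)
    fun a i j => ky_comm_coeffHom t P a _
  · rw [qdiff, sub_add_cancel, Units.mul_inv]
  · rcases Nat.even_or_odd (P a) with ha | ha
    · right
      rw [eig_even _ ha, Units.mul_inv]
    · exact Or.inl (ky_sq (notMem_evens.2 ha))

theorem QPair.KR_sq {X b : Matrix (Fin N) (Fin N) T} (h : QPair t P X b) {j : Fin N}
    (hj : j ∉ evens P) : KR t P b j * KR t P b j = 0 := by
  rw [notMem_evens] at hj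
  refine coact_sq (t := t) ky_qComm ((h.rtt_op.map _).map _) ?_ (fun a => ?_)
    fun a i j => ky_comm_coeffHom t P a _
  · rw [eig_odd _ hj]
  · rcases Nat.even_or_odd (P a) with ha | ha
    · right
      have h0 : (b.map MulOpposite.op).transpose a j * (b.map MulOpposite.op).transpose a j = 0 :=
        MulOpposite.unop_injective (h.sq_inv j a (by rw [add_comm]; exact ha.add_odd hj))
      rw [Matrix.map_apply, Matrix.map_apply, ← map_mul, ← map_mul, h0, map_zero, map_zero]
    · exact Or.inl (ky_sq (notMem_evens.2 ha))

variable (N) in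
/-- The monomial `1` with coefficient `v`. -/
def vac (v : T) : Ext N (Ext N T) := Finsupp.single 0 (Finsupp.single 0 v)

theorem superD_vac (v : T) : superD T t P (vac N v) = (∑ a, kx T t P a * ky T t P a) (vac N v) := by
  rw [superD, koszulD, LinearMap.sum_apply, LinearMap.sum_apply]
  refine Finset.sum_congr rfl fun i _ => ?_
  rw [vac, kd_single, Module.End.mul_apply, kx, ky, extMap_single, mulL_single (kap t P),
    ← Finsupp.smul_single, map_smul, mulL_single, smul_smul]
  simp [kchi, chiR, chiL]

/-- The element that defines the differential, `∑ x i y i`, is invariant under a coordinate change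
and the inverse one of the dual variables. -/
theorem KL_KR_vac {X b : Matrix (Fin N) (Fin N) T} (h : X * b = 1) {v : T}
    (hv : ∀ i j, v * b i j = b i j * v) :
    (∑ i, KL t P X i * KR t P b i) (vac N v) = superD T t P (vac N v) := by
  rw [superD_vac]
  have e : ∀ i, KL t P X i * KR t P b i = ∑ a, ∑ c, kx T t P a * ky T t P c *
      coeffHom N T (Algebra.lmul Cq T (X a i) * rmulHom T (MulOpposite.op (b i c))) := by
    intro i
    rw [KL_eq, KR_eq, Finset.sum_mul_sum]
    refine Finset.sum_congr rfl fun a _ => Finset.sum_congr rfl fun c _ => ?_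
    rw [map_mul, mul_assoc, ← mul_assoc (coeffHom N T _), ← (ky_comm_coeffHom t P c _).eq]
    simp only [mul_assoc]
  simp only [e]
  rw [Finset.sum_comm]
  simp only [LinearMap.sum_apply]
  refine Finset.sum_congr rfl fun a _ => ?_
  rw [Finset.sum_comm]
  have e2 : ∀ c, ∑ i, (kx T t P a * ky T t P c *
      coeffHom N T (Algebra.lmul Cq T (X a i) * rmulHom T (MulOpposite.op (b i c)))) (vac N v) =
      (kx T t P a * ky T t P c) (vac N ((X * b) a c * v)) := by
    intro c
    simp only [Module.End.mul_apply (kx T t P a * ky T t P c), ← map_sum]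
    congr 1
    simp only [vac, coeffHom_single, Module.End.mul_apply, rmulHom_apply, MulOpposite.unop_op, hv]
    rw [Matrix.mul_apply, Finset.sum_mul]
    simp only [Algebra.coe_lmul_eq_mul, LinearMap.mul_apply', ← mul_assoc]
    rw [← Finsupp.lsingle_apply (R := Cq), ← Finsupp.lsingle_apply (R := Cq), map_sum, map_sum]
    rfl
  simp only [e2, h]
  rw [Finset.sum_eq_single a]
  · simp
  · intro c _ hc
    rw [Matrix.one_apply_ne hc.symm]
    simp [vac]
  · simp

theorem commute_superD {f : Module.End Cq (Ext N (Ext N T))}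
    (h : ∀ i, Commute f (mulR (kap (-t)⁻¹ P) (evens P) i))
    (h' : ∀ i, Commute f (extMap N (Ext N T) (mulR (kap t P) (evens P)ᶜ i))) :
    Commute f (superD T t P) :=
  Commute.sum_right _ _ _ fun i _ => (h i).mul_right (h' i)

theorem coeffHom_comm_superD (f : Module.End Cq T) : Commute (coeffHom N T f) (superD T t P) :=
  commute_superD (fun i => (mulR_comm_extMap _ _ _ _).symm)
    fun i => Commute.map (f := extMap N (Ext N T)) (mulR_comm_extMap _ _ _ _).symm 

theorem kx_comm_superD (i : Fin N) : Commute (kx T t P i) (superD T t P) :=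
  commute_superD (fun k => mulL_mul_mulR _ _ _ _) fun k => mulL_comm_extMap _ _ _ _

theorem ky_comm_superD (i : Fin N) : Commute (ky T t P i) (superD T t P) :=
  commute_superD (fun k => (mulR_comm_extMap _ _ _ _).symm)
    fun k => Commute.map (f := extMap N (Ext N T)) (mulL_mul_mulR _ _ _ _)

theorem KL_comm_superD (X : Matrix (Fin N) (Fin N) T) (j : Fin N) :
    Commute (KL t P X j) (superD T t P) := by
  rw [KL_eq]
  exact Commute.sum_left _ _ _ fun i _ => (kx_comm_superD i).mul_left (coeffHom_comm_superD _)

theorem KR_comm_superD (b : Matrix (Fin N) (Fin N) T) (j : Fin N) :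
    Commute (KR t P b j) (superD T t P) := by
  rw [KR_eq]
  exact Commute.sum_left _ _ _ fun i _ => (ky_comm_superD i).mul_left (coeffHom_comm_superD _)

variable (t P) in
/-- The product of a monomial in the transformed exterior variables and a monomial in the
transformed dual variables. -/
def kmon (X b : Matrix (Fin N) (Fin N) T) (e e' : Fin N → ℕ) : Module.End Cq (Ext N (Ext N T)) :=
  mon (KL t P X) e * mon (KR t P b) e'

theorem kmon_comm {X b : Matrix (Fin N) (Fin N) T} {e e' : Fin N → ℕ}
    {f : Module.End Cq (Ext N (Ext N T))} (h : ∀ i, Commute (KL t P X i) f)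
    (h' : ∀ i, Commute (KR t P b i) f) : Commute (kmon t P X b e e') f :=
  (mon_commute h e).mul_left (mon_commute h' e')

theorem kmon_mul {X b : Matrix (Fin N) (Fin N) T} (h : QPair t P X b) (e e' : Fin N → ℕ)
    (i : Fin N) : kmon t P X b e e' * (KL t P X i * KR t P b i) =
      (kchi (kap (-t)⁻¹ P) (kap t P) i e e' : Cq) •
        kmon t P X b (e + Pi.single i 1) (e' + Pi.single i 1) := by
  rw [kmon, mul_assoc, ← mul_assoc (mon (KR t P b) e'),
    (mon_commute (fun k => (KL_comm_KR t P X b i k).symm) e').eq, mul_assoc, ← mul_assoc,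
    mon_mul h.KL_qComm, mon_mul h.KR_qComm, smul_mul_smul_comm, kmon, kchi, Units.val_mul]

theorem kmon_eq_zero {X b : Matrix (Fin N) (Fin N) T} (h : QPair t P X b) {e e' : Fin N → ℕ}
    {i : Fin N} (hi : (i ∈ evens P ∧ 2 ≤ e i) ∨ (i ∉ evens P ∧ 2 ≤ e' i)) :
    kmon t P X b e e' = 0 := by
  rw [kmon]
  rcases hi with ⟨h1, h2⟩ | ⟨h1, h2⟩
  · rw [mon_eq_zero _ (h.KL_sq h1) h2, zero_mul]
  · rw [mon_eq_zero _ (h.KR_sq h1) h2, mul_zero]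

/-- The differential of a monomial in the transformed variables has the same form as that of a
monomial in the original ones. -/
theorem superD_kmon {X b : Matrix (Fin N) (Fin N) T} (h : QPair t P X b) (e e' : Fin N → ℕ)
    {v : T} (hv : ∀ i j, v * b i j = b i j * v) :
    superD T t P (kmon t P X b e e' (vac N v)) =
      ∑ i, (kchi (kap (-t)⁻¹ P) (kap t P) i e e' : Cq) •
        kmon t P X b (e + Pi.single i 1) (e' + Pi.single i 1) (vac N v) := by
  rw [← Module.End.mul_apply, ← (kmon_comm (fun i => KL_comm_superD X i)
    (fun i => KR_comm_superD b i)).eq, Module.End.mul_apply, ← KL_KR_vac h.mul_inv hv,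
    ← Module.End.mul_apply, Finset.mul_sum, LinearMap.sum_apply]
  simp only [kmon_mul h, LinearMap.smul_apply]

variable (t P) in
/-- The cocycle that is obtained from the fundamental one by a coordinate change. -/
def kcoc (X b : Matrix (Fin N) (Fin N) T) : Ext N (Ext N T) :=
  kmon t P X b (topExp (evens P)) (topExp (evens P)ᶜ) (vac N 1)

variable (t P) in
/-- The coefficient of the transformed fundamental cocycle at the fundamental monomial. -/
def kber (X b : Matrix (Fin N) (Fin N) T) : T :=
  kcoc t P X b (topExp (evens P)) (topExp (evens P)ᶜ)

theorem superD_kcoc {X b : Matrix (Fin N) (Fin N) T} (h : QPair t P X b) :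
    superD T t P (kcoc t P X b) = 0 := by
  rw [kcoc, superD_kmon h _ _ (by simp)]
  refine Finset.sum_eq_zero fun i _ => ?_
  rw [kmon_eq_zero h (i := i), LinearMap.zero_apply, smul_zero]
  by_cases hi : i ∈ evens P
  · left; simp [topExp, hi]
  · right; simp [topExp, hi]

/-- The fundamental monomial does not occur in boundaries. -/
theorem superD_top (z : Ext N (Ext N T)) :
    superD T t P z (topExp (evens P)) (topExp (evens P)ᶜ) = 0 := by
  suffices h : (Finsupp.lapply (R := Cq) (topExp (evens P)ᶜ) ∘ₗ
      Finsupp.lapply (R := Cq) (topExp (evens P))) ∘ₗ superD T t P = 0 from LinearMap.congr_fun h z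
  refine ext_ext fun e e' v => ?_
  simp only [superD, koszulD, LinearMap.comp_apply, LinearMap.sum_apply, map_sum, kd_single,
    LinearMap.zero_apply, Finsupp.lapply_apply]
  refine Finset.sum_eq_zero fun i _ => ?_
  rw [Finsupp.smul_apply, Finsupp.smul_apply, Finsupp.single_apply]
  by_cases h1 : e + Pi.single i 1 = topExp (evens P)
  -- a variable of the exterior part of the fundamental monomial is not one of its dual part
  · have h2 : ¬ e' + Pi.single i 1 = topExp (evens P)ᶜ := by
      intro h3
      have h4 := congrFun h1 i
      have h5 := congrFun h3 i
      by_cases hi : i ∈ evens P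
      · simp [topExp, hi] at h5
      · simp [topExp, hi] at h4
    rw [if_pos h1, Finsupp.single_apply, if_neg h2, smul_zero]
  · rw [if_neg h1, Finsupp.zero_apply, smul_zero]

section Substitution

variable {S : Type} [Ring S] [Algebra Cq S] (ι : S →ₐ[Cq] T)

variable (t P) in
/-- The substitution of the transformed variables. -/
def ksub (X b : Matrix (Fin N) (Fin N) T) : Ext N (Ext N S) →ₗ[Cq] Ext N (Ext N T) :=
  Finsupp.lsum Cq fun e => Finsupp.lsum Cq fun e' =>
    kmon t P X b e e' ∘ₗ Finsupp.lsingle 0 ∘ₗ Finsupp.lsingle 0 ∘ₗ ι.toLinearMap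

theorem ksub_single (X b : Matrix (Fin N) (Fin N) T) (e e' : Fin N → ℕ) (θ : S) :
    ksub t P ι X b (Finsupp.single e (Finsupp.single e' θ)) = kmon t P X b e e' (vac N (ι θ)) := by
  simp only [ksub, Finsupp.lsum_single]
  rfl

variable {ι} {X b : Matrix (Fin N) (Fin N) T} {Y c : Matrix (Fin N) (Fin N) S}

theorem kx_smul_kmon (h : QPair t P X b) (i : Fin N) (e e' : Fin N → ℕ) (θ : S) :
    ksub t P ι X b (kx S t P i (Finsupp.single e (Finsupp.single e' θ))) =
      (KL t P X i * kmon t P X b e e') (vac N (ι θ)) := by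
  rw [kx, mulL_single, map_smul, ksub_single, kmon, kmon, ← mul_assoc, mul_mon h.KL_qComm, smul_mul_assoc,
    LinearMap.smul_apply]
  split_ifs with hi
  · have h0 := kmon_eq_zero h (e := e + Pi.single i 1) (e' := e') (i := i)
      (Or.inl ⟨hi.1, by simp; omega⟩)
    rw [kmon] at h0
    rw [h0, zero_smul, LinearMap.zero_apply, smul_zero]
  · rfl

theorem ky_smul_kmon (h : QPair t P X b) (i : Fin N) (e e' : Fin N → ℕ) (θ : S) :
    ksub t P ι X b (ky S t P i (Finsupp.single e (Finsupp.single e' θ))) =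
      (KR t P b i * kmon t P X b e e') (vac N (ι θ)) := by
  rw [ky, extMap_single, mulL_single, ← Finsupp.smul_single, map_smul, ksub_single, kmon,
    kmon, ← mul_assoc, ← (mon_commute (fun k => KL_comm_KR t P X b k i) e).eq, mul_assoc,
    mul_mon h.KR_qComm, mul_smul_comm, LinearMap.smul_apply]
  split_ifs with hi
  · have h0 := kmon_eq_zero h (e := e) (e' := e' + Pi.single i 1) (i := i)
      (Or.inr ⟨Finset.mem_compl.1 hi.1, by simp; omega⟩)
    rw [kmon] at h0
    rw [h0, zero_smul, LinearMap.zero_apply, smul_zero]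
  · rfl

/-- The substitution intertwines the coordinate changes by `Y` and by the product of `X` and `Y`.
-/
theorem ksub_KL (h : QPair t P X b) (hX : ∀ i j s, X i j * ι s = ι s * X i j) (j : Fin N) :
    ksub t P ι X b ∘ₗ KL t P Y j = KL t P (X * Y.map ι) j ∘ₗ ksub t P ι X b := by
  have e1 : KL t P (X * Y.map ι) j =
      ∑ i, coeffHom N T (Algebra.lmul Cq T (ι (Y i j))) * KL t P X i := by
    simp only [KL_eq, Matrix.mul_apply, map_sum, Finset.mul_sum, Matrix.map_apply]
    rw [Finset.sum_comm]
    refine Finset.sum_congr rfl fun i _ => Finset.sum_congr rfl fun a _ => ?_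
    rw [hX, map_mul, map_mul, ← mul_assoc, (kx_comm_coeffHom t P _ _).eq, mul_assoc]
  refine ext_ext fun e e' θ => ?_
  rw [LinearMap.comp_apply, LinearMap.comp_apply, KL_eq, e1, LinearMap.sum_apply, map_sum,
    LinearMap.sum_apply]
  refine Finset.sum_congr rfl fun i _ => ?_
  rw [Module.End.mul_apply, coeffHom_single, kx_smul_kmon h, ksub_single, Module.End.mul_apply,
    Module.End.mul_apply, ← Module.End.mul_apply (KL t P X i), ← Module.End.mul_apply (KL t P X i)]
  have hv : vac N (ι (Algebra.lmul Cq S (Y i j) θ)) =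
      coeffHom N T (Algebra.lmul Cq T (ι (Y i j))) (vac N (ι θ)) := by
    rw [vac, vac, coeffHom_single]; simp
  have hL : ∀ k, Commute (KL t P X k) (coeffHom N T (Algebra.lmul Cq T (ι (Y i j)))) :=
    fun k => KL_comm_coeffHom t P X _ (fun a b => by
      rw [Commute, SemiconjBy, ← map_mul, ← map_mul, hX]) k
  have hR : ∀ k, Commute (KR t P b k) (coeffHom N T (Algebra.lmul Cq T (ι (Y i j)))) :=
    fun k => KR_comm_coeffHom t P b _ (fun _ _ => (lmul_comm_rmul _ _).symm) k
  rw [hv, ← Module.End.mul_apply, ((hL i).mul_left (kmon_comm hL hR)).eq, Module.End.mul_apply]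

theorem ksub_KR (h : QPair t P X b) (hb : ∀ i j s, b i j * ι s = ι s * b i j) (j : Fin N) :
    ksub t P ι X b ∘ₗ KR t P c j = KR t P (c.map ι * b) j ∘ₗ ksub t P ι X b := by
  have hcomm : ∀ (x y : T), x * y = y * x →
      rmulHom T (MulOpposite.op x) * rmulHom T (MulOpposite.op y) =
      rmulHom T (MulOpposite.op y) * rmulHom T (MulOpposite.op x) := fun x y hxy => by
    rw [← map_mul, ← map_mul, ← MulOpposite.op_mul, ← MulOpposite.op_mul, hxy]
  have e1 : KR t P (c.map ι * b) j =
      ∑ i, coeffHom N T (rmulHom T (MulOpposite.op (ι (c j i)))) * KR t P b i := by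
    simp only [KR_eq, Matrix.mul_apply, Finset.mul_sum, Matrix.map_apply, Finset.op_sum,
      map_sum]
    rw [Finset.sum_comm]
    refine Finset.sum_congr rfl fun i _ => Finset.sum_congr rfl fun a _ => ?_
    rw [← hb, MulOpposite.op_mul, map_mul, map_mul, ← mul_assoc,
      (ky_comm_coeffHom t P _ _).eq, mul_assoc]
  refine ext_ext fun e e' θ => ?_
  rw [LinearMap.comp_apply, LinearMap.comp_apply, KR_eq, e1, LinearMap.sum_apply, map_sum,
    LinearMap.sum_apply]
  refine Finset.sum_congr rfl fun i _ => ?_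
  rw [Module.End.mul_apply, coeffHom_single, ky_smul_kmon h, ksub_single, Module.End.mul_apply,
    Module.End.mul_apply, ← Module.End.mul_apply (KR t P b i), ← Module.End.mul_apply (KR t P b i)]
  have hv : vac N (ι (rmulHom S (MulOpposite.op (c j i)) θ)) =
      coeffHom N T (rmulHom T (MulOpposite.op (ι (c j i)))) (vac N (ι θ)) := by
    rw [vac, vac, coeffHom_single, rmulHom_apply, rmulHom_apply]; simp
  have hL : ∀ k, Commute (KL t P X k) (coeffHom N T (rmulHom T (MulOpposite.op (ι (c j i))))) :=
    fun k => KL_comm_coeffHom t P X _ (fun a b => lmul_comm_rmul _ _) k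
  have hR : ∀ k, Commute (KR t P b k) (coeffHom N T (rmulHom T (MulOpposite.op (ι (c j i))))) :=
    fun k => KR_comm_coeffHom t P b _ (fun _ _ => hcomm _ _ (hb _ _ _)) k
  rw [hv, ← Module.End.mul_apply, ((hR i).mul_left (kmon_comm hL hR)).eq, Module.End.mul_apply]

theorem apply_mon {V W : Type} [AddCommGroup V] [Module Cq V] [AddCommGroup W] [Module Cq W]
    {x : Fin N → Module.End Cq V} {y : Fin N → Module.End Cq W} {g : V →ₗ[Cq] W}
    (h : ∀ i, g ∘ₗ x i = y i ∘ₗ g) (e : Fin N → ℕ) (v : V) : g (mon x e v) = mon y e (g v) := by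
  have hpow : ∀ i k v, g ((x i ^ k) v) = (y i ^ k) (g v) := by
    intro i k
    induction k with
    | zero => simp
    | succ k ih =>
      intro v
      rw [pow_succ, pow_succ, Module.End.mul_apply, Module.End.mul_apply, ih]
      exact congrArg _ (LinearMap.congr_fun (h i) v)
  have hl : ∀ l : List (Fin N), g ((l.map fun i => x i ^ e i).prod v) =
      (l.map fun i => y i ^ e i).prod (g v) := by
    intro l
    induction l with
    | nil => simp
    | cons i l ih =>
      rw [List.map_cons, List.prod_cons, List.map_cons, List.prod_cons, Module.End.mul_apply,
        Module.End.mul_apply, hpow, ih]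
  rw [mon, mon, List.ofFn_eq_map, List.ofFn_eq_map, hl]

/-- The cocycle of a product arises from that of the second factor by substitution. -/
theorem ksub_kcoc (h : QPair t P X b) (hX : ∀ i j s, X i j * ι s = ι s * X i j)
    (hb : ∀ i j s, b i j * ι s = ι s * b i j) :
    ksub t P ι X b (kcoc t P Y c) = kcoc t P (X * Y.map ι) (c.map ι * b) := by
  have h0 : ksub t P ι X b (vac N 1) = vac N 1 := by
    rw [vac, ksub_single, kmon, mon_zero, mon_zero, map_one]
    simp
  rw [kcoc, kcoc, kmon, kmon, Module.End.mul_apply, Module.End.mul_apply,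
    apply_mon (fun i => ksub_KL h hX i), apply_mon (fun i => ksub_KR h hb i), h0]

/-- The substitution is a morphism of complexes. -/
theorem ksub_superD (h : QPair t P X b) (hb : ∀ i j s, b i j * ι s = ι s * b i j)
    (z : Ext N (Ext N S)) :
    ksub t P ι X b (superD S t P z) = superD T t P (ksub t P ι X b z) := by
  suffices hh : ksub t P ι X b ∘ₗ superD S t P = superD T t P ∘ₗ ksub t P ι X b from
    LinearMap.congr_fun hh z
  refine ext_ext fun e e' θ => ?_
  rw [LinearMap.comp_apply, LinearMap.comp_apply, ksub_single,
    superD_kmon h e e' (fun i j => (hb i j θ).symm), superD, koszulD, LinearMap.sum_apply, map_sum]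
  refine Finset.sum_congr rfl fun i _ => ?_
  rw [kd_single, map_smul, ksub_single]
  split_ifs with hi
  · rw [kmon_eq_zero h (i := i), LinearMap.zero_apply, smul_zero, smul_zero]
    rcases hi with hi | hi
    · left; refine ⟨hi.1, ?_⟩; simp; omega
    · right; refine ⟨hi.1, ?_⟩; simp; omega
  · rfl

/-- The multiplicativity of the Berezinian: the substitution maps the fundamental cocycle of `Y` to
the one of the product, and only the fundamental coefficient of the former matters. -/
theorem kber_mul (h : QPair t P X b) (h' : QPair t P Y c)
    (hX : ∀ i j s, X i j * ι s = ι s * X i j) (hb : ∀ i j s, b i j * ι s = ι s * b i j) :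
    kber t P (X * Y.map ι) (c.map ι * b) = kber t P X b * ι (kber t P Y c) := by
  have hκ : ∀ i k, kap (-t)⁻¹ P i k * kap t P i k = -1 := fun i k => by
    rw [kap, kap, mul_mul_mul_comm, ← mul_pow]
    simp [inv_neg]
  -- the fundamental coefficient after the substitution, as a functional
  have key := koszul_cocycle (evens P) hκ ((Finsupp.lapply (R := Cq) (topExp (evens P)ᶜ) ∘ₗ
      Finsupp.lapply (R := Cq) (topExp (evens P))) ∘ₗ ksub t P ι X b) (fun z => by
      rw [LinearMap.comp_apply]
      exact (congrArg _ (ksub_superD h hb z)).trans (superD_top _)) (fun i e e' v hi => by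
      rw [LinearMap.comp_apply, ksub_single, kmon_eq_zero h hi, LinearMap.zero_apply, map_zero])
      (kcoc t P Y c) (superD_kcoc h')
  rw [LinearMap.comp_apply, LinearMap.comp_apply, ksub_kcoc h hX hb, LinearMap.comp_apply,
    ksub_single] at key
  refine Eq.trans key ?_
  -- a coefficient on the right of the transformed variables can be taken out, as it commutes with
  -- the entries of `X` and `b`
  have hv : ∀ v, vac N v = coeffHom N T (rmulHom T (MulOpposite.op v)) (vac N (1 : T)) := by
    intro v
    rw [vac, vac, coeffHom_single, rmulHom_apply]; simp
  have hcomm : ∀ (x y : T), x * y = y * x →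
      rmulHom T (MulOpposite.op x) * rmulHom T (MulOpposite.op y) =
      rmulHom T (MulOpposite.op y) * rmulHom T (MulOpposite.op x) := fun x y hxy => by
    rw [← map_mul, ← map_mul, ← MulOpposite.op_mul, ← MulOpposite.op_mul, hxy]
  rw [hv (ι _), ← Module.End.mul_apply, (kmon_comm
    (fun i => KL_comm_coeffHom t P X _ (fun a b => lmul_comm_rmul _ _) i)
    (fun i => KR_comm_coeffHom t P b _ (fun _ _ => hcomm _ _ (hb _ _ _)) i)).eq,
    Module.End.mul_apply, LinearMap.comp_apply, Finsupp.lapply_apply, Finsupp.lapply_apply,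
    coeffHom, AlgHom.comp_apply, extMap_apply, extMap_apply]
  rfl

end Substitution

end BerMul

section Blocks

variable {m n : ℕ} {T : Type} [Ring T] [Algebra Cq T]

theorem blockA_rtt {t : Cqˣ} {X : Matrix (Fin (m + n)) (Fin (m + n)) T} (h : RTT t p X) :
    RTT t (fun _ => 0) (blockA X) := by
  have := h.submatrix (Fin.strictMono_castAdd n)
  rwa [show (p ∘ Fin.castAdd n : Fin m → ℕ) = fun _ => 0 from funext fun i => p_castAdd m n i]
    at this

theorem blockB_rtt {t : Cqˣ} {X : Matrix (Fin (m + n)) (Fin (m + n)) T} (h : RTT t p X) :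
    RTT t⁻¹ (fun _ => 0) (blockB X) := by
  have := h.submatrix (Fin.strictMono_natAdd m)
  rw [show (p ∘ Fin.natAdd m : Fin n → ℕ) = fun _ => 1 from funext fun i => p_natAdd m n i]
    at this
  exact this.of_one

theorem topExp_evens : topExp (evens (p : Fin (m + n) → ℕ)) = indic (Fin.castAdd n) := by
  funext i
  refine Fin.addCases (fun i => ?_) (fun i => ?_) i
  · rw [indic_apply_self (Fin.castAdd_injective m n), topExp, if_pos]
    rw [mem_evens, p_castAdd]; simp
  · rw [indic_apply_of_notMem, topExp, if_neg]
    · rw [mem_evens, p_natAdd]; simp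
    · rintro ⟨j, hj⟩
      have := congrArg Fin.val hj
      simp at this
      omega

theorem topExp_compl_evens : topExp (evens (p : Fin (m + n) → ℕ))ᶜ = indic (Fin.natAdd m) := by
  funext i
  refine Fin.addCases (fun i => ?_) (fun i => ?_) i
  · rw [indic_apply_of_notMem, topExp, if_neg]
    · rw [Finset.mem_compl, not_not, mem_evens, p_castAdd]; simp
    · rintro ⟨j, hj⟩
      have := congrArg Fin.val hj
      simp at this
      omega
  · rw [indic_apply_self (Fin.natAdd_injective n m), topExp, if_pos]
    rw [Finset.mem_compl, mem_evens, p_natAdd]; simp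

theorem mon_topExp_evens {𝓡 : Type} [Ring 𝓡] (x : Fin (m + n) → 𝓡) :
    mon x (topExp (evens p)) = (List.ofFn fun i => x (Fin.castAdd n i)).prod := by
  have h1 : ∀ i : Fin m, topExp (evens (p : Fin (m + n) → ℕ)) (Fin.castAdd n i) = 1 := fun i => by
    rw [topExp, if_pos]; rw [mem_evens, p_castAdd]; simp
  have h2 : ∀ i : Fin n, topExp (evens (p : Fin (m + n) → ℕ)) (Fin.natAdd m i) = 0 := fun i => by
    rw [topExp, if_neg]; rw [mem_evens, p_natAdd]; simp
  rw [mon, List.ofFn_add, List.prod_append]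
  change (List.ofFn fun i => x (Fin.castAdd n i) ^ topExp _ (Fin.castAdd n i)).prod *
    (List.ofFn fun i => x (Fin.natAdd m i) ^ topExp _ (Fin.natAdd m i)).prod = _
  simp only [h1, h2, pow_one, pow_zero]
  rw [List.prod_eq_one (l := List.ofFn fun _ : Fin n => (1 : 𝓡)), mul_one]
  intro y hy
  obtain ⟨i, rfl⟩ := List.mem_ofFn.1 hy
  rfl

theorem mon_topExp_compl_evens {𝓡 : Type} [Ring 𝓡] (x : Fin (m + n) → 𝓡) :
    mon x (topExp (evens p)ᶜ) = (List.ofFn fun i => x (Fin.natAdd m i)).prod := by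
  have h1 : ∀ i : Fin m, topExp (evens (p : Fin (m + n) → ℕ))ᶜ (Fin.castAdd n i) = 0 := fun i => by
    rw [topExp, if_neg]; rw [Finset.mem_compl, not_not, mem_evens, p_castAdd]; simp
  have h2 : ∀ i : Fin n, topExp (evens (p : Fin (m + n) → ℕ))ᶜ (Fin.natAdd m i) = 1 := fun i => by
    rw [topExp, if_pos]; rw [Finset.mem_compl, mem_evens, p_natAdd]; simp
  rw [mon, List.ofFn_add, List.prod_append]
  change (List.ofFn fun i => x (Fin.castAdd n i) ^ topExp _ (Fin.castAdd n i)).prod *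
    (List.ofFn fun i => x (Fin.natAdd m i) ^ topExp _ (Fin.natAdd m i)).prod = _
  simp only [h1, h2, pow_one, pow_zero]
  rw [List.prod_eq_one (l := List.ofFn fun _ : Fin m => (1 : 𝓡)), one_mul]
  intro y hy
  obtain ⟨i, rfl⟩ := List.mem_ofFn.1 hy
  rfl

/-- The coefficient at the fundamental monomial is computed first in the dual variables of odd index
and then in the exterior variables of even index; each step gives a quantum determinant. -/
theorem kber_eq {t : Cqˣ} {X b : Matrix (Fin (m + n)) (Fin (m + n)) T} (h : QPair t p X b) :
    kber t p X b = qdet t (blockA X) * qdet t (blockB b) := by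
  have hP0 : ∀ i : Fin m, p (Fin.castAdd n i) = 0 := fun i => p_castAdd m n i
  have hP1 : ∀ i : Fin n, p (Fin.natAdd m i) = 1 := fun i => p_natAdd m n i
  let Y := (b.map MulOpposite.op).transpose.map (rmulHom T)
  let r : Fin (m + n) → Module.End Cq (Ext (m + n) T) :=
    coact (mulL (kap t p) (evens p)ᶜ) (Y.map (extMap (m + n) T))
  have hKR : ∀ j, KR t p b j = extMap (m + n) (Ext (m + n) T) (r j) := by
    intro j
    rw [KR_eq]
    simp only [r, coact, map_sum, map_mul]
    rfl
  have h1 : mon (KR t p b) (topExp (evens p)ᶜ) (vac (m + n) 1) = Finsupp.single 0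
      ((List.ofFn fun i => r (Fin.natAdd m i)).prod (Finsupp.single 0 1)) := by
    rw [mon_topExp_compl_evens]
    simp only [hKR]
    rw [show (List.ofFn fun i => extMap (m + n) (Ext (m + n) T) (r (Fin.natAdd m i))).prod =
      extMap (m + n) (Ext (m + n) T) (List.ofFn fun i => r (Fin.natAdd m i)).prod by
        rw [map_list_prod, List.map_ofFn]; rfl, vac, extMap_single]
  have h2 := prod_coact_mulL_apply t (evens p) ((X.map (Algebra.lmul Cq T)).map
    (extMap (m + n) T)) (κ := kap (-t)⁻¹ p) (Fin.strictMono_castAdd n)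
    (fun x y => by simp [kap, hP0]) (Fin.castAdd n)
    (mon (KR t p b) (topExp (evens p)ᶜ) (vac (m + n) 1)) (fun e he => by
      rw [h1]; exact Finsupp.single_eq_of_ne he)
  have h3 := prod_coact_mulL_apply t⁻¹ (evens p)ᶜ Y (κ := kap t p) (Fin.strictMono_natAdd m)
    (fun x y => by simp [kap, hP1, inv_neg]) (Fin.natAdd m) (Finsupp.single 0 1)
    (fun e he => Finsupp.single_eq_of_ne he)
  have e1 : ((((X.map (Algebra.lmul Cq T)).map (extMap (m + n) T)).submatrix (Fin.castAdd n)
      (Fin.castAdd n)).transpose) =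
      ((blockA X).transpose.map (Algebra.lmul Cq T)).map (extMap (m + n) T) := rfl
  have e2 : (Y.submatrix (Fin.natAdd m) (Fin.natAdd m)).transpose =
      ((blockB b).map MulOpposite.op).map (rmulHom T) := rfl
  rw [e1, qdet_map, qdet_map, (blockA_rtt h.rtt).qdet_transpose] at h2
  rw [e2, qdet_map, rmulHom_apply, Finsupp.single_eq_same, one_mul] at h3
  have hB := blockB_rtt h.rtt_inv
  rw [inv_inv] at hB
  rw [hB.unop_qdet_op] at h3
  rw [kber, kcoc, kmon, Module.End.mul_apply, mon_topExp_evens, topExp_evens]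
  have h4 := congrArg (fun z : Ext (m + n) T => z (indic (Fin.natAdd m))) h2
  rw [extMap_apply, h1, Finsupp.single_eq_same, h3] at h4
  rw [topExp_compl_evens] at *
  rw [h1]
  exact h4

end Blocks

/-! ### Odd entries: nilpotency, and the squares of the entries of the inverse -/

section Vec

variable {T : Type} [Ring T] [Algebra Cq T] {N : ℕ}

/-- The entries of a vector `l` are moved to the left of the entries of `A` by relations of quantum
matrix type. -/
def MovesLeft (r : Fin N → Fin N → Prop) [DecidableRel r] (A : Matrix (Fin N) (Fin N) T) (l : Fin N → T) (c₀ c₁ c₂ : Cq) : Prop :=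
  ∀ i j k, A i j * l k = c₀ • (l k * A i j) + (if r i k then c₁ • (l i * A k j) else 0) +
    if i = k then c₂ • (l k * A k j) else 0

variable {r : Fin N → Fin N → Prop} [DecidableRel r]

/-- Multiplying the relations by the inverse `S` on both sides moves `l` past `S`. -/
theorem MovesLeft.mul_inverse {A S : Matrix (Fin N) (Fin N) T} {l : Fin N → T} {c₀ c₁ c₂ : Cq}
    (h : MovesLeft r A l c₀ c₁ c₂) (hAS : A * S = 1) (hSA : S * A = 1) (s p k : Fin N) :
    l k * S s p = c₀ • (S s p * l k) +
      if k = p then c₁ • (∑ i, if r i k then S s i * l i else 0) + c₂ • (S s k * l k) else 0 := by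
  have h1 : ∑ i, ∑ j, S s i * (A i j * l k) * S j p = l k * S s p := by
    rw [Finset.sum_comm]
    have : ∀ j, ∑ i, S s i * (A i j * l k) * S j p = (S * A) s j * (l k * S j p) := fun j => by
      rw [Matrix.mul_apply, Finset.sum_mul]
      exact Finset.sum_congr rfl fun i _ => by simp only [mul_assoc]
    simp only [this, hSA, Matrix.one_apply, ite_mul, one_mul, zero_mul, Finset.sum_ite_eq,
      Finset.mem_univ, if_true]
  have h2 : ∀ i k' (c : Cq), ∑ j, S s i * (c • (l k' * A i j)) * S j p =
      if i = p then c • (S s i * l k') else 0 := by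
    intro i k' c
    have : ∀ j, S s i * (c • (l k' * A i j)) * S j p = c • (S s i * l k' * (A i j * S j p)) :=
      fun j => by rw [mul_smul_comm, smul_mul_assoc]; simp only [mul_assoc]
    simp only [this, ← Finset.smul_sum, ← Finset.mul_sum, ← Matrix.mul_apply, hAS,
      Matrix.one_apply, mul_ite, mul_one, mul_zero, smul_ite, smul_zero]
  have h3 : ∀ i k' (c : Cq), ∑ j, S s i * (c • (l i * A k' j)) * S j p =
      if k' = p then c • (S s i * l i) else 0 := by
    intro i k' c
    have : ∀ j, S s i * (c • (l i * A k' j)) * S j p = c • (S s i * l i * (A k' j * S j p)) :=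
      fun j => by rw [mul_smul_comm, smul_mul_assoc]; simp only [mul_assoc]
    simp only [this, ← Finset.smul_sum, ← Finset.mul_sum, ← Matrix.mul_apply, hAS,
      Matrix.one_apply, mul_ite, mul_one, mul_zero, smul_ite, smul_zero]
  rw [← h1]
  simp only [h _ _ k, mul_add, add_mul, Finset.sum_add_distrib, h2]
  rw [add_assoc]
  congr 1
  · simp
  have h4 : ∀ i, ∑ j, S s i * (if r i k then c₁ • (l i * A k j) else 0) * S j p =
      if k = p then (if r i k then c₁ • (S s i * l i) else 0) else 0 := by
    intro i
    by_cases hik : r i k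
    · simp only [if_pos hik, h3]
    · simp [if_neg hik]
  have h5 : ∀ i, ∑ j, S s i * (if i = k then c₂ • (l k * A k j) else 0) * S j p =
      if k = p then (if i = k then c₂ • (S s k * l k) else 0) else 0 := by
    intro i
    by_cases hik : i = k
    · subst hik; simp only [if_true, h3]
    · simp [if_neg hik]
  simp only [h4, h5]
  by_cases hkp : k = p
  · simp only [if_pos hkp, Finset.smul_sum, smul_ite, smul_zero, Finset.sum_ite_eq',
      Finset.mem_univ, if_true]
  · simp [if_neg hkp]

theorem MovesLeft.mul_inverse_of_ne {A S : Matrix (Fin N) (Fin N) T} {l : Fin N → T} {c₀ c₁ c₂ : Cq}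
    (h : MovesLeft r A l c₀ c₁ c₂) (hAS : A * S = 1) (hSA : S * A = 1) (s : Fin N) {p k : Fin N}
    (hk : k ≠ p) : l k * S s p = c₀ • (S s p * l k) := by
  rw [h.mul_inverse hAS hSA, if_neg hk, add_zero]

theorem MovesLeft.mul_inverse_self {A S : Matrix (Fin N) (Fin N) T} {l : Fin N → T} {c₀ c₁ c₂ : Cq}
    (h : MovesLeft r A l c₀ c₁ c₂) (hAS : A * S = 1) (hSA : S * A = 1) (s p : Fin N) :
    l p * S s p = (c₀ + c₂) • (S s p * l p) + c₁ • ∑ i, if r i p then S s i * l i else 0 := by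
  rw [h.mul_inverse hAS hSA, if_pos rfl, add_smul]
  abel

/-- The relations are triangular for the well-founded relation `r`, so they can be solved for the
products `S s p * l k`. -/
theorem MovesLeft.inverse_mul_mem {A S : Matrix (Fin N) (Fin N) T} {l : Fin N → T} {c₀ c₁ c₂ : Cq}
    (h : MovesLeft r A l c₀ c₁ c₂) (hAS : A * S = 1) (hSA : S * A = 1) (h0 : IsUnit c₀)
    (h2 : IsUnit (c₀ + c₂)) (hr : WellFounded r) {O G : Submodule Cq T} (hl : ∀ i, l i ∈ O) (hS : ∀ i j, S i j ∈ G)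
    (s p k : Fin N) : S s p * l k ∈ O * G := by
  have hm : ∀ k p, l k * S s p ∈ O * G := fun k p => Submodule.mul_mem_mul (hl k) (hS s p)
  by_cases hk : k = p
  · subst hk
    induction k using hr.induction with
    | _ k ih =>
    have e := h.mul_inverse_self hAS hSA s k
    have hsum : ∑ i, (if r i k then S s i * l i else 0) ∈ O * G :=
      Submodule.sum_mem _ fun i _ => by
        split_ifs with hi
        · exact ih i hi
        · exact zero_mem _
    obtain ⟨u, hu⟩ := h2
    have : S s k * l k = ((u⁻¹ : Cqˣ) : Cq) • (l k * S s k -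
        c₁ • ∑ i, if r i k then S s i * l i else 0) := by
      rw [e, add_sub_cancel_right, ← hu, smul_smul, Units.inv_mul, one_smul]
    rw [this]
    exact Submodule.smul_mem _ _ (sub_mem (hm k k) (Submodule.smul_mem _ _ hsum))
  · obtain ⟨u, rfl⟩ := h0
    have : S s p * l k = ((u⁻¹ : Cqˣ) : Cq) • (l k * S s p) := by
      rw [h.mul_inverse_of_ne hAS hSA s hk, smul_smul, Units.inv_mul, one_smul]
    rw [this]
    exact Submodule.smul_mem _ _ (hm k p)

theorem transpose_map_op_mul {A S : Matrix (Fin N) (Fin N) T} (h : S * A = 1) :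
    (A.map MulOpposite.op).transpose * (S.map MulOpposite.op).transpose = 1 := by
  ext i j
  apply MulOpposite.unop_injective
  have h' := congrFun (congrFun h j) i
  rw [Matrix.mul_apply, Matrix.one_apply] at h'
  simp only [Matrix.mul_apply, Matrix.transpose_apply, Matrix.map_apply, Finset.unop_sum,
    MulOpposite.unop_mul, MulOpposite.unop_op, h', Matrix.one_apply]
  by_cases hij : i = j
  · simp [hij]
  · simp [hij, Ne.symm hij]

/-- The analogue for relations in which `l` stands on the other side; here no induction is
necessary, as all terms already have `l` on the left. -/
theorem MovesLeft.inverse_mul_mem_of_op {A S : Matrix (Fin N) (Fin N) T} {l : Fin N → T} {c₀ c₁ c₂ : Cq}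
    (h : MovesLeft r (A.map MulOpposite.op).transpose (fun k => MulOpposite.op (l k)) c₀ c₁ c₂)
    (hAS : A * S = 1) (hSA : S * A = 1)
    {O G : Submodule Cq T} (hl : ∀ i, l i ∈ O) (hS : ∀ i j, S i j ∈ G)
    (s p k : Fin N) : S p s * l k ∈ O * G := by
  have hm : ∀ k p, l k * S p s ∈ O * G := fun k p => Submodule.mul_mem_mul (hl k) (hS p s)
  have e := congrArg MulOpposite.unop
    (h.mul_inverse (transpose_map_op_mul hSA) (transpose_map_op_mul hAS) s p k)
  simp only [Matrix.transpose_apply, Matrix.map_apply, MulOpposite.unop_mul, MulOpposite.unop_op,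
    MulOpposite.unop_add, MulOpposite.unop_smul, apply_ite MulOpposite.unop, Finset.unop_sum,
    MulOpposite.unop_zero] at e
  rw [e]
  refine add_mem (Submodule.smul_mem _ _ (hm _ _)) ?_
  split_ifs
  · refine add_mem (Submodule.smul_mem _ _ (Submodule.sum_mem _ fun i _ => ?_))
      (Submodule.smul_mem _ _ (hm _ _))
    split_ifs
    · exact hm _ _
    · exact zero_mem _
  · exact zero_mem _

end Vec

section Nilpotent

variable {T : Type} [Ring T] [Algebra Cq T]

theorem sup_pow_le {a b : Submodule Cq T} (h : b * a ≤ a * b) (r : ℕ) :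
    (a ⊔ b) ^ r ≤ ⨆ x : Fin (r + 1), a ^ (x : ℕ) * b ^ (r - x) := by
  have hba : ∀ k, b * a ^ k ≤ a ^ k * b := by
    intro k
    induction k with
    | zero => simp
    | succ k ih =>
      calc b * a ^ (k + 1) = b * a ^ k * a := by rw [pow_succ, mul_assoc]
        _ ≤ a ^ k * b * a := mul_le_mul' ih le_rfl
        _ = a ^ k * (b * a) := mul_assoc _ _ _
        _ ≤ a ^ k * (a * b) := mul_le_mul' le_rfl h
        _ = a ^ (k + 1) * b := by rw [pow_succ, mul_assoc]
  induction r with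
  | zero => simp
  | succ r ih =>
    rw [pow_succ']
    refine (mul_le_mul' le_rfl ih).trans ?_
    rw [Submodule.mul_iSup]
    refine iSup_le fun x => ?_
    rw [Submodule.sup_mul]
    refine sup_le ?_ ?_
    · refine le_trans (le_of_eq ?_) (le_iSup _ x.succ)
      rw [← mul_assoc, ← pow_succ', Fin.val_succ, Nat.add_sub_add_right]
    · rw [← mul_assoc]
      refine (mul_le_mul' (hba x) le_rfl).trans (le_trans (le_of_eq ?_) (le_iSup _ x.castSucc))
      rw [mul_assoc, ← pow_succ', Fin.val_castSucc]
      congr 2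
      have := x.2
      omega

/-- Among `r + s` factors from `a` and `b`, sorted, there are `r` from `a` or `s` from `b`. -/
theorem sup_pow_eq_bot {a b : Submodule Cq T} (h : b * a ≤ a * b) {r s : ℕ} (ha : a ^ r = ⊥)
    (hb : b ^ s = ⊥) : (a ⊔ b) ^ (r + s) = ⊥ := by
  rw [eq_bot_iff]
  refine (sup_pow_le h _).trans (iSup_le fun x => ?_)
  rcases le_or_gt r x with hx | hx
  · rw [← Nat.sub_add_cancel hx, pow_add, ha, Submodule.mul_bot, Submodule.bot_mul]
  · rw [show r + s - x = (r - x) + s by omega, pow_add, hb, Submodule.mul_bot, Submodule.mul_bot]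

theorem iSup_pow_eq_bot : ∀ {N : ℕ} (M : Fin N → Submodule Cq T) {s : ℕ}
    (_ : ∀ i k, i < k → M k * M i ≤ M i * M k) (_ : ∀ i, M i ^ s = ⊥), ∃ r, (⨆ i, M i) ^ r = ⊥
  | 0, M, s, _, _ => ⟨1, by simp⟩
  | N + 1, M, s, h, hs => by
    obtain ⟨r, hr⟩ := iSup_pow_eq_bot (fun i => M i.succ)
      (fun i k hik => h _ _ (Fin.succ_lt_succ_iff.2 hik)) fun i => hs _
    refine ⟨s + r, ?_⟩
    have e : ⨆ i, M i = M 0 ⊔ ⨆ i : Fin N, M i.succ := by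
      refine le_antisymm (iSup_le fun i => ?_)
        (sup_le (le_iSup M 0) (iSup_le fun i => le_iSup M i.succ))
      refine Fin.cases le_sup_left (fun j => ?_) i
      exact (le_iSup (fun i : Fin N => M i.succ) j).trans le_sup_right
    rw [e]
    refine sup_pow_eq_bot ?_ (hs 0) hr
    rw [Submodule.iSup_mul, Submodule.mul_iSup]
    exact iSup_mono fun i => h 0 i.succ (Fin.succ_pos i)

end Nilpotent

section Odd

variable {m n : ℕ} {T : Type} [Ring T] [Algebra Cq T]

theorem p_zero_or_one (i : Fin (m + n)) : p i = 0 ∨ p i = 1 := by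
  rw [p]; split_ifs <;> simp

theorem p_mono {i k : Fin (m + n)} (h : i < k) : p i ≤ p k := by
  rw [p, p]
  rw [Fin.lt_def] at h
  split_ifs <;> omega

theorem sgn_castAdd_left (i : Fin m) (k : Fin (m + n)) : sgn p (Fin.castAdd n i) k = 1 := by
  simp [sgn, p_castAdd]

theorem sgn_castAdd_right (i : Fin m) (k : Fin (m + n)) : sgn p k (Fin.castAdd n i) = 1 := by
  simp [sgn, p_castAdd]

theorem sgn_natAdd (i k : Fin n) : sgn p (Fin.natAdd m i) (Fin.natAdd m k) = -1 := by
  simp [sgn, p_natAdd]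

theorem eig_castAdd (t : Cqˣ) (i : Fin m) : eig t p (Fin.castAdd n i) = ((t⁻¹ : Cqˣ) : Cq) :=
  eig_even t (by rw [p_castAdd]; simp)

theorem eig_natAdd (t : Cqˣ) (i : Fin n) : eig t p (Fin.natAdd m i) = -(t : Cq) :=
  eig_odd t (by rw [p_natAdd]; simp)

theorem castAdd_lt_natAdd (i : Fin m) (j : Fin n) : Fin.castAdd n i < Fin.natAdd m j := by
  rw [Fin.lt_def, Fin.val_castAdd, Fin.val_natAdd]; omega

theorem castAdd_lt_castAdd {i j : Fin m} (h : i < j) : Fin.castAdd n i < Fin.castAdd n j :=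
  Fin.strictMono_castAdd n h

theorem natAdd_lt_natAdd {i j : Fin n} (h : i < j) : Fin.natAdd m i < Fin.natAdd m j :=
  Fin.strictMono_natAdd m h

variable {t : Cqˣ} {X : Matrix (Fin (m + n)) (Fin (m + n)) T}

theorem RTT.movesLeft_A (h : RTT t p X) (c : Fin n) :
    MovesLeft (· < ·) (blockA X) (fun k => X (Fin.castAdd n k) (Fin.natAdd m c)) 1 (qdiff t)
      (((t⁻¹ : Cqˣ) : Cq) - 1) := by
  intro i j k
  have hjc := castAdd_lt_natAdd j c
  simp only [blockA, Matrix.submatrix_apply]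
  rcases lt_trichotomy i k with hik | rfl | hik
  · rw [if_pos hik, if_neg hik.ne, h.cross _ _ _ _ (castAdd_lt_castAdd hik) hjc]
    simp [sgn_castAdd_left]
  · rw [if_neg (lt_irrefl i), if_pos rfl, h.row _ _ _ hjc, eig_castAdd, sgn_castAdd_left, sub_smul]
    simp
  · rw [if_neg hik.not_gt, if_neg hik.ne', h.comm_symm _ _ _ _ (castAdd_lt_castAdd hik) hjc]
    simp [sgn_castAdd_left, sgn_castAdd_right]

theorem RTT.movesLeft_B (h : RTT t p X) (c : Fin m) :
    MovesLeft (fun i k => k < i) (blockB X) (fun k : Fin n => X (Fin.natAdd m k) (Fin.castAdd n c))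
      (-1) (-qdiff t) (1 - ((t⁻¹ : Cqˣ) : Cq)) := by
  intro i j k
  have hcj := castAdd_lt_natAdd c j
  simp only [blockB, Matrix.submatrix_apply]
  rcases lt_trichotomy i k with hik | hik | hik
  · rw [if_neg hik.not_gt, if_neg hik.ne, h.comm _ _ _ _ (natAdd_lt_natAdd hik) hcj]
    simp [sgn_natAdd, sgn_castAdd_left, sgn_castAdd_right]
  · subst hik
    rw [if_neg (lt_irrefl i), if_pos rfl, h.row_symm _ _ _ hcj, eig_natAdd, sgn_castAdd_left,
      sub_smul]
    simp
    abel
  · rw [if_pos hik, if_neg hik.ne', h.cross_symm _ _ _ _ (natAdd_lt_natAdd hik) hcj,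
      h.comm _ _ _ _ (natAdd_lt_natAdd hik) hcj]
    simp [sgn_natAdd, sgn_castAdd_left, sgn_castAdd_right, sub_eq_add_neg]

theorem RTT.op_transpose (h : RTT t p X) :
    RTT t⁻¹ p (X.map MulOpposite.op).transpose := h.op.transpose

/-- The odd entries, the even ones being replaced by `0`. -/
def oddEntry (X : Matrix (Fin (m + n)) (Fin (m + n)) T) (i j : Fin (m + n)) : T :=
  if Odd (p i + p j) then X i j else 0

/-- The span of the odd entries of a row. -/
def oddRow (X : Matrix (Fin (m + n)) (Fin (m + n)) T) (i : Fin (m + n)) : Submodule Cq T :=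
  ⨆ j, Submodule.span Cq {oddEntry X i j}

/-- The span of the odd entries. -/
def oddSpan (X : Matrix (Fin (m + n)) (Fin (m + n)) T) : Submodule Cq T := ⨆ i, oddRow X i

theorem oddEntry_mem_oddRow (i j : Fin (m + n)) : oddEntry X i j ∈ oddRow X i :=
  Submodule.mem_iSup_of_mem j (Submodule.mem_span_singleton_self _)

theorem mem_oddRow {i j : Fin (m + n)} (hij : Odd (p i + p j)) : X i j ∈ oddRow X i := by
  have := oddEntry_mem_oddRow (X := X) i j
  rwa [oddEntry, if_pos hij] at this

theorem mem_oddSpan {i j : Fin (m + n)} (hij : Odd (p i + p j)) : X i j ∈ oddSpan X :=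
  Submodule.mem_iSup_of_mem i (mem_oddRow hij)

/-- The odd entries of a row have square zero and commute up to scalars. -/
theorem oddRow_pow (h : RTT t p X) (hs : SqZero p X) :
    ∃ r, ∀ i, oddRow X i ^ r = ⊥ := by
  have hi : ∀ i, ∃ r, oddRow X i ^ r = ⊥ := by
    intro i
    refine iSup_pow_eq_bot (s := 2) _ (fun j l hjl => ?_) fun j => ?_
    · rw [Submodule.span_mul_span, Submodule.span_mul_span, Set.singleton_mul_singleton,
        Set.singleton_mul_singleton, Submodule.span_singleton_le_iff_mem,
        Submodule.mem_span_singleton]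
      rw [oddEntry, oddEntry]
      split_ifs
      · exact ⟨_, (h.row_symm i j l hjl).symm⟩
      · exact ⟨0, by simp⟩
      · exact ⟨0, by simp⟩
      · exact ⟨0, by simp⟩
    · rw [pow_two, Submodule.span_mul_span, Set.singleton_mul_singleton, Submodule.span_singleton_eq_bot,
        oddEntry]
      split_ifs with hij
      · exact hs i j hij
      · exact zero_mul _
  choose r hr using hi
  refine ⟨∑ i, r i, fun i => ?_⟩
  obtain ⟨k, hk⟩ := Nat.exists_eq_add_of_le (Finset.single_le_sum (f := r) (fun _ _ => Nat.zero_le _)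
    (Finset.mem_univ i))
  rw [hk, pow_add, hr, Submodule.bot_mul]

/-- The rows are sorted by the relations between entries in different rows; the correction term of
such a relation consists of odd entries when it occurs for two odd entries. -/
theorem oddSpan_pow (h : RTT t p X) (hs : SqZero p X) : ∃ r, oddSpan X ^ r = ⊥ := by
  obtain ⟨r, hr⟩ := oddRow_pow h hs
  refine iSup_pow_eq_bot (s := r) _ (fun i k hik => ?_) hr
  rw [oddRow, oddRow, Submodule.iSup_mul]
  refine iSup_le fun l => ?_
  rw [Submodule.mul_iSup]
  refine iSup_le fun j => ?_
  rw [Submodule.span_mul_span, Set.singleton_mul_singleton, Submodule.span_singleton_le_iff_mem]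
  have hmem : ∀ j l, Odd (p i + p j) → Odd (p k + p l) → X i j * X k l ∈ oddRow X i * oddRow X k :=
    fun j l h1 h2 => Submodule.mul_mem_mul (mem_oddRow h1) (mem_oddRow h2)
  change oddEntry X k l * oddEntry X i j ∈ oddRow X i * oddRow X k
  rw [oddEntry, oddEntry]
  split_ifs with h1 h2
  · rcases lt_trichotomy j l with hjl | rfl | hjl
    · rw [h.cross_symm i j k l hik hjl]
      have hp1 := p_mono hik
      have hp2 := p_mono hjl
      refine sub_mem (Submodule.smul_mem _ _ (hmem _ _ h2 h1)) (Submodule.smul_mem _ _ (hmem _ _ ?_ ?_))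
      · rcases p_zero_or_one i with e1 | e1 <;> rcases p_zero_or_one j with e2 | e2 <;>
          rcases p_zero_or_one k with e3 | e3 <;> rcases p_zero_or_one l with e4 | e4 <;>
          simp_all (decide := true)
      · rcases p_zero_or_one i with e1 | e1 <;> rcases p_zero_or_one j with e2 | e2 <;>
          rcases p_zero_or_one k with e3 | e3 <;> rcases p_zero_or_one l with e4 | e4 <;>
          simp_all (decide := true)
    · rw [h.col_symm i j k hik]
      exact Submodule.smul_mem _ _ (hmem _ _ h2 h1)
    · rw [h.comm_symm i j k l hik hjl]
      exact Submodule.smul_mem _ _ (hmem _ _ h2 h1)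
  all_goals simp

/-- A product with an odd second factor is a combination of products with an odd first factor. -/
theorem entry_mul_mem (h : RTT t p X) {G : Submodule Cq T} (hG : ∀ i j, X i j ∈ G)
    (i j : Fin (m + n)) {k l : Fin (m + n)} (hkl : Odd (p k + p l)) :
    X i j * X k l ∈ oddSpan X * G := by
  have hmem : ∀ {i j} k l, Odd (p i + p j) → X i j * X k l ∈ oddSpan X * G :=
    fun k l h1 => Submodule.mul_mem_mul (mem_oddSpan h1) (hG _ _)
  by_cases hij : Odd (p i + p j)
  · exact hmem _ _ hij
  -- the correction term has an odd factor, too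
  have hpar : Odd (p i + p l) ∨ Odd (p k + p j) := by
    by_contra hc
    rw [not_or, Nat.not_odd_iff_even, Nat.not_odd_iff_even] at hc
    rw [Nat.not_odd_iff_even] at hij
    have h1 := (hc.1.add hc.2).add hij
    rw [show p i + p l + (p k + p j) + (p i + p j) = p k + p l + 2 * (p i + p j) by ring] at h1
    exact (Nat.not_even_iff_odd.2 (hkl.add_even (even_two_mul _))) h1
  rcases lt_trichotomy i k with hik | rfl | hik <;> rcases lt_trichotomy j l with hjl | rfl | hjl
  · rw [h.cross i j k l hik hjl]
    refine add_mem (Submodule.smul_mem _ _ (hmem _ _ hkl)) (Submodule.smul_mem _ _ ?_)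
    rcases hpar with h1 | h1
    · exact hmem _ _ h1
    · rw [h.comm i l k j hik hjl]
      exact Submodule.smul_mem _ _ (hmem _ _ h1)
  · rw [h.col i j k hik]
    exact Submodule.smul_mem _ _ (hmem _ _ hkl)
  · rw [h.comm i j k l hik hjl]
    exact Submodule.smul_mem _ _ (hmem _ _ hkl)
  · rw [h.row i j l hjl]
    exact Submodule.smul_mem _ _ (hmem _ _ hkl)
  · exact absurd hkl hij
  · rw [h.row_symm i l j hjl]
    exact Submodule.smul_mem _ _ (hmem _ _ hkl)
  · rw [h.comm_symm k l i j hik hjl]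
    exact Submodule.smul_mem _ _ (hmem _ _ hkl)
  · rw [h.col_symm k j i hik]
    exact Submodule.smul_mem _ _ (hmem _ _ hkl)
  · rw [h.cross_symm k l i j hik hjl]
    refine sub_mem (Submodule.smul_mem _ _ (hmem _ _ hkl)) (Submodule.smul_mem _ _ ?_)
    rcases hpar with h1 | h1
    · rw [h.comm k j i l hik hjl]
      exact Submodule.smul_mem _ _ (hmem _ _ h1)
    · exact hmem _ _ h1

/-- The odd entries generate a nilpotent ideal of the algebra generated by the entries of a quantum
supermatrix and of the inverses of its diagonal blocks. -/
theorem exists_nilpotent_ideal (h : RTT t p X) (hs : SqZero p X)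
    {SA : Matrix (Fin m) (Fin m) T} (hA : blockA X * SA = 1) (hA' : SA * blockA X = 1)
    {SB : Matrix (Fin n) (Fin n) T} (hB : blockB X * SB = 1) (hB' : SB * blockB X = 1) :
    ∃ (G : Subalgebra Cq T) (J : Submodule Cq T) (r : ℕ), (∀ i j, X i j ∈ G) ∧
      (∀ i j, SA i j ∈ G) ∧ (∀ i j, SB i j ∈ G) ∧ (∀ i j, Odd (p i + p j) → X i j ∈ J) ∧
      (∀ g ∈ G, ∀ x ∈ J, g * x ∈ J) ∧ (∀ g ∈ G, ∀ x ∈ J, x * g ∈ J) ∧ J ^ r = ⊥ := by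
  let gens : Set T := {x | (∃ i j, X i j = x) ∨ (∃ i j, SA i j = x) ∨ ∃ i j, SB i j = x}
  let G := Algebra.adjoin Cq gens
  let G' := Subalgebra.toSubmodule G
  let O := oddSpan X
  have hX : ∀ i j, X i j ∈ G := fun i j => Algebra.subset_adjoin (Or.inl ⟨i, j, rfl⟩)
  have hSA : ∀ i j, SA i j ∈ G := fun i j => Algebra.subset_adjoin (Or.inr (Or.inl ⟨i, j, rfl⟩))
  have hSB : ∀ i j, SB i j ∈ G := fun i j => Algebra.subset_adjoin (Or.inr (Or.inr ⟨i, j, rfl⟩))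
  have hone : (1 : T) ∈ G' := G.one_mem
  have hGG : G' * G' = G' := Subalgebra.isIdempotentElem_toSubmodule G
  have oddΛ : ∀ (a : Fin m) (c : Fin n), X (Fin.castAdd n a) (Fin.natAdd m c) ∈ O := fun a c =>
    mem_oddSpan (by rw [p_castAdd, p_natAdd]; decide)
  have oddΥ : ∀ (a : Fin m) (c : Fin n), X (Fin.natAdd m c) (Fin.castAdd n a) ∈ O := fun a c =>
    mem_oddSpan (by rw [p_castAdd, p_natAdd]; decide)
  have hu : ∀ u : Cqˣ, IsUnit (1 + ((u : Cq) - 1)) := fun u => by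
    rw [add_sub_cancel]; exact u.isUnit
  have hu' : ∀ u : Cqˣ, IsUnit (-1 + (1 - (u : Cq))) := fun u => by
    rw [neg_add_eq_sub, sub_sub_cancel_left]; exact u.isUnit.neg
  -- each generator moves past the odd entries
  have hgen : ∀ g ∈ gens, ∀ k l, Odd (p k + p l) → g * X k l ∈ O * G' := by
    rintro g (⟨i, j, rfl⟩ | ⟨i, j, rfl⟩ | ⟨i, j, rfl⟩) k l hkl
    · exact entry_mul_mem h hX i j hkl
    · revert hkl
      refine Fin.addCases (fun k => ?_) (fun k => ?_) k <;>
        refine Fin.addCases (fun l => ?_) (fun l => ?_) l <;>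
        simp only [p_castAdd, p_natAdd] <;> intro hkl
      · exact absurd hkl (by decide)
      · exact (h.movesLeft_A l).inverse_mul_mem hA hA' isUnit_one (hu _)
          wellFounded_lt (fun a => oddΛ a l)
          hSA i j k
      · exact (h.op_transpose.movesLeft_A k).inverse_mul_mem_of_op
          (l := fun a => X (Fin.natAdd m k) (Fin.castAdd n a)) hA hA' (fun a => oddΥ a k) hSA j i l
      · exact absurd hkl (by decide)
    · revert hkl
      refine Fin.addCases (fun k => ?_) (fun k => ?_) k <;>
        refine Fin.addCases (fun l => ?_) (fun l => ?_) l <;>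
        simp only [p_castAdd, p_natAdd] <;> intro hkl
      · exact absurd hkl (by decide)
      · exact (h.op_transpose.movesLeft_B k).inverse_mul_mem_of_op 
          (l := fun a : Fin n => X (Fin.castAdd n k) (Fin.natAdd m a)) hB hB' (fun a => oddΛ k a)
          hSB j i l
      · exact (h.movesLeft_B l).inverse_mul_mem  hB hB' isUnit_one.neg (hu' _)
          wellFounded_gt
          (fun a => oddΥ l a) hSB i j k
      · exact absurd hkl (by decide)
  have hgenO : ∀ g ∈ gens, ∀ o ∈ O, g * o ∈ O * G' := by
    intro g hg o ho
    have : O ≤ (O * G').comap (LinearMap.mulLeft Cq g) := by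
      refine iSup_le fun k => iSup_le fun l => ?_
      rw [Submodule.span_singleton_le_iff_mem, Submodule.mem_comap, LinearMap.mulLeft_apply, oddEntry]
      split_ifs with hkl
      · exact hgen g hg k l hkl
      · simp
    exact this ho
  have hGO : G' * O ≤ O * G' := by
    rw [Submodule.mul_le]
    intro g hg o ho
    revert o
    refine Algebra.adjoin_induction (p := fun g _ => ∀ o ∈ O, g * o ∈ O * G') hgenO ?_ ?_ ?_ hg
    · intro c o ho
      rw [Algebra.commutes]
      exact Submodule.mul_mem_mul ho (G.algebraMap_mem c)
    · intro x y _ _ hx hy o ho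
      rw [add_mul]
      exact add_mem (hx o ho) (hy o ho)
    · intro x y _ _ hx hy o ho
      rw [mul_assoc]
      refine Submodule.mul_induction_on (hy o ho) (fun o' ho' g' hg' => ?_) fun a b ha hb => ?_
      · rw [← mul_assoc, ← hGG, ← mul_assoc]
        exact Submodule.mul_mem_mul (hx o' ho') hg'
      · rw [mul_add]
        exact add_mem ha hb
  -- the powers of the ideal are generated by the powers of the space of odd entries
  have hOG : ∀ k, (O * G') ^ k * G' ≤ O ^ k * G' := by
    intro k
    induction k with
    | zero => simp
    | succ k ih =>
      calc (O * G') ^ (k + 1) * G' = (O * G') ^ k * (O * (G' * G')) := by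
            rw [pow_succ]; simp only [mul_assoc]
        _ ≤ (O * G') ^ k * (G' * (O * (G' * G'))) := by
            refine mul_le_mul' le_rfl ?_
            rw [Submodule.mul_le]
            intro x hx y hy
            have := Submodule.mul_mem_mul hone (Submodule.mul_mem_mul hx hy)
            rwa [one_mul] at this
        _ = (O * G') ^ k * G' * (O * (G' * G')) := by simp only [mul_assoc]
        _ ≤ O ^ k * G' * (O * (G' * G')) := mul_le_mul' ih le_rfl
        _ = O ^ k * (G' * O * G') := by rw [hGG]; simp only [mul_assoc]
        _ ≤ O ^ k * (O * G' * G') := mul_le_mul' le_rfl (mul_le_mul' hGO le_rfl)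
        _ = O ^ (k + 1) * G' := by rw [mul_assoc O, hGG, pow_succ, mul_assoc]
  obtain ⟨r, hr⟩ := oddSpan_pow h hs
  refine ⟨G, O * G', r, hX, hSA, hSB, fun i j hij => ?_, fun g hg x hx => ?_, fun g hg x hx => ?_,
    ?_⟩
  · have := Submodule.mul_mem_mul (mem_oddSpan (X := X) hij) hone
    rwa [mul_one] at this
  · have h1 := Submodule.mul_mem_mul (M := G') hg hx
    rw [← mul_assoc] at h1
    have h2 := mul_le_mul' hGO (le_refl G') h1
    rwa [mul_assoc, hGG] at h2
  · have h1 := Submodule.mul_mem_mul (N := G') hx hg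
    rwa [mul_assoc, hGG] at h1
  · rw [eq_bot_iff]
    calc (O * G') ^ r ≤ (O * G') ^ r * G' := fun x hx => by
          have := Submodule.mul_mem_mul hx hone
          rwa [mul_one] at this
      _ ≤ O ^ r * G' := hOG r
      _ = ⊥ := by rw [show O ^ r = ⊥ from hr, Submodule.bot_mul]

/-- The relations between the entries of a quantum supermatrix and of its inverse. -/
theorem RTTEntries.mixed {N : ℕ} {P : Fin N → ℕ} {X b : Matrix (Fin N) (Fin N) T}
    (h : RTTEntries t P X) (hXb : X * b = 1) (hbX : b * X = 1) (i k j l : Fin N) :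
    swapCoeff t P l k • (b i l * X k j) +
        (if k = l then qdiff t • ∑ a, (if a < k then b i a * X a j else 0) else 0) =
      swapCoeff t P i j • (X k j * b i l) +
        if i = j then qdiff t • ∑ a, (if i < a then X k a * b a l else 0) else 0 := by
  rw [rttEntries_iff_commute] at h
  -- `R X₁ X₂ = X₁ X₂ R`, multiplied by the inverse of `X₁` from the left and by that of `X₂` from
  -- the right
  have h1 : leg₁ b * rMatrix T t P * leg₁ X = leg₂ X * rMatrix T t P * leg₂ b := by
    have e1 : leg₁ b * leg₁ X = 1 := by rw [← leg₁_mul, hbX, leg₁_one]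
    have e2 : leg₂ X * leg₂ b = 1 := by rw [← leg₂_mul, hXb, leg₂_one]
    calc leg₁ b * rMatrix T t P * leg₁ X = leg₁ b * rMatrix T t P * leg₁ X * (leg₂ X * leg₂ b) := by
          rw [e2, mul_one]
      _ = leg₁ b * (rMatrix T t P * (leg₁ X * leg₂ X)) * leg₂ b := by simp only [mul_assoc]
      _ = leg₁ b * leg₁ X * leg₂ X * rMatrix T t P * leg₂ b := by rw [h]; simp only [mul_assoc]
      _ = leg₂ X * rMatrix T t P * leg₂ b := by rw [e1, one_mul]
  have h2 := congrFun (congrFun h1 (i, k)) (j, l)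
  have e1 : (leg₁ b * rMatrix T t P * leg₁ X) (i, k) (j, l) =
      swapCoeff t P l k • (b i l * X k j) +
        (if k = l then qdiff t • ∑ a, (if a < k then b i a * X a j else 0) else 0) := by
    rw [Matrix.mul_assoc, Matrix.mul_apply, Fintype.sum_prod_type]
    have : ∀ a c, leg₁ b (i, k) (a, c) * (rMatrix T t P * leg₁ X) (a, c) (j, l) =
        if k = c then (swapCoeff t P a k • (b i a * if a = l then X k j else 0) +
          diagCoeff t a k • (b i a * if k = l then X a j else 0)) else 0 := by
      intro a c
      rw [rMatrix_mul_apply]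
      simp only [leg₁, Matrix.of_apply]
      split_ifs with h1 <;> simp_all [mul_add]
    simp only [this, Finset.sum_ite_eq, Finset.mem_univ, if_true, Finset.sum_add_distrib]
    congr 1
    · simp
    · split_ifs
      · simp [diagCoeff, Finset.smul_sum, ite_smul, smul_ite]
      · simp
  have e2 : (leg₂ X * rMatrix T t P * leg₂ b) (i, k) (j, l) =
      swapCoeff t P i j • (X k j * b i l) +
        if i = j then qdiff t • ∑ a, (if i < a then X k a * b a l else 0) else 0 := by
    rw [Matrix.mul_assoc, Matrix.mul_apply, Fintype.sum_prod_type]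
    have : ∀ a c, leg₂ X (i, k) (a, c) * (rMatrix T t P * leg₂ b) (a, c) (j, l) =
        if i = a then (swapCoeff t P i c • (X k c * if c = j then b i l else 0) +
          diagCoeff t i c • (X k c * if i = j then b c l else 0)) else 0 := by
      intro a c
      rw [rMatrix_mul_apply]
      simp only [leg₂, Matrix.of_apply]
      split_ifs with h1 <;> simp_all [mul_add]
    rw [Finset.sum_comm]
    simp only [this, Finset.sum_ite_eq, Finset.mem_univ, if_true, Finset.sum_add_distrib]
    congr 1
    · simp
    · split_ifs
      · simp [diagCoeff, Finset.smul_sum, ite_smul, smul_ite]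
      · simp
  rw [← e1, ← e2, h2]

end Odd

/-! ### Squares of the odd entries of the inverse -/

section InverseSquares

variable {m n : ℕ} {T : Type} [Ring T] [Algebra Cq T] {t : Cqˣ}
  {X : Matrix (Fin (m + n)) (Fin (m + n)) T} {S : Matrix (Fin m) (Fin m) T}

/-- The products of two entries of a row of `S Λ`, where `S` is the inverse of `A`, with the factors
from `S` moved to the left. -/
theorem RTT.inverse_mul_Λ_mul (h : RTT t p X) (hS : blockA X * S = 1) (hS' : S * blockA X = 1)
    (i : Fin m) (c e : Fin n) :
    (S * blockΛ X) i e * (S * blockΛ X) i c = ∑ a, ∑ k,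
      (S i a * S i k * (blockΛ X a e * blockΛ X k c) +
        (if k < a then qdiff t • (S i a * S i k * (blockΛ X k e * blockΛ X a c)) else 0) +
        if a = k then (((t⁻¹ : Cqˣ) : Cq) - 1) • (S i a * S i a * (blockΛ X a e * blockΛ X a c))
          else 0) := by
  have hm : ∀ a k, S i a * blockΛ X a e * (S i k * blockΛ X k c) =
      S i a * S i k * (blockΛ X a e * blockΛ X k c) + if a = k then
        (∑ l, if l < a then qdiff t • (S i a * S i l * (blockΛ X l e * blockΛ X a c)) else 0) +
        (((t⁻¹ : Cqˣ) : Cq) - 1) • (S i a * S i a * (blockΛ X a e * blockΛ X a c)) else 0 := by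
    intro a k
    have := (h.movesLeft_A e).mul_inverse hS hS' i k a
    rw [mul_assoc, ← mul_assoc (blockΛ X a e), show blockΛ X a e = X (Fin.castAdd n a)
      (Fin.natAdd m e) from rfl, this, add_mul, mul_add, one_smul]
    congr 1
    · simp only [mul_assoc]
    split_ifs with hak
    · subst hak
      rw [add_mul, mul_add, smul_mul_assoc, mul_smul_comm, smul_mul_assoc, mul_smul_comm,
        Finset.sum_mul, Finset.mul_sum, Finset.smul_sum]
      congr 1
      · refine Finset.sum_congr rfl fun l _ => ?_
        split_ifs
        · simp only [mul_assoc]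
          rfl
        · simp
      · simp only [mul_assoc]
    · simp
  rw [Matrix.mul_apply, Matrix.mul_apply, Finset.sum_mul_sum]
  simp only [hm, Finset.sum_add_distrib, Finset.sum_ite_eq, Finset.mem_univ, if_true]
  abel

/-- The entries of a row of `S Λ` behave like odd variables; this and `RTT.inverse_mul_Λ_sq` are
computed by pairing the opposite terms of a double sum. -/
theorem RTT.inverse_mul_Λ_comm (h : RTT t p X) (hS : blockA X * S = 1) (hS' : S * blockA X = 1)
    (i : Fin m) {c e : Fin n} (hce : c < e) :
    (S * blockΛ X) i e * (S * blockΛ X) i c =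
      -((t : Cq) • ((S * blockΛ X) i c * (S * blockΛ X) i e)) := by
  have hSr : RTT t⁻¹ (fun _ => 0) S :=
    ((blockA_rtt h).entries (sqZero_even _)).inverse hS hS'
  rw [← add_eq_zero_iff_eq_neg, h.inverse_mul_Λ_mul hS hS', h.inverse_mul_Λ_mul hS hS',
    Finset.smul_sum, ← Finset.sum_add_distrib]
  simp only [Finset.smul_sum, ← Finset.sum_add_distrib]
  have hce' := natAdd_lt_natAdd (m := m) hce
  apply sum_sum_eq_zero_of_antisymm
  · intro a
    have hr := h.row_symm (Fin.castAdd n a) _ _ hce'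
    rw [eig_castAdd, sgn_natAdd, inv_inv] at hr
    simp only [lt_irrefl, if_false, if_true, add_zero, blockΛ, Matrix.submatrix_apply, hr]
    simp only [mul_smul_comm, smul_smul]
    module
  · intro a k hak
    have hak' := castAdd_lt_castAdd (n := n) hak
    have h1 : S i a * S i k = (t : Cq) • (S i k * S i a) := by
      rw [hSr.row i a k hak, eig_even _ (by simp), inv_inv]; simp [sgn]
    have h2 := h.cross _ _ _ _ hak' hce'
    have h3 := h.comm _ _ _ _ hak' hce'
    rw [sgn_castAdd_left, sgn_natAdd] at h2 h3
    simp only [if_pos hak, if_neg hak.not_gt, if_neg hak.ne, if_neg hak.ne', add_zero, blockΛ,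
      Matrix.submatrix_apply, h1, h2, h3]
    simp only [mul_smul_comm, smul_mul_assoc, mul_add, smul_add, smul_smul]
    have ht : (t : Cq) * ((t⁻¹ : Cqˣ) : Cq) = 1 := Units.mul_inv t
    generalize S i k * S i a * _ = u
    generalize S i k * S i a * _ = v
    rw [qdiff]
    match_scalars
    · linear_combination (((t⁻¹ : Cqˣ) : Cq) - t) * ht
    · linear_combination -ht

theorem RTT.inverse_mul_Λ_sq (h : RTT t p X) (hs : SqZero p X) (hS : blockA X * S = 1)
    (hS' : S * blockA X = 1) (i : Fin m) (c : Fin n) :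
    (S * blockΛ X) i c * (S * blockΛ X) i c = 0 := by
  have hSr : RTT t⁻¹ (fun _ => 0) S :=
    ((blockA_rtt h).entries (sqZero_even _)).inverse hS hS'
  rw [h.inverse_mul_Λ_mul hS hS']
  apply sum_sum_eq_zero_of_antisymm
  · intro a
    have := hs (Fin.castAdd n a) (Fin.natAdd m c) (by rw [p_castAdd, p_natAdd]; decide)
    simp [blockΛ, this]
  · intro a k hak
    have hak' := castAdd_lt_castAdd (n := n) hak
    have h1 : S i a * S i k = (t : Cq) • (S i k * S i a) := by
      rw [hSr.row i a k hak, eig_even _ (by simp), inv_inv]; simp [sgn]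
    have h2 := h.col _ (Fin.natAdd m c) _ hak'
    rw [sgn_castAdd_left, eig_natAdd] at h2
    simp only [if_pos hak, if_neg hak.not_gt, if_neg hak.ne, if_neg hak.ne', add_zero, blockΛ,
      Matrix.submatrix_apply, h1, h2]
    simp only [mul_smul_comm, smul_mul_assoc, mul_add, smul_add, smul_smul]
    have ht : (t : Cq) * ((t⁻¹ : Cqˣ) : Cq) = 1 := Units.mul_inv t
    generalize S i k * S i a * _ = u
    rw [qdiff]
    match_scalars
    linear_combination -ht

variable {b : Matrix (Fin (m + n)) (Fin (m + n)) T}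

theorem sum_fin_add_ite_lt {M : Type} [AddCommMonoid M] (c : Fin n) (f : Fin (m + n) → M) :
    ∑ a, (if Fin.natAdd m c < a then f a else 0) = ∑ e, if c < e then f (Fin.natAdd m e) else 0 := by
  rw [Fin.sum_univ_add, Finset.sum_eq_zero, zero_add]
  · refine Finset.sum_congr rfl fun e _ => ?_
    simp only [(Fin.strictMono_natAdd m).lt_iff_lt]
  · intro a _
    rw [if_neg (castAdd_lt_natAdd a c).not_gt]

/-- The relations between the odd-odd block of the inverse and `S Λ`. -/
theorem RTT.blockB_inverse_mul (h : RTT t p X) (hs : SqZero p X) (hS : blockA X * S = 1)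
    (hS' : S * blockA X = 1) (hXb : X * b = 1) (hbX : b * X = 1) (i : Fin m) (c j e : Fin n) :
    blockB b c j * (S * blockΛ X) i e =
      (if c = e then -(t : Cq) else -1) • ((S * blockΛ X) i e * blockB b c j) +
      if c = e then qdiff t • ∑ l, (if c < l then (S * blockΛ X) i l * blockB b l j else 0)
        else 0 := by
  have hmix := (h.entries hs).mixed hXb hbX
  have ne : ∀ (a : Fin m) (c : Fin n), Fin.natAdd m c ≠ Fin.castAdd n a := fun a c =>
    (castAdd_lt_natAdd a c).ne'
  have hA : ∀ k s, blockB b c j * blockA X k s = blockA X k s * blockB b c j := by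
    intro k s
    have := hmix (Fin.natAdd m c) (Fin.castAdd n k) (Fin.castAdd n s) (Fin.natAdd m j)
    simp [swapCoeff, ne, (ne _ _).symm, sgn_castAdd_right] at this
    exact this
  -- what commutes with the entries of `A` commutes with those of its inverse
  have hSc : ∀ k s, blockB b c j * S k s = S k s * blockB b c j := by
    intro k s
    have h1 : blockB b c j * S k s = ∑ a, ∑ l, S k a * (blockB b c j * blockA X a l) * S l s := by
      simp only [hA]
      rw [Finset.sum_comm]
      have : ∀ l, ∑ a, S k a * (blockA X a l * blockB b c j) * S l s =
          (S * blockA X) k l * (blockB b c j * S l s) := fun l => by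
        rw [Matrix.mul_apply, Finset.sum_mul]
        exact Finset.sum_congr rfl fun a _ => by simp only [mul_assoc]
      simp only [this, hS', Matrix.one_apply, ite_mul, one_mul, zero_mul, Finset.sum_ite_eq,
        Finset.mem_univ, if_true]
    have h2 : ∀ a, ∑ l, S k a * (blockB b c j * blockA X a l) * S l s =
        S k a * blockB b c j * (blockA X * S) a s := fun a => by
      rw [Matrix.mul_apply, Finset.mul_sum]
      exact Finset.sum_congr rfl fun l _ => by simp only [mul_assoc]
    rw [h1]
    simp only [h2, hS, Matrix.one_apply, mul_ite, mul_one, mul_zero, Finset.sum_ite_eq',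
      Finset.mem_univ, if_true]
  have hΛ : ∀ k, blockB b c j * blockΛ X k e =
      (if c = e then -(t : Cq) else -1) • (blockΛ X k e * blockB b c j) +
      if c = e then qdiff t • ∑ l, (if c < l then blockΛ X k l * blockB b l j else 0) else 0 := by
    intro k
    have := hmix (Fin.natAdd m c) (Fin.castAdd n k) (Fin.natAdd m e) (Fin.natAdd m j)
    simp only [sum_fin_add_ite_lt] at this
    rw [if_neg (ne _ _).symm, add_zero, swapCoeff, if_neg (ne _ _), sgn_castAdd_right, one_smul] at this
    refine this.trans ?_
    simp only [swapCoeff, (Fin.natAdd_injective n m).eq_iff, sgn_natAdd, eig_natAdd]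
    rfl
  simp only [Matrix.mul_apply, Finset.mul_sum, ← mul_assoc, hSc]
  simp only [mul_assoc, hΛ, mul_add, Finset.sum_add_distrib, mul_smul_comm, ← Finset.smul_sum]
  congr 1
  · congr 1
    simp only [← mul_assoc, ← Finset.sum_mul]
  · split_ifs with hce
    · simp only [mul_smul_comm, ← Finset.smul_sum, Finset.mul_sum]
      congr 1
      rw [Finset.sum_comm]
      refine Finset.sum_congr rfl fun l _ => ?_
      split_ifs
      · simp only [← mul_assoc, ← Finset.sum_mul]
      · simp
    · simp

/-- The even-odd block of the inverse is `-S Λ` times the odd-odd block; the square of an entry is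
a double sum whose opposite terms cancel. -/
theorem RTT.sq_inverse_Λ (h : RTT t p X) (hs : SqZero p X) (hS : blockA X * S = 1)
    (hS' : S * blockA X = 1) (hXb : X * b = 1) (hbX : b * X = 1) (i : Fin m) (j : Fin n) :
    blockΛ b i j * blockΛ b i j = 0 := by
  have hbr : RTT t⁻¹ p b := (h.entries hs).inverse hXb hbX
  have hb : blockΛ b = -(S * blockΛ X * blockB b) := by
    have h0 : blockA X * blockΛ b + blockΛ X * blockB b = 0 := by
      ext a c
      have := congrFun (congrFun hXb (Fin.castAdd n a)) (Fin.natAdd m c)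
      rw [Matrix.mul_apply, Fin.sum_univ_add, Matrix.one_apply_ne
        (castAdd_lt_natAdd a c).ne] at this
      exact this
    rw [Matrix.mul_assoc, ← Matrix.one_mul (blockΛ b), ← hS', Matrix.mul_assoc, ← Matrix.mul_neg,
      eq_neg_of_add_eq_zero_left h0]
  rw [hb, Matrix.neg_apply, neg_mul_neg, Matrix.mul_apply, Finset.sum_mul_sum]
  have key : ∀ c e, (S * blockΛ X) i c * blockB b c j * ((S * blockΛ X) i e * blockB b e j) =
      (if c = e then -(t : Cq) else -1) •
        ((S * blockΛ X) i c * (S * blockΛ X) i e * (blockB b c j * blockB b e j)) +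
      if c = e then ∑ l, (if c < l then qdiff t • ((S * blockΛ X) i c * (S * blockΛ X) i l *
        (blockB b l j * blockB b c j)) else 0) else 0 := by
    intro c e
    rw [mul_assoc, ← mul_assoc (blockB b c j), h.blockB_inverse_mul hs hS hS' hXb hbX, add_mul,
      mul_add, smul_mul_assoc, mul_smul_comm]
    congr 1
    · simp only [mul_assoc]
    · split_ifs with hce
      · subst hce
        rw [smul_mul_assoc, mul_smul_comm, Finset.sum_mul, Finset.mul_sum, Finset.smul_sum]
        refine Finset.sum_congr rfl fun l _ => ?_
        split_ifs
        · simp only [mul_assoc]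
        · simp
      · simp
  simp only [key, Finset.sum_add_distrib, Finset.sum_ite_eq, Finset.mem_univ, if_true]
  simp only [← Finset.sum_add_distrib]
  apply sum_sum_eq_zero_of_antisymm
  · intro c
    simp [h.inverse_mul_Λ_sq hs hS hS']
  · intro c e hce
    have h1 := h.inverse_mul_Λ_comm hS hS' i hce
    have h2 : blockB b c j * blockB b e j = ((t⁻¹ : Cqˣ) : Cq) • (blockB b e j * blockB b c j) := by
      have := hbr.col _ (Fin.natAdd m j) _ (natAdd_lt_natAdd (m := m) hce)
      rw [eig_natAdd, sgn_natAdd, neg_mul_neg, mul_one] at this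
      exact this
    simp only [if_pos hce, if_neg hce.not_gt, if_neg hce.ne, if_neg hce.ne', add_zero, h1, h2]
    simp only [mul_smul_comm, smul_mul_assoc, neg_mul, smul_smul, smul_neg]
    generalize (S * blockΛ X) i c * (S * blockΛ X) i e * _ = u
    rw [qdiff]
    module

/-- The odd entries of the inverse of a quantum supermatrix have square zero. -/
theorem RTT.sqZero_inverse (h : RTT t p X) (hs : SqZero p X) (hS : blockA X * S = 1)
    (hS' : S * blockA X = 1) (hXb : X * b = 1) (hbX : b * X = 1) : SqZero p b := by
  intro i j
  refine Fin.addCases (fun i => ?_) (fun i => ?_) i <;>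
    refine Fin.addCases (fun j => ?_) (fun j => ?_) j <;>
    simp only [p_castAdd, p_natAdd] <;> intro hij
  · exact absurd hij (by decide)
  · exact h.sq_inverse_Λ hs hS hS' hXb hbX i j
  -- the odd-even block is an even-odd block for the transpose over the opposite algebra
  · have hA : blockA (X.map MulOpposite.op).transpose = ((blockA X).map MulOpposite.op).transpose :=
      rfl
    have := h.op_transpose.sq_inverse_Λ (S := (S.map MulOpposite.op).transpose) hs.op.transpose
      (by rw [hA]; exact transpose_map_op_mul hS') (by rw [hA]; exact transpose_map_op_mul hS)
      (transpose_map_op_mul hbX) (transpose_map_op_mul hXb) j i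
    exact MulOpposite.op_injective this
  · exact absurd hij (by decide)

end InverseSquares

/-! ### Quantum supermatrices with Koszul signs -/

section IsQ

variable {m n : ℕ} {T : Type} [Ring T] [Algebra Cq T]

/-- The relations of a quantum supermatrix, with Koszul signs, for a matrix over any algebra. -/
structure IsQ (t : Cqˣ) (X : Matrix (Fin (m + n)) (Fin (m + n)) T) : Prop where
  sq : ∀ i j, p i + p j = 1 → X i j * X i j = 0
  row : ∀ i j l, j < l → X i j * X i l =
    (koszul i j i l * (t ^ ((-1 : ℤ) ^ (p i + 1)) : Cqˣ)) • (X i l * X i j)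
  col : ∀ i j k, i < k → X i j * X k j =
    (koszul i j k j * (t ^ ((-1 : ℤ) ^ (p j + 1)) : Cqˣ)) • (X k j * X i j)
  comm : ∀ i j k l, i < k ∧ l < j ∨ k < i ∧ j < l →
    X i j * X k l = koszul i j k l • (X k l * X i j)
  cross : ∀ i j k l, i < k → j < l → X i j * X k l - koszul i j k l • (X k l * X i j) =
    (η j k l * (((t⁻¹ : Cqˣ) : Cq) - (t : Cq))) • (X i l * X k j)

theorem koszul_comm (i j k l : Fin (m + n)) : koszul i j k l = koszul k l i j := by
  rw [koszul, koszul, mul_comm]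

theorem koszul_mul_self (i j k l : Fin (m + n)) : koszul i j k l * koszul i j k l = 1 := by
  rw [koszul, ← mul_pow]; simp

theorem η_mul_self (j k l : Fin (m + n)) : η j k l * η j k l = 1 := by
  rw [η, ← mul_pow]; simp

theorem odd_p_add_iff {i j : Fin (m + n)} : Odd (p i + p j) ↔ p i + p j = 1 := by
  rcases p_zero_or_one i with h | h <;> rcases p_zero_or_one j with h' | h' <;> simp [h, h']

theorem IsQ.map {T' : Type} [Ring T'] [Algebra Cq T'] {t : Cqˣ}
    {X : Matrix (Fin (m + n)) (Fin (m + n)) T} (h : IsQ t X) (f : T →ₐ[Cq] T') :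
    IsQ t (X.map f) where
  sq i j hij := by simpa using congrArg f (h.sq i j hij)
  row i j l hjl := by simpa using congrArg f (h.row i j l hjl)
  col i j k hik := by simpa using congrArg f (h.col i j k hik)
  comm i j k l hh := by simpa using congrArg f (h.comm i j k l hh)
  cross i j k l hik hjl := by simpa using congrArg f (h.cross i j k l hik hjl)

theorem IsQ.of_map {T' : Type} [Ring T'] [Algebra Cq T'] {t : Cqˣ}
    {X : Matrix (Fin (m + n)) (Fin (m + n)) T} {f : T →ₐ[Cq] T'} (hf : Function.Injective f)
    (h : IsQ t (X.map f)) : IsQ t X where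
  sq i j hij := hf (by simpa using h.sq i j hij)
  row i j l hjl := hf (by simpa using h.row i j l hjl)
  col i j k hik := hf (by simpa using h.col i j k hik)
  comm i j k l hh := hf (by simpa using h.comm i j k l hh)
  cross i j k l hik hjl := hf (by simpa using h.cross i j k l hik hjl)

theorem IsQ.blockA_rtt {t : Cqˣ} {X : Matrix (Fin (m + n)) (Fin (m + n)) T} (h : IsQ t X) :
    RTT t (fun _ => 0) (blockA X) where
  row i j l hjl := by
    simpa [koszul, p_castAdd, eig, sgn, blockA] using
      h.row (Fin.castAdd n i) _ _ (castAdd_lt_castAdd hjl)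
  col i j k hik := by
    simpa [koszul, p_castAdd, eig, sgn, blockA] using
      h.col _ (Fin.castAdd n j) _ (castAdd_lt_castAdd hik)
  comm i j k l hik hlj := by
    simpa [koszul, p_castAdd, eig, sgn, blockA] using
      h.comm _ _ _ _ (Or.inl ⟨castAdd_lt_castAdd hik, castAdd_lt_castAdd hlj⟩)
  cross i j k l hik hjl := by
    have := h.cross _ _ _ _ (castAdd_lt_castAdd (n := n) hik) (castAdd_lt_castAdd (n := n) hjl)
    rw [sub_eq_iff_eq_add'] at this
    simpa [koszul, η, p_castAdd, qdiff, sgn, blockA] using this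

theorem IsQ.blockB_rtt {t : Cqˣ} {X : Matrix (Fin (m + n)) (Fin (m + n)) T} (h : IsQ t X) :
    RTT t⁻¹ (fun _ => 0) (blockB X) where
  row i j l hjl := by
    simpa [koszul, p_natAdd, eig, sgn, blockB, pow_succ] using
      h.row (Fin.natAdd m i) _ _ (natAdd_lt_natAdd hjl)
  col i j k hik := by
    simpa [koszul, p_natAdd, eig, sgn, blockB, pow_succ] using
      h.col _ (Fin.natAdd m j) _ (natAdd_lt_natAdd hik)
  comm i j k l hik hlj := by
    simpa [koszul, p_natAdd, eig, sgn, blockB, pow_succ] using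
      h.comm _ _ _ _ (Or.inl ⟨natAdd_lt_natAdd hik, natAdd_lt_natAdd hlj⟩)
  cross i j k l hik hjl := by
    have := h.cross _ _ _ _ (natAdd_lt_natAdd (m := m) hik) (natAdd_lt_natAdd (m := m) hjl)
    rw [sub_eq_iff_eq_add'] at this
    simpa [koszul, η, p_natAdd, qdiff, sgn, blockB, pow_succ] using this

/-- Signs `ε` such that the products `ε i j k l • X i j * X k l` satisfy relations without Koszul
signs. -/
structure RemovesSigns (ε : Fin (m + n) → Fin (m + n) → Fin (m + n) → Fin (m + n) → Cq) :
    Prop where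
  row : ∀ i j l, ε i j i l * koszul i j i l = (-1) ^ p i * sgn p j l * ε i l i j
  col : ∀ i j k, ε i j k j * koszul i j k j = (-1) ^ p j * sgn p i k * ε k j i j
  comm : ∀ i j k l, ε i j k l * koszul i j k l = sgn p i k * sgn p j l * ε k l i j
  cross : ∀ i j k l, ε i j k l * η j k l = sgn p j l * ε i l k j
  mul_self : ∀ i j k l, ε i j k l * ε i j k l = 1

theorem rel_iff_of_signs {φ : T →ₗ[Cq] T} (hφ : Function.Injective φ) {ε ε' c c' : Cq}
    (hε : ε * ε = 1) (h : ε * c = c' * ε') (x y : T) :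
    x = c • y ↔ ε • φ x = c' • (ε' • φ y) := by
  rw [smul_smul, ← h, mul_smul, ← map_smul φ c]
  refine ⟨fun h => by rw [h], fun h => hφ ?_⟩
  have := congrArg (ε • ·) h
  simpa only [smul_smul, hε, one_smul] using this

theorem rel_iff_of_signs₂ {φ : T →ₗ[Cq] T} (hφ : Function.Injective φ)
    {ε ε₁ ε₂ c₁ c₁' c₂ c₂' : Cq} (hε : ε * ε = 1) (h₁ : ε * c₁ = c₁' * ε₁)
    (h₂ : ε * c₂ = c₂' * ε₂) (x y z : T) :
    x - c₁ • y = c₂ • z ↔ ε • φ x = c₁' • (ε₁ • φ y) + c₂' • (ε₂ • φ z) := by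
  rw [smul_smul, smul_smul, ← h₁, ← h₂, mul_smul, mul_smul, ← map_smul φ c₁, ← map_smul φ c₂,
    ← smul_add, ← map_add, sub_eq_iff_eq_add']
  refine ⟨fun h => by rw [h], fun h => hφ ?_⟩
  have := congrArg (ε • ·) h
  simpa only [smul_smul, hε, one_smul] using this

/-- The relations with Koszul signs for `X` are equivalent to those without for `Y` when products
of entries of `Y` are, up to injective maps `φ`, products of entries of `X` with the signs `ε`. -/
theorem RemovesSigns.isQ_iff {ε : Fin (m + n) → Fin (m + n) → Fin (m + n) → Fin (m + n) → Cq}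
    (hε : RemovesSigns ε) {φ : Fin (m + n) → Fin (m + n) → Fin (m + n) → Fin (m + n) → T →ₗ[Cq] T}
    (hφ₁ : ∀ i j k l, φ k l i j = φ i j k l) (hφ₂ : ∀ i j k l, φ i l k j = φ i j k l)
    (hinj : ∀ i j k l, Function.Injective (φ i j k l)) {t : Cqˣ}
    {X Y : Matrix (Fin (m + n)) (Fin (m + n)) T}
    (hY : ∀ i j k l, Y i j * Y k l = ε i j k l • φ i j k l (X i j * X k l)) :
    IsQ t X ↔ RTT t p Y ∧ SqZero p Y := by
  have hrow : ∀ i j l, X i j * X i l =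
      (koszul i j i l * (t ^ ((-1 : ℤ) ^ (p i + 1)) : Cqˣ)) • (X i l * X i j) ↔
      Y i j * Y i l = (eig t p i * sgn p j l) • (Y i l * Y i j) := fun i j l => by
    rw [hY, hY, hφ₁ i j i l]
    refine rel_iff_of_signs (hinj _ _ _ _) (hε.mul_self _ _ _ _) ?_ _ _
    rw [← mul_assoc, hε.row, eig]
    generalize ((t ^ ((-1 : ℤ) ^ (p i + 1)) : Cqˣ) : Cq) = z
    ring
  have hcol : ∀ i j k, X i j * X k j =
      (koszul i j k j * (t ^ ((-1 : ℤ) ^ (p j + 1)) : Cqˣ)) • (X k j * X i j) ↔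
      Y i j * Y k j = (eig t p j * sgn p i k) • (Y k j * Y i j) := fun i j k => by
    rw [hY, hY, hφ₁ i j k j]
    refine rel_iff_of_signs (hinj _ _ _ _) (hε.mul_self _ _ _ _) ?_ _ _
    rw [← mul_assoc, hε.col, eig]
    generalize ((t ^ ((-1 : ℤ) ^ (p j + 1)) : Cqˣ) : Cq) = z
    ring
  have hcomm : ∀ i j k l, X i j * X k l = koszul i j k l • (X k l * X i j) ↔
      Y i j * Y k l = (sgn p i k * sgn p j l) • (Y k l * Y i j) := fun i j k l => by
    rw [hY, hY, hφ₁ i j k l]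
    exact rel_iff_of_signs (hinj _ _ _ _) (hε.mul_self _ _ _ _) (hε.comm _ _ _ _) _ _
  have hcross : ∀ i j k l, X i j * X k l - koszul i j k l • (X k l * X i j) =
      (η j k l * (((t⁻¹ : Cqˣ) : Cq) - (t : Cq))) • (X i l * X k j) ↔
      Y i j * Y k l = (sgn p i k * sgn p j l) • (Y k l * Y i j) +
        (sgn p j l * qdiff t) • (Y i l * Y k j) := fun i j k l => by
    rw [hY, hY k l, hY i l, hφ₁ i j k l, hφ₂ i j k l]
    refine rel_iff_of_signs₂ (hinj _ _ _ _) (hε.mul_self _ _ _ _) (hε.comm _ _ _ _) ?_ _ _ _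
    rw [← mul_assoc, hε.cross, qdiff]
    generalize ((t⁻¹ : Cqˣ) : Cq) - (t : Cq) = z
    ring
  have hsq : ∀ i j, X i j * X i j = 0 ↔ Y i j * Y i j = 0 := fun i j => by
    simpa using rel_iff_of_signs (hinj i j i j) (c := 0) (c' := 0) (ε' := 0)
      (hε.mul_self i j i j) (by simp) (X i j * X i j) 0 |>.trans (by rw [← hY]; simp)
  constructor
  · intro h
    exact ⟨⟨fun i j l hjl => (hrow i j l).1 (h.row i j l hjl),
      fun i j k hik => (hcol i j k).1 (h.col i j k hik),
      fun i j k l hik hlj => (hcomm i j k l).1 (h.comm i j k l (Or.inl ⟨hik, hlj⟩)),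
      fun i j k l hik hjl => (hcross i j k l).1 (h.cross i j k l hik hjl)⟩,
      fun i j hij => (hsq i j).1 (h.sq i j (odd_p_add_iff.1 hij))⟩
  · rintro ⟨h, hs⟩
    refine ⟨fun i j hij => (hsq i j).2 (hs i j (odd_p_add_iff.2 hij)),
      fun i j l hjl => (hrow i j l).2 (h.row i j l hjl),
      fun i j k hik => (hcol i j k).2 (h.col i j k hik), fun i j k l hh => (hcomm i j k l).2 ?_,
      fun i j k l hik hjl => (hcross i j k l).2 (h.cross i j k l hik hjl)⟩
    rcases hh with hh | hh
    · exact h.comm i j k l hh.1 hh.2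
    · rw [h.comm_symm k l i j hh.1 hh.2, sgn_comm p k i, sgn_comm p l j]

theorem removesSigns_right : RemovesSigns (m := m) (n := n)
    fun i j k l => (-1) ^ (p j * (p k + p l)) := by
  constructor <;> intros <;> simp only [koszul, sgn, η, ← pow_add, ← mul_pow]
  all_goals first
    | (apply neg_one_pow_congr; grind)
    | skip
  simp

theorem removesSigns_left : RemovesSigns (m := m) (n := n)
    fun i j k l => (-1) ^ (p k * (p i + p j)) := by
  constructor <;> intros <;> simp only [koszul, sgn, η, ← pow_add, ← mul_pow]
  all_goals first
    | (apply neg_one_pow_congr; grind)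
    | skip
  simp

/-- The element `σ` commutes with the even entries and anticommutes with the odd entries of `X`. -/
def Signed (σ : T) (X : Matrix (Fin (m + n)) (Fin (m + n)) T) : Prop :=
  ∀ i j, σ * X i j = (-1 : Cq) ^ (p i + p j) • (X i j * σ)

/-- The matrix `X` with its odd columns multiplied by `σ`. -/
def hatR (σ : T) (X : Matrix (Fin (m + n)) (Fin (m + n)) T) :
    Matrix (Fin (m + n)) (Fin (m + n)) T := Matrix.of fun i j => X i j * σ ^ p j

/-- The matrix `X` with its odd rows multiplied by `σ`. -/
def hatL (σ : T) (X : Matrix (Fin (m + n)) (Fin (m + n)) T) :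
    Matrix (Fin (m + n)) (Fin (m + n)) T := Matrix.of fun i j => σ ^ p i * X i j

theorem pow_mul_pow_self {σ : T} (hσ : σ * σ = 1) (a : ℕ) : σ ^ a * σ ^ a = 1 := by
  rw [← (Commute.refl σ).mul_pow, hσ, one_pow]

theorem Signed.pow {σ : T} {X : Matrix (Fin (m + n)) (Fin (m + n)) T} (h : Signed σ X) (a : ℕ)
    (i j : Fin (m + n)) : σ ^ a * X i j = (-1 : Cq) ^ (a * (p i + p j)) • (X i j * σ ^ a) := by
  induction a with
  | zero => simp
  | succ a ih =>
    rw [pow_succ, mul_assoc, h, mul_smul_comm, ← mul_assoc, ih, smul_mul_assoc, smul_smul,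
      mul_assoc, ← pow_succ, ← pow_add]
    congr 2
    ring

/-- Multiplying the odd columns by an element that implements the parity removes the Koszul signs.
-/
theorem isQ_iff_hatR {t : Cqˣ} {σ : T} {X : Matrix (Fin (m + n)) (Fin (m + n)) T}
    (hσ : σ * σ = 1) (h : Signed σ X) : IsQ t X ↔ RTT t p (hatR σ X) ∧ SqZero p (hatR σ X) := by
  refine removesSigns_right.isQ_iff
    (φ := fun i j k l => LinearMap.mulRight Cq (σ ^ p j * σ ^ p l))
    (fun i j k l => by rw [← pow_add, ← pow_add, add_comm])
    (fun i j k l => by rw [← pow_add, ← pow_add, add_comm]) (fun i j k l => ?_) fun i j k l => ?_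
  · apply Function.LeftInverse.injective (g := LinearMap.mulRight Cq (σ ^ p l * σ ^ p j))
    intro x
    simp only [LinearMap.mulRight_apply]
    rw [mul_assoc, mul_assoc (σ ^ p j), ← mul_assoc (σ ^ p l), pow_mul_pow_self hσ, one_mul,
      pow_mul_pow_self hσ, mul_one]
  · simp only [hatR, Matrix.of_apply, LinearMap.mulRight_apply]
    rw [mul_assoc, ← mul_assoc (σ ^ p j), h.pow, smul_mul_assoc, mul_smul_comm]
    simp only [mul_assoc]

theorem isQ_iff_hatL {t : Cqˣ} {σ : T} {X : Matrix (Fin (m + n)) (Fin (m + n)) T}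
    (hσ : σ * σ = 1) (h : Signed σ X) : IsQ t X ↔ RTT t p (hatL σ X) ∧ SqZero p (hatL σ X) := by
  refine removesSigns_left.isQ_iff
    (φ := fun i j k l => LinearMap.mulLeft Cq (σ ^ p i * σ ^ p k))
    (fun i j k l => by rw [← pow_add, ← pow_add, add_comm])
    (fun i j k l => rfl) (fun i j k l => ?_) fun i j k l => ?_
  · apply Function.LeftInverse.injective (g := LinearMap.mulLeft Cq (σ ^ p k * σ ^ p i))
    intro x
    simp only [LinearMap.mulLeft_apply]
    rw [← mul_assoc, mul_assoc (σ ^ p k), ← mul_assoc (σ ^ p i), pow_mul_pow_self hσ, one_mul,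
      pow_mul_pow_self hσ, one_mul]
  · simp only [hatL, Matrix.of_apply, LinearMap.mulLeft_apply]
    have h1 : X i j * σ ^ p k = (-1 : Cq) ^ (p k * (p i + p j)) • (σ ^ p k * X i j) := by
      rw [h.pow, smul_smul, ← mul_pow]; simp
    rw [mul_assoc, ← mul_assoc (X i j), h1, smul_mul_assoc, mul_smul_comm]
    simp only [mul_assoc]

theorem hatR_mul_hatL {σ : T} (hσ : σ * σ = 1) (X Y : Matrix (Fin (m + n)) (Fin (m + n)) T) :
    hatR σ X * hatL σ Y = X * Y := by
  ext i j
  simp only [Matrix.mul_apply, hatR, hatL, Matrix.of_apply]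
  refine Finset.sum_congr rfl fun k _ => ?_
  rw [mul_assoc, ← mul_assoc (σ ^ p k), pow_mul_pow_self hσ, one_mul]

/-- The entries of the product with signs removed are conjugate to those of the product. -/
theorem hatL_mul_hatR {σ : T} (X Y : Matrix (Fin (m + n)) (Fin (m + n)) T) (i j : Fin (m + n)) :
    (hatL σ X * hatR σ Y) i j = σ ^ p i * (X * Y) i j * σ ^ p j := by
  simp only [Matrix.mul_apply, hatR, hatL, Matrix.of_apply, Finset.mul_sum, Finset.sum_mul,
    mul_assoc]

theorem hatL_mul_hatR_eq_one {σ : T} (hσ : σ * σ = 1)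
    {X Y : Matrix (Fin (m + n)) (Fin (m + n)) T} (h : X * Y = 1) : hatL σ X * hatR σ Y = 1 := by
  ext i j
  rw [hatL_mul_hatR, h, Matrix.one_apply]
  split_ifs with hij
  · rw [hij, mul_one, pow_mul_pow_self hσ]
  · simp

/-- The inverse of a quantum supermatrix is one for the inverse parameter: the signs are removed
by columns for `X` and by rows for its inverse, which makes the two matrices inverse to each
other. -/
theorem IsQ.isQ_inverse {t : Cqˣ} {σ : T} {X b : Matrix (Fin (m + n)) (Fin (m + n)) T}
    {S : Matrix (Fin m) (Fin m) T} (h : IsQ t X) (hσ : σ * σ = 1) (hX : Signed σ X)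
    (hb : Signed σ b) (hS : blockA X * S = 1) (hS' : S * blockA X = 1) (hXb : X * b = 1)
    (hbX : b * X = 1) : IsQ t⁻¹ b := by
  have hr := (isQ_iff_hatR hσ hX).1 h
  have hA : blockA (hatR σ X) = blockA X := by
    ext i j; simp [hatR, blockA, p_castAdd]
  have h1 : hatR σ X * hatL σ b = 1 := by rw [hatR_mul_hatL hσ, hXb]
  have h2 : hatL σ b * hatR σ X = 1 := hatL_mul_hatR_eq_one hσ hbX
  refine (isQ_iff_hatL hσ hb).2 ⟨?_, ?_⟩
  · exact ((hr.1.entries hr.2).inverse h1 h2)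
  · exact hr.1.sqZero_inverse hr.2 (by rw [hA, hS]) (by rw [hA, hS']) h1 h2

/-- The signs in the multiplication of a superalgebra become the ordinary multiplication of the
opposite algebra when the odd elements are multiplied by this scalar, a square root of `-1`. -/
def rootSign (i j : Fin (m + n)) : Cq := if p i = p j then 1 else algebraMap ℂ Cq Complex.I

theorem I_mul_I : algebraMap ℂ Cq Complex.I * algebraMap ℂ Cq Complex.I = -1 := by
  rw [← map_mul, Complex.I_mul_I]; simp

theorem rootSign_cross (i j k l : Fin (m + n)) :
    rootSign i j * rootSign k l * koszul i j k l =
      rootSign i l * rootSign k j * koszul i l k j := by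
  have hI := I_mul_I
  simp only [rootSign, koszul]
  generalize algebraMap ℂ Cq Complex.I = I at hI
  rcases p_zero_or_one i with hi | hi <;> rcases p_zero_or_one j with hj | hj <;>
    rcases p_zero_or_one k with hk | hk <;> rcases p_zero_or_one l with hl | hl <;>
    simp [hi, hj, hk, hl, hI, pow_succ]

/-- Passing to the opposite algebra in the super sense inverts the parameter. -/
theorem IsQ.op {t : Cqˣ} {X : Matrix (Fin (m + n)) (Fin (m + n)) T} (h : IsQ t X) :
    IsQ t⁻¹ (Matrix.of fun i j => rootSign i j • MulOpposite.op (X i j)) where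
  sq i j hij := by
    simp only [Matrix.of_apply, smul_mul_smul_comm, ← MulOpposite.op_mul, h.sq i j hij,
      MulOpposite.op_zero, smul_zero]
  row i j l hjl := by
    simp only [Matrix.of_apply, smul_mul_smul_comm, ← MulOpposite.op_mul, h.row i j l hjl,
      MulOpposite.op_smul, smul_smul]
    congr 1
    have h1 := koszul_mul_self i j i l
    have h2 : ((t⁻¹ ^ ((-1 : ℤ) ^ (p i + 1)) : Cqˣ) : Cq) *
        ((t ^ ((-1 : ℤ) ^ (p i + 1)) : Cqˣ) : Cq) = 1 := by
      rw [← Units.val_mul, ← mul_zpow, inv_mul_cancel, one_zpow, Units.val_one]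
    generalize ((t⁻¹ ^ ((-1 : ℤ) ^ (p i + 1)) : Cqˣ) : Cq) = x at *
    generalize ((t ^ ((-1 : ℤ) ^ (p i + 1)) : Cqˣ) : Cq) = y at *
    generalize koszul i j i l = z at *
    linear_combination (-rootSign i j * rootSign i l) * x * y * h1 - rootSign i j * rootSign i l * h2
  col i j k hik := by
    simp only [Matrix.of_apply, smul_mul_smul_comm, ← MulOpposite.op_mul, h.col i j k hik,
      MulOpposite.op_smul, smul_smul]
    congr 1
    have h1 := koszul_mul_self i j k j
    have h2 : ((t⁻¹ ^ ((-1 : ℤ) ^ (p j + 1)) : Cqˣ) : Cq) *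
        ((t ^ ((-1 : ℤ) ^ (p j + 1)) : Cqˣ) : Cq) = 1 := by
      rw [← Units.val_mul, ← mul_zpow, inv_mul_cancel, one_zpow, Units.val_one]
    generalize ((t⁻¹ ^ ((-1 : ℤ) ^ (p j + 1)) : Cqˣ) : Cq) = x at *
    generalize ((t ^ ((-1 : ℤ) ^ (p j + 1)) : Cqˣ) : Cq) = y at *
    generalize koszul i j k j = z at *
    linear_combination (-rootSign i j * rootSign k j) * x * y * h1 - rootSign i j * rootSign k j * h2
  comm i j k l hh := by
    simp only [Matrix.of_apply, smul_mul_smul_comm, ← MulOpposite.op_mul, h.comm k l i j hh.symm,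
      MulOpposite.op_smul, smul_smul]
    rw [koszul_comm k l i j, mul_comm (rootSign i j), mul_comm]
  cross i j k l hik hjl := by
    have h1 := h.cross i j k l hik hjl
    have h2 := h.comm i l k j (Or.inl ⟨hik, hjl⟩)
    have h3 := rootSign_cross i j k l
    have h4 := koszul_mul_self i j k l
    simp only [Matrix.of_apply, smul_mul_smul_comm, ← MulOpposite.op_mul, ← MulOpposite.op_smul,
      smul_smul, ← MulOpposite.op_sub, inv_inv]
    congr 1
    rw [h2, sub_eq_iff_eq_add'] at h1
    rw [h1, smul_add, smul_smul, smul_smul, smul_smul]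
    generalize X k l * X i j = u
    generalize X k j * X i l = v
    generalize ((t⁻¹ : Cqˣ) : Cq) = x at *
    generalize (t : Cq) = y at *
    generalize koszul i j k l = z at *
    generalize hw : koszul i l k j = w at *
    match_scalars
    · linear_combination (-rootSign i j * rootSign k l) * h4
    · have h5 := η_mul_self j k l
      generalize η j k l = e at *
      have h6 := koszul_mul_self i l k j
      rw [hw] at h6
      linear_combination e * (y - x) * w * h3 + e * (y - x) * rootSign i l * rootSign k j * h6

/-- The matrix of the supertranspose. -/
def superTranspose (X : Matrix (Fin (m + n)) (Fin (m + n)) T) :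
    Matrix (Fin (m + n)) (Fin (m + n)) T :=
  Matrix.of fun i j => (-1 : Cq) ^ ((p j + 1) * p i) • X j i

theorem superTranspose_mul (X : Matrix (Fin (m + n)) (Fin (m + n)) T) (i j k l : Fin (m + n)) :
    superTranspose X i j * superTranspose X k l =
      ((-1 : Cq) ^ ((p j + 1) * p i + (p l + 1) * p k)) • (X j i * X l k) := by
  rw [superTranspose, Matrix.of_apply, Matrix.of_apply, smul_mul_smul_comm, pow_add]

theorem IsQ.superTranspose {t : Cqˣ} {X : Matrix (Fin (m + n)) (Fin (m + n)) T} (h : IsQ t X) :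
    IsQ t (superTranspose X) where
  sq i j hij := by
    rw [superTranspose_mul, h.sq j i (by rw [add_comm, hij]), smul_zero]
  row i j l hjl := by
    rw [superTranspose_mul, superTranspose_mul, h.col j i l hjl]
    generalize ((t ^ ((-1 : ℤ) ^ (p i + 1)) : Cqˣ) : Cq) = x
    rw [smul_smul, smul_smul]
    refine congrArg (· • _) ?_
    rw [mul_right_comm, ← mul_assoc]
    refine congrArg (· * x) ?_
    rw [koszul, koszul, ← pow_add, ← pow_add]
    apply neg_one_pow_congr
    rcases p_zero_or_one i with hi | hi <;> rcases p_zero_or_one j with hj | hj <;>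
    rcases p_zero_or_one l with hl | hl <;>
    simp [hi, hj, hl, Nat.even_add_one]
  col i j k hik := by
    rw [superTranspose_mul, superTranspose_mul, h.row j i k hik]
    generalize ((t ^ ((-1 : ℤ) ^ (p j + 1)) : Cqˣ) : Cq) = x
    rw [smul_smul, smul_smul]
    refine congrArg (· • _) ?_
    rw [mul_right_comm, ← mul_assoc]
    refine congrArg (· * x) ?_
    rw [koszul, koszul, ← pow_add, ← pow_add]
    apply neg_one_pow_congr
    rcases p_zero_or_one i with hi | hi <;> rcases p_zero_or_one j with hj | hj <;>
    rcases p_zero_or_one k with hk | hk <;>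
    simp [hi, hj, hk, Nat.even_add_one]
  comm i j k l hh := by
    rw [superTranspose_mul, superTranspose_mul,
      h.comm j i l k (hh.symm.imp And.symm And.symm), smul_smul, smul_smul, koszul, koszul,
      ← pow_add, ← pow_add]
    refine congrArg (· • _) (neg_one_pow_congr ?_)
    rcases p_zero_or_one i with hi | hi <;> rcases p_zero_or_one j with hj | hj <;>
    rcases p_zero_or_one k with hk | hk <;> rcases p_zero_or_one l with hl | hl <;>
    simp [hi, hj, hk, hl, Nat.even_add_one]
  cross i j k l hik hjl := by
    have h1 := h.cross j i l k hjl hik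
    rw [h.comm j k l i (Or.inl ⟨hjl, hik⟩)] at h1
    have e1 : ((-1 : Cq) ^ ((p j + 1) * p i + (p l + 1) * p k)) * koszul j i l k =
        koszul i j k l * ((-1 : Cq) ^ ((p l + 1) * p k + (p j + 1) * p i)) := by
      rw [koszul, koszul, ← pow_add, ← pow_add]
      apply neg_one_pow_congr
      grind
    have e2 : ((-1 : Cq) ^ ((p j + 1) * p i + (p l + 1) * p k)) * (η i l k * koszul j k l i) =
        η j k l * ((-1 : Cq) ^ ((p l + 1) * p i + (p j + 1) * p k)) := by
      rw [koszul, η, η, ← pow_add, ← pow_add, ← pow_add]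
      apply neg_one_pow_congr
      rcases p_zero_or_one i with hi | hi <;> rcases p_zero_or_one j with hj | hj <;>
      rcases p_zero_or_one k with hk | hk <;> rcases p_zero_or_one l with hl | hl <;>
      simp [hi, hj, hk, hl, Nat.even_add_one]
    rw [superTranspose_mul, superTranspose_mul, superTranspose_mul, smul_smul, ← e1, mul_smul,
      ← smul_sub, h1, smul_smul, smul_smul, smul_smul]
    refine congrArg (· • _) ?_
    linear_combination ((((t⁻¹ : Cqˣ) : Cq) - (t : Cq))) * e2

end IsQ

/-! ### Block matrices -/

section Blocks

variable {m n : ℕ} {T : Type} [Ring T] [Algebra Cq T]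

/-- The supermatrix with the given blocks. -/
def ofBlocks (A : Matrix (Fin m) (Fin m) T) (L : Matrix (Fin m) (Fin n) T)
    (U : Matrix (Fin n) (Fin m) T) (B : Matrix (Fin n) (Fin n) T) :
    Matrix (Fin (m + n)) (Fin (m + n)) T :=
  (Matrix.fromBlocks A L U B).submatrix finSumFinEquiv.symm finSumFinEquiv.symm

theorem blockA_ofBlocks (A : Matrix (Fin m) (Fin m) T) (L : Matrix (Fin m) (Fin n) T)
    (U : Matrix (Fin n) (Fin m) T) (B : Matrix (Fin n) (Fin n) T) :
    blockA (ofBlocks A L U B) = A := by ext i j; simp [blockA, ofBlocks]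

theorem blockΛ_ofBlocks (A : Matrix (Fin m) (Fin m) T) (L : Matrix (Fin m) (Fin n) T)
    (U : Matrix (Fin n) (Fin m) T) (B : Matrix (Fin n) (Fin n) T) :
    blockΛ (ofBlocks A L U B) = L := by ext i j; simp [blockΛ, ofBlocks]

theorem blockΥ_ofBlocks (A : Matrix (Fin m) (Fin m) T) (L : Matrix (Fin m) (Fin n) T)
    (U : Matrix (Fin n) (Fin m) T) (B : Matrix (Fin n) (Fin n) T) :
    blockΥ (ofBlocks A L U B) = U := by ext i j; simp [blockΥ, ofBlocks]

theorem blockB_ofBlocks (A : Matrix (Fin m) (Fin m) T) (L : Matrix (Fin m) (Fin n) T)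
    (U : Matrix (Fin n) (Fin m) T) (B : Matrix (Fin n) (Fin n) T) :
    blockB (ofBlocks A L U B) = B := by ext i j; simp [blockB, ofBlocks]

theorem ext_blocks {X Y : Matrix (Fin (m + n)) (Fin (m + n)) T} (hA : blockA X = blockA Y)
    (hΛ : blockΛ X = blockΛ Y) (hΥ : blockΥ X = blockΥ Y) (hB : blockB X = blockB Y) : X = Y := by
  ext i j
  refine Fin.addCases (fun i => ?_) (fun i => ?_) i <;>
    refine Fin.addCases (fun j => ?_) (fun j => ?_) j
  · exact congrFun (congrFun hA i) j
  · exact congrFun (congrFun hΛ i) j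
  · exact congrFun (congrFun hΥ i) j
  · exact congrFun (congrFun hB i) j

theorem blockA_mul (X Y : Matrix (Fin (m + n)) (Fin (m + n)) T) :
    blockA (X * Y) = blockA X * blockA Y + blockΛ X * blockΥ Y := by
  ext i j; simp [blockA, blockΛ, blockΥ, Matrix.mul_apply, Fin.sum_univ_add]

theorem blockΛ_mul (X Y : Matrix (Fin (m + n)) (Fin (m + n)) T) :
    blockΛ (X * Y) = blockA X * blockΛ Y + blockΛ X * blockB Y := by
  ext i j; simp [blockA, blockΛ, blockB, Matrix.mul_apply, Fin.sum_univ_add]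

theorem blockΥ_mul (X Y : Matrix (Fin (m + n)) (Fin (m + n)) T) :
    blockΥ (X * Y) = blockΥ X * blockA Y + blockB X * blockΥ Y := by
  ext i j; simp [blockA, blockΥ, blockB, Matrix.mul_apply, Fin.sum_univ_add]

theorem blockB_mul (X Y : Matrix (Fin (m + n)) (Fin (m + n)) T) :
    blockB (X * Y) = blockΥ X * blockΛ Y + blockB X * blockB Y := by
  ext i j; simp [blockΛ, blockΥ, blockB, Matrix.mul_apply, Fin.sum_univ_add]

theorem blockA_one : blockA (1 : Matrix (Fin (m + n)) (Fin (m + n)) T) = 1 := by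
  ext i j; simp [blockA, Matrix.one_apply]

theorem blockΛ_one : blockΛ (1 : Matrix (Fin (m + n)) (Fin (m + n)) T) = 0 := by
  ext i j; simp [blockΛ, Matrix.one_apply, (castAdd_lt_natAdd i j).ne]

theorem blockΥ_one : blockΥ (1 : Matrix (Fin (m + n)) (Fin (m + n)) T) = 0 := by
  ext i j; simp [blockΥ, Matrix.one_apply, (castAdd_lt_natAdd j i).ne']

theorem blockB_one : blockB (1 : Matrix (Fin (m + n)) (Fin (m + n)) T) = 1 := by
  ext i j; simp [blockB, Matrix.one_apply]

variable {X b : Matrix (Fin (m + n)) (Fin (m + n)) T} {S : Matrix (Fin m) (Fin m) T}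
  {SB : Matrix (Fin n) (Fin n) T}

/-- A block matrix is invertible when its lower right block and the Schur complement of the latter
are. -/
theorem exists_inverse_of_schur {K : Matrix (Fin m) (Fin m) T}
    (hB : blockB X * SB = 1) (hB' : SB * blockB X = 1)
    (hK : (blockA X - blockΛ X * SB * blockΥ X) * K = 1)
    (hK' : K * (blockA X - blockΛ X * SB * blockΥ X) = 1) :
    ∃ b, X * b = 1 ∧ b * X = 1 := by
  refine ⟨ofBlocks K (-(K * blockΛ X * SB)) (-(SB * blockΥ X * K))
    (SB + SB * blockΥ X * K * blockΛ X * SB), ext_blocks ?_ ?_ ?_ ?_, ext_blocks ?_ ?_ ?_ ?_⟩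
  all_goals
    simp only [blockA_mul, blockΛ_mul, blockΥ_mul, blockB_mul, blockA_ofBlocks, blockΛ_ofBlocks,
      blockΥ_ofBlocks, blockB_ofBlocks, blockA_one, blockΛ_one, blockΥ_one, blockB_one]
  all_goals
    generalize blockA X = A at *
    generalize blockB X = B at *
    generalize blockΛ X = L at *
    generalize blockΥ X = U at *
  · rw [← hK]
    simp only [Matrix.mul_add, Matrix.add_mul, Matrix.mul_sub, Matrix.sub_mul, Matrix.mul_neg,
      Matrix.neg_mul, Matrix.mul_assoc]
    abel
  · have : A * -(K * L * SB) + L * (SB + SB * U * K * L * SB) =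
      L * SB - ((A - L * SB * U) * K) * (L * SB) := by
      simp only [Matrix.mul_add, Matrix.add_mul, Matrix.mul_sub, Matrix.sub_mul, Matrix.mul_neg,
        Matrix.neg_mul, Matrix.mul_assoc]
      abel
    rw [this, hK]; simp
  · have : U * K + B * -(SB * U * K) = U * K - (B * SB) * (U * K) := by
      simp only [Matrix.mul_add, Matrix.add_mul, Matrix.mul_sub, Matrix.sub_mul, Matrix.mul_neg,
        Matrix.neg_mul, Matrix.mul_assoc]
      abel
    rw [this, hB]; simp
  · have : U * -(K * L * SB) + B * (SB + SB * U * K * L * SB) =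
      B * SB + (B * SB) * (U * K * L * SB) - U * K * L * SB := by
      simp only [Matrix.mul_add, Matrix.add_mul, Matrix.mul_sub, Matrix.sub_mul, Matrix.mul_neg,
        Matrix.neg_mul, Matrix.mul_assoc]
      abel
    rw [this, hB]; simp
  · rw [← hK']
    simp only [Matrix.mul_add, Matrix.add_mul, Matrix.mul_sub, Matrix.sub_mul, Matrix.mul_neg,
      Matrix.neg_mul, Matrix.mul_assoc]
    abel
  · have : K * L + -(K * L * SB) * B = K * L - K * L * (SB * B) := by
      simp only [Matrix.mul_add, Matrix.add_mul, Matrix.mul_sub, Matrix.sub_mul, Matrix.mul_neg,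
        Matrix.neg_mul, Matrix.mul_assoc]
      abel
    rw [this, hB']; simp
  · have : -(SB * U * K) * A + (SB + SB * U * K * L * SB) * U =
      SB * U - SB * U * (K * (A - L * SB * U)) := by
      simp only [Matrix.mul_add, Matrix.add_mul, Matrix.mul_sub, Matrix.sub_mul, Matrix.mul_neg,
        Matrix.neg_mul, Matrix.mul_assoc]
      abel
    rw [this, hK']; simp
  · have : -(SB * U * K) * L + (SB + SB * U * K * L * SB) * B =
      SB * B + SB * U * K * L * (SB * B) - SB * U * K * L := by
      simp only [Matrix.mul_add, Matrix.add_mul, Matrix.mul_sub, Matrix.sub_mul, Matrix.mul_neg,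
        Matrix.neg_mul, Matrix.mul_assoc]
      abel
    rw [this, hB']; simp

/-- The odd-odd block of the inverse is the inverse of the Schur complement. -/
theorem blockB_inverse_eq (hS' : S * blockA X = 1) (hXb : X * b = 1) :
    (blockB X - blockΥ X * S * blockΛ X) * blockB b = 1 := by
  have h1 := congrArg blockB hXb
  have h2 := congrArg blockΛ hXb
  rw [blockB_mul, blockB_one] at h1
  rw [blockΛ_mul, blockΛ_one] at h2
  have h3 : S * (blockA X * blockΛ b + blockΛ X * blockB b) = 0 := by rw [h2]; simp
  rw [Matrix.mul_add, ← Matrix.mul_assoc, hS', Matrix.one_mul] at h3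
  rw [eq_neg_of_add_eq_zero_left h3] at h1
  rw [← h1]
  simp only [Matrix.mul_add, Matrix.add_mul, Matrix.mul_sub, Matrix.sub_mul, Matrix.mul_neg,
    Matrix.neg_mul, Matrix.mul_assoc]
  abel

theorem blockB_inverse_eq' (hS : blockA X * S = 1) (hbX : b * X = 1) :
    blockB b * (blockB X - blockΥ X * S * blockΛ X) = 1 := by
  have h1 := congrArg blockB hbX
  have h2 := congrArg blockΥ hbX
  rw [blockB_mul, blockB_one] at h1
  rw [blockΥ_mul, blockΥ_one] at h2
  have h3 : (blockΥ b * blockA X + blockB b * blockΥ X) * S = 0 := by rw [h2]; simp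
  rw [Matrix.add_mul, Matrix.mul_assoc, hS, Matrix.mul_one] at h3
  rw [eq_neg_of_add_eq_zero_left h3] at h1
  rw [← h1]
  simp only [Matrix.mul_add, Matrix.add_mul, Matrix.mul_sub, Matrix.sub_mul, Matrix.mul_neg,
    Matrix.neg_mul, Matrix.mul_assoc]
  abel

theorem blockA_inverse_eq (hB' : SB * blockB X = 1) (hXb : X * b = 1) :
    (blockA X - blockΛ X * SB * blockΥ X) * blockA b = 1 := by
  have h1 := congrArg blockA hXb
  have h2 := congrArg blockΥ hXb
  rw [blockA_mul, blockA_one] at h1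
  rw [blockΥ_mul, blockΥ_one] at h2
  have h3 : SB * (blockΥ X * blockA b + blockB X * blockΥ b) = 0 := by rw [h2]; simp
  rw [Matrix.mul_add, ← Matrix.mul_assoc SB (blockB X), hB', Matrix.one_mul] at h3
  rw [eq_neg_of_add_eq_zero_right h3] at h1
  rw [← h1]
  simp only [Matrix.mul_add, Matrix.add_mul, Matrix.mul_sub, Matrix.sub_mul, Matrix.mul_neg,
    Matrix.neg_mul, Matrix.mul_assoc]
  abel

theorem blockA_inverse_eq' (hB : blockB X * SB = 1) (hbX : b * X = 1) :
    blockA b * (blockA X - blockΛ X * SB * blockΥ X) = 1 := by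
  have h1 := congrArg blockA hbX
  have h2 := congrArg blockΛ hbX
  rw [blockA_mul, blockA_one] at h1
  rw [blockΛ_mul, blockΛ_one] at h2
  have h3 : (blockA b * blockΛ X + blockΛ b * blockB X) * SB = 0 := by rw [h2]; simp
  rw [Matrix.add_mul, Matrix.mul_assoc (blockΛ b), hB, Matrix.mul_one] at h3
  rw [eq_neg_of_add_eq_zero_right h3] at h1
  rw [← h1]
  simp only [Matrix.mul_add, Matrix.add_mul, Matrix.mul_sub, Matrix.sub_mul, Matrix.mul_neg,
    Matrix.neg_mul, Matrix.mul_assoc]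
  abel

/-- The blocks of the inverse supermatrix. -/
theorem inverse_blocks (hS : blockA X * S = 1) (hS' : S * blockA X = 1) (hXb : X * b = 1)
    (hbX : b * X = 1) :
    blockA b = S + S * (blockΛ X * blockB b * blockΥ X) * S ∧
      blockΛ b = -(S * blockΛ X * blockB b) ∧ blockΥ b = -(blockB b * blockΥ X * S) := by
  have h2 := congrArg blockΛ hXb
  rw [blockΛ_mul, blockΛ_one] at h2
  have h3 : S * (blockA X * blockΛ b + blockΛ X * blockB b) = 0 := by rw [h2]; simp
  rw [Matrix.mul_add, ← Matrix.mul_assoc, hS', Matrix.one_mul] at h3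
  have hΛ := eq_neg_of_add_eq_zero_left h3
  have h4 := congrArg blockΥ hbX
  rw [blockΥ_mul, blockΥ_one] at h4
  have h5 : (blockΥ b * blockA X + blockB b * blockΥ X) * S = 0 := by rw [h4]; simp
  rw [Matrix.add_mul, Matrix.mul_assoc, hS, Matrix.mul_one] at h5
  have hΥ := eq_neg_of_add_eq_zero_left h5
  have h6 := congrArg blockA hXb
  rw [blockA_mul, blockA_one, hΥ] at h6
  have h7 : S * (blockA X * blockA b + blockΛ X * -(blockB b * blockΥ X * S)) = S := by
    rw [h6, Matrix.mul_one]
  refine ⟨?_, by rw [hΛ, Matrix.mul_assoc], hΥ⟩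
  rw [Matrix.mul_add, ← Matrix.mul_assoc, hS', Matrix.one_mul] at h7
  rw [eq_sub_of_add_eq h7]
  simp only [Matrix.mul_add, Matrix.add_mul, Matrix.mul_sub, Matrix.sub_mul, Matrix.mul_neg,
    Matrix.neg_mul, Matrix.mul_assoc]
  abel

theorem matrix_pow_mem {k : ℕ} {J : Submodule Cq T} {M : Matrix (Fin k) (Fin k) T}
    (h : ∀ i j, M i j ∈ J) (r : ℕ) (i j : Fin k) : (M ^ r) i j ∈ J ^ r := by
  induction r generalizing i j with
  | zero =>
    rw [pow_zero, pow_zero, Matrix.one_apply]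
    split_ifs
    · exact Submodule.one_le.1 le_rfl
    · exact Submodule.zero_mem _
  | succ r ih =>
    rw [pow_succ, pow_succ, Matrix.mul_apply]
    exact Submodule.sum_mem _ fun l _ => Submodule.mul_mem_mul (ih _ _) (h _ _)

theorem matrix_isNilpotent {k : ℕ} {J : Submodule Cq T} {M : Matrix (Fin k) (Fin k) T}
    (h : ∀ i j, M i j ∈ J) {r : ℕ} (hr : J ^ r = ⊥) : IsNilpotent M :=
  ⟨r, by ext i j; simpa [hr] using matrix_pow_mem h r i j⟩

theorem isNilpotent_of_map {T' : Type} [Ring T'] [Algebra Cq T'] {k : ℕ} {f : T →ₐ[Cq] T'}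
    (hf : Function.Injective f) {M : Matrix (Fin k) (Fin k) T} (h : IsNilpotent (M.map f)) :
    IsNilpotent M := by
  obtain ⟨r, hr⟩ := h
  refine ⟨r, ?_⟩
  have : (f.mapMatrix M) ^ r = 0 := hr
  rw [← map_pow] at this
  ext i j
  exact hf (by simpa using congrFun (congrFun this i) j)

theorem exists_inverse_of_isUnit {R : Type} [Ring R] {x : R} (h : IsUnit x) :
    ∃ y, x * y = 1 ∧ y * x = 1 := by
  obtain ⟨u, rfl⟩ := h
  exact ⟨↑u⁻¹, u.mul_inv, u.inv_mul⟩

theorem inverse_unique {R : Type} [Ring R] {x y z : R} (h : y * x = 1) (h' : x * z = 1) :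
    y = z := left_inv_eq_right_inv h h'

end Blocks

section EvenUnits

variable {T : Type} [Ring T] [Algebra Cq T] {N : ℕ}

theorem RTT.even_inverse {t : Cqˣ} {X Y : Matrix (Fin N) (Fin N) T} (hX : RTT t (fun _ => 0) X)
    (hXY : X * Y = 1) (hYX : Y * X = 1) : RTT t⁻¹ (fun _ => 0) Y :=
  (hX.entries (sqZero_even X)).inverse hXY hYX

theorem RTT.isUnit_qdet {t : Cqˣ} {X Y : Matrix (Fin N) (Fin N) T} (hX : RTT t (fun _ => 0) X)
    (hXY : X * Y = 1) (hYX : Y * X = 1) : IsUnit (qdet t X) :=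
  ⟨⟨qdet t X, qdet t⁻¹ Y, hX.qdet_mul_qdet_of_mul_eq_one hXY hYX,
    hX.qdet_inv_mul_qdet_of_mul_eq_one hXY hYX⟩, rfl⟩

theorem RTT.qantipode_eq {t : Cqˣ} {X Y : Matrix (Fin N) (Fin N) T} (hX : RTT t (fun _ => 0) X)
    (hXY : X * Y = 1) (hYX : Y * X = 1) : qantipode t X = Y :=
  inverse_unique (hX.qantipode_mul (hX.isUnit_qdet hXY hYX)) hXY

end EvenUnits

/-! ### Points of the general linear supergroup -/

section Points

variable {m n : ℕ} {R : Type} [Ring R] [Algebra Cq R]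

/-- A quantum supermatrix over a superalgebra with parity automorphism `s`, homogeneous and such
that the quantum determinants of its diagonal blocks are invertible. -/
structure IsPoint (t : Cqˣ) (s : R →ₐ[Cq] R) (X : Matrix (Fin (m + n)) (Fin (m + n)) R) :
    Prop where
  isQ : IsQ t X
  parity : ∀ i j, s (X i j) = (-1 : Cq) ^ (p i + p j) • X i j
  unitA : IsUnit (qdet t (blockA X))
  unitB : IsUnit (qdet t⁻¹ (blockB X))

/-- The left regular representation. -/
abbrev lreg (R : Type) [Ring R] [Algebra Cq R] : R →ₐ[Cq] Module.End Cq R := Algebra.lmul Cq R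

theorem lreg_injective : Function.Injective (lreg R) := Algebra.lmul_injective

/-- The parity automorphism as a linear endomorphism. -/
abbrev parityEnd (s : R →ₐ[Cq] R) : Module.End Cq R := s.toLinearMap

theorem parityEnd_mul_self {s : R →ₐ[Cq] R} (hs : ∀ x, s (s x) = x) :
    parityEnd s * parityEnd s = 1 := LinearMap.ext hs

theorem parityEnd_mul_lreg (s : R →ₐ[Cq] R) (x : R) :
    parityEnd s * lreg R x = lreg R (s x) * parityEnd s :=
  LinearMap.ext fun y => by simp

theorem signed_lreg {s : R →ₐ[Cq] R} {X : Matrix (Fin (m + n)) (Fin (m + n)) R}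
    (h : ∀ i j, s (X i j) = (-1 : Cq) ^ (p i + p j) • X i j) :
    Signed (parityEnd s) (X.map (lreg R)) := fun i j => by
  rw [Matrix.map_apply, parityEnd_mul_lreg, h, map_smul, smul_mul_assoc]

variable {t : Cqˣ} {s : R →ₐ[Cq] R} {X b : Matrix (Fin (m + n)) (Fin (m + n)) R}

/-- `X` with the Koszul signs removed, as a matrix of operators. -/
def opHat (s : R →ₐ[Cq] R) (X : Matrix (Fin (m + n)) (Fin (m + n)) R) :
    Matrix (Fin (m + n)) (Fin (m + n)) (Module.End Cq R) := hatR (parityEnd s) (X.map (lreg R))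

theorem opHat_apply (i j : Fin (m + n)) :
    opHat s X i j = lreg R (X i j) * parityEnd s ^ p j := rfl

namespace IsPoint

theorem opHat_rtt (h : IsPoint t s X) (hs : ∀ x, s (s x) = x) :
    RTT t p (opHat s X) ∧ SqZero p (opHat s X) :=
  (isQ_iff_hatR (parityEnd_mul_self hs) (signed_lreg h.parity)).1 (h.isQ.map (lreg R))

theorem mul_SA (h : IsPoint t s X) : blockA X * qantipode t (blockA X) = 1 :=
  h.isQ.blockA_rtt.mul_qantipode h.unitA

theorem SA_mul (h : IsPoint t s X) : qantipode t (blockA X) * blockA X = 1 :=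
  h.isQ.blockA_rtt.qantipode_mul h.unitA

theorem mul_SB (h : IsPoint t s X) : blockB X * qantipode t⁻¹ (blockB X) = 1 :=
  h.isQ.blockB_rtt.mul_qantipode h.unitB

theorem SB_mul (h : IsPoint t s X) : qantipode t⁻¹ (blockB X) * blockB X = 1 :=
  h.isQ.blockB_rtt.qantipode_mul h.unitB

theorem parity_SBΥ (h : IsPoint t s X) (i : Fin n) (j : Fin m) :
    s ((qantipode t⁻¹ (blockB X) * blockΥ X) i j) =
      -(qantipode t⁻¹ (blockB X) * blockΥ X) i j := by
  have h1 : (qantipode t⁻¹ (blockB X)).map s = qantipode t⁻¹ (blockB X) :=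
    qantipode_fixed s _ _ (by ext i j; simp [blockB, h.parity, p_natAdd])
  have h2 : (blockΥ X).map s = -blockΥ X := by
    ext i j; simp [blockΥ, h.parity, p_natAdd, p_castAdd]
  rw [← Matrix.map_apply (f := s), Matrix.map_mul, h1, h2, Matrix.mul_neg, Matrix.neg_apply]

/-- The odd entries of `X`, multiplied by the entries of the inverses of the diagonal blocks, lie
in a nilpotent space of operators. -/
theorem exists_nilpotent (h : IsPoint t s X) (hs : ∀ x, s (s x) = x) :
    ∃ (J : Submodule Cq (Module.End Cq R)) (r : ℕ), J ^ r = ⊥ ∧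
      (∀ i j, lreg R ((qantipode t (blockA X) * blockΛ X) i j) * parityEnd s ∈ J) ∧
      (∀ i j, lreg R ((qantipode t⁻¹ (blockB X) * blockΥ X) i j) * parityEnd s ∈ J) ∧
      ∀ i j k l, lreg R ((qantipode t (blockA X) * blockΛ X) i j) *
        lreg R ((qantipode t⁻¹ (blockB X) * blockΥ X) k l) ∈ J := by
  have hσ := parityEnd_mul_self hs
  obtain ⟨h1, h2⟩ := h.opHat_rtt hs
  set S := qantipode t (blockA X) with hSdef
  set SB := qantipode t⁻¹ (blockB X) with hSBdef
  have hA : blockA (opHat s X) = (blockA X).map (lreg R) := by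
    ext i j : 2; simp [blockA, opHat_apply, p_castAdd]
  have hB : blockB (opHat s X) = Matrix.of fun i j => lreg R (blockB X i j) * parityEnd s := by
    ext i j : 2; simp [blockB, opHat_apply, p_natAdd]
  have hAS : blockA (opHat s X) * S.map (lreg R) = 1 := by
    rw [hA, ← Matrix.map_mul, h.mul_SA]; exact map_one (lreg R).mapMatrix
  have hSA : S.map (lreg R) * blockA (opHat s X) = 1 := by
    rw [hA, ← Matrix.map_mul, h.SA_mul]; exact map_one (lreg R).mapMatrix
  -- removing the signs multiplies the odd-odd block by the parity operator on the right, hence its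
  -- inverse on the left
  set SB' : Matrix (Fin n) (Fin n) (Module.End Cq R) :=
    Matrix.of fun i j => parityEnd s * lreg R (SB i j) with hSB'
  have hBS : blockB (opHat s X) * SB' = 1 := by
    rw [hB, hSB', ← map_one ((lreg R).mapMatrix (m := Fin n)), ← h.mul_SB]
    refine Matrix.ext fun i j => ?_
    simp only [Matrix.mul_apply, Matrix.of_apply, AlgHom.mapMatrix_apply, Matrix.map_apply,
      map_sum, map_mul]
    refine Finset.sum_congr rfl fun k _ => ?_
    rw [mul_assoc, ← mul_assoc (parityEnd s), hσ, one_mul]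
  have hSB2 : SB' * blockB (opHat s X) = 1 := by
    have h3 : SB.map (lreg R) * (blockB X).map (lreg R) = 1 := by
      rw [← Matrix.map_mul, h.SB_mul]; exact map_one (lreg R).mapMatrix
    refine Matrix.ext fun i j => ?_
    have h4 := congrFun (congrFun h3 i) j
    rw [Matrix.mul_apply] at h4 ⊢
    simp only [hB, hSB', Matrix.of_apply, Matrix.map_apply] at h4 ⊢
    calc ∑ k, parityEnd s * lreg R (SB i k) * (lreg R (blockB X k j) * parityEnd s)
        = parityEnd s * (∑ k, lreg R (SB i k) * lreg R (blockB X k j)) * parityEnd s := by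
          simp only [Finset.mul_sum, Finset.sum_mul, mul_assoc]
      _ = (1 : Matrix (Fin n) (Fin n) (Module.End Cq R)) i j := by
          rw [h4, Matrix.one_apply]
          split_ifs <;> simp [hσ]
  obtain ⟨G, J, r, hG, hGS, hGSB, hodd, hGJ, hJG, hr⟩ :=
    exists_nilpotent_ideal h1 h2 hAS hSA hBS hSB2
  have hΛ : ∀ i j, lreg R ((S * blockΛ X) i j) * parityEnd s ∈ J := fun i j => by
    rw [Matrix.mul_apply, map_sum, Finset.sum_mul]
    refine Submodule.sum_mem _ fun k _ => ?_
    rw [map_mul, mul_assoc]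
    refine hGJ _ (hGS i k) _ ?_
    have := hodd (Fin.castAdd n k) (Fin.natAdd m j) (by rw [p_castAdd, p_natAdd]; decide)
    rwa [opHat_apply, p_natAdd, pow_one] at this
  have hΥ : ∀ i j, parityEnd s * lreg R ((SB * blockΥ X) i j) ∈ J := fun i j => by
    rw [Matrix.mul_apply, map_sum, Finset.mul_sum]
    refine Submodule.sum_mem _ fun k _ => ?_
    rw [map_mul, ← mul_assoc]
    refine hGJ _ (hGSB i k) _ ?_
    have := hodd (Fin.natAdd m k) (Fin.castAdd n j) (by rw [p_castAdd, p_natAdd]; decide)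
    rwa [opHat_apply, p_castAdd, pow_zero, mul_one] at this
  have hΥG : ∀ i j, parityEnd s * lreg R ((SB * blockΥ X) i j) ∈ G := fun i j => by
    rw [Matrix.mul_apply, map_sum, Finset.mul_sum]
    refine Subalgebra.sum_mem _ fun k _ => ?_
    rw [map_mul, ← mul_assoc]
    refine mul_mem (hGSB i k) ?_
    have := hG (Fin.natAdd m k) (Fin.castAdd n j)
    rwa [opHat_apply, p_castAdd, pow_zero, mul_one] at this
  refine ⟨J, r, hr, hΛ, fun i j => ?_, fun i j k l => ?_⟩
  · have h3 := hΥ i j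
    have h4 : lreg R ((SB * blockΥ X) i j) * parityEnd s =
        -(parityEnd s * lreg R ((SB * blockΥ X) i j)) := by
      rw [parityEnd_mul_lreg, h.parity_SBΥ]
      exact LinearMap.ext fun y => by simp; rfl
    rw [h4]
    exact J.neg_mem h3
  · have h3 := hJG _ (hΥG k l) _ (hΛ i j)
    rwa [mul_assoc, ← mul_assoc (parityEnd s), hσ, one_mul] at h3

/-- The Schur complement of the odd-odd block is `A (1 - N)` with a nilpotent matrix `N`. -/
theorem exists_inverse (h : IsPoint t s X) (hs : ∀ x, s (s x) = x) :
    ∃ b, X * b = 1 ∧ b * X = 1 := by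
  obtain ⟨J, r, hr, -, -, hJ⟩ := h.exists_nilpotent hs
  set N := qantipode t (blockA X) * blockΛ X * (qantipode t⁻¹ (blockB X) * blockΥ X) with hN
  have hnil : IsNilpotent N := isNilpotent_of_map (lreg_injective (R := R))
    (matrix_isNilpotent (J := J) (fun i j => by
      rw [Matrix.map_apply, hN, Matrix.mul_apply, map_sum]
      exact Submodule.sum_mem _ fun k _ => by rw [map_mul]; exact hJ _ _ _ _) hr)
  obtain ⟨M, hM, hM'⟩ := exists_inverse_of_isUnit hnil.isUnit_one_sub
  have hfac : blockA X - blockΛ X * qantipode t⁻¹ (blockB X) * blockΥ X =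
      blockA X * (1 - N) := by
    rw [Matrix.mul_sub, hN, Matrix.mul_one, Matrix.mul_assoc (qantipode t (blockA X)),
      ← Matrix.mul_assoc (blockA X), h.mul_SA, Matrix.one_mul, Matrix.mul_assoc]
  refine exists_inverse_of_schur (K := M * qantipode t (blockA X)) h.mul_SB h.SB_mul ?_ ?_
  · rw [hfac, Matrix.mul_assoc, ← Matrix.mul_assoc _ M, hM, Matrix.one_mul, h.mul_SA]
  · rw [hfac, Matrix.mul_assoc, ← Matrix.mul_assoc _ (blockA X), h.SA_mul, Matrix.one_mul, hM']

/-- The inverse supermatrix. -/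
def inv (h : IsPoint t s X) (hs : ∀ x, s (s x) = x) : Matrix (Fin (m + n)) (Fin (m + n)) R :=
  (h.exists_inverse hs).choose

theorem mul_inv (h : IsPoint t s X) (hs : ∀ x, s (s x) = x) : X * h.inv hs = 1 :=
  (h.exists_inverse hs).choose_spec.1

theorem inv_mul (h : IsPoint t s X) (hs : ∀ x, s (s x) = x) : h.inv hs * X = 1 :=
  (h.exists_inverse hs).choose_spec.2

theorem inverse_parity (h : IsPoint t s X) (hs : ∀ x, s (s x) = x) (hXb : X * b = 1)
    (hbX : b * X = 1) (i j : Fin (m + n)) : s (b i j) = (-1 : Cq) ^ (p i + p j) • b i j := by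
  -- conjugating `b` by the parity gives an inverse of `X` again
  have hb : (Matrix.of fun i j => (-1 : Cq) ^ (p i + p j) • s (b i j)) = b := by
    refine (inverse_unique (x := X) hbX (Matrix.ext fun i j => ?_)).symm
    have h1 := congrArg s (congrFun (congrFun hXb i) j)
    rw [Matrix.mul_apply, map_sum] at h1
    simp only [Matrix.mul_apply, Matrix.of_apply, mul_smul_comm]
    have h2 : ∀ k, (-1 : Cq) ^ (p k + p j) • (X i k * s (b k j)) =
        (-1 : Cq) ^ (p i + p j) • s (X i k * b k j) := fun k => by
      rw [map_mul, h.parity, smul_mul_assoc, smul_smul]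
      congr 1
      rw [← pow_add]
      exact neg_one_pow_congr (by grind)
    rw [Finset.sum_congr rfl fun k _ => h2 k, ← Finset.smul_sum, h1, Matrix.one_apply]
    split_ifs with hij
    · rw [map_one, hij, ← two_mul, pow_mul]; simp
    · simp
  conv_rhs => rw [← hb]
  rw [Matrix.of_apply, smul_smul, ← mul_pow]
  simp

theorem isQ_inverse (h : IsPoint t s X) (hs : ∀ x, s (s x) = x) (hXb : X * b = 1)
    (hbX : b * X = 1) : IsQ t⁻¹ b := by
  have hA : blockA (X.map (lreg R)) = (blockA X).map (lreg R) := rfl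
  have hm : ∀ {k : ℕ} {Y Z : Matrix (Fin k) (Fin k) R}, Y * Z = 1 →
      Y.map (lreg R) * Z.map (lreg R) = 1 := fun hYZ => by
    rw [← Matrix.map_mul, hYZ]; exact map_one (lreg R).mapMatrix
  exact IsQ.of_map (lreg_injective (R := R)) ((h.isQ.map (lreg R)).isQ_inverse
    (S := (qantipode t (blockA X)).map (lreg R)) (parityEnd_mul_self hs)
    (signed_lreg h.parity) (signed_lreg (h.inverse_parity hs hXb hbX))
    (hA ▸ hm h.mul_SA) (hA ▸ hm h.SA_mul) (hm hXb) (hm hbX))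

theorem blockH_mul (h : IsPoint t s X) (hXb : X * b = 1) : blockH t X * blockB b = 1 :=
  blockB_inverse_eq h.SA_mul hXb

theorem mul_blockH (h : IsPoint t s X) (hbX : b * X = 1) : blockB b * blockH t X = 1 :=
  blockB_inverse_eq' h.mul_SA hbX

theorem blockB_inverse_rtt (h : IsPoint t s X) (hs : ∀ x, s (s x) = x) (hXb : X * b = 1)
    (hbX : b * X = 1) : RTT t (fun _ => 0) (blockB b) := by
  simpa using (h.isQ_inverse hs hXb hbX).blockB_rtt

/-- The Schur complement is the inverse of the odd-odd block of a quantum supermatrix. -/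
theorem blockH_rtt (h : IsPoint t s X) (hs : ∀ x, s (s x) = x) :
    RTT t⁻¹ (fun _ => 0) (blockH t X) :=
  (h.blockB_inverse_rtt hs (h.mul_inv hs) (h.inv_mul hs)).even_inverse
    (h.mul_blockH (h.inv_mul hs)) (h.blockH_mul (h.mul_inv hs))

theorem qantipode_blockH (h : IsPoint t s X) (hs : ∀ x, s (s x) = x) (hXb : X * b = 1)
    (hbX : b * X = 1) : qantipode t⁻¹ (blockH t X) = blockB b :=
  (h.blockH_rtt hs).qantipode_eq (h.blockH_mul hXb) (h.mul_blockH hbX)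

/-- The Berezinian as a product of two quantum determinants of blocks of `X` and of its inverse.
-/
theorem berezinian_eq (h : IsPoint t s X) (hs : ∀ x, s (s x) = x) (hXb : X * b = 1)
    (hbX : b * X = 1) : berezinian t X = qdet t (blockA X) * qdet t (blockB b) := by
  rw [berezinian, h.qantipode_blockH hs hXb hbX]

/-- The inverse supermatrix is a point with the inverse parameter. -/
theorem inverse (h : IsPoint t s X) (hs : ∀ x, s (s x) = x) (hXb : X * b = 1)
    (hbX : b * X = 1) : IsPoint t⁻¹ s b where
  isQ := h.isQ_inverse hs hXb hbX
  parity := h.inverse_parity hs hXb hbX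
  unitA := (h.isQ_inverse hs hXb hbX).blockA_rtt.isUnit_qdet (blockA_inverse_eq' h.mul_SB hbX)
    (blockA_inverse_eq h.SB_mul hXb)
  unitB := (h.isQ_inverse hs hXb hbX).blockB_rtt.isUnit_qdet (h.mul_blockH hbX) (h.blockH_mul hXb)

/-- Transport along a morphism of superalgebras. -/
theorem map {R' : Type} [Ring R'] [Algebra Cq R'] {s' : R' →ₐ[Cq] R'} (h : IsPoint t s X)
    (f : R →ₐ[Cq] R') (hf : ∀ i j, s' (f (X i j)) = f (s (X i j))) : IsPoint t s' (X.map f) where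
  isQ := h.isQ.map f
  parity i j := by rw [Matrix.map_apply, hf, h.parity, map_smul]
  unitA := by
    rw [show blockA (X.map f) = (blockA X).map f from rfl, qdet_map]; exact h.unitA.map f
  unitB := by
    rw [show blockB (X.map f) = (blockB X).map f from rfl, qdet_map]; exact h.unitB.map f

/-- In the opposite algebra, in the super sense, the parameter is inverted. -/
theorem op {s' : Rᵐᵒᵖ →ₐ[Cq] Rᵐᵒᵖ} (h : IsPoint t s X)
    (hs' : ∀ x, s' (MulOpposite.op x) = MulOpposite.op (s x)) :
    IsPoint t⁻¹ s' (Matrix.of fun i j => rootSign i j • MulOpposite.op (X i j)) where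
  isQ := h.isQ.op
  parity i j := by
    rw [Matrix.of_apply, map_smul, hs', h.parity, MulOpposite.op_smul, smul_comm]
  unitA := by
    have hA : blockA (Matrix.of fun i j => rootSign i j • MulOpposite.op (X i j)) =
        (blockA X).map MulOpposite.op := by
      ext i j : 2; simp [blockA, rootSign, p_castAdd]
    rw [hA, ← MulOpposite.op_unop (qdet _ _), h.isQ.blockA_rtt.unop_qdet_op]
    exact h.unitA.op
  unitB := by
    have hB : blockB (Matrix.of fun i j => rootSign i j • MulOpposite.op (X i j)) =
        (blockB X).map MulOpposite.op := by
      ext i j : 2; simp [blockB, rootSign, p_natAdd]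
    rw [hB, ← MulOpposite.op_unop (qdet _ _), h.isQ.blockB_rtt.unop_qdet_op]
    exact h.unitB.op

/-- The supertranspose keeps the parameter; transposing the blocks does not change their quantum
determinants. -/
theorem superTranspose (h : IsPoint t s X) : IsPoint t s (superTranspose X) where
  isQ := h.isQ.superTranspose
  parity i j := by
    rw [QuantumSuper.superTranspose, Matrix.of_apply, map_smul, h.parity, smul_comm, add_comm (p i)]
  unitA := by
    have hA : blockA (QuantumSuper.superTranspose X) = (blockA X).transpose := by
      ext i j; simp [blockA, QuantumSuper.superTranspose, p_castAdd]
    rw [hA, h.isQ.blockA_rtt.qdet_transpose]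
    exact h.unitA
  unitB := by
    have hB : blockB (QuantumSuper.superTranspose X) = (blockB X).transpose := by
      ext i j; simp [blockB, QuantumSuper.superTranspose, p_natAdd]
    rw [hB, h.isQ.blockB_rtt.qdet_transpose]
    exact h.unitB

end IsPoint

end Points

/-! ### The universal properties -/

section Naturality

variable {A B : Type} [Ring A] [Algebra Cq A] [Ring B] [Algebra Cq B]

theorem map_ringInverse (f : A →ₐ[Cq] B) {x : A} (hx : IsUnit x) :
    f (Ring.inverse x) = Ring.inverse (f x) := by
  obtain ⟨u, rfl⟩ := hx
  rw [Ring.inverse_unit, show f (u : A) = (Units.map (f : A →* B) u : B) from rfl,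
    Ring.inverse_unit]
  rfl

theorem qantipode_map (f : A →ₐ[Cq] B) (t : Cqˣ) :
    ∀ {k : ℕ} (X : Matrix (Fin k) (Fin k) A), IsUnit (qdet t X) →
      qantipode t (X.map f) = (qantipode t X).map f
  | 0, X, _ => rfl
  | k + 1, X, h => by
    ext i j
    simp only [qantipode, Matrix.map_apply, Matrix.of_apply, map_smul, map_mul,
      map_ringInverse f h, ← qdet_map]
    rfl

variable {m n : ℕ} {t : Cqˣ} {s : A →ₐ[Cq] A} {X : Matrix (Fin (m + n)) (Fin (m + n)) A}

theorem IsPoint.blockH_map (h : IsPoint t s X) (f : A →ₐ[Cq] B) :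
    blockH t (X.map f) = (blockH t X).map f := by
  rw [blockH, blockH, show blockA (X.map f) = (blockA X).map f from rfl, qantipode_map f t _ h.unitA,
    Matrix.map_sub _ (map_sub f), Matrix.map_mul, Matrix.map_mul]
  rfl

theorem IsPoint.berezinian_map (h : IsPoint t s X) (hs : ∀ x, s (s x) = x) (f : A →ₐ[Cq] B) :
    berezinian t (X.map f) = f (berezinian t X) := by
  rw [berezinian, berezinian, h.blockH_map, qantipode_map f, qdet_map,
    show blockA (X.map f) = (blockA X).map f from rfl, qdet_map, map_mul]
  exact (h.blockH_rtt hs).isUnit_qdet (h.blockH_mul (h.mul_inv hs)) (h.mul_blockH (h.inv_mul hs))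

/-- A subalgebra that contains the inverses of all its elements that are invertible. -/
def InverseClosed (U : Subalgebra Cq A) : Prop := ∀ x ∈ U, ∀ y, x * y = 1 → y * x = 1 → y ∈ U

/-- The matrix entries generate the algebra once inverses are adjoined. -/
def Generates (X : Matrix (Fin (m + n)) (Fin (m + n)) A) : Prop :=
  ∀ U : Subalgebra Cq A, (∀ i j, X i j ∈ U) → InverseClosed U → ∀ x, x ∈ U

theorem Generates.algHom_ext (hX : Generates X) {f g : A →ₐ[Cq] B}
    (h : ∀ i j, f (X i j) = g (X i j)) : f = g :=
  AlgHom.ext (hX (AlgHom.equalizer f g) h fun x hx y hxy hyx =>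
    inverse_unique (x := f x) (by rw [← map_mul, hyx, map_one])
      (by rw [show f x = g x from hx, ← map_mul, hxy, map_one]))

theorem qdet_mem {k : ℕ} {Y : Matrix (Fin k) (Fin k) A} {U : Subalgebra Cq A}
    (h : ∀ i j, Y i j ∈ U) : qdet t Y ∈ U := by
  refine Subalgebra.sum_mem _ fun s _ => Subalgebra.smul_mem _ (Subalgebra.list_prod_mem _ ?_) _
  intro x hx
  rw [List.mem_ofFn] at hx
  obtain ⟨i, rfl⟩ := hx
  exact h _ _

end Naturality

section Universal

variable {m n : ℕ} {t : Cqˣ} {R : Type} [Ring R] [Algebra Cq R]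

namespace QGL

theorem mk_rel {x y : FreeAlgebra Cq (Gen m n)} (h : GLRel t m n x y) :
    mk t m n x = mk t m n y := RingQuot.mkAlgHom_rel Cq h

theorem mk_surjective : Function.Surjective (mk t m n) := RingQuot.mkAlgHom_surjective Cq _

theorem a_isQ : IsQ t (a t m n) where
  sq i j h := by simpa [a] using mk_rel (GLRel.sq (t := t) i j h)
  row i j l h := by simpa [a] using mk_rel (GLRel.row (t := t) i j l h)
  col i j k h := by simpa [a] using mk_rel (GLRel.col (t := t) i j k h)
  comm i j k l h := by simpa [a] using mk_rel (GLRel.comm (t := t) i j k l h)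
  cross i j k l h h' := by simpa [a] using mk_rel (GLRel.cross (t := t) i j k l h h')

theorem mk_qdet_blockA : mk t m n (qdet t (blockA (freeMatrix m n))) = qdet t (blockA (a t m n)) :=
  (qdet_map _ _ _).symm

theorem mk_qdet_blockB :
    mk t m n (qdet t⁻¹ (blockB (freeMatrix m n))) = qdet t⁻¹ (blockB (a t m n)) :=
  (qdet_map _ _ _).symm

theorem blockA_mul_dInv : qdet t (blockA (a t m n)) * mk t m n (FreeAlgebra.ι Cq Gen.dInv₁) = 1 := by
  rw [← mk_qdet_blockA, ← map_mul, mk_rel GLRel.mul_dInv₁, map_one]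

theorem dInv_mul_blockA : mk t m n (FreeAlgebra.ι Cq Gen.dInv₁) * qdet t (blockA (a t m n)) = 1 := by
  rw [← mk_qdet_blockA, ← map_mul, mk_rel GLRel.dInv₁_mul, map_one]

theorem blockB_mul_dInv : qdet t⁻¹ (blockB (a t m n)) * mk t m n (FreeAlgebra.ι Cq Gen.dInv₂) = 1 := by
  rw [← mk_qdet_blockB, ← map_mul, mk_rel GLRel.mul_dInv₂, map_one]

theorem dInv_mul_blockB : mk t m n (FreeAlgebra.ι Cq Gen.dInv₂) * qdet t⁻¹ (blockB (a t m n)) = 1 := by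
  rw [← mk_qdet_blockB, ← map_mul, mk_rel GLRel.dInv₂_mul, map_one]

theorem isPoint (t : Cqˣ) (m n : ℕ) : IsPoint t (parity t m n) (a t m n) where
  isQ := a_isQ
  parity := parity_a t m n
  unitA := ⟨⟨qdet t (blockA (a t m n)), mk t m n (FreeAlgebra.ι Cq Gen.dInv₁),
    blockA_mul_dInv,
    dInv_mul_blockA⟩, rfl⟩
  unitB := ⟨⟨qdet t⁻¹ (blockB (a t m n)), mk t m n (FreeAlgebra.ι Cq Gen.dInv₂),
    blockB_mul_dInv,
    dInv_mul_blockB⟩, rfl⟩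

theorem generates : Generates (a t m n) := by
  intro U hU hinv x
  obtain ⟨x, rfl⟩ := mk_surjective x
  have hA : qdet t (blockA (a t m n)) ∈ U := qdet_mem fun i j => hU _ _
  have hB : qdet t⁻¹ (blockB (a t m n)) ∈ U := qdet_mem fun i j => hU _ _
  change x ∈ U.comap (mk t m n)
  have : U.comap (mk t m n) = ⊤ := by
    rw [eq_top_iff, ← FreeAlgebra.adjoin_range_ι, Algebra.adjoin_le_iff]
    rintro _ ⟨g, rfl⟩
    cases g with
    | a i j => exact hU i j
    | dInv₁ =>
      exact hinv _ hA _ (blockA_mul_dInv)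
        (dInv_mul_blockA)
    | dInv₂ =>
      exact hinv _ hB _ (blockB_mul_dInv)
        (dInv_mul_blockB)
  rw [this]
  trivial

/-- The morphism of the free algebra underlying the universal property. -/
def freeLift (t : Cqˣ) (X : Matrix (Fin (m + n)) (Fin (m + n)) R) :
    FreeAlgebra Cq (Gen m n) →ₐ[Cq] R :=
  FreeAlgebra.lift Cq fun g => match g with
    | .a i j => X i j
    | .dInv₁ => Ring.inverse (qdet t (blockA X))
    | .dInv₂ => Ring.inverse (qdet t⁻¹ (blockB X))

theorem freeLift_a (X : Matrix (Fin (m + n)) (Fin (m + n)) R) (i j : Fin (m + n)) :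
    freeLift t X (freeMatrix m n i j) = X i j := by
  simp [freeMatrix, freeLift]

theorem freeLift_blockA (X : Matrix (Fin (m + n)) (Fin (m + n)) R) :
    freeLift t X (qdet t (blockA (freeMatrix m n))) = qdet t (blockA X) := by
  rw [← qdet_map]
  congr 1
  ext i j
  exact freeLift_a X _ _

theorem freeLift_blockB (X : Matrix (Fin (m + n)) (Fin (m + n)) R) :
    freeLift t X (qdet t⁻¹ (blockB (freeMatrix m n))) = qdet t⁻¹ (blockB X) := by
  rw [← qdet_map]
  congr 1
  ext i j
  exact freeLift_a X _ _

/-- The universal property of `GL_t(m|n)`. -/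
def lift (X : Matrix (Fin (m + n)) (Fin (m + n)) R) (hX : IsQ t X)
    (hA : IsUnit (qdet t (blockA X))) (hB : IsUnit (qdet t⁻¹ (blockB X))) : QGL t m n →ₐ[Cq] R :=
  RingQuot.liftAlgHom Cq ⟨freeLift t X, fun x y h => by
    cases h with
    | sq i j h => simpa [freeLift_a] using hX.sq i j h
    | row i j l h => simpa [freeLift_a] using hX.row i j l h
    | col i j k h => simpa [freeLift_a] using hX.col i j k h
    | comm i j k l h => simpa [freeLift_a] using hX.comm i j k l h
    | cross i j k l h h' => simpa [freeLift_a] using hX.cross i j k l h h'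
    | mul_dInv₁ =>
      rw [map_mul, freeLift_blockA, map_one, freeLift, FreeAlgebra.lift_ι_apply]
      exact Ring.mul_inverse_cancel _ hA
    | dInv₁_mul =>
      rw [map_mul, freeLift_blockA, map_one, freeLift, FreeAlgebra.lift_ι_apply]
      exact Ring.inverse_mul_cancel _ hA
    | mul_dInv₂ =>
      rw [map_mul, freeLift_blockB, map_one, freeLift, FreeAlgebra.lift_ι_apply]
      exact Ring.mul_inverse_cancel _ hB
    | dInv₂_mul =>
      rw [map_mul, freeLift_blockB, map_one, freeLift, FreeAlgebra.lift_ι_apply]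
      exact Ring.inverse_mul_cancel _ hB⟩

theorem lift_a (X : Matrix (Fin (m + n)) (Fin (m + n)) R) (hX : IsQ t X)
    (hA : IsUnit (qdet t (blockA X))) (hB : IsUnit (qdet t⁻¹ (blockB X))) (i j : Fin (m + n)) :
    lift X hX hA hB (a t m n i j) = X i j := by
  rw [a, Matrix.map_apply, lift]
  exact (RingQuot.liftAlgHom_mkAlgHom_apply Cq _ _ _).trans (freeLift_a X i j)

/-- The morphism given by a point of `GL_t(m|n)`. -/
def ofPoint {s : R →ₐ[Cq] R} {X : Matrix (Fin (m + n)) (Fin (m + n)) R} (h : IsPoint t s X) :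
    QGL t m n →ₐ[Cq] R := lift X h.isQ h.unitA h.unitB

theorem ofPoint_a {s : R →ₐ[Cq] R} {X : Matrix (Fin (m + n)) (Fin (m + n)) R}
    (h : IsPoint t s X) (i j : Fin (m + n)) : ofPoint h (a t m n i j) = X i j :=
  lift_a _ _ _ _ _ _

theorem map_ofPoint {s : R →ₐ[Cq] R} {X : Matrix (Fin (m + n)) (Fin (m + n)) R}
    (h : IsPoint t s X) : (a t m n).map (ofPoint h) = X := by
  ext i j; exact ofPoint_a h i j

end QGL

namespace QSL

theorem proj_surjective : Function.Surjective (proj t m n) := RingQuot.mkAlgHom_surjective Cq _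

theorem isPoint (t : Cqˣ) (m n : ℕ) : IsPoint t (parity t m n) (a t m n) :=
  (QGL.isPoint t m n).map (proj t m n) fun i j => parity_proj t m n _

theorem generates : Generates (a t m n) := by
  intro U hU hinv x
  obtain ⟨x, rfl⟩ := proj_surjective x
  exact QGL.generates (U.comap (proj t m n)) hU (fun x hx y hxy hyx => hinv _ hx _
    (by rw [← map_mul, hxy, map_one]) (by rw [← map_mul, hyx, map_one])) x

theorem berezinian_a : berezinian t (a t m n) = 1 := by
  rw [a, (QGL.isPoint t m n).berezinian_map (QGL.parity_involutive t m n)]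
  exact (RingQuot.mkAlgHom_rel Cq SLRel.ber).trans (map_one _)

/-- A morphism from `GL_t(m|n)` that maps the Berezinian to `1` factors through `SL_t(m|n)`. -/
def lift (f : QGL t m n →ₐ[Cq] R) (hf : f (berezinian t (QGL.a t m n)) = 1) :
    QSL t m n →ₐ[Cq] R :=
  RingQuot.liftAlgHom Cq ⟨f, fun x y h => by cases h; rw [hf, map_one]⟩

theorem lift_proj (f : QGL t m n →ₐ[Cq] R) (hf : f (berezinian t (QGL.a t m n)) = 1)
    (x : QGL t m n) : lift f hf (proj t m n x) = f x :=
  RingQuot.liftAlgHom_mkAlgHom_apply Cq _ _ x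

/-- The morphism given by a point of `SL_t(m|n)`. -/
def ofPoint {s : R →ₐ[Cq] R} {X : Matrix (Fin (m + n)) (Fin (m + n)) R} (h : IsPoint t s X)
    (hX : berezinian t X = 1) : QSL t m n →ₐ[Cq] R :=
  lift (QGL.ofPoint h) (by
    rw [← (QGL.isPoint t m n).berezinian_map (QGL.parity_involutive t m n), QGL.map_ofPoint, hX])

theorem ofPoint_a {s : R →ₐ[Cq] R} {X : Matrix (Fin (m + n)) (Fin (m + n)) R} (h : IsPoint t s X)
    (hX : berezinian t X = 1) (i j : Fin (m + n)) : ofPoint h hX (a t m n i j) = X i j :=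
  (lift_proj _ _ _).trans (QGL.ofPoint_a h i j)

end QSL

end Universal

/-! ### The super tensor square -/

section SuperTensor

variable {A : Type} [Ring A] [Algebra Cq A]

theorem neg_one_uzpow_mul (i j : ZMod 2) : (-1 : ℤˣ) ^ (i * j) = (-1) ^ (i.val * j.val) := by
  have h2 : ∀ k : ZMod 2, k = 0 ∨ k = 1 := by decide
  rcases h2 i with rfl | rfl <;> rcases h2 j with rfl | rfl <;> simp [ZMod.val_one]

theorem intUnits_smul {M : Type} [AddCommGroup M] [Module Cq M] (k : ℕ) (x : M) :
    ((-1 : ℤˣ) ^ k) • x = (-1 : Cq) ^ k • x := by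
  rcases Nat.even_or_odd k with h | h <;> simp [h.neg_one_pow]

theorem even_add_odd {s : A →ₐ[Cq] A} (hs : ∀ x, s (s x) = x) (x : A) :
    ∃ x₀ ∈ parityPart s 0, ∃ x₁ ∈ parityPart s 1, x = x₀ + x₁ := by
  refine ⟨_, (parityProj s hs 0 x).2, _, (parityProj s hs 1 x).2, ?_⟩
  rw [coe_parityProj, coe_parityProj, ← smul_add]
  have h : x + (-1 : Cq) ^ (0 : ZMod 2).val • s x + (x + (-1 : Cq) ^ (1 : ZMod 2).val • s x)
      = (2 : Cq) • x := by
    rw [two_smul]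
    simp only [ZMod.val_zero, ZMod.val_one, pow_zero, pow_one, one_smul, neg_smul]
    abel
  rw [h, invOf_smul_smul]

theorem mem_parityPart_natCast {s : A →ₐ[Cq] A} {k : ℕ} {x : A} (hx : s x = (-1 : Cq) ^ k • x) :
    x ∈ parityPart s (k : ZMod 2) := by
  rw [mem_parityPart, hx, ZMod.val_natCast, ← neg_one_pow_eq_pow_mod_two]

theorem parityEnd_pow_apply {s : A →ₐ[Cq] A} {i : ZMod 2} {x : A} (hx : x ∈ parityPart s i)
    (k : ℕ) : (parityEnd s ^ k) x = (-1 : Cq) ^ (k * i.val) • x := by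
  induction k with
  | zero => simp
  | succ k ih =>
    rw [pow_succ', Module.End.mul_apply, ih, map_smul, AlgHom.toLinearMap_apply,
      mem_parityPart.1 hx, smul_smul, ← pow_add]
    congr 2
    ring

/-- Operators on the left tensor factor. -/
abbrev leftOp (A : Type) [Ring A] [Algebra Cq A] :
    Module.End Cq A →ₐ[Cq] Module.End Cq (A ⊗[Cq] A) := Module.End.rTensorAlgHom Cq A A

/-- Operators on the right tensor factor. -/
abbrev rightOp (A : Type) [Ring A] [Algebra Cq A] :
    Module.End Cq A →ₐ[Cq] Module.End Cq (A ⊗[Cq] A) := Module.End.lTensorAlgHom Cq A A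

theorem leftOp_tmul (f : Module.End Cq A) (x y : A) : leftOp A f (x ⊗ₜ y) = f x ⊗ₜ y := rfl

theorem rightOp_tmul (f : Module.End Cq A) (x y : A) : rightOp A f (x ⊗ₜ y) = x ⊗ₜ f y := rfl

theorem leftOp_mul_rightOp (f g : Module.End Cq A) :
    leftOp A f * rightOp A g = rightOp A g * leftOp A f :=
  TensorProduct.ext' fun x y => rfl

theorem leftOp_mul_rightOp_mul (f g f' g' : Module.End Cq A) :
    leftOp A f * rightOp A g * (leftOp A f' * rightOp A g') =
      leftOp A (f * f') * rightOp A (g * g') :=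
  TensorProduct.ext' fun x y => rfl

variable (s : A →ₐ[Cq] A) [GradedAlgebra (parityPart s)]

/-- The super tensor square of a superalgebra. -/
abbrev SuperSq : Type := parityPart s ᵍ⊗[Cq] parityPart s

/-- The linear identification of the tensor square with the super tensor square. -/
abbrev toSq : A ⊗[Cq] A ≃ₗ[Cq] SuperSq s :=
  GradedTensorProduct.of Cq (parityPart s) (parityPart s)

/-- The embedding `x ↦ x ⊗ 1`. -/
abbrev incL : A →ₐ[Cq] SuperSq s := GradedTensorProduct.includeLeft (parityPart s) (parityPart s)

/-- The embedding `y ↦ 1 ⊗ y`. -/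
abbrev incR : A →ₐ[Cq] SuperSq s := GradedTensorProduct.includeRight (parityPart s) (parityPart s)

/-- The left regular representation of the super tensor square, on the tensor square. -/
def sqReg : SuperSq s →ₐ[Cq] Module.End Cq (A ⊗[Cq] A) :=
  ((toSq s).symm.conjAlgEquiv Cq).toAlgHom.comp (Algebra.lmul Cq (SuperSq s))

theorem sqReg_apply (z : SuperSq s) (v : A ⊗[Cq] A) :
    sqReg s z v = (toSq s).symm (z * toSq s v) := rfl

theorem sqReg_injective : Function.Injective (sqReg s) := fun x y h => by
  have := congrArg (fun f : Module.End Cq (A ⊗[Cq] A) => f ((toSq s).symm 1)) h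
  simpa [sqReg_apply] using this

variable {s}

theorem sqReg_incL (hs : ∀ x, s (s x) = x) (x : A) : sqReg s (incL s x) = leftOp A (lreg A x) := by
  refine TensorProduct.ext' fun c d => ?_
  obtain ⟨c₀, h₀, c₁, h₁, rfl⟩ := even_add_odd hs c
  have key : ∀ (i : ZMod 2) (c : A), c ∈ parityPart s i → sqReg s (incL s x) (c ⊗ₜ d) =
      leftOp A (lreg A x) (c ⊗ₜ d) := fun i c hc => by
    have := GradedTensorProduct.tmul_one_mul_coe_tmul (R := Cq) (parityPart s) (parityPart s) x
      ⟨c, hc⟩ d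
    rw [sqReg_apply, leftOp_tmul]
    exact congrArg (toSq s).symm this
  rw [TensorProduct.add_tmul, map_add, map_add, key 0 _ h₀, key 1 _ h₁]

/-- The sign rule: a homogeneous element on the right passes the left tensor factor. -/
theorem sqReg_incR (hs : ∀ x, s (s x) = x) {k : ℕ} {y : A} (hy : s y = (-1 : Cq) ^ k • y) :
    sqReg s (incR s y) = leftOp A (parityEnd s ^ k) * rightOp A (lreg A y) := by
  refine TensorProduct.ext' fun c d => ?_
  obtain ⟨c₀, h₀, c₁, h₁, rfl⟩ := even_add_odd hs c
  have hy' : y ∈ parityPart s (k : ZMod 2) := by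
    rw [mem_parityPart, hy, ZMod.val_natCast, ← neg_one_pow_eq_pow_mod_two]
  have key : ∀ (i : ZMod 2) (c : A), c ∈ parityPart s i → sqReg s (incR s y) (c ⊗ₜ d) =
      (leftOp A (parityEnd s ^ k) * rightOp A (lreg A y)) (c ⊗ₜ d) := fun i c hc => by
    have := GradedTensorProduct.tmul_coe_mul_coe_tmul (R := Cq) (parityPart s) (parityPart s) 1
      ⟨y, hy'⟩ ⟨c, hc⟩ d
    rw [one_mul, neg_one_uzpow_mul, intUnits_smul] at this
    rw [sqReg_apply, Module.End.mul_apply, rightOp_tmul, leftOp_tmul, parityEnd_pow_apply hc]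
    refine (congrArg (toSq s).symm this).trans ?_
    rw [map_smul, ← TensorProduct.smul_tmul', ZMod.val_natCast, pow_mul,
      ← neg_one_pow_eq_pow_mod_two, ← pow_mul]
    rfl
  rw [TensorProduct.add_tmul, map_add, map_add, key 0 _ h₀, key 1 _ h₁]

theorem incL_mul_incR (x y : A) : incL s x * incR s y = toSq s (x ⊗ₜ y) :=
  GradedTensorProduct.tmul_one_mul_one_tmul _ _ _ _

theorem incR_mul_incL_of_mem {i j : ZMod 2} {x y : A} (hx : x ∈ parityPart s i)
    (hy : y ∈ parityPart s j) :
    incR s y * incL s x = (-1 : Cq) ^ (j.val * i.val) • (incL s x * incR s y) := by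
  have := GradedTensorProduct.tmul_coe_mul_coe_tmul (R := Cq) (parityPart s) (parityPart s) 1
    ⟨y, hy⟩ ⟨x, hx⟩ 1
  rw [one_mul, mul_one, neg_one_uzpow_mul, intUnits_smul] at this
  rw [incL_mul_incR]
  exact this

theorem neg_one_pow_val_mul (k l : ℕ) :
    (-1 : Cq) ^ ((k : ZMod 2).val * (l : ZMod 2).val) = (-1) ^ (k * l) := by
  rw [ZMod.val_natCast, ZMod.val_natCast, pow_mul, ← neg_one_pow_eq_pow_mod_two, ← pow_mul,
    mul_comm, pow_mul, ← neg_one_pow_eq_pow_mod_two, ← pow_mul, mul_comm]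

theorem incR_mul_incL {k l : ℕ} {x y : A} (hx : s x = (-1 : Cq) ^ k • x)
    (hy : s y = (-1 : Cq) ^ l • y) :
    incR s y * incL s x = (-1 : Cq) ^ (l * k) • (incL s x * incR s y) := by
  rw [incR_mul_incL_of_mem (mem_parityPart_natCast hx) (mem_parityPart_natCast hy),
    neg_one_pow_val_mul]

theorem sq_hom_ext {B : Type} [Ring B] [Algebra Cq B] {f g : SuperSq s →ₐ[Cq] B}
    (h₁ : ∀ x, f (incL s x) = g (incL s x)) (h₂ : ∀ x, f (incR s x) = g (incR s x)) : f = g :=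
  GradedTensorProduct.algHom_ext _ _ (AlgHom.ext h₁) (AlgHom.ext h₂)

variable (s) in
/-- The parity automorphism of the super tensor square. -/
def sqParity : SuperSq s →ₐ[Cq] SuperSq s :=
  GradedTensorProduct.lift (parityPart s) (parityPart s) ((incL s).comp s) ((incR s).comp s)
    (fun i j a b => by
      rw [neg_one_uzpow_mul, intUnits_smul, AlgHom.comp_apply, AlgHom.comp_apply,
        mem_parityPart.1 a.2, mem_parityPart.1 b.2, map_smul, map_smul, smul_mul_smul_comm,
        smul_mul_smul_comm, incR_mul_incL_of_mem a.2 b.2, smul_smul, smul_smul,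
        mul_assoc]
      refine congrArg (· • _) ?_
      have h : (-1 : Cq) ^ (j.val * i.val) * (-1 : Cq) ^ (j.val * i.val) = 1 := by
        rw [← mul_pow]; simp
      linear_combination (-(-1 : Cq) ^ i.val * (-1 : Cq) ^ j.val) * h)

theorem sqParity_incL (x : A) : sqParity s (incL s x) = incL s (s x) := by
  refine (GradedTensorProduct.lift_tmul _ _ _ _ _ _ _).trans ?_
  rw [map_one, mul_one]
  rfl

theorem sqParity_incR (x : A) : sqParity s (incR s x) = incR s (s x) := by
  refine (GradedTensorProduct.lift_tmul _ _ _ _ _ _ _).trans ?_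
  rw [map_one, one_mul]
  rfl

theorem sqParity_involutive (hs : ∀ x, s (s x) = x) (z : SuperSq s) :
    sqParity s (sqParity s z) = z := by
  have : (sqParity s).comp (sqParity s) = AlgHom.id Cq _ :=
    sq_hom_ext (fun x => by simp only [AlgHom.comp_apply, sqParity_incL, hs]; rfl)
      (fun x => by simp only [AlgHom.comp_apply, sqParity_incR, hs]; rfl)
  exact DFunLike.congr_fun this z

variable {m n : ℕ} {t : Cqˣ} {X : Matrix (Fin (m + n)) (Fin (m + n)) A}

variable (s) in
/-- The matrix product of `X ⊗ 1` and `1 ⊗ X`. -/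
def comulMatrix (X : Matrix (Fin (m + n)) (Fin (m + n)) A) :
    Matrix (Fin (m + n)) (Fin (m + n)) (SuperSq s) := X.map (incL s) * X.map (incR s)

theorem comulMatrix_apply (i j : Fin (m + n)) :
    comulMatrix s X i j = toSq s (∑ k, X i k ⊗ₜ X k j) := by
  rw [comulMatrix, Matrix.mul_apply, map_sum]
  exact Finset.sum_congr rfl fun k _ => incL_mul_incR _ _

theorem sqParity_comulMatrix (h : ∀ i j, s (X i j) = (-1 : Cq) ^ (p i + p j) • X i j)
    (i j : Fin (m + n)) :
    sqParity s (comulMatrix s X i j) = (-1 : Cq) ^ (p i + p j) • comulMatrix s X i j := by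
  rw [comulMatrix, Matrix.mul_apply, map_sum, Finset.smul_sum]
  refine Finset.sum_congr rfl fun k _ => ?_
  rw [map_mul, Matrix.map_apply, Matrix.map_apply, sqParity_incL, sqParity_incR, h, h, map_smul,
    map_smul, smul_mul_smul_comm, ← pow_add]
  exact congrArg (· • _) (neg_one_pow_congr (by grind))

/-- The parity operator of the tensor square commutes with the even and anticommutes with the odd
entries of the product matrix. -/
theorem signed_sqReg (hs : ∀ x, s (s x) = x)
    (h : ∀ i j, s (X i j) = (-1 : Cq) ^ (p i + p j) • X i j) :
    Signed (leftOp A (parityEnd s) * rightOp A (parityEnd s))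
      ((comulMatrix s X).map (sqReg s)) := by
  intro i j
  simp only [Matrix.map_apply, comulMatrix, Matrix.mul_apply, map_sum, map_mul,
    Finset.mul_sum, Finset.sum_mul, Finset.smul_sum]
  refine Finset.sum_congr rfl fun k _ => ?_
  rw [sqReg_incL hs, sqReg_incR hs (h k j)]
  refine TensorProduct.ext' fun c d => ?_
  change s (X i k * (parityEnd s ^ (p k + p j)) c) ⊗ₜ[Cq] s (X k j * d) =
    (-1 : Cq) ^ (p i + p j) • ((X i k * (parityEnd s ^ (p k + p j)) (s c)) ⊗ₜ[Cq] (X k j * s d))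
  have h1 : s ((parityEnd s ^ (p k + p j)) c) = (parityEnd s ^ (p k + p j)) (s c) := by
    change (parityEnd s * parityEnd s ^ (p k + p j)) c = (parityEnd s ^ (p k + p j) * parityEnd s) c
    rw [← pow_succ, ← pow_succ']
  rw [map_mul, map_mul, h, h, h1, smul_mul_assoc, smul_mul_assoc, TensorProduct.smul_tmul_smul,
    ← pow_add]
  exact congrArg (· • _) (neg_one_pow_congr (by grind))

/-- With the Koszul signs removed, the product matrix is an ordinary product of two matrices whose
entries commute. -/
theorem hatR_comulMatrix (hs : ∀ x, s (s x) = x)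
    (h : ∀ i j, s (X i j) = (-1 : Cq) ^ (p i + p j) • X i j) :
    hatR (leftOp A (parityEnd s) * rightOp A (parityEnd s)) ((comulMatrix s X).map (sqReg s)) =
      (opHat s X).map (leftOp A) * (opHat s X).map (rightOp A) := by
  refine Matrix.ext fun i j => ?_
  simp only [hatR, Matrix.of_apply, Matrix.map_apply, comulMatrix, Matrix.mul_apply, map_sum,
    map_mul, Finset.sum_mul, opHat_apply]
  refine Finset.sum_congr rfl fun k _ => ?_
  have h1 : (leftOp A (parityEnd s) * rightOp A (parityEnd s)) ^ p j =
      leftOp A (parityEnd s ^ p j) * rightOp A (parityEnd s ^ p j) := by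
    rw [map_pow, map_pow]
    exact Commute.mul_pow (leftOp_mul_rightOp _ _) _
  rw [sqReg_incL hs, sqReg_incR hs (h k j), h1]
  refine TensorProduct.ext' fun c d => ?_
  change (X i k * (parityEnd s ^ (p k + p j) * parityEnd s ^ p j) c) ⊗ₜ[Cq]
    (X k j * (parityEnd s ^ p j) d) =
    (X i k * (parityEnd s ^ p k) c) ⊗ₜ[Cq] (X k j * (parityEnd s ^ p j) d)
  rw [pow_add, mul_assoc, pow_mul_pow_self (parityEnd_mul_self hs), mul_one]

theorem IsPoint.comulMatrix_isQ (h : IsPoint t s X) (hs : ∀ x, s (s x) = x) :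
    IsQ t (comulMatrix s X) := by
  have hσ : (leftOp A (parityEnd s) * rightOp A (parityEnd s)) *
      (leftOp A (parityEnd s) * rightOp A (parityEnd s)) = 1 :=
    TensorProduct.ext' fun c d => by
      change s (s c) ⊗ₜ[Cq] s (s d) = c ⊗ₜ d
      rw [hs, hs]
  refine IsQ.of_map (sqReg_injective s) ((isQ_iff_hatR hσ (signed_sqReg hs h.parity)).2 ?_)
  rw [hatR_comulMatrix hs h.parity]
  obtain ⟨h1, h2⟩ := h.opHat_rtt hs
  have hL : SqZero p ((opHat s X).map (leftOp A)) := fun i j hij => by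
    rw [Matrix.map_apply, ← map_mul, h2 i j hij, map_zero]
  have hR : SqZero p ((opHat s X).map (rightOp A)) := fun i j hij => by
    rw [Matrix.map_apply, ← map_mul, h2 i j hij, map_zero]
  have hc : ∀ i j k l, (opHat s X).map (leftOp A) i j * (opHat s X).map (rightOp A) k l =
      (opHat s X).map (rightOp A) k l * (opHat s X).map (leftOp A) i j :=
    fun i j k l => leftOp_mul_rightOp _ _
  exact ⟨(((h1.map (leftOp A)).entries hL).mul ((h1.map (rightOp A)).entries hR) hc).rtt,
    hL.mul (h1.map (leftOp A)) (h1.map (rightOp A)) hR hc⟩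

/-- The operators on the two tensor factors commute, so nilpotency of the left factors suffices.
-/
theorem isNilpotent_incL_mul_incR (hs : ∀ x, s (s x) = x) {k l : ℕ}
    {P : Matrix (Fin k) (Fin l) A} {Q : Matrix (Fin l) (Fin k) A}
    {J : Submodule Cq (Module.End Cq A)} {r : ℕ} (hr : J ^ r = ⊥)
    (hP : ∀ i j, lreg A (P i j) * parityEnd s ∈ J) (hQ : ∀ i j, s (Q i j) = -Q i j) :
    IsNilpotent (P.map (incL s) * Q.map (incR s)) := by
  apply isNilpotent_of_map (sqReg_injective s)
  let C : Submodule Cq (Module.End Cq (A ⊗[Cq] A)) := (⊤ : Submodule Cq (Module.End Cq A)).map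
    (rightOp A).toLinearMap
  let J₁ : Submodule Cq (Module.End Cq (A ⊗[Cq] A)) := J.map (leftOp A).toLinearMap
  have hcomm : Commute J₁ C := by
    apply le_antisymm <;> rw [Submodule.mul_le]
    · rintro _ ⟨f, hf, rfl⟩ _ ⟨g, hg, rfl⟩
      change leftOp A f * rightOp A g ∈ _
      rw [leftOp_mul_rightOp]
      exact Submodule.mul_mem_mul ⟨g, hg, rfl⟩ ⟨f, hf, rfl⟩
    · rintro _ ⟨g, hg, rfl⟩ _ ⟨f, hf, rfl⟩
      change rightOp A g * leftOp A f ∈ _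
      rw [← leftOp_mul_rightOp]
      exact Submodule.mul_mem_mul ⟨f, hf, rfl⟩ ⟨g, hg, rfl⟩
  refine matrix_isNilpotent (J := J₁ * C) (r := r) (fun i j => ?_) ?_
  · rw [Matrix.map_apply, Matrix.mul_apply, map_sum]
    refine Submodule.sum_mem _ fun c _ => ?_
    rw [map_mul, Matrix.map_apply, Matrix.map_apply, sqReg_incL hs,
      sqReg_incR hs (k := 1) (by rw [hQ]; simp), ← mul_assoc, ← map_mul, pow_one]
    exact Submodule.mul_mem_mul ⟨_, hP i c, rfl⟩ ⟨_, trivial, rfl⟩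
  · rw [hcomm.mul_pow, ← Submodule.map_pow, hr, Submodule.map_bot, Submodule.bot_mul]

/-- `A₁ A₂ + P Q` differs from `A₁ A₂` by a unipotent factor. -/
theorem exists_inverse_add {T : Type} [Ring T] {k l : ℕ} {A₁ S₁ A₂ S₂ : Matrix (Fin k) (Fin k) T}
    {P : Matrix (Fin k) (Fin l) T} {Q : Matrix (Fin l) (Fin k) T} (h₁ : A₁ * S₁ = 1)
    (h₁' : S₁ * A₁ = 1) (h₂ : A₂ * S₂ = 1) (h₂' : S₂ * A₂ = 1)
    (h : IsNilpotent (S₁ * P * (Q * S₂))) :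
    ∃ Y, (A₁ * A₂ + P * Q) * Y = 1 ∧ Y * (A₁ * A₂ + P * Q) = 1 := by
  have e : A₁ * A₂ + P * Q = A₁ * (1 + S₁ * P * (Q * S₂)) * A₂ := by
    rw [Matrix.mul_add, Matrix.mul_one, Matrix.add_mul, Matrix.mul_assoc S₁, ← Matrix.mul_assoc A₁,
      h₁, Matrix.one_mul, Matrix.mul_assoc P, Matrix.mul_assoc Q, h₂', Matrix.mul_one]
  rw [e]
  refine exists_inverse_of_isUnit (IsUnit.mul (IsUnit.mul ?_ h.isUnit_one_add) ?_)
  · exact ⟨⟨A₁, S₁, h₁, h₁'⟩, rfl⟩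
  · exact ⟨⟨A₂, S₂, h₂, h₂'⟩, rfl⟩

theorem map_one_matrix {B : Type} [Ring B] [Algebra Cq B] {k : ℕ} (f : A →ₐ[Cq] B)
    {P Q : Matrix (Fin k) (Fin k) A} (h : P * Q = 1) : P.map f * Q.map f = 1 := by
  rw [← Matrix.map_mul, h]; exact map_one f.mapMatrix

theorem odd_map_mul {k l : ℕ} {P : Matrix (Fin l) (Fin k) A} {S : Matrix (Fin k) (Fin k) A}
    (hP : P.map s = -P) (hS : S.map s = S) (i : Fin l) (j : Fin k) :
    s ((P * S) i j) = -(P * S) i j := by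
  rw [← Matrix.map_apply (f := s), Matrix.map_mul, hP, hS, Matrix.neg_mul, Matrix.neg_apply]

/-- The even-even block of the product is `A ⊗ A + Λ ⊗ Υ`, the second term being nilpotent after
multiplication by the inverse of the first one. -/
theorem IsPoint.exists_inverse_blockA_comulMatrix (h : IsPoint t s X) (hs : ∀ x, s (s x) = x) :
    ∃ Y, blockA (comulMatrix s X) * Y = 1 ∧ Y * blockA (comulMatrix s X) = 1 := by
  obtain ⟨J, r, hr, hΛ, -, -⟩ := h.exists_nilpotent hs
  have h1 : (qantipode t (blockA X)).map s = qantipode t (blockA X) :=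
    qantipode_fixed s _ _ (by ext i j; simp [blockA, h.parity, p_castAdd])
  have h2 : (blockΥ X).map s = -blockΥ X := by
    ext i j; simp [blockΥ, h.parity, p_natAdd, p_castAdd]
  have h3 := isNilpotent_incL_mul_incR hs hr hΛ (odd_map_mul h2 h1)
  rw [Matrix.map_mul, Matrix.map_mul] at h3
  rw [comulMatrix, blockA_mul]
  exact exists_inverse_add (map_one_matrix (incL s) h.mul_SA) (map_one_matrix (incL s) h.SA_mul)
    (map_one_matrix (incR s) h.mul_SA) (map_one_matrix (incR s) h.SA_mul) h3

theorem IsPoint.exists_inverse_blockB_comulMatrix (h : IsPoint t s X) (hs : ∀ x, s (s x) = x) :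
    ∃ Y, blockB (comulMatrix s X) * Y = 1 ∧ Y * blockB (comulMatrix s X) = 1 := by
  obtain ⟨J, r, hr, -, hΥ, -⟩ := h.exists_nilpotent hs
  have h1 : (qantipode t⁻¹ (blockB X)).map s = qantipode t⁻¹ (blockB X) :=
    qantipode_fixed s _ _ (by ext i j; simp [blockB, h.parity, p_natAdd])
  have h2 : (blockΛ X).map s = -blockΛ X := by
    ext i j; simp [blockΛ, h.parity, p_natAdd, p_castAdd]
  have h3 := isNilpotent_incL_mul_incR hs hr hΥ (odd_map_mul h2 h1)
  rw [Matrix.map_mul, Matrix.map_mul] at h3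
  rw [comulMatrix, blockB_mul, add_comm]
  exact exists_inverse_add (map_one_matrix (incL s) h.mul_SB) (map_one_matrix (incL s) h.SB_mul)
    (map_one_matrix (incR s) h.mul_SB) (map_one_matrix (incR s) h.SB_mul) h3

/-- The product of the two copies of a point in the super tensor square is a point. -/
theorem IsPoint.comulMatrix (h : IsPoint t s X) (hs : ∀ x, s (s x) = x) :
    IsPoint t (sqParity s) (comulMatrix s X) where
  isQ := h.comulMatrix_isQ hs
  parity := sqParity_comulMatrix h.parity
  unitA := by
    obtain ⟨Y, h1, h2⟩ := h.exists_inverse_blockA_comulMatrix hs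
    exact (h.comulMatrix_isQ hs).blockA_rtt.isUnit_qdet h1 h2
  unitB := by
    obtain ⟨Y, h1, h2⟩ := h.exists_inverse_blockB_comulMatrix hs
    exact (h.comulMatrix_isQ hs).blockB_rtt.isUnit_qdet h1 h2

/-- The inverse of the product matrix is the product of the inverses in the reverse order. -/
theorem comulMatrix_inverse {b : Matrix (Fin (m + n)) (Fin (m + n)) A} (hXb : X * b = 1)
    (hbX : b * X = 1) :
    comulMatrix s X * (b.map (incR s) * b.map (incL s)) = 1 ∧
      b.map (incR s) * b.map (incL s) * comulMatrix s X = 1 := by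
  have h1 := map_one_matrix (incL s) hXb
  have h2 := map_one_matrix (incL s) hbX
  have h3 := map_one_matrix (incR s) hXb
  have h4 := map_one_matrix (incR s) hbX
  rw [QuantumSuper.comulMatrix]
  constructor
  · rw [mul_assoc, ← mul_assoc (X.map (incR s)), h3, one_mul, h1]
  · rw [mul_assoc, ← mul_assoc (b.map (incL s)), h2, one_mul, h4]

/-! ### The Berezinian is group-like -/

theorem qdet_smul_left {T : Type} [Ring T] [Algebra Cq T] {k : ℕ} {σ : T}
    {Y : Matrix (Fin k) (Fin k) T} (hc : ∀ i j, σ * Y i j = Y i j * σ) (u : Cqˣ) :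
    qdet u (Matrix.of fun i j => σ * Y i j) = σ ^ k * qdet u Y := by
  have key : ∀ (r : ℕ) (w : Fin r → Fin k × Fin k),
      (List.ofFn fun i => σ * Y (w i).1 (w i).2).prod =
        σ ^ r * (List.ofFn fun i => Y (w i).1 (w i).2).prod := by
    intro r
    induction r with
    | zero => intro w; simp
    | succ r ih =>
      intro w
      have hcr : ∀ i j, σ ^ r * Y i j = Y i j * σ ^ r := fun i j =>
        (Commute.pow_left (hc i j) r)
      rw [List.ofFn_succ, List.prod_cons, ih, List.ofFn_succ, List.prod_cons, pow_succ',
        mul_assoc, ← mul_assoc (Y _ _), ← hcr]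
      simp only [mul_assoc]
  rw [qdet, qdet, Finset.mul_sum]
  refine Finset.sum_congr rfl fun τ _ => ?_
  rw [mul_smul_comm]
  exact congrArg (_ • ·) (key k fun i => (i, τ i))

section Representation

variable {R T : Type} [Ring R] [Algebra Cq R] [Ring T] [Algebra Cq T] {s : R →ₐ[Cq] R}
  {X b : Matrix (Fin (m + n)) (Fin (m + n)) R} {ρ : R →ₐ[Cq] T} {σ : T}

theorem signed_rep (hρ : ∀ x, σ * ρ x = ρ (s x) * σ)
    (h : ∀ i j, s (X i j) = (-1 : Cq) ^ (p i + p j) • X i j) : Signed σ (X.map ρ) := fun i j => by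
  rw [Matrix.map_apply, hρ, h, map_smul, smul_mul_assoc]

/-- In a representation in which the parity automorphism is inner, a point and its inverse become
a pair of inverse matrices without Koszul signs. -/
theorem IsPoint.qPair (h : IsPoint t s X) (hs : ∀ x, s (s x) = x) (hσ : σ * σ = 1)
    (hρ : ∀ x, σ * ρ x = ρ (s x) * σ) (hXb : X * b = 1) (hbX : b * X = 1) :
    QPair t p (hatR σ (X.map ρ)) (hatL σ (b.map ρ)) := by
  have hX := (isQ_iff_hatR hσ (signed_rep hρ h.parity)).1 (h.isQ.map ρ)
  have hb := (isQ_iff_hatL hσ (signed_rep hρ (h.inverse_parity hs hXb hbX))).1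
    ((h.isQ_inverse hs hXb hbX).map ρ)
  exact ⟨hX.1, hX.2, hb.1, hb.2, (hatR_mul_hatL hσ _ _).trans (map_one_matrix _ hXb),
    hatL_mul_hatR_eq_one hσ (map_one_matrix _ hbX)⟩

theorem IsPoint.qdet_blockB_fixed (h : IsPoint t s X) (hs : ∀ x, s (s x) = x) (hXb : X * b = 1)
    (hbX : b * X = 1) : s (qdet t (blockB b)) = qdet t (blockB b) := by
  rw [← qdet_map]
  congr 1
  ext i j
  simp [blockB, h.inverse_parity hs hXb hbX, p_natAdd]

theorem IsPoint.berezinian_fixed (h : IsPoint t s X) (hs : ∀ x, s (s x) = x) :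
    s (berezinian t X) = berezinian t X := by
  rw [h.berezinian_eq hs (h.mul_inv hs) (h.inv_mul hs), map_mul,
    h.qdet_blockB_fixed hs (h.mul_inv hs) (h.inv_mul hs), ← qdet_map]
  congr 2
  ext i j
  simp [blockA, h.parity, p_castAdd]

/-- The fundamental coefficient of the Koszul complex is the Berezinian, up to a power of the
parity operator that stems from the `n` odd rows of `hatL`. -/
theorem IsPoint.kber_rep (h : IsPoint t s X) (hs : ∀ x, s (s x) = x) (hσ : σ * σ = 1)
    (hρ : ∀ x, σ * ρ x = ρ (s x) * σ) (hXb : X * b = 1) (hbX : b * X = 1) :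
    kber t p (hatR σ (X.map ρ)) (hatL σ (b.map ρ)) = ρ (berezinian t X) * σ ^ n := by
  rw [kber_eq (h.qPair hs hσ hρ hXb hbX), h.berezinian_eq hs hXb hbX]
  have hA : blockA (hatR σ (X.map ρ)) = (blockA X).map ρ := by
    ext i j : 2; simp [blockA, hatR, p_castAdd]
  have hB : blockB (hatL σ (b.map ρ)) = Matrix.of fun i j => σ * (blockB b).map ρ i j := by
    ext i j : 2; simp [blockB, hatL, p_natAdd]
  have hc : ∀ i j, σ * (blockB b).map ρ i j = (blockB b).map ρ i j * σ := fun i j => by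
    rw [Matrix.map_apply, hρ, blockB, Matrix.submatrix_apply, h.inverse_parity hs hXb hbX, p_natAdd,
      p_natAdd]
    simp
  have hpow : ∀ k : ℕ, σ ^ k * ρ (qdet t (blockB b)) = ρ (qdet t (blockB b)) * σ ^ k := fun k =>
    Commute.pow_left (show σ * _ = _ * σ by rw [hρ, h.qdet_blockB_fixed hs hXb hbX]) k
  rw [hA, hB, qdet_smul_left hc, qdet_map, qdet_map, hpow, map_mul, mul_assoc]

end Representation

/-- The parity automorphism of the super tensor square is inner in the regular representation. -/
theorem sqReg_parity (hs : ∀ x, s (s x) = x) (z : SuperSq s) :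
    leftOp A (parityEnd s) * rightOp A (parityEnd s) * sqReg s z =
      sqReg s (sqParity s z) * (leftOp A (parityEnd s) * rightOp A (parityEnd s)) := by
  have hmul : ∀ z w, leftOp A (parityEnd s) * rightOp A (parityEnd s) * sqReg s z =
      sqReg s (sqParity s z) * (leftOp A (parityEnd s) * rightOp A (parityEnd s)) →
      leftOp A (parityEnd s) * rightOp A (parityEnd s) * sqReg s w =
      sqReg s (sqParity s w) * (leftOp A (parityEnd s) * rightOp A (parityEnd s)) →
      leftOp A (parityEnd s) * rightOp A (parityEnd s) * sqReg s (z * w) =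
      sqReg s (sqParity s (z * w)) * (leftOp A (parityEnd s) * rightOp A (parityEnd s)) :=
    fun z w hz hw => by
      rw [map_mul, map_mul, map_mul, ← mul_assoc, hz, mul_assoc, hw, mul_assoc]
  have hR : ∀ (i : ZMod 2) (y : A), y ∈ parityPart s i →
      leftOp A (parityEnd s) * rightOp A (parityEnd s) * sqReg s (incR s y) =
      sqReg s (sqParity s (incR s y)) * (leftOp A (parityEnd s) * rightOp A (parityEnd s)) :=
    fun i y hy => by
      rw [sqParity_incR, mem_parityPart.1 hy, map_smul, map_smul, sqReg_incR hs (mem_parityPart.1 hy)]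
      refine TensorProduct.ext' fun c d => ?_
      change s ((parityEnd s ^ i.val) c) ⊗ₜ[Cq] s (y * d) =
        (-1 : Cq) ^ i.val • (((parityEnd s ^ i.val) (s c)) ⊗ₜ[Cq] (y * s d))
      have h1 : s ((parityEnd s ^ i.val) c) = (parityEnd s ^ i.val) (s c) := by
        change (parityEnd s * parityEnd s ^ i.val) c = (parityEnd s ^ i.val * parityEnd s) c
        rw [← pow_succ, ← pow_succ']
      rw [map_mul, mem_parityPart.1 hy, h1, smul_mul_assoc, TensorProduct.tmul_smul]
  obtain ⟨z, rfl⟩ := (toSq s).surjective z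
  induction z with
  | zero => simp
  | add z w hz hw => rw [map_add, map_add, map_add, map_add, mul_add, add_mul, hz, hw]
  | tmul x y =>
    obtain ⟨y₀, h₀, y₁, h₁, rfl⟩ := even_add_odd hs y
    rw [← incL_mul_incR]
    refine hmul _ _ ?_ ?_
    · rw [sqParity_incL, sqReg_incL hs, sqReg_incL hs]
      refine TensorProduct.ext' fun c d => ?_
      change s (x * c) ⊗ₜ[Cq] s d = (s x * s c) ⊗ₜ[Cq] s d
      rw [map_mul]
    · rw [map_add, map_add, map_add, map_add, mul_add, add_mul, hR _ _ h₀, hR _ _ h₁]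

/-- The Berezinian is group-like. -/
theorem IsPoint.berezinian_comulMatrix (h : IsPoint t s X) (hs : ∀ x, s (s x) = x) :
    berezinian t (QuantumSuper.comulMatrix s X) =
      incL s (berezinian t X) * incR s (berezinian t X) := by
  have hXb := h.mul_inv hs
  have hbX := h.inv_mul hs
  set b := h.inv hs
  have hσ := parityEnd_mul_self hs
  have hσ₂ : (leftOp A (parityEnd s) * rightOp A (parityEnd s)) *
      (leftOp A (parityEnd s) * rightOp A (parityEnd s)) = 1 :=
    TensorProduct.ext' fun c d => by
      change s (s c) ⊗ₜ[Cq] s (s d) = c ⊗ₜ d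
      rw [hs, hs]
  have hinv := comulMatrix_inverse (s := s) hXb hbX
  have hρ₁ : ∀ x, leftOp A (parityEnd s) * (leftOp A).comp (lreg A) x =
      (leftOp A).comp (lreg A) (s x) * leftOp A (parityEnd s) := fun x => by
    rw [AlgHom.comp_apply, AlgHom.comp_apply, ← map_mul, parityEnd_mul_lreg, map_mul]
  have hσ₁ : leftOp A (parityEnd s) * leftOp A (parityEnd s) = 1 := by
    rw [← map_mul, hσ, map_one]
  -- the two tensor factors
  have q₁ := h.qPair hs hσ₁ hρ₁ hXb hbX
  have q₂ := h.qPair hs hσ (parityEnd_mul_lreg s) hXb hbX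
  have k₁ := h.kber_rep hs hσ₁ hρ₁ hXb hbX
  have k₂ := h.kber_rep hs hσ (parityEnd_mul_lreg s) hXb hbX
  -- the product
  have q := (h.comulMatrix hs).qPair (sqParity_involutive hs) hσ₂ (sqReg_parity hs) hinv.1 hinv.2
  have k := (h.comulMatrix hs).kber_rep (sqParity_involutive hs) hσ₂ (sqReg_parity hs)
    hinv.1 hinv.2
  have hprod := kber_mul (ι := rightOp A) q₁ q₂ (fun i j x => ?_) (fun i j x => ?_)
  rotate_left
  · change leftOp A (lreg A (X i j)) * leftOp A (parityEnd s) ^ p j * _ = _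
    rw [← map_pow, ← map_mul, leftOp_mul_rightOp]
    simp [hatR]
  · change leftOp A (parityEnd s) ^ p i * leftOp A (lreg A (b i j)) * _ = _
    rw [← map_pow, ← map_mul, leftOp_mul_rightOp]
    simp [hatL]
  -- the products of the matrices of the factors are the matrices of the product
  have hM : hatR (leftOp A (parityEnd s)) (X.map ((leftOp A).comp (lreg A))) *
      (hatR (parityEnd s) (X.map (lreg A))).map (rightOp A) =
      hatR (leftOp A (parityEnd s) * rightOp A (parityEnd s))
        ((QuantumSuper.comulMatrix s X).map (sqReg s)) := by
    rw [hatR_comulMatrix hs h.parity]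
    congr 1
    refine Matrix.ext fun i j => ?_
    simp [hatR, opHat_apply]
  have hM' : (hatL (parityEnd s) (b.map (lreg A))).map (rightOp A) *
      hatL (leftOp A (parityEnd s)) (b.map ((leftOp A).comp (lreg A))) =
      hatL (leftOp A (parityEnd s) * rightOp A (parityEnd s))
        ((b.map (incR s) * b.map (incL s)).map (sqReg s)) := by
    refine (inverse_unique q.inv_mul ?_).symm
    rw [← hM, mul_assoc, ← mul_assoc (Matrix.map _ (rightOp A)),
      map_one_matrix (rightOp A) q₂.mul_inv, one_mul, q₁.mul_inv]
  rw [hM, hM', k, k₁, k₂] at hprod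
  apply sqReg_injective s
  have hD := sqReg_incR hs (k := 0) (y := berezinian t X) (by rw [h.berezinian_fixed hs]; simp)
  have hpow : ∀ a : ℕ, (leftOp A (parityEnd s) * rightOp A (parityEnd s)) ^ a =
      leftOp A (parityEnd s) ^ a * rightOp A (parityEnd s) ^ a :=
    Commute.mul_pow (leftOp_mul_rightOp _ _)
  rw [map_mul, sqReg_incL hs, hD, pow_zero, map_one, one_mul]
  -- removing the powers of the parity operators
  have h1 := congrArg (· * (leftOp A (parityEnd s) * rightOp A (parityEnd s)) ^ n) hprod
  beta_reduce at h1
  rw [mul_assoc, pow_mul_pow_self hσ₂, mul_one] at h1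
  rw [h1, hpow, AlgHom.comp_apply, ← map_pow, ← map_pow, ← map_mul, leftOp_mul_rightOp_mul,
    mul_assoc, pow_mul_pow_self hσ, mul_one]

end SuperTensor

/-! ### Morphisms out of the super tensor square -/

section SuperLift

variable {A B : Type} [Ring A] [Algebra Cq A] [Ring B] [Algebra Cq B] {s : A →ₐ[Cq] A}

theorem zmod_two_cases (i : ZMod 2) : i = 0 ∨ i = 1 := by revert i; decide

theorem eq_of_homogeneous {M : Type} [AddCommGroup M] [Module Cq M] (hs : ∀ x, s (s x) = x)
    {f g : A →ₗ[Cq] M} (h : ∀ i, ∀ x ∈ parityPart s i, f x = g x) : f = g := by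
  ext x
  obtain ⟨x₀, h₀, x₁, h₁, rfl⟩ := even_add_odd hs x
  rw [map_add, map_add, h 0 _ h₀, h 1 _ h₁]

variable (s) in
/-- The projection onto the even part. -/
def evenProj : A →ₗ[Cq] A := (⅟2 : Cq) • (LinearMap.id + s.toLinearMap)

variable (s) in
/-- The projection onto the odd part. -/
def oddProj : A →ₗ[Cq] A := (⅟2 : Cq) • (LinearMap.id - s.toLinearMap)

theorem evenProj_even {x : A} (hx : x ∈ parityPart s 0) : evenProj s x = x := by
  simp [evenProj, mem_parityPart_zero.1 hx, ← two_smul Cq x]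

theorem evenProj_odd {x : A} (hx : x ∈ parityPart s 1) : evenProj s x = 0 := by
  simp [evenProj, mem_parityPart_one.1 hx]

theorem oddProj_even {x : A} (hx : x ∈ parityPart s 0) : oddProj s x = 0 := by
  simp [oddProj, mem_parityPart_zero.1 hx]

theorem oddProj_odd {x : A} (hx : x ∈ parityPart s 1) : oddProj s x = x := by
  simp [oddProj, mem_parityPart_one.1 hx, ← two_smul Cq x]

/-- The morphism `ρ` with its values on odd elements multiplied by an involution `θ` that commutes
with the values of `ρ`. -/
def twist (hs : ∀ x, s (s x) = x) (ρ : A →ₐ[Cq] B) (θ : B) (hθ : θ * θ = 1)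
    (hρ : ∀ x, θ * ρ x = ρ x * θ) : A →ₐ[Cq] B :=
  AlgHom.ofLinearMap
    (ρ.toLinearMap ∘ₗ evenProj s + LinearMap.mulLeft Cq θ ∘ₗ ρ.toLinearMap ∘ₗ oddProj s)
    (by
      have h1 : (1 : A) ∈ parityPart s 0 := SetLike.GradedOne.one_mem
      simp [evenProj_even h1, oddProj_even h1])
    (fun x y => by
      obtain ⟨x₀, hx₀, x₁, hx₁, rfl⟩ := even_add_odd hs x
      obtain ⟨y₀, hy₀, y₁, hy₁, rfl⟩ := even_add_odd hs y
      have h00 : x₀ * y₀ ∈ parityPart s 0 := SetLike.GradedMul.mul_mem hx₀ hy₀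
      have h01 : x₀ * y₁ ∈ parityPart s 1 := SetLike.GradedMul.mul_mem hx₀ hy₁
      have h10 : x₁ * y₀ ∈ parityPart s 1 := SetLike.GradedMul.mul_mem hx₁ hy₀
      have h11 : x₁ * y₁ ∈ parityPart s 0 := SetLike.GradedMul.mul_mem hx₁ hy₁
      simp only [add_mul, mul_add, map_add, LinearMap.add_apply, LinearMap.comp_apply,
        AlgHom.toLinearMap_apply, LinearMap.mulLeft_apply, evenProj_even hx₀, evenProj_even hy₀,
        evenProj_odd hx₁, evenProj_odd hy₁, oddProj_even hx₀, oddProj_even hy₀, oddProj_odd hx₁,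
        oddProj_odd hy₁, evenProj_even h00, evenProj_even h11, evenProj_odd h01, evenProj_odd h10,
        oddProj_even h00, oddProj_even h11, oddProj_odd h01, oddProj_odd h10, map_zero, mul_zero,
        map_mul, add_zero, zero_add]
      have e1 : θ * ρ x₁ * (θ * ρ y₁) = ρ x₁ * ρ y₁ := by
        rw [hρ, mul_assoc, ← mul_assoc θ, hθ, one_mul]
      have e2 : ρ x₀ * (θ * ρ y₁) = θ * (ρ x₀ * ρ y₁) := by
        rw [← mul_assoc, ← hρ, mul_assoc]
      rw [e1, e2, mul_assoc θ])

theorem twist_of_mem {hs : ∀ x, s (s x) = x} {ρ : A →ₐ[Cq] B} {θ : B} {hθ : θ * θ = 1}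
    {hρ : ∀ x, θ * ρ x = ρ x * θ} {i : ZMod 2} {x : A} (hx : x ∈ parityPart s i) :
    twist hs ρ θ hθ hρ x = θ ^ i.val * ρ x := by
  change ρ (evenProj s x) + θ * ρ (oddProj s x) = _
  rcases zmod_two_cases i with rfl | rfl
  · simp [evenProj_even hx, oddProj_even hx]
  · simp [evenProj_odd hx, oddProj_odd hx, ZMod.val_one]

theorem pow_val_natCast {θ : B} (hθ : θ * θ = 1) (k : ℕ) : θ ^ (k : ZMod 2).val = θ ^ k := by
  rw [ZMod.val_natCast]
  conv_rhs => rw [← Nat.mod_add_div k 2, pow_add, pow_mul, pow_two, hθ, one_pow, mul_one]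

theorem twist_apply {hs : ∀ x, s (s x) = x} {ρ : A →ₐ[Cq] B} {θ : B} {hθ : θ * θ = 1}
    {hρ : ∀ x, θ * ρ x = ρ x * θ} {k : ℕ} {x : A} (hx : s x = (-1 : Cq) ^ k • x) :
    twist hs ρ θ hθ hρ x = θ ^ k * ρ x := by
  rw [twist_of_mem (mem_parityPart_natCast hx), pow_val_natCast hθ]

variable [GradedAlgebra (parityPart s)]

/-- The morphism on the super tensor square given by a morphism `f` on the first factor and a
morphism `ρ` on the second factor whose values commute, the sign rule being implemented by an
involution `θ`. -/
def superLift (hs : ∀ x, s (s x) = x) (f ρ : A →ₐ[Cq] B) (θ : B) (hθ : θ * θ = 1)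
    (hρ : ∀ x, θ * ρ x = ρ x * θ) (hf : ∀ x, θ * f x = f (s x) * θ)
    (hfρ : ∀ x y, f x * ρ y = ρ y * f x) : SuperSq s →ₐ[Cq] B :=
  GradedTensorProduct.lift (parityPart s) (parityPart s) f (twist hs ρ θ hθ hρ) (fun i j a b => by
    rw [neg_one_uzpow_mul, intUnits_smul, twist_of_mem b.2]
    have h : ∀ k : ℕ, θ ^ k * f a = (-1 : Cq) ^ (k * i.val) • (f a * θ ^ k) := fun k => by
      induction k with
      | zero => simp
      | succ k ih =>
        rw [pow_succ, mul_assoc, hf, mem_parityPart.1 a.2, map_smul, smul_mul_assoc, mul_smul_comm,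
          ← mul_assoc, ih, smul_mul_assoc, smul_smul, mul_assoc, ← pow_add]
        congr 2
        ring
    rw [mul_assoc, ← hfρ, ← mul_assoc (θ ^ _), h, smul_mul_assoc, smul_smul, ← mul_pow, mul_assoc]
    simp)

variable {hs : ∀ x, s (s x) = x} {f ρ : A →ₐ[Cq] B} {θ : B} {hθ : θ * θ = 1}
  {hρ : ∀ x, θ * ρ x = ρ x * θ} {hf : ∀ x, θ * f x = f (s x) * θ}
  {hfρ : ∀ x y, f x * ρ y = ρ y * f x}

theorem superLift_toSq (x y : A) :
    superLift hs f ρ θ hθ hρ hf hfρ (toSq s (x ⊗ₜ y)) = f x * twist hs ρ θ hθ hρ y :=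
  GradedTensorProduct.lift_tmul _ _ _ _ _ _ _

theorem superLift_comulMatrix {m n : ℕ} {X : Matrix (Fin (m + n)) (Fin (m + n)) A}
    (h : ∀ i j, s (X i j) = (-1 : Cq) ^ (p i + p j) • X i j) (i j : Fin (m + n)) :
    superLift hs f ρ θ hθ hρ hf hfρ (comulMatrix s X i j) =
      ∑ k, f (X i k) * (θ ^ (p k + p j) * ρ (X k j)) := by
  rw [comulMatrix_apply, map_sum, map_sum]
  exact Finset.sum_congr rfl fun k _ => by rw [superLift_toSq, twist_apply (h k j)]

end SuperLift

/-! ### Antimorphisms of superalgebras -/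

section Untwist

variable {A B : Type} [Ring A] [Algebra Cq A] [Ring B] [Algebra Cq B] {s : A →ₐ[Cq] A}

variable (s) in
/-- The antimorphism in the super sense that belongs to a morphism to the opposite algebra; on odd
elements it is the latter divided by a square root of `-1`. -/
def untwist (f : A →ₐ[Cq] Bᵐᵒᵖ) : A →ₗ[Cq] B :=
  (MulOpposite.opLinearEquiv Cq).symm.toLinearMap ∘ₗ f.toLinearMap ∘ₗ
    (evenProj s - algebraMap ℂ Cq Complex.I • oddProj s)

theorem untwist_even (f : A →ₐ[Cq] Bᵐᵒᵖ) {x : A} (hx : x ∈ parityPart s 0) :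
    untwist s f x = MulOpposite.unop (f x) := by
  simp [untwist, evenProj_even hx, oddProj_even hx]

theorem untwist_odd (f : A →ₐ[Cq] Bᵐᵒᵖ) {x : A} (hx : x ∈ parityPart s 1) :
    untwist s f x = -(algebraMap ℂ Cq Complex.I • MulOpposite.unop (f x)) := by
  simp only [untwist, LinearMap.comp_apply, LinearMap.sub_apply, LinearMap.smul_apply,
    evenProj_odd hx, oddProj_odd hx, zero_sub, map_neg, map_smul]
  rfl

theorem untwist_one (f : A →ₐ[Cq] Bᵐᵒᵖ) : untwist s f 1 = 1 := by
  rw [untwist_even f SetLike.GradedOne.one_mem, map_one]; rfl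

theorem untwist_mul (f : A →ₐ[Cq] Bᵐᵒᵖ) {i j : ZMod 2} {x y : A} (hx : x ∈ parityPart s i)
    (hy : y ∈ parityPart s j) : untwist s f (x * y) =
      (-1 : Cq) ^ (i.val * j.val) • (untwist s f y * untwist s f x) := by
  have hxy := SetLike.GradedMul.mul_mem hx hy
  rcases zmod_two_cases i with rfl | rfl <;> rcases zmod_two_cases j with rfl | rfl
  · rw [untwist_even f hxy, untwist_even f hx, untwist_even f hy]; simp
  · rw [untwist_odd f hxy, untwist_even f hx, untwist_odd f hy]; simp
  · rw [untwist_odd f hxy, untwist_odd f hx, untwist_even f hy]; simp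
  · rw [untwist_even f hxy, untwist_odd f hx, untwist_odd f hy]
    rw [neg_mul_neg, smul_mul_smul_comm, I_mul_I]
    simp [ZMod.val_one]

/-- On a generator the root of `-1` in `rootSign` cancels. -/
theorem untwist_generator {m n : ℕ} (f : A →ₐ[Cq] Bᵐᵒᵖ) {x : A} {y : B} {i j : Fin (m + n)}
    (hx : s x = (-1 : Cq) ^ (p i + p j) • x) (hf : f x = rootSign i j • MulOpposite.op y) :
    untwist s f x = y := by
  have h := mem_parityPart_natCast hx
  by_cases hij : p i = p j
  · have h0 : ((p i + p j : ℕ) : ZMod 2) = 0 := by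
      rw [hij, ← two_mul]; simp [show (2 : ZMod 2) = 0 from rfl]
    rw [h0] at h
    rw [untwist_even f h, hf, rootSign, if_pos hij]
    simp
  · have h1 : ((p i + p j : ℕ) : ZMod 2) = 1 := by
      rcases p_zero_or_one i with hi | hi <;> rcases p_zero_or_one j with hj | hj <;>
        simp_all
    rw [h1] at h
    rw [untwist_odd f h, hf, rootSign, if_neg hij, MulOpposite.unop_smul, MulOpposite.unop_op,
      smul_smul, I_mul_I]
    simp

theorem untwist_mem {s' : B →ₐ[Cq] B} {f : A →ₐ[Cq] Bᵐᵒᵖ}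
    (hf : ∀ x, MulOpposite.unop (f (s x)) = s' (MulOpposite.unop (f x))) {i : ZMod 2} {x : A}
    (hx : x ∈ parityPart s i) : untwist s f x ∈ parityPart s' i := by
  have h := hf x
  rw [mem_parityPart.1 hx, map_smul, MulOpposite.unop_smul] at h
  have h' : MulOpposite.unop (f x) ∈ parityPart s' i := mem_parityPart.2 h.symm
  rcases zmod_two_cases i with rfl | rfl
  · rwa [untwist_even f hx]
  · rw [untwist_odd f hx]
    exact Submodule.neg_mem _ (Submodule.smul_mem _ _ h')

theorem untwist_parity {s' : B →ₐ[Cq] B} {m n : ℕ} {X : Matrix (Fin (m + n)) (Fin (m + n)) A}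
    (hX : Generates X) (hpar : ∀ i j, s (X i j) = (-1 : Cq) ^ (p i + p j) • X i j)
    {Y : Matrix (Fin (m + n)) (Fin (m + n)) B}
    (hY : ∀ i j, s' (Y i j) = (-1 : Cq) ^ (p i + p j) • Y i j) {f : A →ₐ[Cq] Bᵐᵒᵖ}
    (hf : ∀ i j, f (X i j) = rootSign i j • MulOpposite.op (Y i j)) (x : A) :
    MulOpposite.unop (f (s x)) = s' (MulOpposite.unop (f x)) := by
  have : f.comp s = (AlgHom.op s').comp f := hX.algHom_ext fun i j => by
    rw [AlgHom.comp_apply, AlgHom.comp_apply, hpar, map_smul, hf, map_smul, smul_comm]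
    congr 1
    change _ = MulOpposite.op (s' (Y i j))
    rw [hY]
    rfl
  exact congrArg MulOpposite.unop (DFunLike.congr_fun this x)

end Untwist

/-! ### Hopf superalgebras from points -/

/-- The morphism `superLift`, characterized by its values on pure tensors and on the entries of
the product matrix. -/
theorem exists_superLift {A B : Type} [Ring A] [Algebra Cq A] [Ring B] [Algebra Cq B]
    {s : A →ₐ[Cq] A} [GradedAlgebra (parityPart s)] (hs : ∀ x, s (s x) = x) (f ρ : A →ₐ[Cq] B)
    (θ : B) (hθ : θ * θ = 1) (hρ : ∀ x, θ * ρ x = ρ x * θ) (hf : ∀ x, θ * f x = f (s x) * θ)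
    (hfρ : ∀ x y, f x * ρ y = ρ y * f x) {m n : ℕ} {X : Matrix (Fin (m + n)) (Fin (m + n)) A}
    (h : ∀ i j, s (X i j) = (-1 : Cq) ^ (p i + p j) • X i j) :
    ∃ F : SuperSq s →ₐ[Cq] B,
      (∀ i, ∀ y ∈ parityPart s i, ∀ x, F (toSq s (x ⊗ₜ y)) = f x * (θ ^ i.val * ρ y)) ∧
      ∀ i j, F (comulMatrix s X i j) = ∑ k, f (X i k) * (θ ^ (p k + p j) * ρ (X k j)) :=
  ⟨superLift hs f ρ θ hθ hρ hf hfρ, fun i y hy x => by rw [superLift_toSq, twist_of_mem hy],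
    superLift_comulMatrix h⟩

section Hopf

variable {m n : ℕ} {A : Type} [Ring A] [Algebra Cq A]

/-- A superalgebra generated by the entries of a quantum supermatrix `X` with inverse `b`,
together with the algebra morphisms that define a Hopf structure on it; the antipode is given as a
morphism to the opposite algebra. -/
structure HopfData (t : Cqˣ) (s : A →ₐ[Cq] A) [GradedAlgebra (parityPart s)]
    (X b : Matrix (Fin (m + n)) (Fin (m + n)) A) where
  point : IsPoint t s X
  invol : ∀ x, s (s x) = x
  gen : Generates X
  mul_inv : X * b = 1
  inv_mul : b * X = 1
  comulHom : A →ₐ[Cq] SuperSq s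
  comulHom_X : ∀ i j, comulHom (X i j) = comulMatrix s X i j
  counitHom : A →ₐ[Cq] Cq
  counitHom_X : ∀ i j, counitHom (X i j) = if i = j then 1 else 0
  antipodeHom : A →ₐ[Cq] Aᵐᵒᵖ
  antipodeHom_X : ∀ i j, antipodeHom (X i j) = rootSign i j • MulOpposite.op (b i j)

namespace HopfData

variable {t : Cqˣ} {s : A →ₐ[Cq] A} [GradedAlgebra (parityPart s)]
  {X b : Matrix (Fin (m + n)) (Fin (m + n)) A} (D : HopfData t s X b)

/-- The comultiplication as a linear map to the tensor square. -/
def comul : A →ₗ[Cq] A ⊗[Cq] A := (toSq s).symm.toLinearMap ∘ₗ D.comulHom.toLinearMap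

theorem toSq_comul (x : A) : toSq s (D.comul x) = D.comulHom x := rfl

/-- The antipode. -/
def antipode : A →ₗ[Cq] A := untwist s D.antipodeHom

theorem comulHom_parity (x : A) : D.comulHom (s x) = sqParity s (D.comulHom x) := by
  have : D.comulHom.comp s = (sqParity s).comp D.comulHom := D.gen.algHom_ext fun i j => by
    rw [AlgHom.comp_apply, AlgHom.comp_apply, D.point.parity, map_smul, D.comulHom_X,
      sqParity_comulMatrix D.point.parity]
  exact DFunLike.congr_fun this x

theorem counitHom_parity (x : A) : D.counitHom (s x) = D.counitHom x := by
  have : D.counitHom.comp s = D.counitHom := D.gen.algHom_ext fun i j => by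
    rw [AlgHom.comp_apply, D.point.parity, map_smul, D.counitHom_X]
    split_ifs with h
    · rw [h, ← two_mul, pow_mul]; simp
    · simp
  exact DFunLike.congr_fun this x

theorem sqReg_comulMatrix_tmul (hs : ∀ x, s (s x) = x)
    (h : ∀ i j, s (X i j) = (-1 : Cq) ^ (p i + p j) • X i j) (i j : Fin (m + n)) (c d : A) :
    sqReg s (comulMatrix s X i j) (c ⊗ₜ d) =
      ∑ k, (X i k * (parityEnd s ^ (p k + p j)) c) ⊗ₜ (X k j * d) := by
  rw [comulMatrix, Matrix.mul_apply, map_sum, LinearMap.sum_apply]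
  refine Finset.sum_congr rfl fun k _ => ?_
  rw [map_mul, Matrix.map_apply, Matrix.map_apply, sqReg_incL hs, sqReg_incR hs (h k j)]
  rfl

theorem parityEnd_pow_one (k : ℕ) : (parityEnd s ^ k) 1 = 1 := by
  rw [Module.End.pow_apply]
  exact Function.iterate_fixed (map_one s) k

theorem coassoc : TensorProduct.assoc Cq A A A ∘ₗ D.comul.rTensor A ∘ₗ D.comul =
    D.comul.lTensor A ∘ₗ D.comul := by
  have hs := D.invol
  have hσ := parityEnd_mul_self hs
  -- both sides are algebra morphisms to the operators on a triple tensor product, applied to `1`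
  -- operators on the single factors of the two bracketings of the triple tensor product
  let L := Module.End.rTensorAlgHom Cq (A ⊗[Cq] A) A
  let R := Module.End.lTensorAlgHom Cq A (A ⊗[Cq] A)
  let L' := Module.End.rTensorAlgHom Cq A (A ⊗[Cq] A)
  let R' := Module.End.lTensorAlgHom Cq (A ⊗[Cq] A) A
  let σ₂ := leftOp A (parityEnd s) * rightOp A (parityEnd s)
  have hσ₂ : σ₂ * σ₂ = 1 := TensorProduct.ext' fun c d => by
    change s (s c) ⊗ₜ[Cq] s (s d) = c ⊗ₜ d
    rw [hs, hs]
  have hLR : ∀ f g, L f * R g = R g * L f := fun f g => TensorProduct.ext' fun x y => rfl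
  have hLR' : ∀ f g, L' f * R' g = R' g * L' f := fun f g => TensorProduct.ext' fun x y => rfl
  obtain ⟨F₀, hFt, hFX⟩ := exists_superLift hs (L.comp ((sqReg s).comp D.comulHom)) (R.comp (lreg A)) (L σ₂)
    (by rw [← map_mul, hσ₂, map_one]) (fun x => hLR _ _)
    (fun x => by
      change L σ₂ * L (sqReg s (D.comulHom x)) = L (sqReg s (D.comulHom (s x))) * L σ₂
      rw [← map_mul, ← map_mul, sqReg_parity hs, D.comulHom_parity])
    (fun x y => hLR _ _) D.point.parity
  obtain ⟨G₀, hGt, hGX⟩ := exists_superLift hs (L'.comp (lreg A)) (R'.comp ((sqReg s).comp D.comulHom))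
    (L' (parityEnd s)) (by rw [← map_mul, hσ, map_one]) (fun x => hLR' _ _)
    (fun x => by
      change L' (parityEnd s) * L' (lreg A x) = L' (lreg A (s x)) * L' (parityEnd s)
      rw [← map_mul, ← map_mul, parityEnd_mul_lreg])
    (fun x y => hLR' _ _) D.point.parity
  let e := TensorProduct.assoc Cq A A A
  -- the two morphisms agree on the generators, by the associativity of the matrix product
  have hFG : (e.conjAlgEquiv Cq).toAlgHom.comp (F₀.comp D.comulHom) = G₀.comp D.comulHom := by
    refine Generates.algHom_ext (B := Module.End Cq (A ⊗[Cq] (A ⊗[Cq] A))) D.gen fun i j => ?_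
    rw [AlgHom.comp_apply, AlgHom.comp_apply, AlgHom.comp_apply, D.comulHom_X, hFX, hGX]
    refine TensorProduct.ext' fun c w => ?_
    induction w with
    | zero => simp
    | add w w' hw hw' => rw [TensorProduct.tmul_add, map_add, map_add, hw, hw']
    | tmul d f =>
      rw [LinearMap.sum_apply]
      have h1 : ∀ l, ((L.comp ((sqReg s).comp D.comulHom)) (X i l) *
          (L σ₂ ^ (p l + p j) * (R.comp (lreg A)) (X l j))) ((c ⊗ₜ d) ⊗ₜ f) =
          ∑ k, ((X i k * (parityEnd s ^ (p k + p j)) c) ⊗ₜ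
            (X k l * (parityEnd s ^ (p l + p j)) d)) ⊗ₜ (X l j * f) := fun l => by
        have h2 : (σ₂ ^ (p l + p j)) (c ⊗ₜ d) =
            (parityEnd s ^ (p l + p j)) c ⊗ₜ (parityEnd s ^ (p l + p j)) d := by
          have : σ₂ ^ (p l + p j) = leftOp A (parityEnd s ^ (p l + p j)) *
              rightOp A (parityEnd s ^ (p l + p j)) := by
            rw [map_pow, map_pow]
            exact Commute.mul_pow (leftOp_mul_rightOp _ _) _
          rw [this]
          rfl
        rw [← map_pow]
        change (sqReg s (D.comulHom (X i l)) ((σ₂ ^ (p l + p j)) (c ⊗ₜ d))) ⊗ₜ[Cq] (X l j * f) = _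
        rw [h2, D.comulHom_X, sqReg_comulMatrix_tmul hs D.point.parity, TensorProduct.sum_tmul]
        refine Finset.sum_congr rfl fun k _ => ?_
        rw [← Module.End.mul_apply, ← pow_add]
        have : parityEnd s ^ (p k + p l + (p l + p j)) = parityEnd s ^ (p k + p j) := by
          rw [show p k + p l + (p l + p j) = p k + p j + (p l + p l) by ring, pow_add, pow_add _ (p l),
            pow_mul_pow_self hσ, mul_one]
        rw [this]
      have h3 : ∀ k, ((L'.comp (lreg A)) (X i k) * (L' (parityEnd s) ^ (p k + p j) *
          (R'.comp ((sqReg s).comp D.comulHom)) (X k j))) (c ⊗ₜ (d ⊗ₜ f)) =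
          ∑ l, (X i k * (parityEnd s ^ (p k + p j)) c) ⊗ₜ
            ((X k l * (parityEnd s ^ (p l + p j)) d) ⊗ₜ (X l j * f)) := fun k => by
        rw [← map_pow]
        change (X i k * (parityEnd s ^ (p k + p j)) c) ⊗ₜ[Cq]
          (sqReg s (D.comulHom (X k j)) (d ⊗ₜ f)) = _
        rw [D.comulHom_X, sqReg_comulMatrix_tmul hs D.point.parity, TensorProduct.tmul_sum]
      rw [Finset.sum_congr rfl fun k _ => h3 k]
      change e ((∑ l, _ : Module.End Cq ((A ⊗[Cq] A) ⊗[Cq] A)) ((c ⊗ₜ d) ⊗ₜ f)) = _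
      rw [LinearMap.sum_apply, Finset.sum_congr rfl fun l _ => h1 l]
      simp only [map_sum]
      rw [Finset.sum_comm]
      rfl
  -- applied to `1`, they give the two sides
  have hF : ∀ z, F₀ (toSq s z) ((1 ⊗ₜ 1) ⊗ₜ 1) = D.comul.rTensor A z := fun z => by
    induction z with
    | zero => simp
    | add z w hz hw => rw [map_add, map_add, LinearMap.add_apply, hz, hw, map_add]
    | tmul x y =>
      have h1 : ∀ i, ∀ y ∈ parityPart s i, F₀ (toSq s (x ⊗ₜ y)) ((1 ⊗ₜ 1) ⊗ₜ 1) =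
          D.comul x ⊗ₜ y := fun i y hy => by
        rw [hFt i y hy, ← map_pow]
        change (sqReg s (D.comulHom x) ((σ₂ ^ i.val) (1 ⊗ₜ 1))) ⊗ₜ[Cq] (y * 1) = _
        have h2 : σ₂ (1 ⊗ₜ[Cq] 1) = 1 ⊗ₜ 1 := by
          change s 1 ⊗ₜ[Cq] s 1 = _
          rw [map_one]
        rw [Module.End.pow_apply, Function.iterate_fixed h2, mul_one]
        exact congrArg (· ⊗ₜ[Cq] y) (congrArg (toSq s).symm (mul_one _))
      obtain ⟨y₀, h₀, y₁, h₁, rfl⟩ := even_add_odd hs y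
      rw [TensorProduct.tmul_add, map_add, map_add, LinearMap.add_apply, h1 _ _ h₀, h1 _ _ h₁,
        map_add]
      rfl
  have hG : ∀ z, G₀ (toSq s z) (1 ⊗ₜ (1 ⊗ₜ 1)) = D.comul.lTensor A z := fun z => by
    induction z with
    | zero => simp
    | add z w hz hw => rw [map_add, map_add, LinearMap.add_apply, hz, hw, map_add]
    | tmul x y =>
      have h1 : ∀ i, ∀ y ∈ parityPart s i, G₀ (toSq s (x ⊗ₜ y)) (1 ⊗ₜ (1 ⊗ₜ 1)) =
          x ⊗ₜ D.comul y := fun i y hy => by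
        rw [hGt i y hy, ← map_pow]
        change (x * (parityEnd s ^ i.val) 1) ⊗ₜ[Cq] (sqReg s (D.comulHom y) (1 ⊗ₜ 1)) = _
        rw [parityEnd_pow_one, mul_one]
        exact congrArg (x ⊗ₜ[Cq] ·) (congrArg (toSq s).symm (mul_one _))
      obtain ⟨y₀, h₀, y₁, h₁, rfl⟩ := even_add_odd hs y
      rw [TensorProduct.tmul_add, map_add, map_add, LinearMap.add_apply, h1 _ _ h₀, h1 _ _ h₁,
        map_add]
      rfl
  ext x
  have h := congrArg (fun f : Module.End Cq (A ⊗[Cq] (A ⊗[Cq] A)) => f (1 ⊗ₜ (1 ⊗ₜ 1)))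
    (DFunLike.congr_fun hFG x)
  change e (F₀ (D.comulHom x) ((1 ⊗ₜ 1) ⊗ₜ 1)) = G₀ (D.comulHom x) (1 ⊗ₜ (1 ⊗ₜ 1)) at h
  rw [← D.toSq_comul, hF, hG] at h
  exact h

theorem rTensor_counit : D.counitHom.toLinearMap.rTensor A ∘ₗ D.comul =
    TensorProduct.mk Cq Cq A 1 := by
  have hs := D.invol
  obtain ⟨F, hFt, hFX⟩ := exists_superLift hs ((Algebra.ofId Cq A).comp D.counitHom)
    (AlgHom.id Cq A) 1 (one_mul 1) (fun x => by rw [one_mul, mul_one])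
    (fun x => by rw [one_mul, mul_one, AlgHom.comp_apply, AlgHom.comp_apply, D.counitHom_parity])
    (fun x y => Algebra.commutes (D.counitHom x) y) D.point.parity
  have hF : F.comp D.comulHom = AlgHom.id Cq A := D.gen.algHom_ext fun i j => by
    rw [AlgHom.comp_apply, D.comulHom_X, hFX,
      Finset.sum_eq_single i (fun k _ hk => by
        rw [AlgHom.comp_apply, D.counitHom_X, if_neg hk.symm, map_zero, zero_mul]) (by simp),
      AlgHom.comp_apply, D.counitHom_X, if_pos rfl, map_one, one_mul, one_pow, one_mul]
  have hz : ∀ z, F (toSq s z) = TensorProduct.lid Cq A (D.counitHom.toLinearMap.rTensor A z) :=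
    fun z => by
      induction z with
      | zero => simp
      | add z w hz hw => rw [map_add, map_add, hz, hw, map_add, map_add]
      | tmul x y =>
        have h1 : ∀ i, ∀ y ∈ parityPart s i, F (toSq s (x ⊗ₜ y)) = D.counitHom x • y :=
          fun i y hy => by
            rw [hFt i y hy, one_pow, one_mul]
            exact (Algebra.smul_def _ _).symm
        obtain ⟨y₀, h₀, y₁, h₁, rfl⟩ := even_add_odd hs y
        rw [TensorProduct.tmul_add, map_add, map_add, h1 _ _ h₀, h1 _ _ h₁, ← smul_add,
          ← TensorProduct.tmul_add]
        rfl
  ext x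
  apply (TensorProduct.lid Cq A).injective
  rw [LinearMap.comp_apply, ← hz, D.toSq_comul]
  refine (DFunLike.congr_fun hF x).trans ?_
  simp

theorem lTensor_counit : D.counitHom.toLinearMap.lTensor A ∘ₗ D.comul =
    (TensorProduct.mk Cq A Cq).flip 1 := by
  have hs := D.invol
  have hσ := parityEnd_mul_self hs
  obtain ⟨F, hFt, hFX⟩ := exists_superLift hs (lreg A)
    ((Algebra.ofId Cq (Module.End Cq A)).comp D.counitHom) (parityEnd s) hσ
    (fun x => (Algebra.commutes (D.counitHom x) _).symm) (parityEnd_mul_lreg s)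
    (fun x y => (Algebra.commutes (D.counitHom y) _).symm) D.point.parity
  have hF : F.comp D.comulHom = lreg A := D.gen.algHom_ext fun i j => by
    rw [AlgHom.comp_apply, D.comulHom_X, hFX,
      Finset.sum_eq_single j (fun k _ hk => by
        rw [AlgHom.comp_apply, D.counitHom_X, if_neg hk, map_zero, mul_zero, mul_zero]) (by simp),
      AlgHom.comp_apply, D.counitHom_X, if_pos rfl, map_one, mul_one, pow_add,
      pow_mul_pow_self hσ, mul_one]
  have hz : ∀ z, F (toSq s z) 1 = TensorProduct.rid Cq A (D.counitHom.toLinearMap.lTensor A z) :=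
    fun z => by
      induction z with
      | zero => simp
      | add z w hz hw => rw [map_add, map_add, LinearMap.add_apply, hz, hw, map_add, map_add]
      | tmul x y =>
        have h1 : ∀ i, ∀ y ∈ parityPart s i, F (toSq s (x ⊗ₜ y)) 1 = D.counitHom y • x :=
          fun i y hy => by
            rw [hFt i y hy, AlgHom.comp_apply, Algebra.ofId_apply, ← Algebra.commutes,
              ← Algebra.smul_def]
            change x * (D.counitHom y • (parityEnd s ^ i.val) 1) = _
            rw [parityEnd_pow_one, mul_smul_comm, mul_one]
        obtain ⟨y₀, h₀, y₁, h₁, rfl⟩ := even_add_odd hs y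
        rw [TensorProduct.tmul_add, map_add, map_add, LinearMap.add_apply, h1 _ _ h₀, h1 _ _ h₁,
          ← add_smul, ← map_add, ← TensorProduct.tmul_add]
        rfl
  ext x
  apply (TensorProduct.rid Cq A).injective
  rw [LinearMap.comp_apply, ← hz, D.toSq_comul]
  refine (congrArg (fun f : Module.End Cq A => f 1) (DFunLike.congr_fun hF x)).trans ?_
  simp

theorem neg_one_pow_val_natCast_mul (k r : ℕ) :
    (-1 : Cq) ^ ((k : ZMod 2).val * r) = (-1) ^ (k * r) := by
  rw [ZMod.val_natCast, pow_mul, ← neg_one_pow_eq_pow_mod_two, ← pow_mul]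

theorem antipode_X (i j : Fin (m + n)) : D.antipode (X i j) = b i j :=
  untwist_generator _ (D.point.parity i j) (D.antipodeHom_X i j)

theorem antipode_one : D.antipode 1 = 1 := untwist_one _

theorem antipode_mul {i j : ZMod 2} {x y : A} (hx : x ∈ parityPart s i)
    (hy : y ∈ parityPart s j) : D.antipode (x * y) =
      (-1 : Cq) ^ (i.val * j.val) • (D.antipode y * D.antipode x) := untwist_mul _ hx hy

theorem antipode_mem {i : ZMod 2} {x : A} (hx : x ∈ parityPart s i) :
    D.antipode x ∈ parityPart s i :=
  untwist_mem (untwist_parity D.gen D.point.parity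
    (D.point.inverse_parity D.invol D.mul_inv D.inv_mul) D.antipodeHom_X) hx

/-- `S(x₍₁₎ c) x₍₂₎ d = ε(x) S(c) d` with the Koszul signs. -/
theorem mul_antipode_rTensor_sqReg (x : A) (z : A ⊗[Cq] A) :
    LinearMap.mul' Cq A (D.antipode.rTensor A (sqReg s (D.comulHom x) z)) =
      D.counitHom x • LinearMap.mul' Cq A (D.antipode.rTensor A z) := by
  let μ : A ⊗[Cq] A →ₗ[Cq] A := LinearMap.mul' Cq A ∘ₗ D.antipode.rTensor A
  -- the elements for which the identity holds for all `z` form a subalgebra, closed under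
  -- inverses
  let U : Subalgebra Cq A :=
    { carrier := {x | ∀ z, μ (sqReg s (D.comulHom x) z) = D.counitHom x • μ z}
      mul_mem' := fun {x y} hx hy z => by
        rw [map_mul, map_mul, Module.End.mul_apply, hx, hy, map_mul, mul_smul]
      add_mem' := fun {x y} hx hy z => by
        rw [map_add, map_add, LinearMap.add_apply, map_add, hx, hy, map_add, add_smul]
      algebraMap_mem' := fun r z => by
        rw [AlgHom.commutes, AlgHom.commutes, AlgHom.commutes, Module.algebraMap_end_apply,
          map_smul]
        rfl }
  refine D.gen U (fun i j => ?_) (fun x hx y hxy hyx z => ?_) x z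
  · change ∀ z, _
    intro z
    induction z with
    | zero => simp
    | add z w hz hw => rw [map_add, map_add, hz, hw, map_add, smul_add]
    | tmul c d =>
      have key : ∀ r, ∀ c ∈ parityPart s r, μ (sqReg s (D.comulHom (X i j)) (c ⊗ₜ d)) =
          D.counitHom (X i j) • μ (c ⊗ₜ d) := fun r c hc => by
        rw [D.comulHom_X, sqReg_comulMatrix_tmul D.invol D.point.parity, map_sum]
        -- on generators the identity is `b X = 1`
        have h1 : ∀ k, μ ((X i k * (parityEnd s ^ (p k + p j)) c) ⊗ₜ (X k j * d)) =
            (-1 : Cq) ^ ((p i + p j) * r.val) • (D.antipode c * (b i k * X k j) * d) := fun k => by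
          change D.antipode (X i k * (parityEnd s ^ (p k + p j)) c) * (X k j * d) = _
          rw [parityEnd_pow_apply hc, mul_smul_comm, map_smul,
            D.antipode_mul (mem_parityPart_natCast (D.point.parity i k)) hc, D.antipode_X,
            neg_one_pow_val_natCast_mul, smul_smul, ← pow_add, smul_mul_assoc]
          simp only [mul_assoc]
          exact congrArg (· • _) (neg_one_pow_congr (by grind))
        rw [Finset.sum_congr rfl fun k _ => h1 k, ← Finset.smul_sum, ← Finset.sum_mul,
          ← Finset.mul_sum, ← Matrix.mul_apply, D.inv_mul, D.counitHom_X, Matrix.one_apply]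
        split_ifs with hij
        · rw [hij, one_smul, mul_one, (Even.neg_one_pow (by grind) : (-1 : Cq) ^ _ = 1), one_smul]
          rfl
        · simp
      obtain ⟨c₀, h₀, c₁, h₁, rfl⟩ := even_add_odd D.invol c
      rw [TensorProduct.add_tmul, map_add, map_add, key _ _ h₀, key _ _ h₁, map_add, smul_add]
  · have h1 := hx (sqReg s (D.comulHom y) z)
    rw [← Module.End.mul_apply, ← map_mul, ← map_mul, hxy, map_one, map_one,
      Module.End.one_apply] at h1
    rw [h1, smul_smul, ← map_mul, hyx, map_one, one_smul]

/-- `c x₍₁₎ S(d x₍₂₎) = ε(x) c S(d)` with the Koszul signs. -/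
theorem mul_antipode_lTensor_mul (x : A) (z : SuperSq s) :
    LinearMap.mul' Cq A (D.antipode.lTensor A ((toSq s).symm (z * D.comulHom x))) =
      D.counitHom x • LinearMap.mul' Cq A (D.antipode.lTensor A ((toSq s).symm z)) := by
  let μ : SuperSq s →ₗ[Cq] A :=
    LinearMap.mul' Cq A ∘ₗ D.antipode.lTensor A ∘ₗ (toSq s).symm.toLinearMap
  let U : Subalgebra Cq A :=
    { carrier := {x | ∀ z, μ (z * D.comulHom x) = D.counitHom x • μ z}
      mul_mem' := fun {x y} hx hy z => by
        rw [map_mul D.comulHom, ← mul_assoc, hy, hx, map_mul D.counitHom, mul_comm, mul_smul]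
      add_mem' := fun {x y} hx hy z => by
        rw [map_add, mul_add, map_add, hx, hy, map_add, add_smul]
      algebraMap_mem' := fun r z => by
        rw [AlgHom.commutes, AlgHom.commutes, ← Algebra.commutes, ← Algebra.smul_def, map_smul]
        rfl }
  refine D.gen U (fun i j => ?_) (fun x hx y hxy hyx z => ?_) x z
  · change ∀ z, _
    intro z
    obtain ⟨z, rfl⟩ := (toSq s).surjective z
    induction z with
    | zero => simp
    | add z w hz hw => rw [map_add, add_mul, map_add, hz, hw, map_add, smul_add]
    | tmul c d =>
      have key : ∀ r, ∀ d ∈ parityPart s r, μ (toSq s (c ⊗ₜ d) * D.comulHom (X i j)) =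
          D.counitHom (X i j) • μ (toSq s (c ⊗ₜ d)) := fun r d hd => by
        rw [D.comulHom_X, QuantumSuper.comulMatrix, Matrix.mul_apply, Finset.mul_sum, map_sum]
        -- on generators the identity is `X b = 1`
        have h1 : ∀ k, μ (toSq s (c ⊗ₜ d) * (X.map (incL s) i k * X.map (incR s) k j)) =
            (-1 : Cq) ^ ((p i + p j) * r.val) • (c * (X i k * b k j) * D.antipode d) := fun k => by
          rw [← incL_mul_incR, Matrix.map_apply, Matrix.map_apply, mul_assoc (incL s c),
            ← mul_assoc (incR s d),
            incR_mul_incL_of_mem (mem_parityPart_natCast (D.point.parity i k)) hd,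
            smul_mul_assoc, mul_smul_comm, map_smul, mul_assoc (incL s (X i k)), ← map_mul,
            ← mul_assoc, ← map_mul, incL_mul_incR]
          change (-1 : Cq) ^ _ • (c * X i k * D.antipode (d * X k j)) = _
          rw [D.antipode_mul hd (mem_parityPart_natCast (D.point.parity k j)), D.antipode_X,
            mul_comm r.val, mul_comm r.val, neg_one_pow_val_natCast_mul,
            neg_one_pow_val_natCast_mul, mul_smul_comm, smul_smul, ← pow_add]
          simp only [mul_assoc]
          exact congrArg (· • _) (neg_one_pow_congr (by grind))
        rw [Finset.sum_congr rfl fun k _ => h1 k, ← Finset.smul_sum, ← Finset.sum_mul,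
          ← Finset.mul_sum, ← Matrix.mul_apply, D.mul_inv, D.counitHom_X, Matrix.one_apply]
        split_ifs with hij
        · rw [hij, one_smul, mul_one, (Even.neg_one_pow (by grind) : (-1 : Cq) ^ _ = 1), one_smul]
          rfl
        · simp
      obtain ⟨d₀, h₀, d₁, h₁, rfl⟩ := even_add_odd D.invol d
      rw [TensorProduct.tmul_add, map_add, add_mul, map_add, key _ _ h₀, key _ _ h₁, map_add,
        smul_add]
  · have h1 := hx (z * D.comulHom y)
    rw [mul_assoc, ← map_mul, hyx, map_one, mul_one] at h1
    rw [h1, smul_smul, ← map_mul, hyx, map_one, one_smul]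

end HopfData

variable {s : A →ₐ[Cq] A} [GradedAlgebra (parityPart s)]

theorem sqParity_of_mem_tensorPart {i : ZMod 2} {z : A ⊗[Cq] A}
    (hz : z ∈ tensorPart (parityPart s) (parityPart s) i) :
    sqParity s (toSq s z) = (-1 : Cq) ^ i.val • toSq s z := by
  induction hz using Submodule.span_induction with
  | zero => simp
  | add z w _ _ hz hw => rw [map_add, map_add, hz, hw, smul_add]
  | smul r z _ hz => rw [map_smul, map_smul, hz, smul_comm]
  | mem z hz =>
    obtain ⟨j, k, rfl, a, ha, b, hb, rfl⟩ := hz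
    rw [← incL_mul_incR, map_mul, sqParity_incL, sqParity_incR, mem_parityPart.1 ha,
      mem_parityPart.1 hb, map_smul, map_smul, smul_mul_smul_comm, neg_one_pow_val_add]

/-- The grading of the tensor square is the eigenspace decomposition of its parity automorphism.
-/
theorem mem_tensorPart (hs : ∀ x, s (s x) = x) {i : ZMod 2} {z : A ⊗[Cq] A}
    (hz : sqParity s (toSq s z) = (-1 : Cq) ^ i.val • toSq s z) :
    z ∈ tensorPart (parityPart s) (parityPart s) i := by
  have hsplit : ∃ z₀ ∈ tensorPart (parityPart s) (parityPart s) 0,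
      ∃ z₁ ∈ tensorPart (parityPart s) (parityPart s) 1, z = z₀ + z₁ := by
    clear hz
    induction z with
    | zero => exact ⟨0, zero_mem _, 0, zero_mem _, (add_zero 0).symm⟩
    | add z w hz hw =>
      obtain ⟨z₀, h₀, z₁, h₁, rfl⟩ := hz
      obtain ⟨w₀, k₀, w₁, k₁, rfl⟩ := hw
      exact ⟨_, add_mem h₀ k₀, _, add_mem h₁ k₁, by abel⟩
    | tmul x y =>
      obtain ⟨x₀, hx₀, x₁, hx₁, rfl⟩ := even_add_odd hs x
      obtain ⟨y₀, hy₀, y₁, hy₁, rfl⟩ := even_add_odd hs y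
      have h : ∀ {i j k : ZMod 2} {x y : A}, x ∈ parityPart s i → y ∈ parityPart s j →
          i + j = k → x ⊗ₜ[Cq] y ∈ tensorPart (parityPart s) (parityPart s) k :=
        fun hx hy hk => Submodule.subset_span ⟨_, _, hk, _, hx, _, hy, rfl⟩
      refine ⟨_, add_mem (h hx₀ hy₀ rfl) (h hx₁ hy₁ rfl), _,
        add_mem (h hx₀ hy₁ rfl) (h hx₁ hy₀ rfl), ?_⟩
      rw [TensorProduct.add_tmul, TensorProduct.tmul_add, TensorProduct.tmul_add]
      abel
  have h2 : ∀ w : A ⊗[Cq] A, w + w = 0 → w = 0 := fun w hw => by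
    have : (2 : Cq) • w = 0 := by rw [two_smul, hw]
    rw [← invOf_smul_smul (2 : Cq) w, this, smul_zero]
  obtain ⟨z₀, h₀, z₁, h₁, rfl⟩ := hsplit
  rw [map_add, map_add, sqParity_of_mem_tensorPart h₀, sqParity_of_mem_tensorPart h₁] at hz
  have hz' := congrArg (toSq s).symm hz
  simp only [ZMod.val_zero, ZMod.val_one, pow_zero, pow_one, one_smul, neg_smul, map_add, map_neg,
    map_smul, LinearEquiv.symm_apply_apply] at hz'
  rcases zmod_two_cases i with rfl | rfl
  · rw [h2 z₁, add_zero]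
    · exact h₀
    · simp only [ZMod.val_zero, pow_zero, one_smul] at hz'
      linear_combination (norm := module) -hz'
  · rw [h2 z₀, zero_add]
    · exact h₁
    · simp only [ZMod.val_one, pow_one, neg_smul, one_smul] at hz'
      linear_combination (norm := module) hz'

/-- The Hopf superalgebra structure of a Hopf datum. -/
def HopfData.hopf {t : Cqˣ} {X b : Matrix (Fin (m + n)) (Fin (m + n)) A} (D : HopfData t s X b) :
    HopfSuperalgebra Cq (parityPart s) where
  comul := D.comul
  counit := D.counitHom.toLinearMap
  coassoc := D.coassoc
  rTensor_counit_comp_comul := D.rTensor_counit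
  lTensor_counit_comp_comul := D.lTensor_counit
  comul_mem i x hx := mem_tensorPart D.invol (by
    rw [D.toSq_comul, ← D.comulHom_parity, mem_parityPart.1 hx, map_smul])
  comul_one := (congrArg (toSq s).symm (map_one D.comulHom)).trans rfl
  comul_mul x y := map_mul D.comulHom x y
  counit_odd x hx := by
    have h := D.counitHom_parity x
    rw [mem_parityPart_one.1 hx, map_neg] at h
    -- an odd element has `2 ε(x) = 0`, and `2` is invertible
    have h2 : (2 : Cq) * D.counitHom x = 0 := by linear_combination -h
    exact (invOf_mul_cancel_left (2 : Cq) (D.counitHom x)).symm.trans (by rw [h2, mul_zero])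
  counit_one := map_one D.counitHom
  counit_mul := map_mul D.counitHom
  antipode := D.antipode
  antipode_mem i x hx := D.antipode_mem hx
  mul_antipode_rTensor_comul := by
    ext x
    have h := D.mul_antipode_rTensor_sqReg x (1 ⊗ₜ 1)
    have h1 : sqReg s (D.comulHom x) (1 ⊗ₜ 1) = D.comul x :=
      congrArg (toSq s).symm (mul_one _)
    rw [h1] at h
    refine h.trans ?_
    rw [LinearMap.rTensor_tmul, LinearMap.mul'_apply, D.antipode_one, mul_one]
    exact (Algebra.algebraMap_eq_smul_one _).symm
  mul_antipode_lTensor_comul := by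
    ext x
    have h := D.mul_antipode_lTensor_mul x 1
    rw [one_mul] at h
    refine h.trans ?_
    rw [show (toSq s).symm 1 = 1 ⊗ₜ 1 from rfl, LinearMap.lTensor_tmul, LinearMap.mul'_apply,
      D.antipode_one, mul_one]
    exact (Algebra.algebraMap_eq_smul_one _).symm

end Hopf

/-! ### Morphisms and uniqueness of Hopf structures -/

section HopfMorphism

variable {A B : Type} [Ring A] [Algebra Cq A] [Ring B] [Algebra Cq B] {s : A →ₐ[Cq] A}
  {s' : B →ₐ[Cq] B}

/-- A parity-preserving morphism that is compatible with two morphisms to the opposite algebras is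
compatible with the corresponding antimorphisms. -/
theorem untwist_comp {f : A →ₐ[Cq] B} {g : A →ₐ[Cq] Aᵐᵒᵖ} {g' : B →ₐ[Cq] Bᵐᵒᵖ}
    (hs : ∀ x, s (s x) = x) (hf : ∀ x, s' (f x) = f (s x))
    (h : ∀ x, g' (f x) = MulOpposite.op (f (MulOpposite.unop (g x)))) (x : A) :
    untwist s' g' (f x) = f (untwist s g x) := by
  have hmem : ∀ i, ∀ x ∈ parityPart s i, f x ∈ parityPart s' i := fun i x hx => by
    rw [mem_parityPart, hf, mem_parityPart.1 hx, map_smul]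
  refine DFunLike.congr_fun (eq_of_homogeneous hs (f := untwist s' g' ∘ₗ f.toLinearMap)
    (g := f.toLinearMap ∘ₗ untwist s g) fun i x hx => ?_) x
  change untwist s' g' (f x) = f (untwist s g x)
  rcases zmod_two_cases i with rfl | rfl
  · rw [untwist_even _ (hmem _ _ hx), untwist_even _ hx, h, MulOpposite.unop_op]
  · rw [untwist_odd _ (hmem _ _ hx), untwist_odd _ hx, h, MulOpposite.unop_op, map_neg, map_smul]

variable [GradedAlgebra (parityPart s)] [GradedAlgebra (parityPart s')]

/-- A morphism of superalgebras induces a morphism of the super tensor squares. -/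
theorem exists_sqMap {f : A →ₐ[Cq] B} (hf : ∀ x, s' (f x) = f (s x)) :
    ∃ F : SuperSq s →ₐ[Cq] SuperSq s',
      ∀ z, F (toSq s z) = toSq s' (TensorProduct.map f.toLinearMap f.toLinearMap z) := by
  have hmem : ∀ {i x}, x ∈ parityPart s i → f x ∈ parityPart s' i := fun {i x} hx => by
    rw [mem_parityPart, hf, mem_parityPart.1 hx, map_smul]
  refine ⟨GradedTensorProduct.lift (parityPart s) (parityPart s) ((incL s').comp f)
    ((incR s').comp f) (fun i j a b => ?_), fun z => ?_⟩
  · rw [neg_one_uzpow_mul, intUnits_smul, AlgHom.comp_apply, AlgHom.comp_apply,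
      incR_mul_incL_of_mem (hmem a.2) (hmem b.2), smul_smul, ← mul_pow]
    simp
  · induction z with
    | zero => simp
    | add z w hz hw => rw [map_add, map_add, hz, hw, map_add, map_add]
    | tmul x y =>
      exact (GradedTensorProduct.lift_tmul _ _ _ _ _ _ _).trans (incL_mul_incR _ _)

variable {m n : ℕ} {t : Cqˣ} {X b : Matrix (Fin (m + n)) (Fin (m + n)) A}
  {X' b' : Matrix (Fin (m + n)) (Fin (m + n)) B}

/-- A morphism that maps the generating matrix of a Hopf datum to that of another one is a
morphism of Hopf superalgebras, since all structure maps are determined by their values on the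
generators. -/
theorem HopfData.isHopfMorphism (D : HopfData t s X b) (D' : HopfData t s' X' b')
    (f : A →ₐ[Cq] B) (hf : ∀ i j, f (X i j) = X' i j) : IsHopfMorphism D.hopf D'.hopf f := by
  have hX : X.map f = X' := Matrix.ext hf
  have hs : ∀ x, s' (f x) = f (s x) := by
    have : s'.comp f = f.comp s := D.gen.algHom_ext fun i j => by
      rw [AlgHom.comp_apply, AlgHom.comp_apply, hf, D'.point.parity, D.point.parity, map_smul, hf]
    exact DFunLike.congr_fun this
  have hb : b.map f = b' := by
    refine inverse_unique (x := X') ?_ D'.mul_inv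
    rw [← hX]
    exact map_one_matrix f D.inv_mul
  constructor
  · intro i x hx
    rw [mem_parityPart, hs, mem_parityPart.1 hx, map_smul]
  · intro x
    obtain ⟨F, hF⟩ := exists_sqMap hs
    apply (toSq s').injective
    rw [← hF]
    have hFL : ∀ x, F (incL s x) = incL s' (f x) := fun x =>
      (hF (x ⊗ₜ 1)).trans (congrArg (fun y => toSq s' (f x ⊗ₜ y)) (map_one f))
    have hFR : ∀ x, F (incR s x) = incR s' (f x) := fun x =>
      (hF (1 ⊗ₜ x)).trans (congrArg (fun y => toSq s' (y ⊗ₜ f x)) (map_one f))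
    have : D'.comulHom.comp f = F.comp D.comulHom := D.gen.algHom_ext fun i j => by
      rw [AlgHom.comp_apply, AlgHom.comp_apply, hf, D'.comulHom_X, D.comulHom_X, comulMatrix,
        comulMatrix, Matrix.mul_apply, Matrix.mul_apply, map_sum]
      refine Finset.sum_congr rfl fun k _ => ?_
      rw [map_mul, Matrix.map_apply, Matrix.map_apply, Matrix.map_apply, Matrix.map_apply, hFL,
        hFR, hf, hf]
    exact DFunLike.congr_fun this x
  · intro x
    have : D'.counitHom.comp f = D.counitHom := D.gen.algHom_ext fun i j => by
      rw [AlgHom.comp_apply, hf, D'.counitHom_X, D.counitHom_X]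
    exact DFunLike.congr_fun this x
  · refine untwist_comp D.invol hs fun x => ?_
    have : D'.antipodeHom.comp f = (AlgHom.op f).comp D.antipodeHom :=
      D.gen.algHom_ext fun i j => by
        rw [AlgHom.comp_apply, AlgHom.comp_apply, hf, D'.antipodeHom_X, D.antipodeHom_X, map_smul,
          ← hb]
        rfl
    exact DFunLike.congr_fun this x

end HopfMorphism

section Uniqueness

variable {A : Type} [Ring A] [Algebra Cq A]

/-- The antipode is the inverse of the identity for the convolution product. -/
theorem HopfSuperalgebra.eq_of_comul_counit {𝒜 : ZMod 2 → Submodule Cq A} [GradedAlgebra 𝒜]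
    {H K : HopfSuperalgebra Cq 𝒜} (h : H.comul = K.comul) (h' : H.counit = K.counit) : H = K := by
  have hS : H.antipode = K.antipode := by
    letI := H.toCoalgebra
    have h1 : WithConv.toConv H.antipode * WithConv.toConv LinearMap.id = 1 :=
      congrArg WithConv.toConv H.mul_antipode_rTensor_comul
    have h2 : WithConv.toConv (LinearMap.id : A →ₗ[Cq] A) * WithConv.toConv K.antipode = 1 := by
      have := K.mul_antipode_lTensor_comul
      rw [← h, ← h'] at this
      exact congrArg WithConv.toConv this
    exact WithConv.toConv_injective (left_inv_eq_right_inv h1 h2)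
  obtain @⟨@⟨⟨Δ, ε⟩, _, _, _⟩⟩ := H
  obtain @⟨@⟨⟨Δ', ε'⟩, _, _, _⟩⟩ := K
  cases h
  cases h'
  cases hS
  rfl

variable {m n : ℕ} {t : Cqˣ} {s : A →ₐ[Cq] A} [GradedAlgebra (parityPart s)]
  {X b : Matrix (Fin (m + n)) (Fin (m + n)) A}

/-- A Hopf structure with the given comultiplication and counit on the generators is unique. -/
theorem HopfData.eq_hopf (D : HopfData t s X b) (H : HopfSuperalgebra Cq (parityPart s))
    (hΔ : ∀ i j, H.comul (X i j) = ∑ k, X i k ⊗ₜ X k j)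
    (hε : ∀ i j, H.counit (X i j) = if i = j then 1 else 0) : H = D.hopf := by
  apply HopfSuperalgebra.eq_of_comul_counit
  · let F : A →ₐ[Cq] SuperSq s := AlgHom.ofLinearMap ((toSq s).toLinearMap ∘ₗ H.comul)
      (congrArg (toSq s) H.comul_one) H.comul_mul
    have : F = D.comulHom := D.gen.algHom_ext fun i j => by
      rw [D.comulHom_X, comulMatrix_apply]
      exact congrArg (toSq s) (hΔ i j)
    exact LinearMap.ext fun x => (toSq s).injective (DFunLike.congr_fun this x)
  · let F : A →ₐ[Cq] Cq := AlgHom.ofLinearMap H.counit H.counit_one H.counit_mul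
    have : F = D.counitHom := D.gen.algHom_ext fun i j => by
      rw [D.counitHom_X]
      exact hε i j
    exact LinearMap.ext fun x => DFunLike.congr_fun this x

end Uniqueness

/-! ### The Hopf structures of the general and the special linear supergroup -/

section Standard

variable {t : Cqˣ} {m n : ℕ}

theorem IsQ.one {R : Type} [Ring R] [Algebra Cq R] :
    IsQ t (1 : Matrix (Fin (m + n)) (Fin (m + n)) R) where
  sq i j h := by
    rw [Matrix.one_apply_ne, zero_mul]
    rintro rfl
    omega
  row i j l h := by
    by_cases hj : i = j
    · rw [Matrix.one_apply_ne (hj ▸ h.ne : i ≠ l)]; simp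
    · rw [Matrix.one_apply_ne hj]; simp
  col i j k h := by
    by_cases hj : i = j
    · rw [Matrix.one_apply_ne (hj ▸ h.ne' : k ≠ j)]; simp
    · rw [Matrix.one_apply_ne hj]; simp
  comm i j k l h := by
    by_cases hj : i = j
    · rw [Matrix.one_apply_ne (show k ≠ l by omega)]; simp
    · rw [Matrix.one_apply_ne hj]; simp
  cross i j k l h h' := by
    have h1 : (1 : Matrix (Fin (m + n)) (Fin (m + n)) R) i l *
        (1 : Matrix (Fin (m + n)) (Fin (m + n)) R) k j = 0 := by
      by_cases hj : i = l
      · rw [Matrix.one_apply_ne (show k ≠ j by omega), mul_zero]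
      · rw [Matrix.one_apply_ne hj, zero_mul]
    rw [h1, smul_zero]
    by_cases hj : i = j
    · subst hj
      by_cases hk : k = l
      · subst hk
        rw [koszul, (Even.neg_one_pow (by grind) : (-1 : Cq) ^ _ = 1)]
        simp
      · rw [Matrix.one_apply_ne hk]; simp
    · rw [Matrix.one_apply_ne hj]; simp

theorem qdet_one {R : Type} [Ring R] [Algebra Cq R] {k : ℕ} (u : Cqˣ) :
    qdet u (1 : Matrix (Fin k) (Fin k) R) = 1 := by
  rw [qdet, Finset.sum_eq_single 1]
  · have h1 : permLength (1 : Equiv.Perm (Fin k)) = 0 := by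
      rw [permLength, Finset.card_eq_zero, Finset.filter_eq_empty_iff]
      rintro x - ⟨h, h'⟩
      exact lt_asymm h h'
    have h2 : (fun i => (1 : Matrix (Fin k) (Fin k) R) i ((1 : Equiv.Perm (Fin k)) i)) =
        fun _ => 1 := funext fun i => Matrix.one_apply_eq i
    rw [h1, h2]
    simp
  · intro σ _ hσ
    obtain ⟨i, hi⟩ : ∃ i, σ i ≠ i := by
      by_contra! h
      exact hσ (Equiv.ext h)
    rw [List.prod_eq_zero, smul_zero]
    rw [List.mem_ofFn]
    exact ⟨i, Matrix.one_apply_ne hi.symm⟩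
  · simp

theorem berezinian_one {R : Type} [Ring R] [Algebra Cq R] :
    berezinian t (1 : Matrix (Fin (m + n)) (Fin (m + n)) R) = 1 := by
  have h1 : RTT t⁻¹ (fun _ => 0) (1 : Matrix (Fin n) (Fin n) R) := by
    simpa [blockB_one] using (IsQ.one (t := t) (m := m) (n := n) (R := R)).blockB_rtt
  rw [berezinian, blockH, blockA_one, blockΛ_one, blockB_one, Matrix.mul_zero, sub_zero,
    h1.qantipode_eq (one_mul 1) (one_mul 1), qdet_one, qdet_one, one_mul]

/-- Inversion and the passage to the opposite algebra both invert the parameter. -/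
theorem IsPoint.inverse_op {A : Type} [Ring A] [Algebra Cq A] {s : A →ₐ[Cq] A}
    {X b : Matrix (Fin (m + n)) (Fin (m + n)) A} (h : IsPoint t s X) (hs : ∀ x, s (s x) = x)
    (hXb : X * b = 1) (hbX : b * X = 1) : IsPoint t (AlgHom.op s)
      (Matrix.of fun i j => rootSign i j • MulOpposite.op (b i j)) := by
  have := (h.inverse hs hXb hbX).op (s' := AlgHom.op s) fun x => rfl
  rwa [inv_inv] at this

namespace QGL

variable (t m n) in
/-- The inverse of the generic quantum supermatrix. -/
def b : Matrix (Fin (m + n)) (Fin (m + n)) (QGL t m n) :=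
  (isPoint t m n).inv (parity_involutive t m n)

theorem a_mul_b : a t m n * b t m n = 1 := (isPoint t m n).mul_inv (parity_involutive t m n)

theorem b_mul_a : b t m n * a t m n = 1 := (isPoint t m n).inv_mul (parity_involutive t m n)

variable (t m n) in
/-- The counit as a morphism of algebras. -/
def counitHom : QGL t m n →ₐ[Cq] Cq :=
  lift 1 IsQ.one (by rw [blockA_one, qdet_one]; exact isUnit_one)
    (by rw [blockB_one, qdet_one]; exact isUnit_one)

theorem map_counitHom : (a t m n).map (counitHom t m n) = 1 :=
  Matrix.ext fun i j => lift_a _ _ _ _ i j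

variable (t m n) in
/-- The Hopf structure of `GL_t(m|n)`. -/
def hopfData : HopfData t (parity t m n) (a t m n) (b t m n) where
  point := isPoint t m n
  invol := parity_involutive t m n
  gen := generates
  mul_inv := a_mul_b
  inv_mul := b_mul_a
  comulHom := ofPoint ((isPoint t m n).comulMatrix (parity_involutive t m n))
  comulHom_X := ofPoint_a _
  counitHom := counitHom t m n
  counitHom_X i j := (lift_a _ _ _ _ i j).trans Matrix.one_apply
  antipodeHom := ofPoint ((isPoint t m n).inverse_op (parity_involutive t m n) a_mul_b b_mul_a)
  antipodeHom_X := ofPoint_a _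

theorem isStandardGL {G : HopfSuperalgebra Cq (grading t m n)}
    (hG : G = (hopfData t m n).hopf) : IsStandardGL G := by
  subst hG
  have hb := (isPoint t m n).qantipode_blockH (parity_involutive t m n) a_mul_b b_mul_a
  obtain ⟨h1, h2, h3⟩ := inverse_blocks (isPoint t m n).mul_SA (isPoint t m n).SA_mul
    (a_mul_b (t := t) (m := m) (n := n)) b_mul_a
  have hS : ∀ i j, (hopfData t m n).hopf.antipode (a t m n i j) = b t m n i j :=
    (hopfData t m n).antipode_X
  constructor
  · intro i j
    exact (congrArg (toSq (parity t m n)).symm ((hopfData t m n).comulHom_X i j)).trans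
      (congrArg (toSq (parity t m n)).symm (comulMatrix_apply i j))
  · exact (hopfData t m n).counitHom_X
  · rw [hb, ← h1]
    exact Matrix.ext fun i j => hS _ _
  · rw [hb]
    exact Matrix.ext fun i j => hS _ _
  · rw [hb, ← h2]
    exact Matrix.ext fun i j => hS _ _
  · rw [hb, ← h3]
    exact Matrix.ext fun i j => hS _ _

variable (t m n) in
/-- The Berezinian of the generic quantum supermatrix. -/
abbrev ber : QGL t m n := berezinian t (a t m n)

theorem map_ber {R : Type} [Ring R] [Algebra Cq R] (f : QGL t m n →ₐ[Cq] R) :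
    f (ber t m n) = berezinian t ((a t m n).map f) :=
  ((isPoint t m n).berezinian_map (parity_involutive t m n) f).symm

theorem counitHom_ber : counitHom t m n (ber t m n) = 1 := by
  rw [map_ber, map_counitHom, berezinian_one]

theorem ber_even : ber t m n ∈ grading t m n 0 :=
  mem_parityPart_zero.2 (parity_berezinian t m n)

theorem comulHom_ber : (hopfData t m n).comulHom (ber t m n) =
    toSq (parity t m n) (ber t m n ⊗ₜ ber t m n) := by
  rw [map_ber, show (a t m n).map (hopfData t m n).comulHom = _ from
    Matrix.ext (hopfData t m n).comulHom_X,
    (isPoint t m n).berezinian_comulMatrix (parity_involutive t m n), incL_mul_incR]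

/-- The Berezinian is group-like, so the antipode maps it to its inverse. -/
theorem antipode_ber_mul_ber :
    MulOpposite.unop ((hopfData t m n).antipodeHom (ber t m n)) * ber t m n = 1 := by
  have h := DFunLike.congr_fun (hopfData t m n).hopf.mul_antipode_rTensor_comul (ber t m n)
  have h1 : (hopfData t m n).hopf.comul (ber t m n) = ber t m n ⊗ₜ ber t m n :=
    congrArg (toSq (parity t m n)).symm comulHom_ber
  have h2 : (hopfData t m n).hopf.counit (ber t m n) = 1 := counitHom_ber
  rw [LinearMap.comp_apply, LinearMap.comp_apply, LinearMap.comp_apply, h1, h2,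
    LinearMap.rTensor_tmul, LinearMap.mul'_apply] at h
  have h3 : (hopfData t m n).hopf.antipode (ber t m n) =
      MulOpposite.unop ((hopfData t m n).antipodeHom (ber t m n)) := untwist_even _ ber_even
  rw [h3] at h
  exact h.trans (map_one (algebraMap Cq (QGL t m n)))

end QGL

namespace QSL

theorem proj_ber : proj t m n (QGL.ber t m n) = 1 := by
  rw [QGL.map_ber]
  exact berezinian_a

variable (t m n) in
/-- The inverse of the generic quantum supermatrix of Berezinian `1`. -/
def b : Matrix (Fin (m + n)) (Fin (m + n)) (QSL t m n) := (QGL.b t m n).map (proj t m n)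

theorem a_mul_b : a t m n * b t m n = 1 := map_one_matrix (proj t m n) QGL.a_mul_b

theorem b_mul_a : b t m n * a t m n = 1 := map_one_matrix (proj t m n) QGL.b_mul_a

variable (t m n) in
/-- The Hopf structure of `SL_t(m|n)`. -/
def hopfData : HopfData t (parity t m n) (a t m n) (b t m n) where
  point := isPoint t m n
  invol := parity_involutive t m n
  gen := generates
  mul_inv := a_mul_b
  inv_mul := b_mul_a
  comulHom := ofPoint ((isPoint t m n).comulMatrix (parity_involutive t m n)) (by
    rw [(isPoint t m n).berezinian_comulMatrix (parity_involutive t m n), berezinian_a, map_one,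
      map_one, one_mul])
  comulHom_X := ofPoint_a _ _
  counitHom := lift (QGL.counitHom t m n) QGL.counitHom_ber
  counitHom_X i j := (lift_proj _ _ _).trans ((QGL.hopfData t m n).counitHom_X i j)
  antipodeHom := lift ((AlgHom.op (proj t m n)).comp (QGL.hopfData t m n).antipodeHom) (by
    have h := congrArg (proj t m n) (QGL.antipode_ber_mul_ber (t := t) (m := m) (n := n))
    rw [map_mul, proj_ber, mul_one, map_one] at h
    exact congrArg MulOpposite.op h)
  antipodeHom_X i j := (lift_proj _ _ _).trans (by
    rw [AlgHom.comp_apply, (QGL.hopfData t m n).antipodeHom_X, map_smul]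
    rfl)

theorem isStandardSL_hopf : IsStandardSL (hopfData t m n).hopf :=
  ⟨(QGL.hopfData t m n).hopf, QGL.isStandardGL rfl,
    (QGL.hopfData t m n).isHopfMorphism (hopfData t m n) (proj t m n) fun i j => rfl⟩

theorem _root_.QuantumSuper.IsStandardSL.eq_hopf {H : HopfSuperalgebra Cq (grading t m n)}
    (h : IsStandardSL H) : H = (hopfData t m n).hopf := by
  obtain ⟨G, hG, hp⟩ := h
  refine (hopfData t m n).eq_hopf H (fun i j => ?_) (fun i j => ?_)
  · rw [a, Matrix.map_apply, hp.map_comul, hG.comul_a, map_sum]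
    rfl
  · rw [a, Matrix.map_apply, hp.map_counit, hG.counit_a]

end QSL

end Standard

/-! ### The Schur complement under transposition -/

section Weights

/-- The telescoping sum behind `sum_weighted_mul_inverse`. -/
theorem sum_weights {t v : Cq} (htv : t * v = 1) : ∀ {m k : ℕ}, k < m →
    v ^ (2 * k) * v + ∑ k' ∈ Finset.range m, (if k < k' then v ^ (2 * k') * (v - t) else 0) =
      t * v ^ (2 * m)
  | 0, _, h => absurd h (Nat.not_lt_zero _)
  | m + 1, k, h => by
    rw [Finset.sum_range_succ]
    rcases Nat.lt_succ_iff_lt_or_eq.1 h with h | rfl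
    · rw [if_pos h, ← add_assoc, sum_weights htv h]
      linear_combination (-v ^ (2 * m) * v) * htv
    · rw [Finset.sum_eq_zero (fun k' hk' => if_neg (by rw [Finset.mem_range] at hk'; omega)),
        if_neg (lt_irrefl _)]
      linear_combination (-v ^ (2 * k) * v) * htv

variable {R : Type} [Ring R] [Algebra Cq R] {m : ℕ} {A S : Matrix (Fin m) (Fin m) R}
  {x : Fin m → R} {t v : Cq}

theorem mul_inverse_eq_sum (hAS : A * S = 1) (hSA : S * A = 1)
    (h : ∀ i j k, A i j * x k = (if i = k then v else 1) • (x k * A i j) +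
      (if i < k then v - t else 0) • (x i * A k j)) (l k : Fin m) :
    x k * S l k = ∑ i, ((if i = k then v else 0) + if i < k then v - t else 0) •
      (S l i * x i) := by
  have h1 : ∀ i, ∑ j, A i j * x k * S j k =
      ((if i = k then v else 0) + if i < k then v - t else 0) • x i := fun i => by
    have e1 : ∀ j, A i j * x k * S j k = (if i = k then v else 1) • (x k * (A i j * S j k)) +
        (if i < k then v - t else 0) • (x i * (A k j * S j k)) := fun j => by
      rw [h, add_mul, smul_mul_assoc, smul_mul_assoc, mul_assoc, mul_assoc]
    simp only [e1, Finset.sum_add_distrib, ← Finset.smul_sum, ← Finset.mul_sum]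
    rw [← Matrix.mul_apply, ← Matrix.mul_apply, hAS, Matrix.one_apply_eq, Matrix.one_apply,
      mul_one, add_smul]
    by_cases hik : i = k
    · simp [hik]
    · simp [hik]
  calc x k * S l k = ∑ j, (S * A) l j * (x k * S j k) := by
        rw [hSA]; simp [Matrix.one_apply]
    _ = ∑ i, S l i * ∑ j, A i j * x k * S j k := by
        simp only [Matrix.mul_apply, Finset.sum_mul, Finset.mul_sum, mul_assoc]
        exact Finset.sum_comm
    _ = _ := Finset.sum_congr rfl fun i _ => by rw [h1, mul_smul_comm]

/-- Moving a family `x` that is quantum-commuting with a quantum matrix past the inverse of the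
latter; the weights `v ^ (2 k)` make the correction terms telescope. -/
theorem sum_weighted_mul_inverse (htv : t * v = 1) (hAS : A * S = 1) (hSA : S * A = 1)
    (h : ∀ i j k, A i j * x k = (if i = k then v else 1) • (x k * A i j) +
      (if i < k then v - t else 0) • (x i * A k j)) (l : Fin m) :
    ∑ k : Fin m, v ^ (2 * (k : ℕ)) • (x k * S l k) =
      (t * v ^ (2 * m)) • ∑ k, S l k * x k := by
  simp only [mul_inverse_eq_sum hAS hSA h, Finset.smul_sum, smul_smul]
  rw [Finset.sum_comm]
  refine Finset.sum_congr rfl fun i _ => ?_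
  rw [← Finset.sum_smul]
  congr 1
  rw [← sum_weights htv i.2]
  simp only [mul_add, Finset.sum_add_distrib, mul_ite, mul_zero]
  congr 1
  · simp
  · exact Fin.sum_univ_eq_sum_range (fun k' => if (i : ℕ) < k' then v ^ (2 * k') * (v - t) else 0) m

end Weights

/-- The quantum cofactors of the transpose are transposed, but the powers of `-t` in front of them
are not symmetric. -/
theorem RTT.qantipode_transpose {R : Type} [Ring R] [Algebra Cq R] {t : Cqˣ} :
    ∀ {k : ℕ} {A : Matrix (Fin k) (Fin k) R}, RTT t (fun _ => 0) A → ∀ i j : Fin k,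
      qantipode t A.transpose i j =
        (((t⁻¹ : Cqˣ) : Cq) ^ (2 * (i : ℕ)) * (t : Cq) ^ (2 * (j : ℕ))) • qantipode t A j i
  | 0, _, _, i, _ => i.elim0
  | k + 1, A, h, i, j => by
    have h1 := (h.submatrix_submatrix (Fin.strictMono_succAbove i)
      (Fin.strictMono_succAbove j)).qdet_transpose
    rw [qantipode, qantipode, Matrix.of_apply, Matrix.of_apply, h.qdet_transpose, smul_smul, ← h1]
    refine congrArg₂ (· • ·) ?_ rfl
    have h2 : (-t) ^ ((j : ℤ) - i) = t⁻¹ ^ (2 * (i : ℕ)) * t ^ (2 * (j : ℕ)) *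
        (-t) ^ ((i : ℤ) - j) := by
      have e : ∀ k : ℕ, t ^ (2 * k) = (-t) ^ (2 * (k : ℤ)) := fun k => by
        exact_mod_cast ((even_two_mul k).neg_pow t).symm
      rw [inv_pow, e, e, ← zpow_neg, ← zpow_add, ← zpow_add]
      exact congrArg _ (by ring)
    have h3 := congrArg Units.val h2
    rw [Units.val_mul, Units.val_mul, Units.val_pow_eq_pow_val, Units.val_pow_eq_pow_val] at h3
    exact h3

section Schur

variable {m n : ℕ} {R : Type} [Ring R] [Algebra Cq R] {t : Cqˣ} {s : R →ₐ[Cq] R}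
  {X : Matrix (Fin (m + n)) (Fin (m + n)) R}

theorem IsQ.blockA_mul_blockΛ (h : IsQ t X) (j : Fin n) (i l k : Fin m) :
    blockA X i l * blockΛ X k j =
      (if i = k then ((t⁻¹ : Cqˣ) : Cq) else 1) • (blockΛ X k j * blockA X i l) +
      (if i < k then ((t⁻¹ : Cqˣ) : Cq) - (t : Cq) else 0) • (blockΛ X i j * blockA X k l) := by
  simp only [blockA, blockΛ, Matrix.submatrix_apply]
  rcases lt_trichotomy i k with hik | rfl | hik
  · have := h.cross (Fin.castAdd n i) (Fin.castAdd n l) (Fin.castAdd n k) (Fin.natAdd m j)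
      hik (castAdd_lt_natAdd _ _)
    simp [koszul, η, p_castAdd, p_natAdd] at this
    simp [hik, hik.ne, ← this]
  · have := h.row (Fin.castAdd n i) (Fin.castAdd n l) (Fin.natAdd m j) (castAdd_lt_natAdd _ _)
    simp [koszul, p_castAdd, p_natAdd] at this
    simp [this]
  · have := h.comm (Fin.castAdd n i) (Fin.castAdd n l) (Fin.castAdd n k) (Fin.natAdd m j)
      (Or.inr ⟨hik, castAdd_lt_natAdd _ _⟩)
    simp [koszul, p_castAdd, p_natAdd] at this
    simp [this, hik.ne', hik.not_gt]

theorem IsQ.blockΥ_mul_blockA (h : IsQ t X) (j : Fin n) (i l k : Fin m) :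
    blockΥ X j k * blockA X l i =
      (if i = k then (t : Cq) else 1) • (blockA X l i * blockΥ X j k) +
      (if i < k then (t : Cq) - ((t⁻¹ : Cqˣ) : Cq) else 0) • (blockA X l k * blockΥ X j i) := by
  simp only [blockA, blockΥ, Matrix.submatrix_apply]
  rcases lt_trichotomy i k with hik | rfl | hik
  · have := h.cross (Fin.castAdd n l) (Fin.castAdd n i) (Fin.natAdd m j) (Fin.castAdd n k)
      (castAdd_lt_natAdd _ _) hik
    simp [koszul, η, p_castAdd, p_natAdd] at this
    rw [if_neg hik.ne, if_pos hik, one_smul, ← neg_sub, neg_smul, ← this]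
    abel
  · have := h.col (Fin.castAdd n l) (Fin.castAdd n i) (Fin.natAdd m j) (castAdd_lt_natAdd _ _)
    simp [koszul, p_castAdd, p_natAdd] at this
    rw [this, smul_smul]
    simp
  · have := h.comm (Fin.castAdd n l) (Fin.castAdd n i) (Fin.natAdd m j) (Fin.castAdd n k)
      (Or.inl ⟨castAdd_lt_natAdd _ _, hik⟩)
    simp [koszul, p_castAdd, p_natAdd] at this
    simp [this, hik.ne', hik.not_gt]

theorem IsQ.blockΛ_mul_blockΥ (h : IsQ t X) (k l : Fin m) (i j : Fin n) :
    blockΛ X k i * blockΥ X j l = -(blockΥ X j l * blockΛ X k i) := by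
  have := h.comm (Fin.castAdd n k) (Fin.natAdd m i) (Fin.natAdd m j) (Fin.castAdd n l)
    (Or.inl ⟨castAdd_lt_natAdd _ _, castAdd_lt_natAdd _ _⟩)
  simpa [koszul, p_castAdd, p_natAdd, blockΛ, blockΥ] using this

/-- The term `Υ S(A) Λ` of the Schur complement, formed with the transposed matrices. The twist of
`S(Aᵀ)` against `S(A)ᵀ` makes up for the reordering of the factors. -/
theorem IsPoint.transpose_mul_qantipode_mul (h : IsPoint t s X) :
    (blockΛ X).transpose * qantipode t (blockA X).transpose * (blockΥ X).transpose =
      -(blockΥ X * qantipode t (blockA X) * blockΛ X).transpose := by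
  set S := qantipode t (blockA X) with hS
  have htv : (t : Cq) * ((t⁻¹ : Cqˣ) : Cq) = 1 := t.mul_inv
  have hvt : ((t⁻¹ : Cqˣ) : Cq) * (t : Cq) = 1 := t.inv_mul
  have hΛ := fun i => sum_weighted_mul_inverse htv h.mul_SA h.SA_mul (h.isQ.blockA_mul_blockΛ i)
  -- the same for `Υ`, over the opposite algebra and with the inverse parameter
  have hΥ : ∀ (j : Fin n) (k : Fin m),
      ∑ l : Fin m, (t : Cq) ^ (2 * (l : ℕ)) • (S l k * blockΥ X j l) =
        (((t⁻¹ : Cqˣ) : Cq) * (t : Cq) ^ (2 * m)) • ∑ l, blockΥ X j l * S l k := fun j k => by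
    have := sum_weighted_mul_inverse (x := fun k => MulOpposite.op (blockΥ X j k))
      hvt (transpose_map_op_mul h.SA_mul) (transpose_map_op_mul h.mul_SA)
      (fun i l k => congrArg MulOpposite.op (h.isQ.blockΥ_mul_blockA j i l k)) k
    have := congrArg MulOpposite.unop this
    simpa using this
  rw [← hS] at hΛ
  ext i j
  have e1 : ∀ l k : Fin m, blockΛ X k i * qantipode t (blockA X).transpose k l * blockΥ X j l =
      (t : Cq) ^ (2 * (l : ℕ)) • (((t⁻¹ : Cqˣ) : Cq) ^ (2 * (k : ℕ)) • (blockΛ X k i * S l k) *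
        blockΥ X j l) := fun l k => by
    rw [h.isQ.blockA_rtt.qantipode_transpose, mul_smul_comm, smul_mul_assoc, smul_mul_assoc,
      smul_smul, mul_comm]
  simp only [Matrix.mul_apply, Matrix.neg_apply, Matrix.transpose_apply, Finset.sum_mul, e1]
  simp only [← Finset.smul_sum, ← Finset.sum_mul, hΛ]
  have e2 : ∀ l : Fin m, (t : Cq) ^ (2 * (l : ℕ)) • (((t : Cq) * ((t⁻¹ : Cqˣ) : Cq) ^ (2 * m)) •
      (∑ k, S l k * blockΛ X k i) * blockΥ X j l) =
      -(((t : Cq) * ((t⁻¹ : Cqˣ) : Cq) ^ (2 * m)) • ∑ k, ((t : Cq) ^ (2 * (l : ℕ)) •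
        (S l k * blockΥ X j l)) * blockΛ X k i) := fun l => by
    rw [smul_mul_assoc, smul_comm, Finset.sum_mul, ← smul_neg, ← Finset.sum_neg_distrib,
      Finset.smul_sum]
    refine congrArg _ (Finset.sum_congr rfl fun k _ => ?_)
    rw [mul_assoc, h.isQ.blockΛ_mul_blockΥ, smul_mul_assoc, mul_neg, smul_neg, mul_assoc]
  simp only [e2]
  rw [Finset.sum_neg_distrib, ← Finset.smul_sum, Finset.sum_comm]
  simp only [← Finset.sum_mul, hΥ]
  simp only [smul_mul_assoc, ← Finset.smul_sum]
  rw [smul_smul]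
  -- the factors from moving `Λ` and `Υ` past `S` cancel
  have e3 : (t : Cq) * ((t⁻¹ : Cqˣ) : Cq) ^ (2 * m) * (((t⁻¹ : Cqˣ) : Cq) * (t : Cq) ^ (2 * m)) =
      1 := by
    rw [mul_mul_mul_comm, htv, one_mul, ← mul_pow, hvt, one_pow]
  rw [e3, one_smul]

theorem IsPoint.blockH_superTranspose (h : IsPoint t s X) :
    blockH t (QuantumSuper.superTranspose X) = (blockH t X).transpose := by
  have hA : blockA (QuantumSuper.superTranspose X) = (blockA X).transpose := by
    ext i j; simp [blockA, QuantumSuper.superTranspose, p_castAdd]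
  have hB : blockB (QuantumSuper.superTranspose X) = (blockB X).transpose := by
    ext i j; simp [blockB, QuantumSuper.superTranspose, p_natAdd]
  have hΛ : blockΛ (QuantumSuper.superTranspose X) = (blockΥ X).transpose := by
    ext i j; simp [blockΛ, blockΥ, QuantumSuper.superTranspose, p_natAdd, p_castAdd]
  have hΥ : blockΥ (QuantumSuper.superTranspose X) = -(blockΛ X).transpose := by
    ext i j; simp [blockΛ, blockΥ, QuantumSuper.superTranspose, p_natAdd, p_castAdd]
  rw [blockH, blockH, hA, hB, hΛ, hΥ, Matrix.neg_mul, Matrix.neg_mul,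
    h.transpose_mul_qantipode_mul, neg_neg, Matrix.transpose_sub]

/-- The matrix over the opposite algebra that makes an antimorphism in the super sense out of an
algebra morphism. -/
abbrev opMatrix (X : Matrix (Fin (m + n)) (Fin (m + n)) R) :
    Matrix (Fin (m + n)) (Fin (m + n)) Rᵐᵒᵖ :=
  Matrix.of fun i j => rootSign i j • MulOpposite.op (X i j)

theorem blockA_opMatrix : blockA (opMatrix X) = (blockA X).map MulOpposite.op := by
  ext i j : 2; simp [blockA, rootSign, p_castAdd]

theorem blockB_opMatrix : blockB (opMatrix X) = (blockB X).map MulOpposite.op := by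
  ext i j : 2; simp [blockB, rootSign, p_natAdd]

/-- The Schur complement over the opposite algebra involves the transposed order of the factors,
hence is covered by `IsPoint.transpose_mul_qantipode_mul`; the sign there is the square of
`rootSign` on odd entries. -/
theorem IsPoint.blockH_opMatrix (h : IsPoint t s X) :
    blockH t⁻¹ (opMatrix X) = (blockH t X).map MulOpposite.op := by
  have hAt : RTT t (fun _ => 0) (blockA X).transpose := h.isQ.blockA_rtt.transpose
  have hu : IsUnit (qdet t (blockA X).transpose) := by
    rw [h.isQ.blockA_rtt.qdet_transpose]; exact h.unitA
  have hS : qantipode t⁻¹ ((blockA X).map MulOpposite.op) =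
      ((qantipode t (blockA X).transpose).map MulOpposite.op).transpose :=
    RTT.qantipode_eq h.isQ.blockA_rtt.op
      (transpose_map_op_mul (A := (blockA X).transpose) (hAt.qantipode_mul hu))
      (transpose_map_op_mul (S := (blockA X).transpose) (hAt.mul_qantipode hu))
  ext i j
  apply MulOpposite.unop_injective
  have key := congrFun (congrFun h.transpose_mul_qantipode_mul j) i
  rw [Matrix.neg_apply, Matrix.transpose_apply, ← neg_eq_iff_eq_neg] at key
  rw [blockH, blockA_opMatrix, blockB_opMatrix, hS, Matrix.sub_apply, MulOpposite.unop_sub,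
    Matrix.map_apply, Matrix.map_apply, MulOpposite.unop_op, MulOpposite.unop_op, blockH,
    Matrix.sub_apply, ← key]
  congr 1
  simp only [Matrix.mul_apply, Matrix.transpose_apply, Finset.sum_mul, Finset.unop_sum,
    Matrix.map_apply]
  rw [← Finset.sum_neg_distrib, Finset.sum_comm]
  refine Finset.sum_congr rfl fun k _ => ?_
  rw [← Finset.sum_neg_distrib]
  refine Finset.sum_congr rfl fun l _ => ?_
  simp only [blockΛ, blockΥ, Matrix.submatrix_apply, Matrix.of_apply, rootSign, p_castAdd,
    p_natAdd, MulOpposite.unop_mul, Matrix.transpose_apply, MulOpposite.unop_smul, MulOpposite.unop_op]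
  rw [if_neg zero_ne_one, if_neg one_ne_zero, mul_smul_comm, smul_mul_smul_comm, I_mul_I,
    neg_smul, one_smul, mul_assoc]

/-- The Berezinian is the quotient of the quantum determinants of `A` and of the Schur
complement. -/
theorem IsPoint.berezinian_mul_qdet_blockH (h : IsPoint t s X) (hs : ∀ x, s (s x) = x) :
    berezinian t X * qdet t⁻¹ (blockH t X) = qdet t (blockA X) := by
  have hXb := h.mul_inv hs
  have hbX := h.inv_mul hs
  have h1 := (h.blockH_rtt hs).qdet_inv_mul_qdet_of_mul_eq_one (h.blockH_mul hXb)
    (h.mul_blockH hbX)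
  rw [inv_inv] at h1
  rw [h.berezinian_eq hs hXb hbX, mul_assoc, h1, mul_one]

/-- This form of the condition involves only quantum determinants of `A` and `H`, which are not
changed by transposition and by the passage to the opposite algebra. -/
theorem IsPoint.berezinian_eq_one_iff (h : IsPoint t s X) (hs : ∀ x, s (s x) = x) :
    berezinian t X = 1 ↔ qdet t (blockA X) = qdet t⁻¹ (blockH t X) := by
  have h1 := h.berezinian_mul_qdet_blockH hs
  have hu : IsUnit (qdet t⁻¹ (blockH t X)) := (h.blockH_rtt hs).isUnit_qdet
    (h.blockH_mul (h.mul_inv hs)) (h.mul_blockH (h.inv_mul hs))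
  rw [← h1]
  constructor
  · intro h2
    rw [h2, one_mul]
  · intro h2
    exact hu.mul_right_cancel (h2.trans (one_mul _).symm)

theorem IsPoint.berezinian_superTranspose (h : IsPoint t s X) (hs : ∀ x, s (s x) = x)
    (hX : berezinian t X = 1) : berezinian t (QuantumSuper.superTranspose X) = 1 := by
  have hA : blockA (QuantumSuper.superTranspose X) = (blockA X).transpose := by
    ext i j; simp [blockA, QuantumSuper.superTranspose, p_castAdd]
  rw [h.superTranspose.berezinian_eq_one_iff hs, h.blockH_superTranspose, hA,
    h.isQ.blockA_rtt.qdet_transpose, (h.blockH_rtt hs).qdet_transpose]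
  exact (h.berezinian_eq_one_iff hs).1 hX

theorem IsPoint.berezinian_opMatrix (h : IsPoint t s X) (hs : ∀ x, s (s x) = x)
    (hX : berezinian t X = 1) : berezinian t⁻¹ (opMatrix X) = 1 := by
  have hop : IsPoint t⁻¹ (AlgHom.op s) (opMatrix X) := h.op fun x => rfl
  rw [hop.berezinian_eq_one_iff fun x => congrArg MulOpposite.op (hs _), h.blockH_opMatrix,
    blockA_opMatrix]
  apply MulOpposite.unop_injective
  rw [h.isQ.blockA_rtt.unop_qdet_op, (h.blockH_rtt hs).unop_qdet_op]
  exact (h.berezinian_eq_one_iff hs).1 hX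

end Schur

/-! ### Antimorphisms in the super sense -/

section AntiHom

variable {A B C : Type} [Ring A] [Algebra Cq A] [Ring B] [Algebra Cq B] [Ring C] [Algebra Cq C]
  {s : A →ₐ[Cq] A} {s' : B →ₐ[Cq] B} {s'' : C →ₐ[Cq] C}

/-- The map `F` preserves parity and `F (x y) = (-1) ^ (|x| |y|) F y F x`. -/
structure IsAntiHom (s : A →ₐ[Cq] A) (s' : B →ₐ[Cq] B) (F : A →ₗ[Cq] B) : Prop where
  map_one : F 1 = 1
  map_mem : ∀ i, ∀ x ∈ parityPart s i, F x ∈ parityPart s' i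
  map_mul : ∀ i j : ZMod 2, ∀ x ∈ parityPart s i, ∀ y ∈ parityPart s j,
    F (x * y) = (-1 : Cq) ^ (i.val * j.val) • (F y * F x)

theorem isAntiHom_untwist {f : A →ₐ[Cq] Bᵐᵒᵖ}
    (hf : ∀ x, MulOpposite.unop (f (s x)) = s' (MulOpposite.unop (f x))) :
    IsAntiHom s s' (untwist s f) where
  map_one := untwist_one f
  map_mem i x hx := untwist_mem hf hx
  map_mul i j x hx y hy := untwist_mul f hx hy

/-- The composition of two antimorphisms is a morphism. -/
def IsAntiHom.comp {F : A →ₗ[Cq] B} {G : B →ₗ[Cq] C} (hG : IsAntiHom s' s'' G)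
    (hF : IsAntiHom s s' F) (hs : ∀ x, s (s x) = x) : A →ₐ[Cq] C :=
  AlgHom.ofLinearMap (G ∘ₗ F) (by rw [LinearMap.comp_apply, hF.map_one, hG.map_one])
    (fun x y => by
      have key : ∀ i j, ∀ x ∈ parityPart s i, ∀ y ∈ parityPart s j,
          (G ∘ₗ F) (x * y) = (G ∘ₗ F) x * (G ∘ₗ F) y := fun i j x hx y hy => by
        rw [LinearMap.comp_apply, hF.map_mul i j x hx y hy, map_smul,
          hG.map_mul j i _ (hF.map_mem j y hy) _ (hF.map_mem i x hx), smul_smul, mul_comm j.val,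
          ← mul_pow]
        simp
      obtain ⟨x₀, hx₀, x₁, hx₁, rfl⟩ := even_add_odd hs x
      obtain ⟨y₀, hy₀, y₁, hy₁, rfl⟩ := even_add_odd hs y
      rw [add_mul, mul_add, mul_add, map_add, map_add, map_add, key _ _ _ hx₀ _ hy₀,
        key _ _ _ hx₀ _ hy₁, key _ _ _ hx₁ _ hy₀, key _ _ _ hx₁ _ hy₁, map_add, map_add, add_mul,
        mul_add, mul_add])

theorem IsAntiHom.comp_apply {F : A →ₗ[Cq] B} {G : B →ₗ[Cq] C} (hG : IsAntiHom s' s'' G)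
    (hF : IsAntiHom s s' F) (hs : ∀ x, s (s x) = x) (x : A) : hG.comp hF hs x = G (F x) := rfl

theorem IsAntiHom.parity {F : A →ₗ[Cq] B} (hF : IsAntiHom s s' F) {k : ℕ} {x : A}
    (hx : s x = (-1 : Cq) ^ k • x) : s' (F x) = (-1 : Cq) ^ k • F x := by
  have := mem_parityPart.1 (hF.map_mem _ x (mem_parityPart_natCast hx))
  rwa [ZMod.val_natCast, ← neg_one_pow_eq_pow_mod_two] at this

variable {m n : ℕ}

/-- The signed transpose of the image of a supermatrix under an antimorphism. -/
def antiTranspose (F : A →ₗ[Cq] B) (P : Matrix (Fin (m + n)) (Fin (m + n)) A) :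
    Matrix (Fin (m + n)) (Fin (m + n)) B :=
  Matrix.of fun i j => (-1 : Cq) ^ ((p j + 1) * p i) • F (P j i)

/-- The signed transpose turns an antimorphism into a map that reverses matrix products. -/
theorem IsAntiHom.antiTranspose_mul {F : A →ₗ[Cq] B} (hF : IsAntiHom s s' F)
    {P Q : Matrix (Fin (m + n)) (Fin (m + n)) A}
    (hP : ∀ i j, s (P i j) = (-1 : Cq) ^ (p i + p j) • P i j)
    (hQ : ∀ i j, s (Q i j) = (-1 : Cq) ^ (p i + p j) • Q i j) (hPQ : P * Q = 1) :
    antiTranspose F Q * antiTranspose F P = 1 := by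
  ext j i
  have h1 : ∀ k, antiTranspose F Q j k * antiTranspose F P k i =
      (-1 : Cq) ^ ((p i + 1) * p j) • F (P i k * Q k j) := fun k => by
    rw [hF.map_mul _ _ _ (mem_parityPart_natCast (hP i k)) _ (mem_parityPart_natCast (hQ k j)),
      neg_one_pow_val_mul, antiTranspose, antiTranspose, Matrix.of_apply, Matrix.of_apply,
      smul_mul_smul_comm, smul_smul, ← pow_add, ← pow_add]
    refine congrArg (· • _) (neg_one_pow_congr ?_)
    rcases p_zero_or_one i with hi | hi <;> rcases p_zero_or_one j with hj | hj <;>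
      rcases p_zero_or_one k with hk | hk <;> simp [hi, hj, hk, Nat.even_add_one]
  rw [Matrix.mul_apply, Finset.sum_congr rfl fun k _ => h1 k, ← Finset.smul_sum, ← map_sum,
    ← Matrix.mul_apply, hPQ, Matrix.one_apply, Matrix.one_apply]
  by_cases hij : i = j
  · rw [if_pos hij, if_pos hij.symm, hF.map_one, hij,
      (Even.neg_one_pow (by rcases p_zero_or_one j with hj | hj <;> simp [hj]) :
        (-1 : Cq) ^ _ = 1), one_smul]
  · rw [if_neg hij, if_neg (Ne.symm hij), map_zero, smul_zero]

/-- The morphism to the opposite algebra is recovered from its antimorphism. -/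
theorem eq_rootSign_smul_of_untwist (f : A →ₐ[Cq] Bᵐᵒᵖ) {x : A} {i j : Fin (m + n)}
    (hx : s x = (-1 : Cq) ^ (p i + p j) • x) :
    f x = rootSign i j • MulOpposite.op (untwist s f x) := by
  have h := mem_parityPart_natCast hx
  by_cases hij : p i = p j
  · have h0 : ((p i + p j : ℕ) : ZMod 2) = 0 := by
      rw [hij, ← two_mul]; simp [show (2 : ZMod 2) = 0 from rfl]
    rw [h0] at h
    rw [untwist_even f h, rootSign, if_pos hij]
    simp
  · have h1 : ((p i + p j : ℕ) : ZMod 2) = 1 := by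
      rcases p_zero_or_one i with hi | hi <;> rcases p_zero_or_one j with hj | hj <;>
        simp_all
    rw [h1] at h
    rw [untwist_odd f h, rootSign, if_neg hij, MulOpposite.op_neg, MulOpposite.op_smul,
      MulOpposite.op_unop, smul_neg, smul_smul, I_mul_I]
    simp

variable {t : Cqˣ} [GradedAlgebra (parityPart s)] {X b : Matrix (Fin (m + n)) (Fin (m + n)) A}

theorem HopfData.isAntiHom (D : HopfData t s X b) : IsAntiHom s s D.antipode :=
  isAntiHom_untwist (untwist_parity D.gen D.point.parity
    (D.point.inverse_parity D.invol D.mul_inv D.inv_mul) D.antipodeHom_X)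

end AntiHom

/-! ### Supertranspose and reversal -/

namespace QSL

variable {t u : Cqˣ} {m n : ℕ}

variable (t m n) in
/-- The supertranspose as a morphism. -/
def stHom : QSL t m n →ₐ[Cq] QSL t m n :=
  ofPoint (isPoint t m n).superTranspose
    ((isPoint t m n).berezinian_superTranspose (parity_involutive t m n) berezinian_a)

theorem stHom_a (i j : Fin (m + n)) :
    stHom t m n (a t m n i j) = (-1 : Cq) ^ ((p j + 1) * p i) • a t m n j i := ofPoint_a _ _ i j

theorem parity_a (i j : Fin (m + n)) :
    parity t m n (a t m n i j) = (-1 : Cq) ^ (p i + p j) • a t m n i j := (isPoint t m n).parity i j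

theorem b_parity (i j : Fin (m + n)) :
    parity t m n (b t m n i j) = (-1 : Cq) ^ (p i + p j) • b t m n i j :=
  (isPoint t m n).inverse_parity (parity_involutive t m n) a_mul_b b_mul_a i j

theorem neg_one_pow_transpose (i j : Fin (m + n)) :
    (-1 : Cq) ^ ((p j + 1) * p i) * (-1 : Cq) ^ ((p i + 1) * p j) = (-1) ^ (p i + p j) := by
  rw [← pow_add]
  refine neg_one_pow_congr ?_
  rcases p_zero_or_one i with hi | hi <;> rcases p_zero_or_one j with hj | hj <;>
    simp [hi, hj, Nat.even_iff]

theorem neg_one_pow_mul_self (k : ℕ) : (-1 : Cq) ^ k * (-1 : Cq) ^ k = 1 := by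
  rw [← mul_pow]; simp

variable (t m n) in
/-- The supertranspose; its square is the parity automorphism. -/
def supertranspose : QSL t m n ≃ₐ[Cq] QSL t m n :=
  AlgEquiv.ofAlgHom (stHom t m n) ((parity t m n).comp (stHom t m n))
    (generates.algHom_ext fun i j => by
      rw [AlgHom.comp_apply, AlgHom.comp_apply, stHom_a, map_smul, parity_a, smul_smul, map_smul,
        stHom_a, smul_smul, mul_right_comm, neg_one_pow_transpose, add_comm (p j),
        neg_one_pow_mul_self, one_smul]
      rfl)
    (generates.algHom_ext fun i j => by
      rw [AlgHom.comp_apply, AlgHom.comp_apply, stHom_a, map_smul, map_smul, stHom_a, map_smul,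
        parity_a, smul_smul, smul_smul, neg_one_pow_transpose, neg_one_pow_mul_self, one_smul]
      rfl)

theorem isSupertranspose : IsSupertranspose (supertranspose t m n) := stHom_a

theorem _root_.QuantumSuper.IsSupertranspose.eq {st : QSL t m n ≃ₐ[Cq] QSL t m n}
    (h : IsSupertranspose st) (x : QSL t m n) : st x = stHom t m n x := by
  have : (st : QSL t m n →ₐ[Cq] QSL t m n) = stHom t m n :=
    generates.algHom_ext fun i j => (h i j).trans (stHom_a i j).symm
  exact DFunLike.congr_fun this x

/-- The morphism to the opposite algebra underlying the reversal. -/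
def reversalHom (m n : ℕ) (hu : u⁻¹ = t) : QSL t m n →ₐ[Cq] (QSL u m n)ᵐᵒᵖ :=
  ofPoint (s := AlgHom.op (parity u m n)) (X := opMatrix (a u m n))
    (hu ▸ (isPoint u m n).op fun x => rfl)
    (hu ▸ (isPoint u m n).berezinian_opMatrix (parity_involutive u m n) berezinian_a)

theorem reversalHom_a (hu : u⁻¹ = t) (i j : Fin (m + n)) :
    reversalHom m n hu (a t m n i j) = rootSign i j • MulOpposite.op (a u m n i j) :=
  ofPoint_a _ _ i j

/-- The reversal as a linear map. -/
def reversal (m n : ℕ) (hu : u⁻¹ = t) : QSL t m n →ₗ[Cq] QSL u m n :=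
  untwist (parity t m n) (reversalHom m n hu)

theorem reversal_a (hu : u⁻¹ = t) (i j : Fin (m + n)) :
    reversal m n hu (a t m n i j) = a u m n i j :=
  untwist_generator _ (parity_a i j) (reversalHom_a hu i j)

theorem isAntiHom_reversal (hu : u⁻¹ = t) :
    IsAntiHom (parity t m n) (parity u m n) (reversal m n hu) :=
  isAntiHom_untwist (untwist_parity generates parity_a parity_a (reversalHom_a hu))

/-- The composition of two reversals is a morphism that fixes the generators. -/
theorem reversal_comp_reversal (hu : u⁻¹ = t) (ht : t⁻¹ = u) {F : QSL t m n →ₗ[Cq] QSL u m n}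
    (hF : IsAntiHom (parity t m n) (parity u m n) F) (hFa : ∀ i j, F (a t m n i j) = a u m n i j)
    (x : QSL t m n) : reversal m n ht (F x) = x := by
  have : (isAntiHom_reversal ht).comp hF (parity_involutive t m n) = AlgHom.id Cq _ :=
    generates.algHom_ext fun i j => by
      rw [IsAntiHom.comp_apply, hFa, reversal_a]
      rfl
  exact DFunLike.congr_fun this x

/-- The reversal as a linear equivalence. -/
def reversalEquiv (m n : ℕ) (hu : u⁻¹ = t) (ht : t⁻¹ = u) : QSL t m n ≃ₗ[Cq] QSL u m n :=
  LinearEquiv.ofLinear (reversal m n hu) (reversal m n ht)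
    (LinearMap.ext (reversal_comp_reversal ht hu (isAntiHom_reversal ht) (reversal_a ht)))
    (LinearMap.ext (reversal_comp_reversal hu ht (isAntiHom_reversal hu) (reversal_a hu)))

theorem isReversal (t : Cqˣ) (m n : ℕ) :
    IsReversal (reversalEquiv (t := t) m n (inv_inv t) rfl) where
  map_a := reversal_a (inv_inv t)
  map_one := (isAntiHom_reversal (inv_inv t)).map_one
  map_mem := (isAntiHom_reversal (inv_inv t)).map_mem
  map_mul := (isAntiHom_reversal (inv_inv t)).map_mul

/-- A reversal is determined by its values on the generators: composed with the inverse reversal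
it is an algebra morphism. -/
theorem _root_.QuantumSuper.IsReversal.eq {τ : QSL t m n ≃ₗ[Cq] QSL t⁻¹ m n} (h : IsReversal τ)
    (x : QSL t m n) : τ x = reversal m n (inv_inv t) x := by
  have hτ : IsAntiHom (parity t m n) (parity t⁻¹ m n) τ.toLinearMap :=
    ⟨h.map_one, h.map_mem, h.map_mul⟩
  apply (reversalEquiv (t := t⁻¹) (u := t) m n rfl (inv_inv t)).injective
  exact (reversal_comp_reversal (inv_inv t) rfl hτ h.map_a x).trans
    (reversal_comp_reversal (inv_inv t) rfl (isAntiHom_reversal _) (reversal_a _) x).symm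

/-! ### The isomorphism -/

variable (t m n) in
/-- The antipode. -/
abbrev S : QSL t m n →ₗ[Cq] QSL t m n := (hopfData t m n).antipode

theorem S_a (i j : Fin (m + n)) : S t m n (a t m n i j) = b t m n i j :=
  (hopfData t m n).antipode_X i j

/-- The antipode after the reversal, a morphism. -/
def antipodeReversal (m n : ℕ) (hu : u⁻¹ = t) : QSL t m n →ₐ[Cq] QSL u m n :=
  (hopfData u m n).isAntiHom.comp (isAntiHom_reversal hu) (parity_involutive t m n)

theorem antipodeReversal_a (hu : u⁻¹ = t) :
    (a t m n).map (antipodeReversal m n hu) = b u m n := by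
  ext i j
  rw [Matrix.map_apply, antipodeReversal, IsAntiHom.comp_apply, reversal_a]
  exact S_a i j

theorem antipodeReversal_b (hu : u⁻¹ = t) :
    (b t m n).map (antipodeReversal m n hu) = a u m n := by
  have h := map_one_matrix (antipodeReversal m n hu) (a_mul_b (t := t) (m := m) (n := n))
  rw [antipodeReversal_a] at h
  exact (inverse_unique a_mul_b h).symm

/-- The morphisms `a ↦ b` in the two directions map `b` to `a` as well, hence are inverse to each
other. -/
theorem antipodeReversal_comp (hu : u⁻¹ = t) (ht : t⁻¹ = u) (x : QSL t m n) :
    antipodeReversal m n ht (antipodeReversal m n hu x) = x := by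
  have : (antipodeReversal m n ht).comp (antipodeReversal m n hu) = AlgHom.id Cq _ :=
    generates.algHom_ext fun i j => by
      have h1 := congrFun (congrFun (antipodeReversal_a (m := m) (n := n) hu) i) j
      have h2 := congrFun (congrFun (antipodeReversal_b (m := m) (n := n) ht) i) j
      rw [Matrix.map_apply] at h1 h2
      rw [AlgHom.comp_apply, h1, h2]
      rfl
  exact DFunLike.congr_fun this x

/-- The antipode is a composition of the bijections `antipodeReversal` and `reversal`. -/
theorem S_bijective : Function.Bijective (S t m n) := by
  have h1 : Function.Bijective (antipodeReversal (t := t⁻¹) (u := t) m n rfl) :=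
    Function.bijective_iff_has_inverse.2 ⟨antipodeReversal m n (inv_inv t),
      antipodeReversal_comp rfl (inv_inv t), antipodeReversal_comp (inv_inv t) rfl⟩
  have h2 := h1.comp (reversalEquiv (t := t) m n (inv_inv t) rfl).bijective
  have h3 : S t m n = antipodeReversal (t := t⁻¹) (u := t) m n rfl ∘
      reversalEquiv (t := t) m n (inv_inv t) rfl := funext fun x =>
    congrArg (S t m n) (reversal_comp_reversal (inv_inv t) rfl (isAntiHom_reversal _)
      (reversal_a _) x).symm
  rw [h3]
  exact h2

variable (t m n) in
/-- The map `τ ∘ S ∘ st` as a morphism of algebras. -/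
def isoHom : QSL t m n →ₐ[Cq] QSL t⁻¹ m n :=
  ((isAntiHom_reversal (inv_inv t)).comp (hopfData t m n).isAntiHom
    (parity_involutive t m n)).comp (stHom t m n)

theorem isoHom_bijective : Function.Bijective (isoHom t m n) :=
  ((reversalEquiv (t := t) m n (inv_inv t) rfl).bijective.comp S_bijective).comp
    (supertranspose t m n).bijective

theorem map_isoHom : (a t m n).map (isoHom t m n) =
    antiTranspose (reversal m n (inv_inv t)) (b t m n) := by
  ext i j
  rw [Matrix.map_apply, isoHom, AlgHom.comp_apply, stHom_a, map_smul, IsAntiHom.comp_apply]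
  exact congrArg (_ • ·) (congrArg _ (S_a j i))

/-- The Hopf structure of `SL_{t⁻¹}(m|n)`, described by the images of the generators of
`SL_t(m|n)`. -/
def transportedHopfData (t : Cqˣ) (m n : ℕ) : HopfData t (parity t⁻¹ m n)
    ((a t m n).map (isoHom t m n)) (antiTranspose (reversal m n (inv_inv t)) (a t m n)) :=
  have hτ := isAntiHom_reversal (m := m) (n := n) (inv_inv t)
  -- the images of the generators form the inverse of the supertransposed generating matrix
  have hmul : (a t m n).map (isoHom t m n) *
      antiTranspose (reversal m n (inv_inv t)) (a t m n) = 1 := by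
    rw [map_isoHom]
    exact hτ.antiTranspose_mul parity_a b_parity a_mul_b
  have hmul' : antiTranspose (reversal m n (inv_inv t)) (a t m n) *
      (a t m n).map (isoHom t m n) = 1 := by
    rw [map_isoHom]
    exact hτ.antiTranspose_mul b_parity parity_a b_mul_a
  have hat : ∀ i j, antiTranspose (reversal m n (inv_inv t)) (a t m n) i j =
      (-1 : Cq) ^ ((p j + 1) * p i) • a t⁻¹ m n j i := fun i j => by
    rw [antiTranspose, Matrix.of_apply, reversal_a]
  have hpar : ∀ i j, parity t⁻¹ m n ((a t m n).map (isoHom t m n) i j) =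
      (-1 : Cq) ^ (p i + p j) • (a t m n).map (isoHom t m n) i j := fun i j => by
    rw [map_isoHom, antiTranspose, Matrix.of_apply, map_smul, hτ.parity (b_parity j i), smul_comm,
      add_comm (p i)]
  { point := (isPoint t m n).map _ fun i j => by
      rw [parity_a, map_smul]
      exact hpar i j
    invol := parity_involutive t⁻¹ m n
    gen := fun U hU hinv x => by
      obtain ⟨x, rfl⟩ := isoHom_bijective.2 x
      exact generates (U.comap (isoHom t m n)) hU (fun x hx y hxy hyx => hinv _ hx _
        (by rw [← map_mul, hxy, map_one]) (by rw [← map_mul, hyx, map_one])) x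
    mul_inv := hmul
    inv_mul := hmul'
    comulHom := (hopfData t⁻¹ m n).comulHom
    comulHom_X := fun i j => by
      -- the supertransposed generating matrix is comultiplicative with the factors reversed, so
      -- its inverse is comultiplicative with the factors in the usual order
      have h1 : (antiTranspose (reversal m n (inv_inv t)) (a t m n)).map
          (hopfData t⁻¹ m n).comulHom =
          (antiTranspose (reversal m n (inv_inv t)) (a t m n)).map (incR (parity t⁻¹ m n)) *
            (antiTranspose (reversal m n (inv_inv t)) (a t m n)).map
              (incL (parity t⁻¹ m n)) := by
        ext i j
        rw [Matrix.map_apply, hat, map_smul, (hopfData t⁻¹ m n).comulHom_X, comulMatrix,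
          Matrix.mul_apply, Matrix.mul_apply, Finset.smul_sum]
        refine Finset.sum_congr rfl fun k _ => ?_
        rw [Matrix.map_apply, Matrix.map_apply, Matrix.map_apply, Matrix.map_apply, hat, hat,
          map_smul, map_smul, smul_mul_smul_comm, incR_mul_incL (parity_a j k) (parity_a k i),
          smul_smul, ← pow_add, ← pow_add]
        refine congrArg (· • _) (neg_one_pow_congr ?_)
        rcases p_zero_or_one i with hi | hi <;> rcases p_zero_or_one j with hj | hj <;>
          rcases p_zero_or_one k with hk | hk <;> simp [hi, hj, hk, Nat.even_add_one]
      have h2 := map_one_matrix (hopfData t⁻¹ m n).comulHom hmul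
      have h3 := (comulMatrix_inverse (s := parity t⁻¹ m n) hmul hmul').2
      rw [h1] at h2
      have h4 := inverse_unique h2 h3
      exact congrFun (congrFun h4 i) j
    counitHom := (hopfData t⁻¹ m n).counitHom
    counitHom_X := fun i j => by
      have h1 : (antiTranspose (reversal m n (inv_inv t)) (a t m n)).map
          (hopfData t⁻¹ m n).counitHom = 1 := by
        ext i j
        rw [Matrix.map_apply, hat, map_smul, (hopfData t⁻¹ m n).counitHom_X, Matrix.one_apply]
        by_cases hij : i = j
        · rw [if_pos hij, if_pos hij.symm, hij,
            (Even.neg_one_pow (by rcases p_zero_or_one j with hj | hj <;> simp [hj]) :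
              (-1 : Cq) ^ _ = 1), one_smul]
        · rw [if_neg hij, if_neg (Ne.symm hij), smul_zero]
      have h2 := map_one_matrix (hopfData t⁻¹ m n).counitHom hmul
      rw [h1, mul_one] at h2
      exact (congrFun (congrFun h2 i) j).trans Matrix.one_apply
    antipodeHom := (hopfData t⁻¹ m n).antipodeHom
    antipodeHom_X := fun i j => by
      rw [eq_rootSign_smul_of_untwist (s := parity t⁻¹ m n) _ (hpar i j)]
      refine congrArg (fun y => rootSign i j • MulOpposite.op y) ?_
      have hapar : ∀ i j, parity t⁻¹ m n (antiTranspose (reversal m n (inv_inv t)) (a t m n) i j) =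
          (-1 : Cq) ^ (p i + p j) • antiTranspose (reversal m n (inv_inv t)) (a t m n) i j :=
        fun i j => by
          rw [hat, map_smul, parity_a, smul_comm, add_comm (p i)]
      -- the signed transposes, under the antipode, of mutually inverse matrices are mutually inverse;
      -- for the supertransposed generating matrix this is `b`, up to the parity automorphism
      have h1 := (hopfData t⁻¹ m n).isAntiHom.antiTranspose_mul hpar hapar hmul
      have h2 : antiTranspose (S t⁻¹ m n)
          (antiTranspose (reversal m n (inv_inv t)) (a t m n)) =
          (b t⁻¹ m n).map (parity t⁻¹ m n) := by
        ext i j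
        rw [antiTranspose, Matrix.of_apply, hat, map_smul, S_a, smul_smul, neg_one_pow_transpose,
          Matrix.map_apply, b_parity]
      rw [h2] at h1
      have h2' := inverse_unique
        (map_one_matrix (parity t⁻¹ m n) (a_mul_b (t := t⁻¹) (m := m) (n := n))) h1
      have h3 := congrFun (congrFun h2' j) i
      rw [Matrix.map_apply, parity_a, antiTranspose, Matrix.of_apply] at h3
      have h4 := congrArg ((-1 : Cq) ^ ((p i + 1) * p j) • ·) h3
      simp only [smul_smul, neg_one_pow_mul_self, one_smul] at h4
      refine h4.symm.trans ?_
      rw [hat, ← neg_one_pow_transpose j i, ← mul_assoc, neg_one_pow_mul_self, one_mul] }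

theorem isHopfMorphism_isoHom :
    IsHopfMorphism (hopfData t m n).hopf (hopfData t⁻¹ m n).hopf (isoHom t m n) :=
  (hopfData t m n).isHopfMorphism (transportedHopfData t m n) (isoHom t m n) fun i j => rfl

end QSL

end QuantumSuper

end

theorem mainTheorem6 (m n : ℕ) :
    (∃ H : QuantumSuper.HopfSuperalgebra QuantumSuper.Cq
        (QuantumSuper.QSL.grading QuantumSuper.q m n), QuantumSuper.IsStandardSL H) ∧
    (∃ H' : QuantumSuper.HopfSuperalgebra QuantumSuper.Cq
        (QuantumSuper.QSL.grading QuantumSuper.q⁻¹ m n), QuantumSuper.IsStandardSL H') ∧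
    (∃ st : QuantumSuper.QSL QuantumSuper.q m n ≃ₐ[QuantumSuper.Cq]
        QuantumSuper.QSL QuantumSuper.q m n, QuantumSuper.IsSupertranspose st) ∧
    (∃ τ : QuantumSuper.QSL QuantumSuper.q m n ≃ₗ[QuantumSuper.Cq]
        QuantumSuper.QSL QuantumSuper.q⁻¹ m n, QuantumSuper.IsReversal τ) ∧
    ∀ (H : QuantumSuper.HopfSuperalgebra QuantumSuper.Cq
        (QuantumSuper.QSL.grading QuantumSuper.q m n))
      (H' : QuantumSuper.HopfSuperalgebra QuantumSuper.Cq
        (QuantumSuper.QSL.grading QuantumSuper.q⁻¹ m n))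
      (st : QuantumSuper.QSL QuantumSuper.q m n ≃ₐ[QuantumSuper.Cq]
        QuantumSuper.QSL QuantumSuper.q m n)
      (τ : QuantumSuper.QSL QuantumSuper.q m n ≃ₗ[QuantumSuper.Cq]
        QuantumSuper.QSL QuantumSuper.q⁻¹ m n),
      QuantumSuper.IsStandardSL H → QuantumSuper.IsStandardSL H' →
      QuantumSuper.IsSupertranspose st → QuantumSuper.IsReversal τ →
      ∃ φ : QuantumSuper.QSL QuantumSuper.q m n ≃ₐ[QuantumSuper.Cq]
          QuantumSuper.QSL QuantumSuper.q⁻¹ m n,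
        (∀ x, φ x = τ (H.antipode (st x))) ∧
        QuantumSuper.IsHopfMorphism H H' (φ : QuantumSuper.QSL QuantumSuper.q m n →ₐ[QuantumSuper.Cq]
          QuantumSuper.QSL QuantumSuper.q⁻¹ m n) := by
  refine ⟨⟨_, QuantumSuper.QSL.isStandardSL_hopf⟩, ⟨_, QuantumSuper.QSL.isStandardSL_hopf⟩,
    ⟨_, QuantumSuper.QSL.isSupertranspose⟩, ⟨_, QuantumSuper.QSL.isReversal _ m n⟩,
    fun H H' st τ hH hH' hst hτ => ?_⟩
  obtain rfl := hH.eq_hopf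
  obtain rfl := hH'.eq_hopf
  refine ⟨AlgEquiv.ofBijective (QuantumSuper.QSL.isoHom QuantumSuper.q m n)
    QuantumSuper.QSL.isoHom_bijective, fun x => ?_, QuantumSuper.QSL.isHopfMorphism_isoHom⟩
  rw [hst.eq, hτ.eq]
  rfl
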